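/- **Setting.** Let $K=\mathbb{Q}(\theta)$ be a number field with $\theta$ a root of an irreducible trinomial $f(x)=x^6+ax+b\in\mathbb{Z}[x]$, and assume that there is no prime $p$ with $p^5\mid a$ and $p^6\mid b$. Let $d_K$ be the discriminant of $K$ and $D$ the discriminant of $f$. For a prime $p$ let $v_p$ be the $p$-adic valuation ($v_p(0)=\infty$), let $\mathbb{Z}_{(p)}$ be the localisation of $\mathbb{Z}$ at $p\mathbb{Z}$, and call a $\mathbb{Z}_{(p)}$-basis of the integral closure of $\mathbb{Z}_{(p)}$ in $K$ a $p$-integral basis of $K$. **Theorem.** $D=5^5a^6-6^6b^5\neq 0$. For every prime $p$, at least one of the rows listed below for $p$ applies (E1–E26 if $p=2$, F1–F27 if $p=3$, G1–G22 if $p=5$, H1–H12 if $p>5$). Whenever a row applies, $v_p(D)$ and $v_p(d_K)$ are as stated in it and the displayed six elements $\alpha_0,\dots,\alpha_5$ form a $p$-integral basis of $K$. This basis is triangular: $\alpha_0=1$ and $\alpha_i=(c_{i0}+c_{i1}\theta+\cdots+c_{i,i-1}\theta^{i-1}+\theta^i)/p^{k_i}$ with $c_{ij}\in\mathbb{Z}$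 and $0\le k_1\le\cdots\le k_5$. Where integers $x$ (or $x,y,z,v,w$) subject to congruences occur in a basis, such integers exist, and every choice of them gives a $p$-integral basis. Each row is written as: condition; $v_p(D)$; $v_p(d_K)$; basis. Put $\mathcal P=\{1,\theta,\theta^2,\theta^3,\theta^4,\theta^5\}$, $[k_2,k_3,k_4,k_5]_p=\{1,\theta,\theta^2/p^{k_2},\theta^3/p^{k_3},\theta^4/p^{k_4},\theta^5/p^{k_5}\}$ and $\lambda_p(x,k)=(-5x^5+x^4\theta+x^3\theta^2+x^2\theta^3+x\theta^4+\theta^5)/p^k$. **Table I** ($p=2$; $v=v_2$, $d=v_2(D)$, $D_2=D/2^{d}$). - E1: $v(a)=0$; $0$; $0$; $\mathcal P$. - E2: $v(b)=1,v(a)=1$; $6$; $6$; $\mathcal P$. - E3: $v(b)=1,v(a)\ge2$; $11$; $11$; $\mathcal P$. - E4: $v(b)\ge2,v(a)=1$; $6$; $4$; $[0,0,0,1]_2$. - E5: $v(b)\ge3,v(a)=2$; $12$; $4$; $[0,1,1,2]_2$. - E6: $v(b)=3,v(a)=3$; $18$; $6$; $[1,1,2,2]_2$. - E7: $v(b)=3,v(a)\ge4$;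 $21$; $9$; $[1,1,2,2]_2$. - E8: $v(b)\ge4,v(a)=3$; $18$; $4$; $[1,1,2,3]_2$. - E9: $v(b)\ge5,v(a)=4$; $24$; $4$; $[1,2,3,4]_2$. - E10: $v(b)=5,v(a)=5$; $30$; $10$; $[1,2,3,4]_2$. - E11: $v(b)=5,v(a)\ge6$; $31$; $11$; $[1,2,3,4]_2$. - E12: $v(a)=1$, $b\equiv3\pmod 4$; $7$; $7$; $\mathcal P$. - E13: $v(a)=1$, $b\equiv1\pmod4$, $d$ odd; $d\ge9$ odd; $7$; $\{1,\theta,\theta^2,\theta^3,\theta^4,\lambda_2(x,k)\}$, $k=\frac{d-7}2$, $5\frac a2x+3b\equiv0\pmod{2^k}$. - E14: $v(a)=1$, $b\equiv1\pmod4$, $d$ even, $D_2\equiv3\pmod4$; $d\ge8$ even; $4$; $\{1,\theta,\theta^2,\theta^3,\theta^4,\lambda_2(x,k)\}$, $k=\frac{d-4}2$, $5\frac a2x-2^{(d-6)/2}+3b\equiv0\pmod{2^k}$. - E15: $v(a)=1$, $b\equiv1\pmod4$, $d$ even, $D_2\equiv1\pmod4$; $d\ge8$ even; $6$; $\{1,\theta,\theta^2,\theta^3,\theta^4,\lambda_2(x,k)\}$,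 $k=\frac{d-6}2$, $5\frac a2x+3b\equiv0\pmod{2^k}$. - E16: $v(a)\ge2$, $b\equiv1\pmod4$; $6$; $6$; $\mathcal P$. - E17: $v(a)\ge2$, $b\equiv3\pmod4$; $6$; $0$; $\{1,\theta,\theta^2,\frac{1+\theta^3}2,\frac{\theta+\theta^4}2,\frac{\theta^2+\theta^5}2\}$. - E18: $v(b)=2,v(a)=2$; $12$; $6$; $[0,1,1,1]_2$. - E19: $v(b)=2,v(a)=3$, $\frac b4\equiv3\pmod4$; $16$; $6$; $\{1,\theta,\theta^2,\frac{\theta^3}2,\frac{2\theta+\theta^4}{2^2},\frac{2\theta^2+\theta^5}{2^2}\}$. - E20: $v(b)=2,v(a)\ge4$, $\frac b4\equiv3\pmod4$; $16$; $4$; $\{1,\theta,\theta^2,\frac{2+\theta^3}{2^2},\frac{2\theta+\theta^4}{2^2},\frac{2\theta^2+\theta^5}{2^2}\}$. - E21: $v(b)=2,v(a)\ge3$, $\frac b4\equiv1\pmod4$; $16$; $8$; $\{1,\theta,\theta^2,\frac{\theta^3}2,\frac{\theta^4}2,\frac{2\theta^2+\theta^5}{2^2}\}$. - E22: $v(b)=4,v(a)=4$,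 $\frac b{16}\equiv1\pmod4$; $24$; $4$; $\{1,\theta,\frac{\theta^2}2,\frac{\theta^3}{2^2},\frac{4\theta+\theta^4}{2^3},\frac{8\theta+4\theta^2+\theta^5}{2^4}\}$. - E23: $v(b)=4,v(a)=4$, $\frac b{16}\equiv3\pmod4$; $24$; $6$; $\{1,\theta,\frac{\theta^2}2,\frac{\theta^3}{2^2},\frac{4\theta+\theta^4}{2^3},\frac{4\theta^2+\theta^5}{2^3}\}$. - E24: $v(b)=4,v(a)=5$, $\frac b{16}\equiv3\pmod4$; $26$; $6$; $\{1,\theta,\frac{\theta^2}2,\frac{\theta^3}{2^2},\frac{4\theta+\theta^4}{2^3},\frac{4\theta^2+\theta^5}{2^4}\}$. - E25: $v(b)=4,v(a)\ge6$, $\frac b{16}\equiv3\pmod4$; $26$; $4$; $\{1,\theta,\frac{\theta^2}2,\frac{4+\theta^3}{2^3},\frac{4\theta+\theta^4}{2^3},\frac{4\theta^2+\theta^5}{2^4}\}$. - E26: $v(b)=4,v(a)\ge5$, $\frac b{16}\equiv1\pmod4$; $26$; $8$; $\{1,\theta,\frac{\theta^2}2,\frac{\theta^3}{2^2},\frac{4\theta+\theta^4}{2^3},\frac{\theta^5}{2^3}\}$.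 **Table II** ($p=3$; $v=v_3$, $d=v_3(D)$, $B=b/3^3$). - F1: $v(a)=0$; $0$; $0$; $\mathcal P$. - F2: $v(b)=1,v(a)=1$; $6$; $6$; $\mathcal P$. - F3: $v(b)=1,v(a)\ge2$; $11$; $11$; $\mathcal P$. - F4: $v(b)\ge2,v(a)=1$; $6$; $4$; $[0,0,0,1]_3$. - F5: $v(b)=2,v(a)=2$; $12$; $6$; $[0,1,1,1]_3$. - F6: $v(b)=2,v(a)\ge3$; $16$; $10$; $[0,1,1,1]_3$. - F7: $v(b)\ge3,v(a)=2$; $12$; $4$; $[0,1,1,2]_3$. - F8: $v(b)\ge4,v(a)=3$; $18$; $4$; $[1,1,2,3]_3$. - F9: $v(b)=4,v(a)=4$; $24$; $8$; $[1,2,2,3]_3$. - F10: $v(b)=4,v(a)\ge5$; $26$; $10$; $[1,2,2,3]_3$. - F11: $v(b)\ge5,v(a)=4$; $24$; $4$; $[1,2,3,4]_3$. - F12: $v(b)=5,v(a)=5$; $30$; $10$; $[1,2,3,4]_3$. - F13: $v(b)=5,v(a)\ge6$; $31$; $11$; $[1,2,3,4]_3$. - F14: $v(a)=1$, $b\equiv1\pmod3$;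 $6$; $6$; $\mathcal P$. - F15: $v(a)\ge2$, $b\equiv4$ or $7\pmod9$; $6$; $6$; $\mathcal P$. - F16: $v(a)\ge2$, $b\equiv1\pmod9$; $6$; $2$; $\{1,\theta,\theta^2,\theta^3,\frac{1-\theta^2+\theta^4}3,\frac{\theta-\theta^3+\theta^5}3\}$. - F17: $v(a)\ge2$, $b\equiv2$ or $5\pmod9$; $6$; $6$; $\mathcal P$. - F18: $v(a)\ge2$, $b\equiv-1\pmod9$; $6$; $2$; $\{1,\theta,\theta^2,\theta^3,\frac{1+\theta^2+\theta^4}3,\frac{\theta+\theta^3+\theta^5}3\}$. - F19: $b\equiv2\pmod9$, $a\equiv\pm3\pmod9$; $7$; $5$; $\{1,\theta,\theta^2,\theta^3,\theta^4,\frac{\varepsilon+\theta+\varepsilon\theta^2+\theta^3+\varepsilon\theta^4+\theta^5}3\}$ with $\varepsilon=-1$ or $1$ according as $a\equiv3$ or $-3\pmod9$. - F20: $b\equiv-1\pmod9$, $a\equiv\pm3\pmod9$; $7$; $7$; $\mathcal P$. In F21–F24, $b\equiv5\pmod9$, $a\equiv\pm3\pmod9$, and $\varepsilon=-1$ or $1$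 according as $a\equiv-3$ or $3\pmod9$. - F21: $d=8$; $8$; $6$; $\{1,\theta,\theta^2,\theta^3,\theta^4,\frac{\varepsilon+\theta+\varepsilon\theta^2+\theta^3+\varepsilon\theta^4+\theta^5}3\}$. - F22: $d=9$; $9$; $3$; $\{1,\theta,\theta^2,\theta^3,\frac{-1+\varepsilon\theta-\varepsilon\theta^3+\theta^4}3,\lambda_3(x,2)\}$, $5\frac a3x+2b\equiv0\pmod9$. - F23: $d\ge10$ even; $d$; $4$; $\{1,\theta,\theta^2,\theta^3,\frac{-1+\varepsilon\theta-\varepsilon\theta^3+\theta^4}3,\lambda_3(x,k)\}$, $k=\frac{d-6}2$, $5\frac a3x+2b\equiv0\pmod{3^k}$. - F24: $d\ge11$ odd; $d$; $3$; $\{1,\theta,\theta^2,\theta^3,\frac{-1+\varepsilon\theta-\varepsilon\theta^3+\theta^4}3,\lambda_3(x,k)\}$, $k=\frac{d-5}2$, $5\frac a3x+2b\equiv0\pmod{3^k}$. - F25: $v(b)=3,v(a)=3$; $18$; $6$; $[1,1,2,2]_3$. - F26: $v(b)=3,v(a)\ge4$, $v(B^3-B)=1$; $21$; $7$; $\{1,\theta,\frac{\theta^2}3,\frac{\theta^3}3,\frac{\theta^4}{3^2},\frac{(\theta^2+3B)^2\theta}{3^3}\}$.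 - F27: $v(b)=3,v(a)\ge4$, $v(B^3-B)\ge2$; $21$; $3$; $\{1,\theta,\frac{\theta^2}3,\frac{(\theta^2+3B)\theta}{3^2},\frac{(\theta^2+3B)^2}{3^3},\frac{(\theta^2+3B)^2\theta}{3^3}\}$. **Table III** ($p=5$; $v=v_5$, $d=v_5(D)$). - G1: $v(b)=0$; $0$; $0$; $\mathcal P$. In G2–G7, $v(b)=1$ and $v(a)=0$. - G2: $a^4\not\equiv21\pmod{25}$, $b\not\equiv a^2-a^6\pmod{25}$, $a^2\not\equiv\frac b5\pmod5$; $5$; $5$; $\mathcal P$. - G3: $a^4\not\equiv21\pmod{25}$, $b\not\equiv a^2-a^6\pmod{25}$, $a^2\equiv\frac b5\pmod5$; $6$; $6$; $\mathcal P$. - G4: $a^4\not\equiv21\pmod{25}$, $b\equiv a^2-a^6\pmod{25}$; $5$; $3$; $\{1,\theta,\theta^2,\theta^3,\theta^4,\frac{\theta-a^3\theta^2+a^2\theta^3-a\theta^4+\theta^5}5\}$. - G5: $a^4\equiv21\pmod{25}$, $b\not\equiv a^2-a^6\pmod{25}$; $5$; $5$; $\mathcal P$. - G6: $a^4\equiv21\pmod{25}$,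 $b\equiv a^2-a^6\pmod{25}$, $d$ odd; $d\ge7$ odd; $3$; $\{1,\theta,\theta^2,\theta^3,\frac{-4a^3\theta+3a^2\theta^2-2a\theta^3+\theta^4}5,\lambda_5(x,k)\}$, $k=\frac{d-5}2$, $ax+6\frac b5\equiv0\pmod{5^k}$. - G7: $a^4\equiv21\pmod{25}$, $b\equiv a^2-a^6\pmod{25}$, $d$ even; $d\ge8$ even; $2$; $\{1,\theta,\theta^2,\theta^3,\frac{-4a^3\theta+3a^2\theta^2-2a\theta^3+\theta^4}5,\lambda_5(x,k)\}$, $k=\frac{d-4}2$, $ax+6\frac b5\equiv0\pmod{5^k}$. - G8: $v(b)=1,v(a)\ge1$; $5$; $5$; $\mathcal P$. - G9: $v(b)\ge2,v(a)=0$, $a^4\not\equiv1\pmod{25}$; $5$; $5$; $\mathcal P$. - G10: $v(b)\ge2,v(a)=0$, $a^4\equiv1\pmod{25}$; $5$; $3$; $\{1,\theta,\theta^2,\theta^3,\theta^4,\frac{\theta-a^3\theta^2+a^2\theta^3-a\theta^4+\theta^5}5\}$. - G11: $v(b)=2,v(a)=1$; $10$; $8$; $[0,0,0,1]_5$. - G12: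 $v(b)=2,v(a)\ge2$; $10$; $4$; $[0,1,1,1]_5$. - G13: $v(b)\ge3,v(a)=1$; $11$; $9$; $[0,0,0,1]_5$. - G14: $v(b)=3,v(a)=2$; $15$; $7$; $[0,1,1,2]_5$. - G15: $v(b)=3,v(a)\ge3$; $15$; $3$; $[1,1,2,2]_5$. - G16: $v(b)\ge4,v(a)=2$; $17$; $9$; $[0,1,1,2]_5$. - G17: $v(b)=4,v(a)=3$; $20$; $6$; $[1,1,2,3]_5$. - G18: $v(b)=4,v(a)\ge4$; $20$; $4$; $[1,2,2,3]_5$. - G19: $v(b)\ge5,v(a)=3$; $23$; $9$; $[1,1,2,3]_5$. - G20: $v(b)=5,v(a)=4$; $25$; $5$; $[1,2,3,4]_5$. - G21: $v(b)=5,v(a)\ge5$; $25$; $5$; $[1,2,3,4]_5$. - G22: $v(b)\ge6,v(a)=4$; $29$; $9$; $[1,2,3,4]_5$. **Table IV** ($p>5$; $v=v_p$, $d=v_p(D)$). - H1: $v(b)=0,v(a)\ge1$ or $v(a)=0,v(b)\ge1$; $0$; $0$; $\mathcal P$. - H2: $v(b)=1,v(a)\ge1$; $5$; $5$; $\mathcal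 P$. - H3: $v(a)=1,v(b)\ge2$; $6$; $4$; $[0,0,0,1]_p$. - H4: $v(b)=2,v(a)\ge2$; $10$; $4$; $[0,1,1,1]_p$. - H5: $v(a)=2,v(b)\ge3$; $12$; $4$; $[0,1,1,2]_p$. - H6: $v(b)=3,v(a)\ge3$; $15$; $3$; $[1,1,2,2]_p$. - H7: $v(a)=3,v(b)\ge4$; $18$; $4$; $[1,1,2,3]_p$. - H8: $v(b)=4,v(a)\ge4$; $20$; $4$; $[1,2,2,3]_p$. - H9: $v(a)=4,v(b)\ge5$; $24$; $4$; $[1,2,3,4]_p$. - H10: $v(b)=5,v(a)\ge5$; $25$; $5$; $[1,2,3,4]_p$. - H11: $v(ab)=0$, $d$ even; $d$; $0$; $\{1,\theta,\theta^2,\theta^3,\theta^4,\frac{x+y\theta+z\theta^2+v\theta^3+w\theta^4+\theta^5}{p^m}\}$ with $m=\frac d2$. - H12: $v(ab)=0$, $d$ odd; $d$; $1$; the same elements with $m=\frac{d-1}2$. In H11 and H12 the integers $x,y,z,v,w$ satisfy, modulo $p^m$: $6x\equiv5a$, $(5a)^4y\equiv(6b)^4$, $(5a)^3z\equiv-(6b)^3$,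 $(5a)^2v\equiv(6b)^2$, $5aw\equiv-6b$. -/

import Mathlib

open Polynomial

namespace Sextic

/-- The localisation `ℤ_(p)` of `ℤ` at the prime ideal `pℤ`, as a subring of `ℚ`. -/
def localInt (p : ℕ) [hp : Fact p.Prime] : Subring ℚ where
  carrier := {q | ∃ m s : ℤ, ¬ (p : ℤ) ∣ s ∧ q = (m : ℚ) / (s : ℚ)}
  one_mem' := ⟨1, 1, fun h => hp.out.one_lt.ne' (by
    have h2 := Int.natCast_dvd_natCast.mp (by simpa using h : (p : ℤ) ∣ ((1 : ℕ) : ℤ))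
    exact Nat.dvd_one.mp h2), by simp⟩
  zero_mem' := ⟨0, 1, fun h => hp.out.one_lt.ne' (by
    have h2 := Int.natCast_dvd_natCast.mp (by simpa using h : (p : ℤ) ∣ ((1 : ℕ) : ℤ))
    exact Nat.dvd_one.mp h2), by simp⟩
  mul_mem' := by
    rintro _ _ ⟨m, s, hs, rfl⟩ ⟨n, t, ht, rfl⟩
    refine ⟨m * n, s * t, fun h => ?_, by push_cast; rw [div_mul_div_comm]⟩
    exact ((Nat.prime_iff_prime_int.mp hp.out).dvd_or_dvd h).elim hs ht
  add_mem' := by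
    rintro _ _ ⟨m, s, hs, rfl⟩ ⟨n, t, ht, rfl⟩
    have hs0 : (s : ℚ) ≠ 0 := by
      intro h; exact hs ((Int.cast_eq_zero.mp h) ▸ dvd_zero _)
    have ht0 : (t : ℚ) ≠ 0 := by
      intro h; exact ht ((Int.cast_eq_zero.mp h) ▸ dvd_zero _)
    refine ⟨m * t + s * n, s * t, fun h => ?_, by push_cast; rw [div_add_div _ _ hs0 ht0]⟩
    exact ((Nat.prime_iff_prime_int.mp hp.out).dvd_or_dvd h).elim hs ht
  neg_mem' := by
    rintro _ ⟨m, s, hs, rfl⟩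
    exact ⟨-m, s, hs, by push_cast; rw [neg_div]⟩

/-- `α` is a `p`-integral basis of the sextic field `K`: a `ℤ_(p)`-basis of the integral closure
of `ℤ_(p)` in `K`. -/
def IsPIntegralBasis (p : ℕ) [Fact p.Prime] {K : Type*} [Field K] [NumberField K]
    (α : Fin 6 → K) : Prop :=
  LinearIndependent (localInt p) α ∧
    Submodule.span (localInt p) (Set.range α) =
      Subalgebra.toSubmodule (integralClosure (localInt p) K)

/-- `α` has triangular form with respect to `θ` and `p`: `α 0 = 1` and
`α i = (c i 0 + c i 1 * θ + ⋯ + c i (i-1) * θ ^ (i-1) + θ ^ i) / p ^ k i` with integers `c i j` and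
`0 = k 0 ≤ k 1 ≤ ⋯ ≤ k 5`. -/
def IsTriangular (p : ℕ) {K : Type*} [Field K] (θ : K) (α : Fin 6 → K) : Prop :=
  ∃ (c : Fin 6 → ℕ → ℤ) (k : Fin 6 → ℕ), k 0 = 0 ∧ Monotone k ∧
    ∀ i : Fin 6, α i =
      ((∑ j ∈ Finset.range (i : ℕ), (c i j : K) * θ ^ j) + θ ^ (i : ℕ)) / (p : K) ^ k i

/-- A row of a table: the condition under which the row applies, the values that it allows for
`v_p(D)`, the value of `v_p(d_K)`, and the bases that it displays (several when the display
involves auxiliary integers that are only prescribed modulo a power of `p`). -/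
structure Row (K : Type*) where
  cond : Prop
  vD : Set ℕ
  vdK : ℕ
  bases : Set (Fin 6 → K)

/-- The rows of the list describe the situation at `p`: some row applies, and each row that applies
gives the right values of `v_p(D)` and `v_p(d_K)` and displays (at least one basis, and only)
`p`-integral bases of triangular form. -/
def Describes (p : ℕ) [Fact p.Prime] {K : Type*} [Field K] [NumberField K] (D : ℤ) (θ : K)
    (rows : List (Row K)) : Prop :=
  (∃ r ∈ rows, r.cond) ∧
    ∀ r ∈ rows, r.cond →
      padicValInt p D ∈ r.vD ∧
      padicValInt p (NumberField.discr K) = r.vdK ∧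
      r.bases.Nonempty ∧
      ∀ α ∈ r.bases, IsTriangular p θ α ∧ IsPIntegralBasis p α

/-- The last basis element
`(-5x⁵ + x⁴θ + x³θ² + x²θ³ + xθ⁴ + θ⁵) / p ^ k` occurring in several rows. -/
noncomputable def lastElt {K : Type*} [Field K] (p : ℕ) (θ : K) (x : ℤ) (k : ℕ) : K :=
  (-5 * (x : K) ^ 5 + (x : K) ^ 4 * θ + (x : K) ^ 3 * θ ^ 2 + (x : K) ^ 2 * θ ^ 3
    + (x : K) * θ ^ 4 + θ ^ 5) / (p : K) ^ k

/-- The table for `p = 2`. Valuations of `a`, `b` are taken in `ℕ∞`, with value `⊤` at `0`; the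
integer `D` is the discriminant of `x ^ 6 + a x + b`. -/
noncomputable def tableI {K : Type*} [Field K] (a b D : ℤ) (θ : K) : List (Row K) :=
  let va := emultiplicity (2 : ℤ) a
  let vb := emultiplicity (2 : ℤ) b
  let d := padicValInt 2 D
  let D₂ := D / 2 ^ d
  [ -- E1
    ⟨va = 0, {0}, 0, {![1, θ, θ ^ 2, θ ^ 3, θ ^ 4, θ ^ 5]}⟩,
    -- E2
    ⟨vb = 1 ∧ va = 1, {6}, 6, {![1, θ, θ ^ 2, θ ^ 3, θ ^ 4, θ ^ 5]}⟩,
    -- E3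
    ⟨vb = 1 ∧ 2 ≤ va, {11}, 11, {![1, θ, θ ^ 2, θ ^ 3, θ ^ 4, θ ^ 5]}⟩,
    -- E4
    ⟨2 ≤ vb ∧ va = 1, {6}, 4, {![1, θ, θ ^ 2, θ ^ 3, θ ^ 4, θ ^ 5 / 2]}⟩,
    -- E5
    ⟨3 ≤ vb ∧ va = 2, {12}, 4, {![1, θ, θ ^ 2, θ ^ 3 / 2, θ ^ 4 / 2, θ ^ 5 / 2 ^ 2]}⟩,
    -- E6
    ⟨vb = 3 ∧ va = 3, {18}, 6, {![1, θ, θ ^ 2 / 2, θ ^ 3 / 2, θ ^ 4 / 2 ^ 2, θ ^ 5 / 2 ^ 2]}⟩,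
    -- E7
    ⟨vb = 3 ∧ 4 ≤ va, {21}, 9, {![1, θ, θ ^ 2 / 2, θ ^ 3 / 2, θ ^ 4 / 2 ^ 2, θ ^ 5 / 2 ^ 2]}⟩,
    -- E8
    ⟨4 ≤ vb ∧ va = 3, {18}, 4, {![1, θ, θ ^ 2 / 2, θ ^ 3 / 2, θ ^ 4 / 2 ^ 2, θ ^ 5 / 2 ^ 3]}⟩,
    -- E9
    ⟨5 ≤ vb ∧ va = 4, {24}, 4,
      {![1, θ, θ ^ 2 / 2, θ ^ 3 / 2 ^ 2, θ ^ 4 / 2 ^ 3, θ ^ 5 / 2 ^ 4]}⟩,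
    -- E10
    ⟨vb = 5 ∧ va = 5, {30}, 10,
      {![1, θ, θ ^ 2 / 2, θ ^ 3 / 2 ^ 2, θ ^ 4 / 2 ^ 3, θ ^ 5 / 2 ^ 4]}⟩,
    -- E11
    ⟨vb = 5 ∧ 6 ≤ va, {31}, 11,
      {![1, θ, θ ^ 2 / 2, θ ^ 3 / 2 ^ 2, θ ^ 4 / 2 ^ 3, θ ^ 5 / 2 ^ 4]}⟩,
    -- E12
    ⟨va = 1 ∧ b ≡ 3 [ZMOD 4], {7}, 7, {![1, θ, θ ^ 2, θ ^ 3, θ ^ 4, θ ^ 5]}⟩,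
    -- E13
    ⟨va = 1 ∧ b ≡ 1 [ZMOD 4] ∧ Odd d, {n | 9 ≤ n ∧ Odd n}, 7,
      {α | ∃ x : ℤ, 5 * (a / 2) * x + 3 * b ≡ 0 [ZMOD 2 ^ ((d - 7) / 2)] ∧
        α = ![1, θ, θ ^ 2, θ ^ 3, θ ^ 4, lastElt 2 θ x ((d - 7) / 2)]}⟩,
    -- E14
    ⟨va = 1 ∧ b ≡ 1 [ZMOD 4] ∧ Even d ∧ D₂ ≡ 3 [ZMOD 4], {n | 8 ≤ n ∧ Even n}, 4,
      {α | ∃ x : ℤ,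
        5 * (a / 2) * x - 2 ^ ((d - 6) / 2) + 3 * b ≡ 0 [ZMOD 2 ^ ((d - 4) / 2)] ∧
        α = ![1, θ, θ ^ 2, θ ^ 3, θ ^ 4, lastElt 2 θ x ((d - 4) / 2)]}⟩,
    -- E15
    ⟨va = 1 ∧ b ≡ 1 [ZMOD 4] ∧ Even d ∧ D₂ ≡ 1 [ZMOD 4], {n | 8 ≤ n ∧ Even n}, 6,
      {α | ∃ x : ℤ, 5 * (a / 2) * x + 3 * b ≡ 0 [ZMOD 2 ^ ((d - 6) / 2)] ∧
        α = ![1, θ, θ ^ 2, θ ^ 3, θ ^ 4, lastElt 2 θ x ((d - 6) / 2)]}⟩,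
    -- E16
    ⟨2 ≤ va ∧ b ≡ 1 [ZMOD 4], {6}, 6, {![1, θ, θ ^ 2, θ ^ 3, θ ^ 4, θ ^ 5]}⟩,
    -- E17
    ⟨2 ≤ va ∧ b ≡ 3 [ZMOD 4], {6}, 0,
      {![1, θ, θ ^ 2, (1 + θ ^ 3) / 2, (θ + θ ^ 4) / 2, (θ ^ 2 + θ ^ 5) / 2]}⟩,
    -- E18
    ⟨vb = 2 ∧ va = 2, {12}, 6, {![1, θ, θ ^ 2, θ ^ 3 / 2, θ ^ 4 / 2, θ ^ 5 / 2]}⟩,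
    -- E19
    ⟨vb = 2 ∧ va = 3 ∧ b / 4 ≡ 3 [ZMOD 4], {16}, 6,
      {![1, θ, θ ^ 2, θ ^ 3 / 2, (2 * θ + θ ^ 4) / 2 ^ 2, (2 * θ ^ 2 + θ ^ 5) / 2 ^ 2]}⟩,
    -- E20
    ⟨vb = 2 ∧ 4 ≤ va ∧ b / 4 ≡ 3 [ZMOD 4], {16}, 4,
      {![1, θ, θ ^ 2, (2 + θ ^ 3) / 2 ^ 2, (2 * θ + θ ^ 4) / 2 ^ 2,
        (2 * θ ^ 2 + θ ^ 5) / 2 ^ 2]}⟩,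
    -- E21
    ⟨vb = 2 ∧ 3 ≤ va ∧ b / 4 ≡ 1 [ZMOD 4], {16}, 8,
      {![1, θ, θ ^ 2, θ ^ 3 / 2, θ ^ 4 / 2, (2 * θ ^ 2 + θ ^ 5) / 2 ^ 2]}⟩,
    -- E22
    ⟨vb = 4 ∧ va = 4 ∧ b / 16 ≡ 1 [ZMOD 4], {24}, 4,
      {![1, θ, θ ^ 2 / 2, θ ^ 3 / 2 ^ 2, (4 * θ + θ ^ 4) / 2 ^ 3,
        (8 * θ + 4 * θ ^ 2 + θ ^ 5) / 2 ^ 4]}⟩,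
    -- E23
    ⟨vb = 4 ∧ va = 4 ∧ b / 16 ≡ 3 [ZMOD 4], {24}, 6,
      {![1, θ, θ ^ 2 / 2, θ ^ 3 / 2 ^ 2, (4 * θ + θ ^ 4) / 2 ^ 3,
        (4 * θ ^ 2 + θ ^ 5) / 2 ^ 3]}⟩,
    -- E24
    ⟨vb = 4 ∧ va = 5 ∧ b / 16 ≡ 3 [ZMOD 4], {26}, 6,
      {![1, θ, θ ^ 2 / 2, θ ^ 3 / 2 ^ 2, (4 * θ + θ ^ 4) / 2 ^ 3,
        (4 * θ ^ 2 + θ ^ 5) / 2 ^ 4]}⟩,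
    -- E25
    ⟨vb = 4 ∧ 6 ≤ va ∧ b / 16 ≡ 3 [ZMOD 4], {26}, 4,
      {![1, θ, θ ^ 2 / 2, (4 + θ ^ 3) / 2 ^ 3, (4 * θ + θ ^ 4) / 2 ^ 3,
        (4 * θ ^ 2 + θ ^ 5) / 2 ^ 4]}⟩,
    -- E26
    ⟨vb = 4 ∧ 5 ≤ va ∧ b / 16 ≡ 1 [ZMOD 4], {26}, 8,
      {![1, θ, θ ^ 2 / 2, θ ^ 3 / 2 ^ 2, (4 * θ + θ ^ 4) / 2 ^ 3, θ ^ 5 / 2 ^ 3]}⟩ ]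

/-- The table for `p = 3`. -/
noncomputable def tableII {K : Type*} [Field K] (a b D : ℤ) (θ : K) : List (Row K) :=
  let va := emultiplicity (3 : ℤ) a
  let vb := emultiplicity (3 : ℤ) b
  let d := padicValInt 3 D
  let B := b / 3 ^ 3
  [ -- F1
    ⟨va = 0, {0}, 0, {![1, θ, θ ^ 2, θ ^ 3, θ ^ 4, θ ^ 5]}⟩,
    -- F2
    ⟨vb = 1 ∧ va = 1, {6}, 6, {![1, θ, θ ^ 2, θ ^ 3, θ ^ 4, θ ^ 5]}⟩,
    -- F3
    ⟨vb = 1 ∧ 2 ≤ va, {11}, 11, {![1, θ, θ ^ 2, θ ^ 3, θ ^ 4, θ ^ 5]}⟩,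
    -- F4
    ⟨2 ≤ vb ∧ va = 1, {6}, 4, {![1, θ, θ ^ 2, θ ^ 3, θ ^ 4, θ ^ 5 / 3]}⟩,
    -- F5
    ⟨vb = 2 ∧ va = 2, {12}, 6, {![1, θ, θ ^ 2, θ ^ 3 / 3, θ ^ 4 / 3, θ ^ 5 / 3]}⟩,
    -- F6
    ⟨vb = 2 ∧ 3 ≤ va, {16}, 10, {![1, θ, θ ^ 2, θ ^ 3 / 3, θ ^ 4 / 3, θ ^ 5 / 3]}⟩,
    -- F7
    ⟨3 ≤ vb ∧ va = 2, {12}, 4, {![1, θ, θ ^ 2, θ ^ 3 / 3, θ ^ 4 / 3, θ ^ 5 / 3 ^ 2]}⟩,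
    -- F8
    ⟨4 ≤ vb ∧ va = 3, {18}, 4, {![1, θ, θ ^ 2 / 3, θ ^ 3 / 3, θ ^ 4 / 3 ^ 2, θ ^ 5 / 3 ^ 3]}⟩,
    -- F9
    ⟨vb = 4 ∧ va = 4, {24}, 8,
      {![1, θ, θ ^ 2 / 3, θ ^ 3 / 3 ^ 2, θ ^ 4 / 3 ^ 2, θ ^ 5 / 3 ^ 3]}⟩,
    -- F10
    ⟨vb = 4 ∧ 5 ≤ va, {26}, 10,
      {![1, θ, θ ^ 2 / 3, θ ^ 3 / 3 ^ 2, θ ^ 4 / 3 ^ 2, θ ^ 5 / 3 ^ 3]}⟩,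
    -- F11
    ⟨5 ≤ vb ∧ va = 4, {24}, 4,
      {![1, θ, θ ^ 2 / 3, θ ^ 3 / 3 ^ 2, θ ^ 4 / 3 ^ 3, θ ^ 5 / 3 ^ 4]}⟩,
    -- F12
    ⟨vb = 5 ∧ va = 5, {30}, 10,
      {![1, θ, θ ^ 2 / 3, θ ^ 3 / 3 ^ 2, θ ^ 4 / 3 ^ 3, θ ^ 5 / 3 ^ 4]}⟩,
    -- F13
    ⟨vb = 5 ∧ 6 ≤ va, {31}, 11,
      {![1, θ, θ ^ 2 / 3, θ ^ 3 / 3 ^ 2, θ ^ 4 / 3 ^ 3, θ ^ 5 / 3 ^ 4]}⟩,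
    -- F14
    ⟨va = 1 ∧ b ≡ 1 [ZMOD 3], {6}, 6, {![1, θ, θ ^ 2, θ ^ 3, θ ^ 4, θ ^ 5]}⟩,
    -- F15
    ⟨2 ≤ va ∧ (b ≡ 4 [ZMOD 9] ∨ b ≡ 7 [ZMOD 9]), {6}, 6,
      {![1, θ, θ ^ 2, θ ^ 3, θ ^ 4, θ ^ 5]}⟩,
    -- F16
    ⟨2 ≤ va ∧ b ≡ 1 [ZMOD 9], {6}, 2,
      {![1, θ, θ ^ 2, θ ^ 3, (1 - θ ^ 2 + θ ^ 4) / 3, (θ - θ ^ 3 + θ ^ 5) / 3]}⟩,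
    -- F17
    ⟨2 ≤ va ∧ (b ≡ 2 [ZMOD 9] ∨ b ≡ 5 [ZMOD 9]), {6}, 6,
      {![1, θ, θ ^ 2, θ ^ 3, θ ^ 4, θ ^ 5]}⟩,
    -- F18
    ⟨2 ≤ va ∧ b ≡ -1 [ZMOD 9], {6}, 2,
      {![1, θ, θ ^ 2, θ ^ 3, (1 + θ ^ 2 + θ ^ 4) / 3, (θ + θ ^ 3 + θ ^ 5) / 3]}⟩,
    -- F19
    ⟨b ≡ 2 [ZMOD 9] ∧ (a ≡ 3 [ZMOD 9] ∨ a ≡ -3 [ZMOD 9]), {7}, 5,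
      {α | ∃ ε : ℤ, ((a ≡ 3 [ZMOD 9] ∧ ε = -1) ∨ (a ≡ -3 [ZMOD 9] ∧ ε = 1)) ∧
        α = ![1, θ, θ ^ 2, θ ^ 3, θ ^ 4,
          (ε + θ + ε * θ ^ 2 + θ ^ 3 + ε * θ ^ 4 + θ ^ 5) / 3]}⟩,
    -- F20
    ⟨b ≡ -1 [ZMOD 9] ∧ (a ≡ 3 [ZMOD 9] ∨ a ≡ -3 [ZMOD 9]), {7}, 7,
      {![1, θ, θ ^ 2, θ ^ 3, θ ^ 4, θ ^ 5]}⟩,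
    -- F21
    ⟨b ≡ 5 [ZMOD 9] ∧ (a ≡ 3 [ZMOD 9] ∨ a ≡ -3 [ZMOD 9]) ∧ d = 8, {8}, 6,
      {α | ∃ ε : ℤ, ((a ≡ -3 [ZMOD 9] ∧ ε = -1) ∨ (a ≡ 3 [ZMOD 9] ∧ ε = 1)) ∧
        α = ![1, θ, θ ^ 2, θ ^ 3, θ ^ 4,
          (ε + θ + ε * θ ^ 2 + θ ^ 3 + ε * θ ^ 4 + θ ^ 5) / 3]}⟩,
    -- F22
    ⟨b ≡ 5 [ZMOD 9] ∧ (a ≡ 3 [ZMOD 9] ∨ a ≡ -3 [ZMOD 9]) ∧ d = 9, {9}, 3,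
      {α | ∃ ε x : ℤ, ((a ≡ -3 [ZMOD 9] ∧ ε = -1) ∨ (a ≡ 3 [ZMOD 9] ∧ ε = 1)) ∧
        5 * (a / 3) * x + 2 * b ≡ 0 [ZMOD 9] ∧
        α = ![1, θ, θ ^ 2, θ ^ 3, (-1 + ε * θ - ε * θ ^ 3 + θ ^ 4) / 3, lastElt 3 θ x 2]}⟩,
    -- F23
    ⟨b ≡ 5 [ZMOD 9] ∧ (a ≡ 3 [ZMOD 9] ∨ a ≡ -3 [ZMOD 9]) ∧ 10 ≤ d ∧ Even d,
      {n | 10 ≤ n ∧ Even n}, 4,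
      {α | ∃ ε x : ℤ, ((a ≡ -3 [ZMOD 9] ∧ ε = -1) ∨ (a ≡ 3 [ZMOD 9] ∧ ε = 1)) ∧
        5 * (a / 3) * x + 2 * b ≡ 0 [ZMOD 3 ^ ((d - 6) / 2)] ∧
        α = ![1, θ, θ ^ 2, θ ^ 3, (-1 + ε * θ - ε * θ ^ 3 + θ ^ 4) / 3,
          lastElt 3 θ x ((d - 6) / 2)]}⟩,
    -- F24
    ⟨b ≡ 5 [ZMOD 9] ∧ (a ≡ 3 [ZMOD 9] ∨ a ≡ -3 [ZMOD 9]) ∧ 11 ≤ d ∧ Odd d,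
      {n | 11 ≤ n ∧ Odd n}, 3,
      {α | ∃ ε x : ℤ, ((a ≡ -3 [ZMOD 9] ∧ ε = -1) ∨ (a ≡ 3 [ZMOD 9] ∧ ε = 1)) ∧
        5 * (a / 3) * x + 2 * b ≡ 0 [ZMOD 3 ^ ((d - 5) / 2)] ∧
        α = ![1, θ, θ ^ 2, θ ^ 3, (-1 + ε * θ - ε * θ ^ 3 + θ ^ 4) / 3,
          lastElt 3 θ x ((d - 5) / 2)]}⟩,
    -- F25
    ⟨vb = 3 ∧ va = 3, {18}, 6, {![1, θ, θ ^ 2 / 3, θ ^ 3 / 3, θ ^ 4 / 3 ^ 2, θ ^ 5 / 3 ^ 2]}⟩,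
    -- F26
    ⟨vb = 3 ∧ 4 ≤ va ∧ emultiplicity (3 : ℤ) (B ^ 3 - B) = 1, {21}, 7,
      {![1, θ, θ ^ 2 / 3, θ ^ 3 / 3, θ ^ 4 / 3 ^ 2, (θ ^ 2 + 3 * B) ^ 2 * θ / 3 ^ 3]}⟩,
    -- F27
    ⟨vb = 3 ∧ 4 ≤ va ∧ 2 ≤ emultiplicity (3 : ℤ) (B ^ 3 - B), {21}, 3,
      {![1, θ, θ ^ 2 / 3, (θ ^ 2 + 3 * B) * θ / 3 ^ 2, (θ ^ 2 + 3 * B) ^ 2 / 3 ^ 3,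
        (θ ^ 2 + 3 * B) ^ 2 * θ / 3 ^ 3]}⟩ ]

/-- The table for `p = 5`. -/
noncomputable def tableIII {K : Type*} [Field K] (a b D : ℤ) (θ : K) : List (Row K) :=
  let va := emultiplicity (5 : ℤ) a
  let vb := emultiplicity (5 : ℤ) b
  let d := padicValInt 5 D
  [ -- G1
    ⟨vb = 0, {0}, 0, {![1, θ, θ ^ 2, θ ^ 3, θ ^ 4, θ ^ 5]}⟩,
    -- G2
    ⟨vb = 1 ∧ va = 0 ∧ ¬ a ^ 4 ≡ 21 [ZMOD 25] ∧ ¬ b ≡ a ^ 2 - a ^ 6 [ZMOD 25] ∧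
      ¬ a ^ 2 ≡ b / 5 [ZMOD 5], {5}, 5, {![1, θ, θ ^ 2, θ ^ 3, θ ^ 4, θ ^ 5]}⟩,
    -- G3
    ⟨vb = 1 ∧ va = 0 ∧ ¬ a ^ 4 ≡ 21 [ZMOD 25] ∧ ¬ b ≡ a ^ 2 - a ^ 6 [ZMOD 25] ∧
      a ^ 2 ≡ b / 5 [ZMOD 5], {6}, 6, {![1, θ, θ ^ 2, θ ^ 3, θ ^ 4, θ ^ 5]}⟩,
    -- G4
    ⟨vb = 1 ∧ va = 0 ∧ ¬ a ^ 4 ≡ 21 [ZMOD 25] ∧ b ≡ a ^ 2 - a ^ 6 [ZMOD 25], {5}, 3,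
      {![1, θ, θ ^ 2, θ ^ 3, θ ^ 4,
        (θ - a ^ 3 * θ ^ 2 + a ^ 2 * θ ^ 3 - a * θ ^ 4 + θ ^ 5) / 5]}⟩,
    -- G5
    ⟨vb = 1 ∧ va = 0 ∧ a ^ 4 ≡ 21 [ZMOD 25] ∧ ¬ b ≡ a ^ 2 - a ^ 6 [ZMOD 25], {5}, 5,
      {![1, θ, θ ^ 2, θ ^ 3, θ ^ 4, θ ^ 5]}⟩,
    -- G6
    ⟨vb = 1 ∧ va = 0 ∧ a ^ 4 ≡ 21 [ZMOD 25] ∧ b ≡ a ^ 2 - a ^ 6 [ZMOD 25] ∧ Odd d,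
      {n | 7 ≤ n ∧ Odd n}, 3,
      {α | ∃ x : ℤ, a * x + 6 * (b / 5) ≡ 0 [ZMOD 5 ^ ((d - 5) / 2)] ∧
        α = ![1, θ, θ ^ 2, θ ^ 3,
          (-4 * a ^ 3 * θ + 3 * a ^ 2 * θ ^ 2 - 2 * a * θ ^ 3 + θ ^ 4) / 5,
          lastElt 5 θ x ((d - 5) / 2)]}⟩,
    -- G7
    ⟨vb = 1 ∧ va = 0 ∧ a ^ 4 ≡ 21 [ZMOD 25] ∧ b ≡ a ^ 2 - a ^ 6 [ZMOD 25] ∧ Even d,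
      {n | 8 ≤ n ∧ Even n}, 2,
      {α | ∃ x : ℤ, a * x + 6 * (b / 5) ≡ 0 [ZMOD 5 ^ ((d - 4) / 2)] ∧
        α = ![1, θ, θ ^ 2, θ ^ 3,
          (-4 * a ^ 3 * θ + 3 * a ^ 2 * θ ^ 2 - 2 * a * θ ^ 3 + θ ^ 4) / 5,
          lastElt 5 θ x ((d - 4) / 2)]}⟩,
    -- G8
    ⟨vb = 1 ∧ 1 ≤ va, {5}, 5, {![1, θ, θ ^ 2, θ ^ 3, θ ^ 4, θ ^ 5]}⟩,
    -- G9
    ⟨2 ≤ vb ∧ va = 0 ∧ ¬ a ^ 4 ≡ 1 [ZMOD 25], {5}, 5, {![1, θ, θ ^ 2, θ ^ 3, θ ^ 4, θ ^ 5]}⟩,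
    -- G10
    ⟨2 ≤ vb ∧ va = 0 ∧ a ^ 4 ≡ 1 [ZMOD 25], {5}, 3,
      {![1, θ, θ ^ 2, θ ^ 3, θ ^ 4,
        (θ - a ^ 3 * θ ^ 2 + a ^ 2 * θ ^ 3 - a * θ ^ 4 + θ ^ 5) / 5]}⟩,
    -- G11
    ⟨vb = 2 ∧ va = 1, {10}, 8, {![1, θ, θ ^ 2, θ ^ 3, θ ^ 4, θ ^ 5 / 5]}⟩,
    -- G12
    ⟨vb = 2 ∧ 2 ≤ va, {10}, 4, {![1, θ, θ ^ 2, θ ^ 3 / 5, θ ^ 4 / 5, θ ^ 5 / 5]}⟩,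
    -- G13
    ⟨3 ≤ vb ∧ va = 1, {11}, 9, {![1, θ, θ ^ 2, θ ^ 3, θ ^ 4, θ ^ 5 / 5]}⟩,
    -- G14
    ⟨vb = 3 ∧ va = 2, {15}, 7, {![1, θ, θ ^ 2, θ ^ 3 / 5, θ ^ 4 / 5, θ ^ 5 / 5 ^ 2]}⟩,
    -- G15
    ⟨vb = 3 ∧ 3 ≤ va, {15}, 3, {![1, θ, θ ^ 2 / 5, θ ^ 3 / 5, θ ^ 4 / 5 ^ 2, θ ^ 5 / 5 ^ 2]}⟩,
    -- G16
    ⟨4 ≤ vb ∧ va = 2, {17}, 9, {![1, θ, θ ^ 2, θ ^ 3 / 5, θ ^ 4 / 5, θ ^ 5 / 5 ^ 2]}⟩,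
    -- G17
    ⟨vb = 4 ∧ va = 3, {20}, 6, {![1, θ, θ ^ 2 / 5, θ ^ 3 / 5, θ ^ 4 / 5 ^ 2, θ ^ 5 / 5 ^ 3]}⟩,
    -- G18
    ⟨vb = 4 ∧ 4 ≤ va, {20}, 4,
      {![1, θ, θ ^ 2 / 5, θ ^ 3 / 5 ^ 2, θ ^ 4 / 5 ^ 2, θ ^ 5 / 5 ^ 3]}⟩,
    -- G19
    ⟨5 ≤ vb ∧ va = 3, {23}, 9, {![1, θ, θ ^ 2 / 5, θ ^ 3 / 5, θ ^ 4 / 5 ^ 2, θ ^ 5 / 5 ^ 3]}⟩,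
    -- G20
    ⟨vb = 5 ∧ va = 4, {25}, 5,
      {![1, θ, θ ^ 2 / 5, θ ^ 3 / 5 ^ 2, θ ^ 4 / 5 ^ 3, θ ^ 5 / 5 ^ 4]}⟩,
    -- G21
    ⟨vb = 5 ∧ 5 ≤ va, {25}, 5,
      {![1, θ, θ ^ 2 / 5, θ ^ 3 / 5 ^ 2, θ ^ 4 / 5 ^ 3, θ ^ 5 / 5 ^ 4]}⟩,
    -- G22
    ⟨6 ≤ vb ∧ va = 4, {29}, 9,
      {![1, θ, θ ^ 2 / 5, θ ^ 3 / 5 ^ 2, θ ^ 4 / 5 ^ 3, θ ^ 5 / 5 ^ 4]}⟩ ]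

/-- The bases displayed in the last two rows of the table for `p > 5`. -/
noncomputable def generalBases {K : Type*} [Field K] (p : ℕ) (a b : ℤ) (θ : K) (m : ℕ) : Set (Fin 6 → K) :=
  {α | ∃ x y z v w : ℤ,
    6 * x ≡ 5 * a [ZMOD (p : ℤ) ^ m] ∧
    (5 * a) ^ 4 * y ≡ (6 * b) ^ 4 [ZMOD (p : ℤ) ^ m] ∧
    (5 * a) ^ 3 * z ≡ -(6 * b) ^ 3 [ZMOD (p : ℤ) ^ m] ∧
    (5 * a) ^ 2 * v ≡ (6 * b) ^ 2 [ZMOD (p : ℤ) ^ m] ∧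
    5 * a * w ≡ -(6 * b) [ZMOD (p : ℤ) ^ m] ∧
    α = ![1, θ, θ ^ 2, θ ^ 3, θ ^ 4,
      (x + y * θ + z * θ ^ 2 + v * θ ^ 3 + w * θ ^ 4 + θ ^ 5) / (p : K) ^ m]}

/-- The table for primes `p > 5`. -/
noncomputable def tableIV {K : Type*} [Field K] (p : ℕ) (a b D : ℤ) (θ : K) : List (Row K) :=
  let va := emultiplicity (p : ℤ) a
  let vb := emultiplicity (p : ℤ) b
  let d := padicValInt p D
  let π : K := p
  [ -- H1
    ⟨(vb = 0 ∧ 1 ≤ va) ∨ (va = 0 ∧ 1 ≤ vb), {0}, 0, {![1, θ, θ ^ 2, θ ^ 3, θ ^ 4, θ ^ 5]}⟩,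
    -- H2
    ⟨vb = 1 ∧ 1 ≤ va, {5}, 5, {![1, θ, θ ^ 2, θ ^ 3, θ ^ 4, θ ^ 5]}⟩,
    -- H3
    ⟨va = 1 ∧ 2 ≤ vb, {6}, 4, {![1, θ, θ ^ 2, θ ^ 3, θ ^ 4, θ ^ 5 / π]}⟩,
    -- H4
    ⟨vb = 2 ∧ 2 ≤ va, {10}, 4, {![1, θ, θ ^ 2, θ ^ 3 / π, θ ^ 4 / π, θ ^ 5 / π]}⟩,
    -- H5
    ⟨va = 2 ∧ 3 ≤ vb, {12}, 4, {![1, θ, θ ^ 2, θ ^ 3 / π, θ ^ 4 / π, θ ^ 5 / π ^ 2]}⟩,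
    -- H6
    ⟨vb = 3 ∧ 3 ≤ va, {15}, 3, {![1, θ, θ ^ 2 / π, θ ^ 3 / π, θ ^ 4 / π ^ 2, θ ^ 5 / π ^ 2]}⟩,
    -- H7
    ⟨va = 3 ∧ 4 ≤ vb, {18}, 4, {![1, θ, θ ^ 2 / π, θ ^ 3 / π, θ ^ 4 / π ^ 2, θ ^ 5 / π ^ 3]}⟩,
    -- H8
    ⟨vb = 4 ∧ 4 ≤ va, {20}, 4,
      {![1, θ, θ ^ 2 / π, θ ^ 3 / π ^ 2, θ ^ 4 / π ^ 2, θ ^ 5 / π ^ 3]}⟩,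
    -- H9
    ⟨va = 4 ∧ 5 ≤ vb, {24}, 4,
      {![1, θ, θ ^ 2 / π, θ ^ 3 / π ^ 2, θ ^ 4 / π ^ 3, θ ^ 5 / π ^ 4]}⟩,
    -- H10
    ⟨vb = 5 ∧ 5 ≤ va, {25}, 5,
      {![1, θ, θ ^ 2 / π, θ ^ 3 / π ^ 2, θ ^ 4 / π ^ 3, θ ^ 5 / π ^ 4]}⟩,
    -- H11
    ⟨emultiplicity (p : ℤ) (a * b) = 0 ∧ Even d, {n | Even n}, 0,
      generalBases p a b θ (d / 2)⟩,
    -- H12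
    ⟨emultiplicity (p : ℤ) (a * b) = 0 ∧ Odd d, {n | Odd n}, 1,
      generalBases p a b θ ((d - 1) / 2)⟩ ]

/-- The table that belongs to the prime `p`. -/
noncomputable def table {K : Type*} [Field K] (p : ℕ) (a b D : ℤ) (θ : K) : List (Row K) :=
  if p = 2 then tableI a b D θ
  else if p = 3 then tableII a b D θ
  else if p = 5 then tableIII a b D θ
  else tableIV p a b D θ

end Sextic

namespace Sextic

/-- The discriminant of `x ^ 6 + a x + b`. -/
notation:max "Δ(" a "," b ")" => 5 ^ 5 * a ^ 6 - 6 ^ 6 * b ^ 5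

/-- An algebraic closure of `ℚ_[p]`, with the norm that extends the `p`-adic norm. -/
def Ω (p : ℕ) [Fact p.Prime] : Type := PadicAlgCl p

section Valuation

variable {p : ℕ} [hp : Fact p.Prime]

noncomputable instance Ω.normedField : NormedField (Ω p) := PadicAlgCl.normedField p

instance : IsUltrametricDist (Ω p) := PadicAlgCl.isUltrametricDist p

instance : CharZero (Ω p) := PadicAlgCl.charZero p

instance : IsAlgClosed (Ω p) := AlgebraicClosure.isAlgClosed ℚ_[p]

theorem Ω.norm_intCast (n : ℤ) : ‖(n : Ω p)‖ = ‖(n : ℚ_[p])‖ := by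
  have h : ‖((n : ℤ) : PadicAlgCl p)‖ = ‖(n : ℚ_[p])‖ := by
    rw [← map_intCast (algebraMap ℚ_[p] (PadicAlgCl p)), PadicAlgCl.norm_extends]
  exact h

attribute [irreducible] Ω.normedField

/-- The `p`-adic valuation of `x` is at least `r`. -/
def ValGE (x : Ω p) (r : ℝ) : Prop := ‖x‖ ≤ (p : ℝ) ^ (-r)

/-- The `p`-adic valuation of `x` is equal to `r`. -/
def ValEq (x : Ω p) (r : ℝ) : Prop := ‖x‖ = (p : ℝ) ^ (-r)

variable {x y : Ω p} {r s t : ℝ}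

theorem one_lt_prime_real (p : ℕ) [hp : Fact p.Prime] : (1 : ℝ) < p := by
  exact_mod_cast hp.out.one_lt

theorem prime_real_pos (p : ℕ) [hp : Fact p.Prime] : (0 : ℝ) < p :=
  zero_lt_one.trans (one_lt_prime_real p)

theorem ValEq.ge (h : ValEq x r) : ValGE x r := le_of_eq h

theorem ValEq.congr (h : ValEq x r) (hrs : r = s := by norm_num) : ValEq x s := hrs ▸ h

theorem ValGE.mono (h : ValGE x r) (hrs : s ≤ r := by norm_num) : ValGE x s :=
  h.trans (Real.rpow_le_rpow_of_exponent_le (one_lt_prime_real p).le (by linarith))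

theorem ValEq.ge' (h : ValEq x r) (hrs : s ≤ r := by norm_num) : ValGE x s := h.ge.mono hrs

theorem valGE_zero (r : ℝ) : ValGE (0 : Ω p) r := by
  simp only [ValGE, norm_zero]; exact Real.rpow_nonneg (prime_real_pos p).le _

theorem ValGE.add (hx : ValGE x r) (hy : ValGE y r) : ValGE (x + y) r :=
  (IsUltrametricDist.norm_add_le_max x y).trans (max_le hx hy)

theorem ValGE.neg (hx : ValGE x r) : ValGE (-x) r := by simpa [ValGE] using hx

theorem ValGE.sub (hx : ValGE x r) (hy : ValGE y r) : ValGE (x - y) r := by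
  rw [sub_eq_add_neg]; exact hx.add hy.neg

theorem ValGE.mul (hx : ValGE x r) (hy : ValGE y s) (h : t ≤ r + s := by norm_num) : ValGE (x * y) t := by
  refine ValGE.mono ?_ h
  simp only [ValGE] at *
  rw [norm_mul, neg_add, Real.rpow_add (prime_real_pos p)]
  gcongr

theorem ValEq.neg (hx : ValEq x r) : ValEq (-x) r := by simpa [ValEq] using hx

theorem ValEq.mul (hx : ValEq x r) (hy : ValEq y s) (h : t = r + s := by norm_num) : ValEq (x * y) t := by
  simp only [ValEq] at *
  rw [norm_mul, hx, hy, h, neg_add, Real.rpow_add (prime_real_pos p)]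

theorem ValEq.pow (hx : ValEq x r) (n : ℕ) (h : t = n * r := by norm_num) : ValEq (x ^ n) t := by
  simp only [ValEq] at *
  rw [norm_pow, hx, ← Real.rpow_natCast, ← Real.rpow_mul (prime_real_pos p).le, h]
  ring_nf

theorem ValGE.pow (hx : ValGE x r) (n : ℕ) (h : t ≤ n * r := by norm_num) : ValGE (x ^ n) t := by
  refine ValGE.mono ?_ h
  simp only [ValGE] at *
  rw [norm_pow, show -((n : ℝ) * r) = (-r) * n by ring, Real.rpow_mul (prime_real_pos p).le,
    Real.rpow_natCast]
  gcongr

theorem ValEq.ne_zero (hx : ValEq x r) : x ≠ 0 := by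
  rintro rfl
  have h : (0 : ℝ) = (p : ℝ) ^ (-r) := by simpa [ValEq] using hx
  exact (Real.rpow_pos_of_pos (prime_real_pos p) _).ne h

theorem ValEq.inv (hx : ValEq x r) : ValEq x⁻¹ (-r) := by
  simp only [ValEq] at *
  rw [norm_inv, hx, ← Real.rpow_neg (prime_real_pos p).le]

theorem ValEq.div (hx : ValEq x r) (hy : ValEq y s) (h : t = r - s := by norm_num) : ValEq (x / y) t := by
  rw [div_eq_mul_inv]; exact hx.mul hy.inv (by linarith)

theorem ValGE.div (hx : ValGE x r) (hy : ValEq y s) (h : t ≤ r - s := by norm_num) : ValGE (x / y) t := by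
  rw [div_eq_mul_inv]; exact hx.mul hy.inv.ge (by linarith)

theorem ValGE.of_mul (h : ValGE (x * y) r) (hy : ValEq y s) (ht : t ≤ r - s := by norm_num) : ValGE x t := by
  have := h.div hy ht
  rwa [mul_div_cancel_right₀ _ hy.ne_zero] at this

theorem ValEq.of_mul (h : ValEq (x * y) r) (hy : ValEq y s) (ht : t = r - s := by norm_num) : ValEq x t := by
  have := h.div hy ht
  rwa [mul_div_cancel_right₀ _ hy.ne_zero] at this

theorem exists_valEq (hx : x ≠ 0) : ∃ r, ValEq x r := by
  refine ⟨-Real.logb p ‖x‖, ?_⟩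
  rw [ValEq, neg_neg, Real.rpow_logb (prime_real_pos p) (one_lt_prime_real p).ne'
    (norm_pos_iff.mpr hx)]

theorem ValEq.le_of_ge (hx : ValEq x r) (h : ValGE x s) : s ≤ r := by
  simp only [ValEq, ValGE] at *
  rw [hx, Real.rpow_le_rpow_left_iff (one_lt_prime_real p)] at h
  linarith

theorem ValEq.unique (hx : ValEq x r) (h : ValEq x s) : r = s :=
  le_antisymm (h.le_of_ge hx.ge) (hx.le_of_ge h.ge)

theorem ValEq.add (hx : ValEq x r) (hy : ValGE y s) (h : r < s := by norm_num) : ValEq (x + y) r := by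
  have hlt : ‖y‖ < ‖x‖ := by
    rw [hx]
    exact lt_of_le_of_lt hy (Real.rpow_lt_rpow_of_exponent_lt (one_lt_prime_real p) (by linarith))
  rw [ValEq, IsUltrametricDist.norm_add_eq_max_of_norm_ne_norm hlt.ne', max_eq_left hlt.le]
  exact hx

theorem ValEq.false_of_add_eq_zero (hx : ValEq x r) (hy : ValGE y s) (h : r < s)
    (h0 : x + y = 0) : False :=
  (hx.add hy h).ne_zero h0

theorem ValEq.of_pow {n : ℕ} (hn : n ≠ 0) (h : ValEq (x ^ n) r) (hs : s = r / n := by norm_num) : ValEq x s := by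
  have hx : x ≠ 0 := by rintro rfl; exact h.ne_zero (zero_pow hn)
  obtain ⟨u, hu⟩ := exists_valEq hx
  have hn' : (n : ℝ) ≠ 0 := by exact_mod_cast hn
  have := h.unique (hu.pow n rfl)
  exact hu.congr (by rw [hs, this]; field_simp)

theorem ValGE.of_pow {n : ℕ} (hn : n ≠ 0) (h : ValGE (x ^ n) r) (hs : s ≤ r / n := by norm_num) : ValGE x s := by
  by_cases hx : x = 0
  · rw [hx]; exact valGE_zero s
  obtain ⟨u, hu⟩ := exists_valEq hx
  have hn' : (0 : ℝ) < n := by exact_mod_cast hn.bot_lt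
  have := (hu.pow n rfl).le_of_ge h
  exact hu.ge' (hs.trans ((div_le_iff₀ hn').mpr (by linarith)))

theorem valEq_one : ValEq (1 : Ω p) 0 := by simp [ValEq]

theorem norm_natCast_prime : ‖((p : ℕ) : Ω p)‖ = (p : ℝ)⁻¹ := by
  have h := Ω.norm_intCast (p := p) p
  rwa [Int.cast_natCast, Int.cast_natCast, Padic.norm_p] at h

theorem valEq_prime : ValEq ((p : ℕ) : Ω p) 1 := by
  rw [ValEq, norm_natCast_prime, Real.rpow_neg_one]

theorem valGE_intCast (n : ℤ) : ValGE (n : Ω p) 0 := by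
  simpa [ValGE, Ω.norm_intCast] using Padic.norm_int_le_one n

theorem valGE_natCast (n : ℕ) : ValGE (n : Ω p) 0 := by
  simpa using valGE_intCast (p := p) n

theorem valGE_ofNat (n : ℕ) [n.AtLeastTwo] : ValGE (OfNat.ofNat n : Ω p) 0 := by
  simpa using valGE_natCast (p := p) (OfNat.ofNat n)

theorem valEq_intCast {n : ℤ} (h : ¬ (p : ℤ) ∣ n) : ValEq (n : Ω p) 0 := by
  have h1 : ‖(n : ℚ_[p])‖ = 1 := by
    refine le_antisymm (Padic.norm_int_le_one n) (not_lt.mp fun hlt => h ?_)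
    exact (Padic.norm_intCast_lt_one_iff).mp hlt
  simp only [ValEq, Ω.norm_intCast, h1, neg_zero, Real.rpow_zero]

theorem valEq_prime_pow (k : ℕ) : ValEq ((p : Ω p) ^ k) k :=
  valEq_prime.pow k (by simp)

theorem valGE_of_dvd {n : ℤ} {k : ℕ} (h : (p : ℤ) ^ k ∣ n) : ValGE (n : Ω p) k := by
  obtain ⟨m, rfl⟩ := h
  push_cast
  exact (valEq_prime_pow k).ge.mul (valGE_intCast m) (by simp)

theorem valEq_of_dvd_of_not {n : ℤ} {k : ℕ} (h : (p : ℤ) ^ k ∣ n) (h' : ¬ (p : ℤ) ^ (k + 1) ∣ n) :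
    ValEq (n : Ω p) k := by
  obtain ⟨m, rfl⟩ := h
  have hm : ¬ (p : ℤ) ∣ m := fun hm => h' (by rw [pow_succ]; exact mul_dvd_mul_left _ hm)
  push_cast
  exact (valEq_prime_pow k).mul (valEq_intCast hm) (by simp)

theorem dvd_of_valGE {n : ℤ} (h : ValGE (n : Ω p) r) (hr : 0 < r) : (p : ℤ) ∣ n := by
  by_contra hn
  have := (valEq_intCast (p := p) hn).le_of_ge h
  linarith

theorem valGE_one_of_dvd {n : ℤ} (h : (p : ℤ) ∣ n) : ValGE (n : Ω p) 1 := by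
  simpa using valGE_of_dvd (p := p) (k := 1) (by simpa using h)

theorem dvd_of_valGE_mul {d : ℤ} {γ : Ω p} (h : ValGE ((d : Ω p) * γ) t)
    (hγ : ValEq γ r) (hrt : r < t) : (p : ℤ) ∣ d := by
  by_contra hd
  have h1 : ValEq ((d : Ω p) * γ) r := (valEq_intCast hd).mul hγ (by ring)
  exact absurd (h1.le_of_ge h) (by linarith)

/-- A root of a monic quadratic polynomial has at least the valuation that its Newton polygon
predicts. -/
theorem valGE_of_sq_eq {u v : Ω p} (h : x ^ 2 = u * x + v) (hu : ValGE u r)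
    (hv : ValGE v (2 * r)) : ValGE x r := by
  by_cases hx : x = 0
  · rw [hx]; exact valGE_zero r
  obtain ⟨w, hw⟩ := exists_valEq hx
  rcases le_or_gt r w with hrw | hrw
  · exact hw.ge' hrw
  exfalso
  refine (hw.pow 2 rfl).false_of_add_eq_zero (y := -(u * x + v)) (s := min (r + w) (2 * r)) ?_ ?_ ?_
  · exact (((hu.mul hw.ge (min_le_left _ _)).add (hv.mono (min_le_right _ _)))).neg
  · push_cast; exact lt_min (by linarith) (by linarith)
  · rw [h]; ring

end Valuation


section Roots

/-- The trinomial `X ^ 6 + a X + b`. -/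
noncomputable def trinomial {R : Type*} [CommRing R] (a b : R) : R[X] := X ^ 6 + C a * X + C b

variable {F : Type*} [Field F]

theorem trinomial_degree_lt {R : Type*} [CommRing R] [Nontrivial R] (a b : R) :
    (C a * X + C b : R[X]).degree < ((6 : ℕ) : WithBot ℕ) :=
  lt_of_le_of_lt degree_linear_le (by norm_num)

theorem trinomial_monic {R : Type*} [CommRing R] [Nontrivial R] (a b : R) :
    (trinomial a b).Monic := by
  rw [trinomial, add_assoc]
  exact monic_X_pow_add (trinomial_degree_lt a b)

theorem trinomial_natDegree {R : Type*} [CommRing R] [Nontrivial R] (a b : R) :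
    (trinomial a b).natDegree = 6 := by
  rw [trinomial]
  compute_degree!

theorem trinomial_derivative {R : Type*} [CommRing R] (a b : R) :
    derivative (trinomial a b) = C 6 * X ^ 5 + C a := by
  simp only [trinomial, derivative_add, derivative_X_pow, derivative_C_mul_X, derivative_C]
  norm_num

theorem trinomial_map {R S : Type*} [CommRing R] [CommRing S] (φ : R →+* S) (a b : R) :
    (trinomial a b).map φ = trinomial (φ a) (φ b) := by
  simp [trinomial]

theorem trinomial_resultant_map {R S : Type*} [CommRing R] [CommRing S] (φ : R →+* S) (a b : R) :
    φ ((trinomial a b).resultant (derivative (trinomial a b)) 6 5) =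
      (trinomial (φ a) (φ b)).resultant (C 6 * X ^ 5 + C (φ a)) 6 5 := by
  rw [← resultant_map_map, ← derivative_map, trinomial_map, trinomial_derivative]

theorem exists_trinomial_eq_prod [IsAlgClosed F] (a b : F) :
    ∃ r : Fin 6 → F, trinomial a b = ∏ i, (X - C (r i)) ∧
      (trinomial a b).roots = Finset.univ.val.map r := by
  have hs := IsAlgClosed.splits (trinomial a b)
  have hcard : (trinomial a b).roots.card = 6 := by
    rw [← hs.natDegree_eq_card_roots, trinomial_natDegree]
  have hl : (trinomial a b).roots.toList.length = 6 := by simpa using hcard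
  let r : Fin 6 → F := fun i => (trinomial a b).roots.toList.get (Fin.cast hl.symm i)
  have hr : (trinomial a b).roots = Finset.univ.val.map r := by
    have h1 : List.ofFn r = (trinomial a b).roots.toList := by
      apply List.ext_get
      · simp [hl]
      · intro n h1 h2
        have hn : n < 6 := hl ▸ h2
        interval_cases n <;> simp [r]
    rw [← Multiset.coe_toList (trinomial a b).roots, ← h1]
    simp [Fin.univ_val_map]
  refine ⟨r, ?_, hr⟩
  have h2 := hs.eq_prod_roots
  rw [(trinomial_monic a b).leadingCoeff, C_1, one_mul, hr] at h2
  rw [h2]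
  simp [Finset.prod]

/-- The roots of `X ^ 6 + a X + b` and their first power sums. -/
theorem exists_roots [CharZero F] [IsAlgClosed F] (a b : F) :
    ∃ r : Fin 6 → F, (∀ i, r i ^ 6 + a * r i + b = 0) ∧
      (∀ x, ∏ i, (x - r i) = x ^ 6 + a * x + b) ∧
      ∑ i, r i = 0 ∧ ∑ i, r i ^ 2 = 0 ∧ ∑ i, r i ^ 3 = 0 ∧ ∑ i, r i ^ 4 = 0 ∧
      ∑ i, r i ^ 5 = -5 * a := by
  obtain ⟨r, hr, -⟩ := exists_trinomial_eq_prod a b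
  have hprod : ∀ x, ∏ i, (x - r i) = x ^ 6 + a * x + b := by
    intro x
    have := congrArg (eval x) hr
    simp only [trinomial, eval_add, eval_pow, eval_X, eval_mul, eval_C, eval_prod, eval_sub] at this
    exact this.symm
  have hroot : ∀ i, r i ^ 6 + a * r i + b = 0 := by
    intro i
    rw [← hprod, Finset.prod_eq_zero (Finset.mem_univ i) (sub_self _)]
  have hder : derivative (trinomial a b) = ∑ i, (X ^ 5 + C (r i) * X ^ 4 + C (r i ^ 2) * X ^ 3 +
      C (r i ^ 3) * X ^ 2 + C (r i ^ 4) * X + C (r i ^ 5 + a)) := by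
    rw [hr, derivative_prod_finset]
    refine Finset.sum_congr rfl fun i _ => ?_
    have hne : (X - C (r i)) ≠ 0 := X_sub_C_ne_zero _
    apply mul_left_cancel₀ hne
    rw [derivative_X_sub_C, mul_one, Finset.mul_prod_erase _ (fun j => X - C (r j))
      (Finset.mem_univ i), ← hr, trinomial]
    have hb : b = -(r i ^ 6 + a * r i) := by linear_combination hroot i
    rw [hb]
    simp only [C_neg, C_add, C_mul, C_pow]
    ring
  rw [trinomial_derivative] at hder
  refine ⟨r, hroot, hprod, ?_, ?_, ?_, ?_, ?_⟩
  · have h := congrArg (fun q => coeff q 4) hder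
    simp [-map_pow] at h; exact h.symm
  · have h := congrArg (fun q => coeff q 3) hder
    simp [-map_pow] at h; exact h.symm
  · have h := congrArg (fun q => coeff q 2) hder
    simp [-map_pow] at h; exact h.symm
  · have h := congrArg (fun q => coeff q 1) hder
    simp [-map_pow] at h; exact h.symm
  · have h := congrArg (fun q => coeff q 0) hder
    simp [Finset.sum_add_distrib, -map_pow, -map_add] at h
    linear_combination -h

theorem prod_deriv_roots [CharZero F] (a b : F) (hb : b ≠ 0) (r : Fin 6 → F)
    (hroot : ∀ i, r i ^ 6 + a * r i + b = 0)
    (hprod : ∀ x, ∏ i, (x - r i) = x ^ 6 + a * x + b) :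
    ∏ i, (6 * r i ^ 5 + a) = 6 ^ 6 * b ^ 5 - 5 ^ 5 * a ^ 6 := by
  have h0 : ∏ i, r i = b := by
    have := hprod 0
    simp only [zero_sub, Fin.prod_univ_six] at this ⊢
    linear_combination this
  have h1 : (∏ i, r i) * ∏ i, (6 * r i ^ 5 + a) = ∏ i, (-5 * a * r i - 6 * b) := by
    rw [← Finset.prod_mul_distrib]
    refine Finset.prod_congr rfl fun i _ => ?_
    linear_combination 6 * hroot i
  have h2 : ∏ i, (-5 * a * r i - 6 * b) = (6 * b) ^ 6 - 6 * b * a * (5 * a) ^ 5 +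
      b * (5 * a) ^ 6 := by
    by_cases ha : a = 0
    · subst ha
      simp only [Fin.prod_univ_six]; ring
    · have h3 : ∀ i, -5 * a * r i - 6 * b = 5 * a * (-6 * b / (5 * a) - r i) := by
        intro i; field_simp
        ring
      simp only [h3]
      rw [Finset.prod_mul_distrib, hprod, Finset.prod_const, Finset.card_univ, Fintype.card_fin]
      field_simp
      ring
  rw [h0, h2] at h1
  apply mul_left_cancel₀ hb
  rw [h1]
  ring

theorem trinomial_discr (a b : ℤ) (hb : b ≠ 0) :
    (trinomial a b).discr = Δ(a,b) := by
  have : Fact (Nat.Prime 2) := ⟨Nat.prime_two⟩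
  have hdeg : 0 < (trinomial a b).degree := by
    rw [← natDegree_pos_iff_degree_pos, trinomial_natDegree]; norm_num
  have h := resultant_deriv hdeg
  rw [(trinomial_monic a b).leadingCoeff, trinomial_natDegree] at h
  norm_num at h
  obtain ⟨r, hr, hroots⟩ := exists_trinomial_eq_prod (a : Ω 2) (b : Ω 2)
  have hprod : ∀ x, ∏ i, (x - r i) = x ^ 6 + (a : Ω 2) * x + b := by
    intro x
    have := congrArg (eval x) hr
    simp only [trinomial, eval_add, eval_pow, eval_X, eval_mul, eval_C, eval_prod, eval_sub] at this
    exact this.symm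
  have hroot : ∀ i, r i ^ 6 + (a : Ω 2) * r i + b = 0 := by
    intro i
    rw [← hprod, Finset.prod_eq_zero (Finset.mem_univ i) (sub_self _)]
  have h1 := prod_deriv_roots (a : Ω 2) b (by exact_mod_cast hb) r hroot hprod
  have h2 := resultant_eq_prod_eval (trinomial (a : Ω 2) b)
    (derivative (trinomial (a : Ω 2) b)) 5 (by
      rw [trinomial_derivative]; compute_degree) (IsAlgClosed.splits _)
  rw [(trinomial_monic _ _).leadingCoeff, hroots, trinomial_natDegree, trinomial_derivative] at h2
  have h3 : (((trinomial a b).resultant (derivative (trinomial a b)) 6 5 : ℤ) : Ω 2) =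
      (trinomial (a : Ω 2) b).resultant (C 6 * X ^ 5 + C (a : Ω 2)) 6 5 := by
    exact trinomial_resultant_map (Int.castRingHom (Ω 2)) a b
  have h4 : (((trinomial a b).resultant (derivative (trinomial a b)) 6 5 : ℤ) : Ω 2) =
      6 ^ 6 * b ^ 5 - 5 ^ 5 * a ^ 6 := by
    rw [h3, h2, ← h1]
    simp [Finset.prod]
  have h5 : (trinomial a b).resultant (derivative (trinomial a b)) 6 5 =
      6 ^ 6 * b ^ 5 - 5 ^ 5 * a ^ 6 := by exact_mod_cast h4
  linarith

end Roots


section Generator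

variable {K : Type*} [Field K] [NumberField K]

/-- `K = ℚ(θ)` where `θ` is a root of the irreducible trinomial `X ^ 6 + a X + b`. -/
structure IsTrinomialGenerator (θ : K) (a b : ℤ) : Prop where
  irreducible : Irreducible (trinomial a b)
  aeval_eq_zero : aeval θ (trinomial a b) = 0
  adjoin_eq_top : IntermediateField.adjoin ℚ {θ} = ⊤

variable {θ : K} {a b : ℤ}

namespace IsTrinomialGenerator

theorem root_eq (h : IsTrinomialGenerator θ a b) : θ ^ 6 + a * θ + b = 0 := by
  simpa [trinomial] using h.aeval_eq_zero

theorem ne_zero (h : IsTrinomialGenerator θ a b) : b ≠ 0 := by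
  rintro rfl
  have hf : (trinomial a 0 : ℤ[X]) = X * (X ^ 5 + C a) := by
    simp only [trinomial, C_0]; ring
  rcases h.irreducible.isUnit_or_isUnit hf with h1 | h1
  · exact not_isUnit_X h1
  · have h2 : (X ^ 5 + C a : ℤ[X]).natDegree = 5 := natDegree_X_pow_add_C
    rw [natDegree_eq_zero_of_isUnit h1] at h2
    omega

theorem minpoly_eq (h : IsTrinomialGenerator θ a b) :
    minpoly ℚ θ = trinomial (a : ℚ) (b : ℚ) := by
  have h1 : (trinomial a b).map (algebraMap ℤ ℚ) = trinomial (a : ℚ) (b : ℚ) := by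
    rw [trinomial_map]; simp
  symm
  refine minpoly.eq_of_irreducible_of_monic ?_ ?_ (trinomial_monic _ _)
  · rw [← h1]
    exact (trinomial_monic a b).irreducible_iff_irreducible_map_fraction_map.mp h.irreducible
  · rw [← h1, aeval_map_algebraMap, h.aeval_eq_zero]

theorem finrank_eq (h : IsTrinomialGenerator θ a b) : Module.finrank ℚ K = 6 := by
  have h1 := IntermediateField.adjoin.finrank (K := ℚ) (Algebra.IsIntegral.isIntegral θ)
  rw [h.adjoin_eq_top, IntermediateField.finrank_top', h.minpoly_eq, trinomial_natDegree] at h1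
  exact h1

theorem algebra_adjoin_eq_top (h : IsTrinomialGenerator θ a b) : Algebra.adjoin ℚ {θ} = ⊤ := by
  rw [← IntermediateField.adjoin_simple_toSubalgebra_of_isAlgebraic
    (Algebra.IsAlgebraic.isAlgebraic θ), h.adjoin_eq_top]
  rfl

theorem exists_algHom (h : IsTrinomialGenerator θ a b) {E : Type*} [Field E] [CharZero E]
    [IsAlgClosed E] {t : E} (ht : t ^ 6 + a * t + b = 0) : ∃ σ : K →ₐ[ℚ] E, σ θ = t := by
  have h1 := Algebra.IsAlgebraic.range_eval_eq_rootSet_minpoly (F := ℚ) E θ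
  have h2 : t ∈ (minpoly ℚ θ).rootSet E := by
    rw [mem_rootSet, h.minpoly_eq]
    refine ⟨(trinomial_monic _ _).ne_zero, ?_⟩
    simpa [trinomial] using ht
  rw [← h1] at h2
  exact h2

theorem algHom_root (h : IsTrinomialGenerator θ a b) {E : Type*} [Field E] [CharZero E]
    (σ : K →ₐ[ℚ] E) : σ θ ^ 6 + a * σ θ + b = 0 := by
  have := congrArg σ h.root_eq
  simpa using this

theorem aroots_eq (h : IsTrinomialGenerator θ a b) {E : Type*} [Field E] [CharZero E]
    [IsAlgClosed E] : (Finset.univ : Finset (K →ₐ[ℚ] E)).val.map (fun σ => σ θ) =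
      (trinomial (a : E) (b : E)).roots := by
  have hm : (minpoly ℚ θ).map (algebraMap ℚ E) = trinomial (a : E) (b : E) := by
    rw [h.minpoly_eq, trinomial_map]; simp
  refine (Multiset.Nodup.ext ?_ ?_).mpr ?_
  · refine (Multiset.nodup_map_iff_of_injective ?_).mpr Finset.univ.nodup
    intro σ τ hστ
    apply AlgHom.ext_of_adjoin_eq_top h.algebra_adjoin_eq_top
    simpa using hστ
  · rw [← hm]
    exact nodup_roots (Polynomial.Separable.map (Algebra.IsSeparable.isSeparable ℚ θ))
  · intro t
    rw [mem_roots (trinomial_monic _ _).ne_zero]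
    simp only [Multiset.mem_map, Finset.mem_val, Finset.mem_univ, true_and]
    constructor
    · rintro ⟨σ, rfl⟩
      simpa [trinomial] using h.algHom_root σ
    · intro ht
      exact h.exists_algHom (by simpa [trinomial] using ht)

theorem discr_pow (h : IsTrinomialGenerator θ a b) :
    Algebra.discr ℚ (fun i : Fin 6 => θ ^ (i : ℕ)) = 5 ^ 5 * (a : ℚ) ^ 6 - 6 ^ 6 * (b : ℚ) ^ 5 := by
  let pb := PowerBasis.ofAdjoinEqTop (Algebra.IsIntegral.isIntegral (R := ℚ) θ)
    h.algebra_adjoin_eq_top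
  have hgen : pb.gen = θ := PowerBasis.ofAdjoinEqTop_gen _ _
  have hdim : pb.dim = 6 := by rw [← pb.finrank, h.finrank_eq]
  have hb : Algebra.discr ℚ (fun i : Fin 6 => θ ^ (i : ℕ)) = Algebra.discr ℚ pb.basis := by
    rw [← Algebra.discr_reindex ℚ pb.basis (finCongr hdim)]
    congr 1
    ext i
    simp [hgen]
  rw [hb, Algebra.discr_powerBasis_eq_norm, h.finrank_eq, hgen, h.minpoly_eq, trinomial_derivative]
  have hn := Algebra.norm_eq_prod_embeddings ℚ (AlgebraicClosure ℚ)
    (aeval θ (C 6 * X ^ 5 + C (a : ℚ)))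
  obtain ⟨r, hr, hroots⟩ := exists_trinomial_eq_prod (a : AlgebraicClosure ℚ)
    (b : AlgebraicClosure ℚ)
  have hprod : ∀ x, ∏ i, (x - r i) = x ^ 6 + (a : AlgebraicClosure ℚ) * x + b := by
    intro x
    have := congrArg (eval x) hr
    simp only [trinomial, eval_add, eval_pow, eval_X, eval_mul, eval_C, eval_prod, eval_sub] at this
    exact this.symm
  have hroot : ∀ i, r i ^ 6 + (a : AlgebraicClosure ℚ) * r i + b = 0 := by
    intro i
    rw [← hprod, Finset.prod_eq_zero (Finset.mem_univ i) (sub_self _)]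
  have h1 := prod_deriv_roots (a : AlgebraicClosure ℚ) b (by exact_mod_cast h.ne_zero) r hroot hprod
  have h2 : ∏ σ : K →ₐ[ℚ] AlgebraicClosure ℚ, σ (aeval θ (C 6 * X ^ 5 + C (a : ℚ))) =
      ∏ i, (6 * r i ^ 5 + (a : AlgebraicClosure ℚ)) := by
    have h3 := congrArg (fun s => (s.map (fun t : AlgebraicClosure ℚ => 6 * t ^ 5 + a)).prod)
      (h.aroots_eq (E := AlgebraicClosure ℚ))
    simp only [hroots, Multiset.map_map] at h3
    calc _ = ∏ σ : K →ₐ[ℚ] AlgebraicClosure ℚ, (6 * σ θ ^ 5 + (a : AlgebraicClosure ℚ)) := by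
          refine Finset.prod_congr rfl fun σ _ => ?_
          simp
          left; exact map_ofNat σ 6
      _ = _ := h3
  rw [h2, h1] at hn
  have h4 : Algebra.norm ℚ (aeval θ (C 6 * X ^ 5 + C (a : ℚ))) =
      6 ^ 6 * (b : ℚ) ^ 5 - 5 ^ 5 * (a : ℚ) ^ 6 := by
    apply (algebraMap ℚ (AlgebraicClosure ℚ)).injective
    rw [hn]
    simp
  rw [h4]
  norm_num

end IsTrinomialGenerator

/-- A monic quantity of degree `i` in `t`, whose lower coefficients are given by the list `l i`. -/
def tri {R : Type*} [CommRing R] (l : Fin 6 → List ℤ) (t : R) (i : Fin 6) : R :=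
  (∑ j ∈ Finset.range (i : ℕ), ((l i).getD j 0 : R) * t ^ j) + t ^ (i : ℕ)

theorem map_tri {R S : Type*} [CommRing R] [CommRing S] (φ : R →+* S) (l : Fin 6 → List ℤ) (t : R)
    (i : Fin 6) : φ (tri l t i) = tri l (φ t) i := by
  simp [tri]

end Generator

section Integrality

variable {p : ℕ} [hp : Fact p.Prime]

theorem norm_le_one_of_isIntegral {R : Type*} [CommRing R] [Algebra R (Ω p)]
    (hR : ∀ c : R, ‖algebraMap R (Ω p) c‖ ≤ 1) {y : Ω p} (hy : IsIntegral R y) :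
    ‖y‖ ≤ 1 := by
  by_contra! hlt
  obtain ⟨q, hq, hq0⟩ := hy
  rw [eval₂_eq_sum_range, Finset.sum_range_succ, hq.coeff_natDegree, map_one, one_mul] at hq0
  have hle : ‖∑ i ∈ Finset.range q.natDegree, algebraMap R (Ω p) (q.coeff i) * y ^ i‖ <
      ‖y ^ q.natDegree‖ := by
    rcases Nat.eq_zero_or_pos q.natDegree with h0 | hpos
    · simp [h0]
    · have hne : (Finset.range q.natDegree).Nonempty := ⟨0, Finset.mem_range.mpr hpos⟩
      obtain ⟨i, hi, hmax⟩ := IsUltrametricDist.exists_norm_finsetSum_le_of_nonempty hne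
        (fun i => algebraMap R (Ω p) (q.coeff i) * y ^ i)
      refine lt_of_le_of_lt hmax ?_
      rw [norm_mul, norm_pow, norm_pow]
      calc _ ≤ 1 * ‖y‖ ^ i := by gcongr; exact hR _
        _ < ‖y‖ ^ q.natDegree := by
          rw [one_mul]; exact pow_lt_pow_right₀ hlt (Finset.mem_range.mp hi)
  have h1 : ‖y ^ q.natDegree‖ =
      ‖∑ i ∈ Finset.range q.natDegree, algebraMap R (Ω p) (q.coeff i) * y ^ i‖ := by
    rw [← norm_neg (y ^ q.natDegree)]
    congr 1
    linear_combination -hq0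
  linarith

theorem valGE_zero_iff {x : Ω p} : ValGE x 0 ↔ ‖x‖ ≤ 1 := by simp [ValGE]

theorem norm_ratCast_le_one_iff {q : ℚ} : ‖(q : Ω p)‖ ≤ 1 ↔ ¬ (p : ℤ) ∣ (q.den : ℤ) := by
  have hden : ((q.den : ℤ) : Ω p) ≠ 0 := by exact_mod_cast q.den_ne_zero
  have hq : (q : Ω p) = (q.num : Ω p) / ((q.den : ℤ) : Ω p) := by
    rw [Int.cast_natCast, ← Rat.cast_def]
  constructor
  · intro h hd
    have h1 : ¬ (p : ℤ) ∣ q.num := by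
      intro hn
      have := q.reduced
      rw [Nat.coprime_iff_gcd_eq_one] at this
      have h2 : p ∣ Nat.gcd q.num.natAbs q.den :=
        Nat.dvd_gcd (Int.natCast_dvd.mp hn) (by exact_mod_cast hd)
      rw [this] at h2
      exact hp.out.one_lt.ne' (Nat.dvd_one.mp h2)
    have h3 : (q : Ω p) * ((q.den : ℤ) : Ω p) = q.num := by rw [hq]; field_simp
    have h4 : ValGE ((q : Ω p) * ((q.den : ℤ) : Ω p)) 1 :=
      (valGE_zero_iff.mpr h).mul (valGE_one_of_dvd hd)
    rw [h3] at h4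
    exact h1 (dvd_of_valGE h4 one_pos)
  · intro hd
    rw [hq, ← valGE_zero_iff]
    exact (valGE_intCast _).div (valEq_intCast hd)

theorem mem_localInt_of_norm_le_one {q : ℚ} (h : ‖(q : Ω p)‖ ≤ 1) : q ∈ localInt p :=
  ⟨q.num, q.den, norm_ratCast_le_one_iff.mp h, by exact_mod_cast (Rat.num_div_den q).symm⟩

variable {K : Type*} [Field K] [NumberField K]

/-- An element all of whose conjugates have norm at most one is `p`-integral. -/
theorem isIntegral_localInt_of_norm_le_one {y : K}
    (h : ∀ σ : K →ₐ[ℚ] Ω p, ‖σ y‖ ≤ 1) : IsIntegral (localInt p) y := by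
  classical
  have hy := Algebra.IsIntegral.isIntegral (R := ℚ) y
  have hspl := IsAlgClosed.splits ((minpoly ℚ y).map (algebraMap ℚ (Ω p)))
  have hroots : ∀ t ∈ ((minpoly ℚ y).map (algebraMap ℚ (Ω p))).roots, ‖t‖ ≤ 1 := by
    intro t ht
    have h2 : t ∈ (minpoly ℚ y).rootSet (Ω p) := by
      rw [rootSet, Finset.mem_coe, Multiset.mem_toFinset]; exact ht
    rw [← Algebra.IsAlgebraic.range_eval_eq_rootSet_minpoly (F := ℚ) (Ω p) y] at h2
    obtain ⟨σ, rfl⟩ := h2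
    exact h σ
  let O : Subring (Ω p) :=
    { carrier := {x | ValGE x 0}
      mul_mem' := fun hx hy => hx.mul hy
      one_mem' := valEq_one.ge
      add_mem' := fun hx hy => hx.add hy
      zero_mem' := valGE_zero 0
      neg_mem' := fun hx => hx.neg }
  have hmon : ((minpoly ℚ y).map (algebraMap ℚ (Ω p))).Monic := (minpoly.monic hy).map _
  have hlift : (minpoly ℚ y).map (algebraMap ℚ (Ω p)) ∈ lifts O.subtype := by
    rw [hspl.eq_prod_roots, hmon.leadingCoeff, C_1, one_mul]
    apply Subsemiring.multiset_prod_mem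
    intro c hc
    obtain ⟨t, ht, rfl⟩ := Multiset.mem_map.mp hc
    rw [sub_eq_add_neg, ← C_neg]
    exact add_mem (X_mem_lifts _)
      (C_mem_lifts O.subtype (⟨-t, (valGE_zero_iff.mpr (hroots t ht)).neg⟩ : O))
  have hcoeff : ∀ n, (minpoly ℚ y).coeff n ∈ localInt p := by
    intro n
    obtain ⟨c, hc⟩ := (lifts_iff_coeff_lifts _).mp hlift n
    apply mem_localInt_of_norm_le_one (p := p)
    rw [coeff_map, eq_ratCast] at hc
    rw [← hc]
    exact valGE_zero_iff.mp c.2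
  have hlift2 : minpoly ℚ y ∈ lifts (localInt p).subtype := by
    rw [lifts_iff_coeff_lifts]
    exact fun n => ⟨⟨_, hcoeff n⟩, rfl⟩
  obtain ⟨q, hq1, -, hq2⟩ := lifts_and_natDegree_eq_and_monic hlift2 (minpoly.monic hy)
  refine ⟨q, hq2, ?_⟩
  have h3 : aeval y (q.map (localInt p).subtype) = 0 := by rw [hq1, minpoly.aeval]
  have h4 : (algebraMap (localInt p) K) = (algebraMap ℚ K).comp (localInt p).subtype := rfl
  rw [h4, ← eval₂_map]
  exact h3

theorem norm_le_one_of_isIntegral_localInt {y : K} (h : IsIntegral (localInt p) y)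
    (σ : K →ₐ[ℚ] Ω p) : ‖σ y‖ ≤ 1 := by
  let _ : Algebra (localInt p) (Ω p) :=
    ((algebraMap ℚ (Ω p)).comp (localInt p).subtype).toAlgebra
  refine norm_le_one_of_isIntegral (R := localInt p) ?_ ?_
  · rintro ⟨_, m, s, hs, rfl⟩
    change ‖algebraMap ℚ (Ω p) ((m : ℚ) / s)‖ ≤ 1
    rw [map_div₀, map_intCast, map_intCast, ← valGE_zero_iff]
    exact (valGE_intCast m).div (valEq_intCast hs)
  · obtain ⟨q, hq, hq0⟩ := h
    refine ⟨q, hq, ?_⟩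
    have h4 : (algebraMap (localInt p) (Ω p)) =
        (σ : K →+* Ω p).comp (algebraMap (localInt p) K) := by
      ext c
      change algebraMap ℚ (Ω p) c = σ (algebraMap ℚ K c)
      rw [σ.commutes]
    rw [h4]
    have := congrArg (σ : K →+* Ω p) hq0
    rwa [hom_eval₂, map_zero] at this

/-- A `p`-integral element becomes integral over `ℤ` after multiplication by an integer that is not
divisible by `p`. -/
theorem exists_isIntegral_mul {y : K} (h : IsIntegral (localInt p) y) :
    ∃ s : ℤ, ¬ (p : ℤ) ∣ s ∧ IsIntegral ℤ ((s : K) * y) := by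
  have hprime : (Ideal.span {(p : ℤ)}).IsPrime :=
    (Ideal.span_singleton_prime (by exact_mod_cast hp.out.ne_zero)).mpr
      (Nat.prime_iff_prime_int.mp hp.out)
  have hmem : ∀ s : ℤ, s ∈ (Ideal.span {(p : ℤ)}).primeCompl ↔ ¬ (p : ℤ) ∣ s := by
    intro s
    rw [Ideal.mem_primeCompl_iff, Ideal.mem_span_singleton]
  have hne : ∀ {s : ℤ}, ¬ (p : ℤ) ∣ s → (s : ℚ) ≠ 0 := by
    intro s hs h0
    exact hs ((Int.cast_eq_zero.mp h0) ▸ dvd_zero _)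
  have hloc : IsLocalization (Ideal.span {(p : ℤ)}).primeCompl (localInt p) := by
    refine ⟨⟨?_, ?_, ?_⟩⟩
    · rintro ⟨s, hs⟩
      rw [hmem] at hs
      have h1 : ((s : ℚ)⁻¹) ∈ localInt p := ⟨1, s, hs, by simp⟩
      refine IsUnit.of_mul_eq_one ⟨_, h1⟩ ?_
      apply Subtype.ext
      change (algebraMap ℤ (localInt p) s : ℚ) * (s : ℚ)⁻¹ = 1
      simp [hne hs]
    · rintro ⟨_, m, s, hs, rfl⟩
      refine ⟨⟨m, ⟨s, (hmem s).mpr hs⟩⟩, ?_⟩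
      apply Subtype.ext
      change (m : ℚ) / s * (algebraMap ℤ (localInt p) s : ℚ) = (algebraMap ℤ (localInt p) m : ℚ)
      simp [hne hs]
    · intro x y hxy
      refine ⟨1, ?_⟩
      have := congrArg (fun z : localInt p => (z : ℚ)) hxy
      simp at this
      rw [this]
  obtain ⟨⟨s, hs⟩, h1⟩ := IsIntegral.exists_multiple_integral_of_isLocalization
    (Ideal.span {(p : ℤ)}).primeCompl y h
  refine ⟨s, (hmem s).mp hs, ?_⟩
  have h2 : (⟨s, hs⟩ : (Ideal.span {(p : ℤ)}).primeCompl) • y = (s : K) * y := by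
    rw [Submonoid.smul_def, zsmul_eq_mul]
  rwa [h2] at h1

end Integrality


section Family

variable {K : Type*} [Field K] [NumberField K] {θ : K} {a b : ℤ}

namespace IsTrinomialGenerator

theorem exists_basis (h : IsTrinomialGenerator θ a b) :
    ∃ B : Module.Basis (Fin 6) ℚ K, ∀ i, B i = θ ^ (i : ℕ) := by
  let pb := PowerBasis.ofAdjoinEqTop (Algebra.IsIntegral.isIntegral (R := ℚ) θ)
    h.algebra_adjoin_eq_top
  have hgen : pb.gen = θ := PowerBasis.ofAdjoinEqTop_gen _ _
  have hdim : pb.dim = 6 := by rw [← pb.finrank, h.finrank_eq]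
  exact ⟨pb.basis.reindex (finCongr hdim), fun i => by simp [hgen]⟩

theorem discr_ne_zero (h : IsTrinomialGenerator θ a b) : Δ(a,b) ≠ 0 := by
  obtain ⟨B, hB⟩ := h.exists_basis
  have h1 := Algebra.discr_not_zero_of_basis ℚ B
  rw [show (B : Fin 6 → K) = fun i : Fin 6 => θ ^ (i : ℕ) from funext hB, h.discr_pow] at h1
  exact_mod_cast h1

end IsTrinomialGenerator

variable (p : ℕ) [hp : Fact p.Prime]

/-- The elements `tri l t i / p ^ k i` are integral at every root `t` of the trinomial. -/
def IntegralFamily (a b : ℤ) (l : Fin 6 → List ℤ) (k : Fin 6 → ℕ) : Prop :=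
  ∀ t : Ω p, t ^ 6 + a * t + b = 0 → ∀ i, ValGE (tri l t i) (k i)

/-- An integer combination of the elements `tri l t i / p ^ k i` is divisible by `p` at all roots
of the trinomial only if all coefficients are divisible by `p`. -/
def SaturatedFamily (a b : ℤ) (l : Fin 6 → List ℤ) (k : Fin 6 → ℕ) : Prop :=
  ∀ d : Fin 6 → ℤ, (∀ t : Ω p, t ^ 6 + a * t + b = 0 →
    ValGE (∑ i, (d i : Ω p) * (tri l t i / (p : Ω p) ^ k i)) 1) → ∀ i, (p : ℤ) ∣ d i

/-- The elements of `K` that belong to the data `l` and `k`. -/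
noncomputable def family {K : Type*} [Field K] (p : ℕ) (θ : K) (l : Fin 6 → List ℤ) (k : Fin 6 → ℕ) (i : Fin 6) : K :=
  tri l θ i / (p : K) ^ k i

variable {p} {l : Fin 6 → List ℤ} {k : Fin 6 → ℕ}

theorem map_family (σ : K →ₐ[ℚ] Ω p) (i : Fin 6) :
    σ (family p θ l k i) = tri l (σ θ) i / (p : Ω p) ^ k i := by
  have h : σ (tri l θ i) = tri l (σ θ) i := map_tri (σ : K →+* Ω p) l θ i
  simp only [family, map_div₀, map_pow, map_natCast, h]

theorem valGE_one_of_isIntegral {y : K} (h : IsIntegral ℤ y) (σ : K →ₐ[ℚ] Ω p) :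
    ValGE (σ y) 0 := by
  rw [valGE_zero_iff]
  exact norm_le_one_of_isIntegral_localInt (p := p) h.tower_top σ

theorem algHom_intCast (σ : K →ₐ[ℚ] Ω p) (n : ℤ) : σ (n : K) = n :=
  map_intCast (σ : K →+* Ω p) n

theorem IntegralFamily.isIntegral (hS : IsTrinomialGenerator θ a b)
    (hI : IntegralFamily p a b l k) (i : Fin 6) : IsIntegral ℤ (family p θ l k i) := by
  have hp0 : (p : K) ≠ 0 := by exact_mod_cast hp.out.ne_zero
  have hθ : IsIntegral ℤ θ := ⟨trinomial a b, trinomial_monic a b, hS.aeval_eq_zero⟩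
  have h1 : IsIntegral (localInt p) (family p θ l k i) := by
    apply isIntegral_localInt_of_norm_le_one
    intro σ
    rw [map_family, ← valGE_zero_iff]
    exact (hI _ (hS.algHom_root σ) i).div (valEq_prime_pow _) (by simp)
  obtain ⟨s, hs, hsi⟩ := exists_isIntegral_mul h1
  have h2 : IsIntegral ℤ ((p : K) ^ k i * family p θ l k i) := by
    rw [family, mul_div_cancel₀ _ (pow_ne_zero _ hp0)]
    refine IsIntegral.add (IsIntegral.sum _ fun j _ => ?_) (hθ.pow _)
    exact (isIntegral_algebraMap (R := ℤ) (x := (l i).getD j 0)).mul (hθ.pow _)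
  have hcop : IsCoprime s ((p : ℤ) ^ k i) :=
    (((Nat.prime_iff_prime_int.mp hp.out).coprime_iff_not_dvd).mpr hs).symm.pow_right
  obtain ⟨u, v, huv⟩ := hcop
  have h3 : family p θ l k i =
      (u : K) * ((s : K) * family p θ l k i) + (v : K) * ((p : K) ^ k i * family p θ l k i) := by
    have : (u : K) * s + v * (p : K) ^ k i = 1 := by exact_mod_cast congrArg (Int.cast (R := K)) huv
    linear_combination -family p θ l k i * this
  rw [h3]
  exact ((isIntegral_algebraMap (R := ℤ) (x := u)).mul hsi).add
    ((isIntegral_algebraMap (R := ℤ) (x := v)).mul h2)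

theorem discr_family (hS : IsTrinomialGenerator θ a b) :
    Algebra.discr ℚ (family p θ l k) * ((p : ℚ) ^ ∑ i, k i) ^ 2 =
      5 ^ 5 * (a : ℚ) ^ 6 - 6 ^ 6 * (b : ℚ) ^ 5 := by
  have hp0 : (p : K) ≠ 0 := by exact_mod_cast hp.out.ne_zero
  have hp1 : (p : ℚ) ≠ 0 := by exact_mod_cast hp.out.ne_zero
  let M : Matrix (Fin 6) (Fin 6) ℚ := Matrix.of fun i j =>
    if j < i then ((l i).getD j 0 : ℚ) / (p : ℚ) ^ k i else if j = i then 1 / (p : ℚ) ^ k i else 0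
  have hM : M.det = 1 / (p : ℚ) ^ ∑ i, k i := by
    rw [Matrix.det_of_isLowerTriangular M]
    · simp [M, Finset.prod_pow_eq_pow_sum]
    · intro i j hij
      have hij' : i < j := hij
      simp [M, hij'.ne', hij'.not_gt]
  have hfam : family p θ l k = (M.map (algebraMap ℚ K)).mulVec (fun i : Fin 6 => θ ^ (i : ℕ)) := by
    ext i
    simp only [family, tri, Matrix.mulVec, dotProduct, Matrix.map_apply, Matrix.of_apply, M]
    rw [Fin.sum_univ_six]
    fin_cases i <;> simp [Finset.sum_range_succ] <;> field_simp
  rw [hfam, Algebra.discr_of_matrix_mulVec, hS.discr_pow, hM]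
  field_simp

theorem IntegralFamily.exists_matrix (hS : IsTrinomialGenerator θ a b)
    (hI : IntegralFamily p a b l k) :
    ∃ (ω : Fin 6 → K) (N : Matrix (Fin 6) (Fin 6) ℤ), (∀ j, IsIntegral ℤ (ω j)) ∧
      (∀ y : K, IsIntegral ℤ y → ∃ c : Fin 6 → ℤ, y = ∑ j, (c j : K) * ω j) ∧
      (∀ i, family p θ l k i = ∑ j, (N i j : K) * ω j) ∧
      Δ(a,b) =
        N.det ^ 2 * NumberField.discr K * ((p : ℤ) ^ ∑ i, k i) ^ 2 := by
  let e := Fintype.equivFinOfCardEq (α := Module.Free.ChooseBasisIndex ℤ (NumberField.RingOfIntegers K))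
    (n := 6) (by
      rw [← Module.finrank_eq_card_chooseBasisIndex, NumberField.RingOfIntegers.rank,
        hS.finrank_eq])
  let B := (NumberField.RingOfIntegers.basis K).reindex e
  let ω : Fin 6 → K := fun j => (B j : K)
  have hω : ∀ y : K, IsIntegral ℤ y → ∃ c : Fin 6 → ℤ, y = ∑ j, (c j : K) * ω j := by
    intro y hy
    refine ⟨B.repr ⟨y, hy⟩, ?_⟩
    have h1 := congrArg (algebraMap (NumberField.RingOfIntegers K) K) (B.sum_repr ⟨y, hy⟩)
    rw [map_sum] at h1
    calc y = algebraMap (NumberField.RingOfIntegers K) K ⟨y, hy⟩ := rfl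
      _ = _ := h1.symm
      _ = _ := Finset.sum_congr rfl fun j _ => by rw [zsmul_eq_mul, map_mul, map_intCast]
  choose N' hN using fun i => hω _ (hI.isIntegral hS i)
  let N : Matrix (Fin 6) (Fin 6) ℤ := Matrix.of N'
  refine ⟨ω, N, fun j => NumberField.RingOfIntegers.isIntegral_coe (B j), hω, hN, ?_⟩
  have h1 := discr_family (p := p) (l := l) (k := k) hS
  have h2 : family p θ l k =
      ((N.map (Int.castRingHom ℚ)).map (algebraMap ℚ K)).mulVec ω := by
    ext i
    simp [hN i, Matrix.mulVec, dotProduct, N]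
  have h3 : Algebra.discr ℚ ω = NumberField.discr K := by
    rw [NumberField.coe_discr, ← Algebra.discr_reindex ℚ (NumberField.integralBasis K) e]
    congr 1
    ext j
    simp [ω, B]
  have h4 : (N.map (Int.castRingHom ℚ)).det = (N.det : ℚ) :=
    ((Int.castRingHom ℚ).map_det N).symm
  rw [h2, Algebra.discr_of_matrix_mulVec, h3, h4] at h1
  exact_mod_cast h1.symm

theorem padicValInt_discr_eq {m dK n : ℤ} {e : ℕ} (h : n = m ^ 2 * dK * ((p : ℤ) ^ e) ^ 2)
    (hn : n ≠ 0) : padicValInt p n = padicValInt p dK + 2 * (e + padicValInt p m) := by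
  have hm : m ≠ 0 := by rintro rfl; simp at h; exact hn h
  have hd : dK ≠ 0 := by rintro rfl; simp at h; exact hn h
  have hpz : (p : ℤ) ≠ 0 := by exact_mod_cast hp.out.ne_zero
  have hp1 : padicValInt p ((p : ℤ) ^ e * (p : ℤ) ^ e) = e + e := by
    rw [← pow_add, show ((p : ℤ) ^ (e + e)) = ((p ^ (e + e) : ℕ) : ℤ) by push_cast; rfl,
      padicValInt.of_nat, padicValNat.prime_pow]
  rw [h, sq, sq, padicValInt.mul (mul_ne_zero (mul_ne_zero hm hm) hd)
    (mul_ne_zero (pow_ne_zero _ hpz) (pow_ne_zero _ hpz)), padicValInt.mul (mul_ne_zero hm hm) hd,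
    padicValInt.mul hm hm, hp1]
  ring

theorem IntegralFamily.padicValInt_discr (hS : IsTrinomialGenerator θ a b)
    (hI : IntegralFamily p a b l k) :
    ∃ j, padicValInt p (NumberField.discr K) + 2 * (∑ i, k i + j) =
      padicValInt p Δ(a,b) := by
  obtain ⟨ω, N, -, -, -, h⟩ := hI.exists_matrix hS
  exact ⟨_, (padicValInt_discr_eq h hS.discr_ne_zero).symm⟩

theorem SaturatedFamily.padicValInt_discr (hS : IsTrinomialGenerator θ a b)
    (hI : IntegralFamily p a b l k) (hM : SaturatedFamily p a b l k) :
    padicValInt p (NumberField.discr K) + 2 * ∑ i, k i =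
      padicValInt p Δ(a,b) := by
  obtain ⟨ω, N, hω, -, hN, h⟩ := hI.exists_matrix hS
  have h1 := padicValInt_discr_eq h hS.discr_ne_zero
  have h2 : ¬ (p : ℤ) ∣ N.det := by
    intro hdvd
    have h3 : (N.map (Int.castRingHom (ZMod p))).det = 0 := by
      rw [← RingHom.mapMatrix_apply, ← RingHom.map_det]
      exact (ZMod.intCast_zmod_eq_zero_iff_dvd _ p).mpr hdvd
    obtain ⟨v, hv0, hv⟩ := Matrix.exists_vecMul_eq_zero_iff.mpr h3
    have hcast : ∀ i, (((v i).val : ℤ) : ZMod p) = v i := by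
      intro i; simp
    have hdiv : ∀ j, (p : ℤ) ∣ ∑ i, ((v i).val : ℤ) * N i j := by
      intro j
      rw [← ZMod.intCast_zmod_eq_zero_iff_dvd]
      have := congrFun hv j
      simp only [Matrix.vecMul, dotProduct, Matrix.map_apply, Pi.zero_apply] at this
      rw [Int.cast_sum, ← this]
      refine Finset.sum_congr rfl fun i _ => ?_
      rw [Int.cast_mul, hcast]; rfl
    choose c hc using hdiv
    have h4 := hM (fun i => ((v i).val : ℤ)) (by
      intro t ht
      obtain ⟨σ, rfl⟩ := hS.exists_algHom ht
      have h5 : ∑ i, (((v i).val : ℤ) : K) * family p θ l k i = (p : K) * ∑ j, (c j : K) * ω j := by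
        simp_rw [hN, Finset.mul_sum]
        rw [Finset.sum_comm]
        refine Finset.sum_congr rfl fun j _ => ?_
        have h6 := congrArg (Int.cast (R := K)) (hc j)
        push_cast at h6 ⊢
        rw [← mul_assoc, ← h6, Finset.sum_mul]
        refine Finset.sum_congr rfl fun i _ => by ring
      have h6 := congrArg σ h5
      simp only [map_sum, map_mul, algHom_intCast, map_natCast, map_family] at h6
      rw [h6]
      refine valEq_prime.ge.mul (s := 0) ?_
      have h7 : IsIntegral ℤ (∑ j, (c j : K) * ω j) :=
        IsIntegral.sum _ fun j _ => (isIntegral_algebraMap (R := ℤ) (x := c j)).mul (hω j)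
      have h8 := valGE_one_of_isIntegral h7 σ
      simpa only [map_sum, map_mul, algHom_intCast] using h8)
    apply hv0
    ext i
    rw [← hcast i]
    exact (ZMod.intCast_zmod_eq_zero_iff_dvd _ p).mpr (h4 i)
  rw [padicValInt.eq_zero_of_not_dvd h2] at h1
  omega

theorem IntegralFamily.isPIntegralBasis (hS : IsTrinomialGenerator θ a b)
    (hI : IntegralFamily p a b l k)
    (hD : padicValInt p (NumberField.discr K) + 2 * ∑ i, k i =
      padicValInt p Δ(a,b)) :
    IsPIntegralBasis p (family p θ l k) := by
  have hp0 : (p : K) ≠ 0 := by exact_mod_cast hp.out.ne_zero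
  obtain ⟨ω, N, hω, hωs, hN, h⟩ := hI.exists_matrix hS
  have h1 := padicValInt_discr_eq h hS.discr_ne_zero
  have hdet0 : N.det ≠ 0 := by
    intro h0
    rw [h0] at h
    exact hS.discr_ne_zero (by rw [h]; ring)
  have hdet : ¬ (p : ℤ) ∣ N.det := by
    intro hdvd
    have : 1 ≤ padicValInt p N.det := by
      by_contra! hlt
      rw [Nat.lt_one_iff, padicValInt.eq_zero_iff] at hlt
      rcases hlt with hlt | hlt | hlt
      · exact hp.out.one_lt.ne' hlt
      · exact hdet0 hlt
      · exact hlt hdvd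
    omega
  constructor
  · have hlin : LinearIndependent ℚ (family p θ l k) := by
      by_contra hnot
      have h2 := discr_family (p := p) (l := l) (k := k) hS
      rw [Algebra.discr_zero_of_not_linearIndependent ℚ hnot, zero_mul] at h2
      apply hS.discr_ne_zero
      exact_mod_cast h2.symm
    exact hlin.restrict_scalars (R := localInt p) (by
      intro x y hxy
      apply Subtype.ext
      simpa [Subring.smul_def] using hxy)
  · apply le_antisymm
    · rw [Submodule.span_le]
      rintro _ ⟨i, rfl⟩
      exact (hI.isIntegral hS i).tower_top
    · intro y hy
      have hy' : IsIntegral (localInt p) y := hy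
      obtain ⟨s, hs, hsi⟩ := exists_isIntegral_mul hy'
      obtain ⟨c, hc⟩ := hωs _ hsi
      have hadj : ∀ j, (N.det : K) * ω j = ∑ i, (N.adjugate j i : K) * family p θ l k i := by
        intro j
        simp_rw [hN, Finset.mul_sum]
        rw [Finset.sum_comm]
        have h2 : ∀ m, ∑ i, (N.adjugate j i : K) * ((N i m : K) * ω m) =
            (((N.adjugate * N) j m : ℤ) : K) * ω m := by
          intro m
          rw [Matrix.mul_apply, Int.cast_sum, Finset.sum_mul]
          refine Finset.sum_congr rfl fun i _ => by push_cast; ring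
        simp_rw [h2, Matrix.adjugate_mul, Matrix.smul_apply, Matrix.one_apply]
        simp
      have hsd : ¬ (p : ℤ) ∣ s * N.det := fun h2 =>
        ((Nat.prime_iff_prime_int.mp hp.out).dvd_or_dvd h2).elim hs hdet
      have hsd0 : ((s * N.det : ℤ) : K) ≠ 0 := by
        intro h0
        exact hsd ((Int.cast_eq_zero.mp h0) ▸ dvd_zero _)
      have hey : ∃ e : Fin 6 → ℤ, ((s * N.det : ℤ) : K) * y = ∑ i, (e i : K) * family p θ l k i := by
        refine ⟨fun i => ∑ j, c j * N.adjugate j i, ?_⟩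
        calc ((s * N.det : ℤ) : K) * y = (N.det : K) * ((s : K) * y) := by push_cast; ring
          _ = ∑ j, (c j : K) * ((N.det : K) * ω j) := by
            rw [hc, Finset.mul_sum]
            exact Finset.sum_congr rfl fun j _ => by ring
          _ = _ := by
            simp_rw [hadj, Finset.mul_sum]
            rw [Finset.sum_comm]
            refine Finset.sum_congr rfl fun i _ => ?_
            push_cast
            rw [Finset.sum_mul]
            exact Finset.sum_congr rfl fun j _ => by ring
      obtain ⟨e, he⟩ := hey
      have hfin : y = ∑ i, (⟨(e i : ℚ) / ((s * N.det : ℤ) : ℚ), e i, _, hsd, rfl⟩ : localInt p) •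
          family p θ l k i := by
        have h3 : ∀ (q : localInt p) (z : K), q • z = ((q : ℚ) : K) * z := by
          intro q z
          rw [Subring.smul_def, Algebra.smul_def]; rfl
        have h4 : ∀ i, (⟨(e i : ℚ) / ((s * N.det : ℤ) : ℚ), e i, _, hsd, rfl⟩ : localInt p) •
            family p θ l k i = ((s * N.det : ℤ) : K)⁻¹ * ((e i : K) * family p θ l k i) := by
          intro i
          rw [h3]
          change (((e i : ℚ) / ((s * N.det : ℤ) : ℚ) : ℚ) : K) * _ = _
          rw [Rat.cast_div, Rat.cast_intCast, Rat.cast_intCast]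
          ring
        rw [Finset.sum_congr rfl fun i _ => h4 i, ← Finset.mul_sum, ← he, inv_mul_cancel_left₀ hsd0]
      rw [hfin]
      exact Submodule.sum_mem _ fun i _ =>
        Submodule.smul_mem _ _ (Submodule.subset_span ⟨i, rfl⟩)

end Family

theorem isTriangular_family {K : Type*} [Field K] {p : ℕ} (θ : K) (l : Fin 6 → List ℤ)
    {k : Fin 6 → ℕ} (h0 : k 0 = 0) (hk : Monotone k) : IsTriangular p θ (family p θ l k) :=
  ⟨fun i j => (l i).getD j 0, k, h0, hk, fun _ => rfl⟩


section Peeling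

variable {p : ℕ} [hp : Fact p.Prime]

theorem valEq_two : ValEq (2 : Ω 2) 1 := by
  simpa using valEq_prime (p := 2)

theorem valEq_three : ValEq (3 : Ω 3) 1 := by
  simpa using valEq_prime (p := 3)

instance : Fact (Nat.Prime 5) := ⟨by norm_num⟩

theorem valEq_five : ValEq (5 : Ω 5) 1 := by
  simpa using valEq_prime (p := 5)

theorem exists_gt_valGE {x : Ω p} {r : ℝ} (h : ‖x‖ < (p : ℝ) ^ (-r)) :
    ∃ s, r < s ∧ ValGE x s := by
  by_cases hx : x = 0
  · exact ⟨r + 1, by linarith, hx ▸ valGE_zero _⟩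
  obtain ⟨u, hu⟩ := exists_valEq hx
  refine ⟨u, ?_, hu.ge⟩
  rw [hu, Real.rpow_lt_rpow_left_iff (one_lt_prime_real p)] at h
  linarith

theorem ValGE.norm_lt {x : Ω p} {r s : ℝ} (h : ValGE x s) (hrs : r < s) :
    ‖x‖ < (p : ℝ) ^ (-r) :=
  lt_of_le_of_lt h ((Real.rpow_lt_rpow_left_iff (one_lt_prime_real p)).mpr (by linarith))

theorem ValGE.sum {ι : Type*} {T : Finset ι} {f : ι → Ω p} {r : ℝ}
    (h : ∀ i ∈ T, ValGE (f i) r) : ValGE (∑ i ∈ T, f i) r := by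
  classical
  induction T using Finset.induction_on with
  | empty => simpa using valGE_zero r
  | insert j T hj ih =>
    rw [Finset.sum_insert hj]
    exact (h j (by simp)).add (ih fun i hi => h i (by simp [hi]))

theorem exists_gt_valGE_sum {ι : Type*} {T : Finset ι} {f : ι → Ω p} {r : ℝ}
    (h : ∀ i ∈ T, ∃ s, r < s ∧ ValGE (f i) s) : ∃ s, r < s ∧ ValGE (∑ i ∈ T, f i) s := by
  classical
  induction T using Finset.induction_on with
  | empty => exact ⟨r + 1, by linarith, by simpa using valGE_zero _⟩
  | insert j T hj ih =>
    obtain ⟨s, hs, h1⟩ := h j (by simp)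
    obtain ⟨s', hs', h2⟩ := ih fun i hi => h i (by simp [hi])
    rw [Finset.sum_insert hj]
    exact ⟨min s s', lt_min hs hs', (h1.mono (min_le_left _ _)).add (h2.mono (min_le_right _ _))⟩

variable {d : Fin 6 → ℤ} {γ : Fin 6 → Ω p}

/-- If the terms of an integer combination outside `J` have valuation greater than `r`, and those in
`J` are, up to such terms, multiples of an element of valuation `r`, then the combination of the
cofactors has positive valuation. -/
theorem exists_pos_valGE_sum {r : ℝ} (h : ValGE (∑ i, (d i : Ω p) * γ i) 1) (hr : r < 1)
    (J : Finset (Fin 6)) {δ : Ω p} (hδ : ValEq δ r) (η : Fin 6 → Ω p)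
    (hη : ∀ i ∈ J, ∃ s, r < s ∧ ValGE (γ i - δ * η i) s)
    (hJ : ∀ i, i ∉ J → ((p : ℤ) ∣ d i ∧ ValGE (γ i) 0) ∨ ∃ s, r < s ∧ ValGE (γ i) s) :
    ∃ s, 0 < s ∧ ValGE (∑ i ∈ J, (d i : Ω p) * η i) s := by
  obtain ⟨s1, hs1, h1⟩ := exists_gt_valGE_sum (T := J) (r := r)
    (f := fun i => (d i : Ω p) * (γ i - δ * η i)) (fun i hi => by
      obtain ⟨s, hs, h⟩ := hη i hi
      exact ⟨s, hs, (valGE_intCast (d i)).mul h (by linarith)⟩)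
  obtain ⟨s2, hs2, h2⟩ := exists_gt_valGE_sum (T := Jᶜ) (r := r)
    (f := fun i => (d i : Ω p) * γ i) (fun i hi => by
      rcases hJ i (by simpa using hi) with ⟨h, h'⟩ | ⟨s, hs, h⟩
      · exact ⟨1, hr, (valGE_one_of_dvd h).mul h'⟩
      · exact ⟨s, hs, (valGE_intCast (d i)).mul h (by linarith)⟩)
  have h3 : δ * ∑ i ∈ J, (d i : Ω p) * η i = ∑ i, (d i : Ω p) * γ i -
      (∑ i ∈ J, (d i : Ω p) * (γ i - δ * η i) + ∑ i ∈ Jᶜ, (d i : Ω p) * γ i) := by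
    rw [← Finset.sum_add_sum_compl J fun i => (d i : Ω p) * γ i, Finset.mul_sum,
      add_sub_add_right_eq_sub, ← Finset.sum_sub_distrib]
    exact Finset.sum_congr rfl fun i _ => by ring
  have h4 : ValGE (δ * ∑ i ∈ J, (d i : Ω p) * η i) (min 1 (min s1 s2)) := by
    rw [h3]
    exact (h.mono (min_le_left _ _)).sub
      ((h1.mono ((min_le_right _ _).trans (min_le_left _ _))).add
        (h2.mono ((min_le_right _ _).trans (min_le_right _ _))))
  refine ⟨min 1 (min s1 s2) - r, ?_, ?_⟩
  · exact sub_pos.mpr (lt_min hr (lt_min hs1 hs2))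
  · rw [mul_comm] at h4
    exact h4.of_mul hδ le_rfl

/-- The coefficient of a term of strictly smallest valuation is divisible by `p`. -/
theorem dvd_of_min {r : ℝ} (h : ValGE (∑ i, (d i : Ω p) * γ i) 1) (j : Fin 6) (hr : r < 1)
    (hj : ValEq (γ j) r)
    (hJ : ∀ i, i ≠ j → ((p : ℤ) ∣ d i ∧ ValGE (γ i) 0) ∨ ∃ s, r < s ∧ ValGE (γ i) s) :
    (p : ℤ) ∣ d j := by
  obtain ⟨s, hs, h1⟩ := exists_pos_valGE_sum h hr {j} hj (fun _ => 1)
    (by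
      intro i hi
      rw [Finset.mem_singleton.mp hi, mul_one, sub_self]
      exact ⟨r + 1, by linarith, valGE_zero _⟩)
    (fun i hi => hJ i (by simpa using hi))
  rw [Finset.sum_singleton, mul_one] at h1
  exact dvd_of_valGE h1 hs

/-- If the terms with unknown coefficients have distinct valuations in `[0, 1)`, all coefficients
are divisible by `p`. -/
theorem dvd_of_distinct (h : ValGE (∑ i, (d i : Ω p) * γ i) 1) (m : ℕ) (n : Fin 6 → ℕ)
    (S : Finset (Fin 6)) (hS : ∀ i ∈ S, (p : ℤ) ∣ d i ∧ ValGE (γ i) 0)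
    (hn : ∀ i, n i < m) (hinj : ∀ i, i ∉ S → ∀ j, j ∉ S → n i = n j → i = j)
    (hv : ∀ i, i ∉ S → ValEq (γ i) ((n i : ℝ) / m)) (i : Fin 6) : (p : ℤ) ∣ d i := by
  have hm : (0 : ℝ) < m := by exact_mod_cast (Nat.zero_le _).trans_lt (hn 0)
  by_contra hi
  obtain ⟨j, hj, hmin⟩ := Finset.exists_min_image (Finset.univ.filter fun i => ¬ (p : ℤ) ∣ d i) n
    ⟨i, by simpa using hi⟩
  simp only [Finset.mem_filter, Finset.mem_univ, true_and] at hj hmin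
  have hjS : j ∉ S := fun hjS => hj (hS j hjS).1
  refine hj (dvd_of_min h j (r := (n j : ℝ) / m) ?_ (hv j hjS) ?_)
  · rw [div_lt_one hm]; exact_mod_cast hn j
  · intro i hij
    by_cases hd : (p : ℤ) ∣ d i
    · left
      refine ⟨hd, ?_⟩
      by_cases hiS : i ∈ S
      · exact (hS i hiS).2
      · exact (hv i hiS).ge' (by positivity)
    · right
      have hiS : i ∉ S := fun hiS => hd (hS i hiS).1
      refine ⟨_, ?_, (hv i hiS).ge⟩
      rw [div_lt_div_iff_of_pos_right hm]
      have h1 := hmin i hd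
      have h2 : n j ≠ n i := fun h2 => hij (hinj j hjS i hiS h2).symm
      exact_mod_cast lt_of_le_of_ne h1 h2

theorem dvd_of_two_residues {d0 d1 : ℤ} {x y : Ω p} {s s' : ℝ}
    (h1 : ValGE ((d0 : Ω p) + (d1 : Ω p) * x) s) (hs : 0 < s)
    (h2 : ValGE ((d0 : Ω p) + (d1 : Ω p) * y) s') (hs' : 0 < s')
    (hxy : ValEq (x - y) 0) (hx : ValGE x 0) : (p : ℤ) ∣ d0 ∧ (p : ℤ) ∣ d1 := by
  have hm : 0 < min s s' := lt_min hs hs'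
  have h3 : ValGE ((d1 : Ω p) * (x - y)) (min s s') := by
    have := (h1.mono (min_le_left s s')).sub (h2.mono (min_le_right s s'))
    rwa [add_sub_add_left_eq_sub, ← mul_sub] at this
  have hd1 : (p : ℤ) ∣ d1 := dvd_of_valGE_mul h3 hxy hm
  refine ⟨?_, hd1⟩
  have h4 := (h1.mono (min_le_left s 1)).sub
    (((valGE_one_of_dvd hd1).mul hx).mono (min_le_right s 1))
  rw [add_sub_cancel_right] at h4
  exact dvd_of_valGE h4 (lt_min hs one_pos)

theorem dvd_of_three_residues {d0 d1 d2 : ℤ} {x y z : Ω p} {s s' s'' : ℝ}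
    (h1 : ValGE ((d0 : Ω p) + (d1 : Ω p) * x + (d2 : Ω p) * x ^ 2) s) (hs : 0 < s)
    (h2 : ValGE ((d0 : Ω p) + (d1 : Ω p) * y + (d2 : Ω p) * y ^ 2) s') (hs' : 0 < s')
    (h3 : ValGE ((d0 : Ω p) + (d1 : Ω p) * z + (d2 : Ω p) * z ^ 2) s'') (hs'' : 0 < s'')
    (hxy : ValEq (x - y) 0) (hxz : ValEq (x - z) 0) (hyz : ValEq (y - z) 0)
    (hx : ValGE x 0) : (p : ℤ) ∣ d0 ∧ (p : ℤ) ∣ d1 ∧ (p : ℤ) ∣ d2 := by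
  set m := min s (min s' s'') with hm
  have hm0 : 0 < m := lt_min hs (lt_min hs' hs'')
  have h1' := h1.mono (show m ≤ s from min_le_left _ _)
  have h2' := h2.mono (show m ≤ s' from (min_le_right _ _).trans (min_le_left _ _))
  have h3' := h3.mono (show m ≤ s'' from (min_le_right _ _).trans (min_le_right _ _))
  have h4 : ValGE ((d1 : Ω p) + (d2 : Ω p) * (x + y)) m := by
    refine ValGE.of_mul (y := x - y) (r := m) ?_ hxy (by linarith)
    convert h1'.sub h2' using 1; ring
  have h5 : ValGE ((d1 : Ω p) + (d2 : Ω p) * (x + z)) m := by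
    refine ValGE.of_mul (y := x - z) (r := m) ?_ hxz (by linarith)
    convert h1'.sub h3' using 1; ring
  have hy : ValGE y 0 := by simpa using hx.sub hxy.ge
  obtain ⟨h6, h7⟩ := dvd_of_two_residues h4 hm0 h5 hm0
    (by rw [add_sub_add_left_eq_sub]; exact hyz) (hx.add hy)
  refine ⟨?_, h6, h7⟩
  have h8 := (h1'.mono (min_le_left m 1)).sub
    ((((valGE_one_of_dvd h6).mul hx).add
      ((valGE_one_of_dvd h7).mul (hx.pow 2 (t := 0)))).mono
        (min_le_right m 1))
  rw [add_assoc, add_sub_cancel_right] at h8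
  exact dvd_of_valGE h8 (lt_min hm0 one_pos)

variable {a b : ℤ}

/-- If the trinomial is smaller at `ξ` than at `ξ'`, it has a root that is closer to `ξ` than
`ξ'`. -/
theorem exists_root_near {ξ ξ' : Ω p} {r s c : ℝ} (h : ValGE (ξ ^ 6 + (a : Ω p) * ξ + (b : Ω p)) s)
    (h' : ValEq (ξ' ^ 6 + (a : Ω p) * ξ' + (b : Ω p)) r) (hrs : r < s) (hc : ValEq (ξ' - ξ) c) :
    ∃ t : Ω p, t ^ 6 + a * t + b = 0 ∧ ∃ c', c < c' ∧ ValGE (t - ξ) c' := by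
  obtain ⟨t, ht, hprod, -⟩ := exists_roots (a : Ω p) (b : Ω p)
  have hlt : ∏ i, ‖ξ - t i‖ < ∏ i, ‖ξ' - t i‖ := by
    rw [← norm_prod, ← norm_prod, hprod, hprod, h']
    exact h.norm_lt hrs
  have hex : ∃ i, ‖ξ - t i‖ < ‖ξ' - t i‖ := by
    by_contra! hle
    exact absurd hlt (not_lt.mpr (Finset.prod_le_prod (fun _ _ => norm_nonneg _) fun i _ => hle i))
  obtain ⟨i, hi⟩ := hex
  refine ⟨t i, ht i, exists_gt_valGE ?_⟩
  have h1 : ‖ξ' - ξ‖ = ‖ξ' - t i‖ := by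
    have h2 : ξ' - ξ = (ξ' - t i) + -(ξ - t i) := by ring
    rw [h2, IsUltrametricDist.norm_add_eq_max_of_norm_ne_norm (by rw [norm_neg]; exact hi.ne'),
      norm_neg, max_eq_left hi.le]
  rw [← hc, h1, norm_sub_rev]
  exact hi

theorem exists_root (p : ℕ) [Fact p.Prime] (a b : ℤ) :
    ∃ t : Ω p, t ^ 6 + a * t + b = 0 := by
  obtain ⟨t, ht, -⟩ := exists_roots (a : Ω p) (b : Ω p)
  exact ⟨t 0, ht 0⟩

/-- Not all roots have the same distance `c` from a point at which the trinomial does not have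
valuation `6 c`. -/
theorem exists_root_of_not_valEq {ξ : Ω p} {c : ℝ} {P : Ω p → Prop}
    (hP : ∀ t : Ω p, t ^ 6 + a * t + b = 0 → P t ∨ ValEq (ξ - t) c)
    (h : ¬ ValEq (ξ ^ 6 + (a : Ω p) * ξ + (b : Ω p)) (6 * c)) :
    ∃ t : Ω p, t ^ 6 + a * t + b = 0 ∧ P t := by
  by_contra! hno
  obtain ⟨t, ht, hprod, -⟩ := exists_roots (a : Ω p) (b : Ω p)
  apply h
  have hall : ∀ i, ValEq (ξ - t i) c := fun i => (hP _ (ht i)).resolve_left (hno _ (ht i))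
  rw [← hprod, Fin.prod_univ_six]
  exact ((((((hall 0).mul (hall 1) rfl).mul (hall 2) rfl).mul (hall 3) rfl).mul (hall 4) rfl).mul
    (hall 5) (by ring))

theorem SaturatedFamily.of_eq {l : Fin 6 → List ℤ} {k : Fin 6 → ℕ}
    (γ : Ω p → Fin 6 → Ω p)
    (hγ : ∀ t i, tri l t i / (p : Ω p) ^ k i = γ t i)
    (H : ∀ d : Fin 6 → ℤ, (∀ t : Ω p, t ^ 6 + a * t + b = 0 →
      ValGE (∑ i, (d i : Ω p) * γ t i) 1) → ∀ i, (p : ℤ) ∣ d i) :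
    SaturatedFamily p a b l k := by
  intro d hd
  refine H d fun t ht => ?_
  simpa only [hγ] using hd t ht

theorem IntegralFamily.of_eq {l : Fin 6 → List ℤ} {k : Fin 6 → ℕ}
    (γ : Ω p → Fin 6 → Ω p)
    (hγ : ∀ t i, tri l t i / (p : Ω p) ^ k i = γ t i)
    (H : ∀ t : Ω p, t ^ 6 + a * t + b = 0 → ∀ i, ValGE (γ t i) 0) :
    IntegralFamily p a b l k := by
  intro t ht i
  have h1 := H t ht i
  rw [← hγ] at h1
  have h2 := h1.mul (valEq_prime_pow (p := p) (k i)).ge (t := k i) (by linarith)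
  rwa [div_mul_cancel₀ _ (valEq_prime_pow (p := p) (k i)).ne_zero] at h2

end Peeling


section Groups

variable {p : ℕ} [hp : Fact p.Prime] {d : Fin 6 → ℤ}

/-- Suppose that the elements `γ i` fall into groups, the level sets of `g`, such that at all of the
places considered the elements of a group are multiples of a representative of valuation `g i / m`.
If the cofactors in each group are linearly independent modulo `p`, then a combination of the `γ i`
that is divisible by `p` has coefficients divisible by `p`. -/
theorem dvd_of_groups {T : Type*} {γ : T → Fin 6 → Ω p}
    (h : ∀ τ, ValGE (∑ i, (d i : Ω p) * γ τ i) 1) (m : ℕ) (g : Fin 6 → ℕ)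
    (rep : Fin 6 → Fin 6) (hg : ∀ i, g i < m) (hrep : ∀ i j, g i = g j → rep i = rep j)
    (hv : ∀ τ i, ValEq (γ τ (rep i)) ((g i : ℝ) / m)) (η : T → Fin 6 → Ω p)
    (hη : ∀ τ i, ∃ s, (g i : ℝ) / m < s ∧ ValGE (γ τ i - γ τ (rep i) * η τ i) s)
    (hη0 : ∀ τ i, ValGE (η τ i) 0)
    (hres : ∀ i, (∀ τ, ∃ s, 0 < s ∧
      ValGE (∑ j with g j = g i, (d j : Ω p) * η τ j) s) → (p : ℤ) ∣ d i) (i : Fin 6) :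
    (p : ℤ) ∣ d i := by
  have hm : (0 : ℝ) < m := by exact_mod_cast (Nat.zero_le _).trans_lt (hg 0)
  have hγ : ∀ τ i, ValGE (γ τ i) ((g i : ℝ) / m) := by
    intro τ i
    obtain ⟨s, hs, h1⟩ := hη τ i
    have h2 := (h1.mono hs.le).add ((hv τ i).ge.mul (hη0 τ i) (t := (g i : ℝ) / m) (by linarith))
    rwa [sub_add_cancel] at h2
  by_contra hi
  obtain ⟨j, hj, hmin⟩ := Finset.exists_min_image (Finset.univ.filter fun i => ¬ (p : ℤ) ∣ d i) g
    ⟨i, by simpa using hi⟩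
  simp only [Finset.mem_filter, Finset.mem_univ, true_and] at hj hmin
  refine hj (hres j fun τ => ?_)
  refine exists_pos_valGE_sum (h τ) (r := (g j : ℝ) / m) ?_ _ (hv τ j) (η τ) ?_ ?_
  · rw [div_lt_one hm]; exact_mod_cast hg j
  · intro i hi
    have hij : g i = g j := (Finset.mem_filter.mp hi).2
    have := hη τ i
    rwa [hrep i j hij, hij] at this
  · intro i hi
    have hij : g i ≠ g j := fun hij => hi (by simp [hij])
    by_cases hd : (p : ℤ) ∣ d i
    · exact Or.inl ⟨hd, (hγ τ i).mono (by positivity)⟩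
    · refine Or.inr ⟨_, ?_, hγ τ i⟩
      rw [div_lt_div_iff_of_pos_right hm]
      exact_mod_cast lt_of_le_of_ne (hmin i hd) hij.symm

end Groups

section Discriminant

variable {p : ℕ} [hp : Fact p.Prime] {a b : ℤ}

theorem valEq_of_emultiplicity {n : ℤ} {k : ℕ} (h : emultiplicity (p : ℤ) n = k) :
    ValEq (n : Ω p) k := by
  rw [emultiplicity_eq_coe] at h
  exact valEq_of_dvd_of_not h.1 h.2

theorem valGE_of_le_emultiplicity {n : ℤ} {k : ℕ} (h : (k : ℕ∞) ≤ emultiplicity (p : ℤ) n) :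
    ValGE (n : Ω p) k :=
  valGE_of_dvd (pow_dvd_of_le_emultiplicity h)

theorem valEq_padicValInt {n : ℤ} (hn : n ≠ 0) : ValEq (n : Ω p) (padicValInt p n) := by
  refine valEq_of_dvd_of_not (padicValInt_dvd n) ?_
  rw [padicValInt_dvd_iff]
  push Not
  exact ⟨hn, Nat.lt_succ_self _⟩

theorem padicValInt_eq_of_valEq {n : ℤ} {k : ℕ} (h : ValEq (n : Ω p) k) :
    padicValInt p n = k := by
  have hn : n ≠ 0 := by rintro rfl; exact h.ne_zero (by simp)
  exact_mod_cast (valEq_padicValInt (p := p) hn).unique h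

/-- The valuation of the discriminant when the term with `a` dominates. -/
theorem padicValInt_of_lt {s r e5 e6 : ℝ} {n : ℕ} (h5 : ValEq (5 : Ω p) e5)
    (h6 : ValGE (6 : Ω p) e6) (ha : ValEq (a : Ω p) s) (hb : ValGE (b : Ω p) r)
    (hlt : 5 * e5 + 6 * s < 6 * e6 + 5 * r := by norm_num) (hn : (n : ℝ) = 5 * e5 + 6 * s := by norm_num) :
    padicValInt p Δ(a,b) = n := by
  apply padicValInt_eq_of_valEq
  have h1 : ValEq ((5 : Ω p) ^ 5 * (a : Ω p) ^ 6) n :=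
    (h5.pow 5 rfl).mul (ha.pow 6 rfl) (by push_cast; linarith)
  have h2 : ValGE ((6 : Ω p) ^ 6 * (b : Ω p) ^ 5) (6 * e6 + 5 * r) :=
    (h6.pow 6 le_rfl).mul (hb.pow 5 le_rfl) (by push_cast; linarith)
  have h3 := h1.add h2.neg (by linarith)
  rw [← sub_eq_add_neg] at h3
  exact_mod_cast h3

/-- The valuation of the discriminant when the term with `b` dominates. -/
theorem padicValInt_of_gt {s r e5 e6 : ℝ} {n : ℕ} (h5 : ValGE (5 : Ω p) e5)
    (h6 : ValEq (6 : Ω p) e6) (ha : ValGE (a : Ω p) s) (hb : ValEq (b : Ω p) r)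
    (hlt : 6 * e6 + 5 * r < 5 * e5 + 6 * s := by norm_num) (hn : (n : ℝ) = 6 * e6 + 5 * r := by norm_num) :
    padicValInt p Δ(a,b) = n := by
  apply padicValInt_eq_of_valEq
  have h1 : ValGE ((5 : Ω p) ^ 5 * (a : Ω p) ^ 6) (5 * e5 + 6 * s) :=
    (h5.pow 5 le_rfl).mul (ha.pow 6 le_rfl) (by push_cast; linarith)
  have h2 : ValEq ((6 : Ω p) ^ 6 * (b : Ω p) ^ 5) n :=
    (h6.pow 6 rfl).mul (hb.pow 5 rfl) (by push_cast; linarith)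
  have h3 := h2.neg.add h1 (by linarith)
  rw [neg_add_eq_sub] at h3
  exact_mod_cast h3

end Discriminant

section Conclusion

variable {K : Type*} [Field K] [NumberField K]

/-- What the tables claim about a row that applies. -/
def RowHolds (p : ℕ) [Fact p.Prime] (θ : K) (D : ℤ) (vD : Set ℕ) (vdK : ℕ)
    (bases : Set (Fin 6 → K)) : Prop :=
  padicValInt p D ∈ vD ∧ padicValInt p (NumberField.discr K) = vdK ∧ bases.Nonempty ∧
    ∀ α ∈ bases, IsTriangular p θ α ∧ IsPIntegralBasis p α

variable {p : ℕ} [hp : Fact p.Prime] {θ : K} {a b : ℤ} {l l' : Fin 6 → List ℤ} {k : Fin 6 → ℕ}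

theorem rowHolds_of_discr (hS : IsTrinomialGenerator θ a b) {vD : Set ℕ} {vdK : ℕ}
    {bases : Set (Fin 6 → K)}
    (hD : padicValInt p Δ(a,b) ∈ vD)
    (hdK : padicValInt p (NumberField.discr K) = vdK)
    (hsum : vdK + 2 * ∑ i, k i = padicValInt p Δ(a,b))
    (hne : bases.Nonempty) (hk0 : k 0 = 0) (hk : Monotone k)
    (hb : ∀ α ∈ bases, ∃ l, IntegralFamily p a b l k ∧ α = family p θ l k) :
    RowHolds p θ Δ(a,b) vD vdK bases := by
  refine ⟨hD, hdK, hne, fun α hα => ?_⟩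
  obtain ⟨l, hI, rfl⟩ := hb α hα
  exact ⟨isTriangular_family θ l hk0 hk, hI.isPIntegralBasis hS (by rw [hdK, hsum])⟩

theorem rowHolds_of_saturated (hS : IsTrinomialGenerator θ a b) {vD : Set ℕ} {vdK : ℕ}
    {bases : Set (Fin 6 → K)}
    (hD : padicValInt p Δ(a,b) ∈ vD)
    (hsum : vdK + 2 * ∑ i, k i = padicValInt p Δ(a,b))
    (hI : IntegralFamily p a b l k) (hM : SaturatedFamily p a b l k)
    (hne : bases.Nonempty) (hk0 : k 0 = 0) (hk : Monotone k)
    (hb : ∀ α ∈ bases, ∃ l, IntegralFamily p a b l k ∧ α = family p θ l k) :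
    RowHolds p θ Δ(a,b) vD vdK bases := by
  refine rowHolds_of_discr hS hD ?_ hsum hne hk0 hk hb
  have := hM.padicValInt_discr hS hI
  omega

/-- The case of a single basis, checked directly. -/
theorem rowHolds_single (hS : IsTrinomialGenerator θ a b) {n vdK : ℕ} {α : Fin 6 → K}
    (hD : padicValInt p Δ(a,b) = n) (hsum : vdK + 2 * ∑ i, k i = n)
    (hI : IntegralFamily p a b l k) (hM : SaturatedFamily p a b l k)
    (hk0 : k 0 = 0) (hk : Monotone k) (hα : α = family p θ l k) :
    RowHolds p θ Δ(a,b) {n} vdK {α} :=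
  rowHolds_of_saturated hS hD (hsum.trans hD.symm) hI hM ⟨α, rfl⟩ hk0 hk
    fun _ hβ => ⟨l, hI, hβ.trans hα⟩

/-- The case of a single basis, checked through another one with the same denominators. -/
theorem rowHolds_single' (hS : IsTrinomialGenerator θ a b) {n vdK : ℕ} {α : Fin 6 → K}
    (hD : padicValInt p Δ(a,b) = n) (hsum : vdK + 2 * ∑ i, k i = n)
    (hI : IntegralFamily p a b l k) (hM : SaturatedFamily p a b l k)
    (hI' : IntegralFamily p a b l' k)
    (hk0 : k 0 = 0) (hk : Monotone k) (hα : α = family p θ l' k) :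
    RowHolds p θ Δ(a,b) {n} vdK {α} :=
  rowHolds_of_saturated hS hD (hsum.trans hD.symm) hI hM ⟨α, rfl⟩ hk0 hk
    fun _ hβ => ⟨l', hI', hβ.trans hα⟩

/-- If the discriminant of the field can have valuation at most one, an integral family is a basis
for reasons of parity. -/
theorem rowHolds_of_le_one (hS : IsTrinomialGenerator θ a b) {vD : Set ℕ} {vdK : ℕ}
    {bases : Set (Fin 6 → K)} (hdK : vdK ≤ 1)
    (hD : padicValInt p Δ(a,b) ∈ vD)
    (hsum : vdK + 2 * ∑ i, k i = padicValInt p Δ(a,b))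
    (hne : bases.Nonempty) (hk0 : k 0 = 0) (hk : Monotone k)
    (hb : ∀ α ∈ bases, ∃ l, IntegralFamily p a b l k ∧ α = family p θ l k) :
    RowHolds p θ Δ(a,b) vD vdK bases := by
  refine rowHolds_of_discr hS hD ?_ hsum hne hk0 hk hb
  obtain ⟨α, hα⟩ := hne
  obtain ⟨l, hI, -⟩ := hb α hα
  obtain ⟨j, hj⟩ := hI.padicValInt_discr hS
  omega

theorem integralFamily_zero : IntegralFamily p a b (fun _ => []) (fun _ => 0) := by
  intro t ht i
  have h0 : ValGE t 0 := by
    by_cases h : t = 0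
    · rw [h]; exact valGE_zero 0
    obtain ⟨w, hw⟩ := exists_valEq h
    by_contra hneg
    have hw0 : w < 0 := by
      by_contra hw0
      exact hneg (hw.ge' (not_lt.mp hw0))
    refine (hw.pow 6 rfl).false_of_add_eq_zero (y := (a : Ω p) * t + (b : Ω p)) (s := w) ?_ ?_
      (by rw [← add_assoc]; exact ht)
    · exact ((valGE_intCast a).mul hw.ge (by linarith)).add ((valGE_intCast b).mono hw0.le)
    · push_cast; linarith
  simpa [tri] using h0.pow i (t := 0) (by simp)

theorem root_valGE {t : Ω p} (ht : t ^ 6 + a * t + b = 0) : ValGE t 0 := by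
  simpa [tri] using integralFamily_zero (p := p) t ht 1

end Conclusion


section Newton

variable {p : ℕ} [hp : Fact p.Prime] {a b : ℤ}

theorem valEq_root_of_le {r : ℝ} (hr : 0 < r) (ha : ValGE (a : Ω p) r)
    (hb : ValEq (b : Ω p) r) {t : Ω p} (ht : t ^ 6 + a * t + b = 0) :
    ValEq t (r / 6) := by
  have h0 : t ≠ 0 := by
    rintro rfl
    exact hb.ne_zero (by simpa using ht)
  obtain ⟨w, hw⟩ := exists_valEq h0
  have hw0 : 0 ≤ w := hw.le_of_ge (root_valGE ht)
  have h6 := hw.pow 6 rfl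
  rcases lt_trichotomy w (r / 6) with hlt | rfl | hgt
  · exfalso
    refine h6.false_of_add_eq_zero (y := (a : Ω p) * t + (b : Ω p)) (s := r) ?_ ?_
      (by rw [← add_assoc]; exact ht)
    · exact (ha.mul hw.ge (by linarith)).add hb.ge
    · push_cast; linarith
  · exact hw
  · exfalso
    have hat := ha.mul hw.ge (t := r + w) le_rfl
    refine hb.false_of_add_eq_zero (y := t ^ 6 + (a : Ω p) * t) (s := min (6 * w) (r + w))
      ?_ ?_ (by rw [add_comm]; exact ht)
    · exact (h6.ge' (by push_cast; exact min_le_left _ _)).add (hat.mono (min_le_right _ _))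
    · exact lt_min (by linarith) (by linarith)

/-- The exponents `⌊i r / m⌋`. -/
def slopeExp (r m : ℕ) (i : Fin 6) : ℕ := (i : ℕ) * r / m

theorem slopeExp_zero (r m : ℕ) : slopeExp r m 0 = 0 := by simp [slopeExp]

theorem slopeExp_monotone (r m : ℕ) : Monotone (slopeExp r m) := by
  intro i j hij
  exact Nat.div_le_div_right (Nat.mul_le_mul_right r hij)

theorem valEq_pow_div_slope {t : Ω p} {r m : ℕ} (hm : 0 < m) (ht : ValEq t (r / m))
    (i : Fin 6) :
    ValEq (t ^ (i : ℕ) / (p : Ω p) ^ slopeExp r m i) ((((i : ℕ) * r % m : ℕ) : ℝ) / m) := by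
  refine (ht.pow i rfl).div (valEq_prime_pow _) ?_
  have h1 := Nat.div_add_mod ((i : ℕ) * r) m
  have hm' : (m : ℝ) ≠ 0 := by exact_mod_cast hm.ne'
  have h2 : ((i : ℕ) : ℝ) * r = m * (slopeExp r m i : ℝ) + (((i : ℕ) * r % m : ℕ) : ℝ) := by
    unfold slopeExp
    exact_mod_cast h1.symm
  have h3 : (((i : ℕ) * r % m : ℕ) : ℝ) = ((i : ℕ) : ℝ) * r - m * (slopeExp r m i : ℝ) := by
    linarith
  rw [h3]
  field_simp

theorem tri_nil (t : Ω p) (i : Fin 6) : tri (fun _ => []) t i = t ^ (i : ℕ) := by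
  simp [tri]

theorem integralFamily_six {r : ℕ} (hr : 0 < r) (ha : ValGE (a : Ω p) r)
    (hb : ValEq (b : Ω p) r) : IntegralFamily p a b (fun _ => []) (slopeExp r 6) := by
  refine IntegralFamily.of_eq _ (fun t i => rfl) fun t ht i => ?_
  simp only [tri_nil]
  have h1 := valEq_root_of_le (by exact_mod_cast hr) ha hb ht
  exact (valEq_pow_div_slope (m := 6) (by norm_num) (by exact_mod_cast h1) i).ge' (by positivity)

theorem saturatedFamily_six_of_coprime {r : ℕ} (hr : r = 1 ∨ r = 5)
    (ha : ValGE (a : Ω p) r) (hb : ValEq (b : Ω p) r) :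
    SaturatedFamily p a b (fun _ => []) (slopeExp r 6) := by
  refine SaturatedFamily.of_eq _ (fun t i => rfl) fun d hd => ?_
  simp only [tri_nil] at hd
  obtain ⟨t, ht⟩ := exists_root p a b
  have h1 := valEq_root_of_le (by rcases hr with rfl | rfl <;> norm_num) ha hb ht
  refine dvd_of_distinct (hd t ht) 6 (fun i => (i : ℕ) * r % 6) ∅ (by simp)
    (fun i => Nat.mod_lt _ (by norm_num)) ?_
    (fun i _ => by exact_mod_cast valEq_pow_div_slope (m := 6) (by norm_num) (by exact_mod_cast h1) i)
  rcases hr with rfl | rfl <;> decide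

/-- For each root `ξ` of `X ^ 6 + b` there is a root of the trinomial close to it. -/
theorem exists_root_near_pow {r : ℝ} (hr : 0 < r) (ha : ValGE (a : Ω p) r)
    (hb : ValEq (b : Ω p) r) {ξ : Ω p} (hξ : ξ ^ 6 + b = 0) :
    ∃ t : Ω p, t ^ 6 + a * t + b = 0 ∧ ∃ c, r / 6 < c ∧ ValGE (t - ξ) c := by
  have hξr : ValEq ξ (r / 6) := by
    refine ValEq.of_pow (n := 6) (by norm_num) (r := r) ?_
    rw [eq_neg_of_add_eq_zero_left hξ]
    exact hb.neg
  refine exists_root_near (ξ' := 0) (r := r) (s := r + r / 6) ?_ ?_ (by linarith) ?_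
  · have : ξ ^ 6 + (a : Ω p) * ξ + (b : Ω p) = a * ξ := by linear_combination hξ
    rw [this]
    exact ha.mul hξr.ge le_rfl
  · simpa using hb
  · rw [zero_sub]; exact hξr.neg

theorem exists_pow_eq {n : ℕ} (hn : 0 < n) (x : Ω p) : ∃ y : Ω p, y ^ n = x :=
  IsAlgClosed.exists_pow_nat_eq x hn

theorem saturatedFamily_six_of_two {e : ℕ} (he : e = 1 ∨ e = 2) (hp2 : ValEq (2 : Ω p) 0)
    (ha : ValGE (a : Ω p) (2 * e : ℕ)) (hb : ValEq (b : Ω p) (2 * e : ℕ)) :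
    SaturatedFamily p a b (fun _ => []) (slopeExp (2 * e) 6) := by
  refine SaturatedFamily.of_eq _ (fun t i => rfl) fun d hd => ?_
  simp only [tri_nil] at hd
  have he0 : (0 : ℝ) < (2 * e : ℕ) := by rcases he with rfl | rfl <;> norm_num
  have hP := valEq_prime_pow (p := p) e
  -- the two square roots of `-b`, and roots of the trinomial whose cubes are close to them
  obtain ⟨β, hβ⟩ := exists_pow_eq (p := p) (n := 2) (by norm_num) (-(b : Ω p))
  have hβe : ValEq β e := by
    refine ValEq.of_pow (n := 2) (by norm_num) (r := (2 * e : ℕ)) ?_ (by push_cast; ring)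
    rw [hβ]; exact hb.neg
  have key : ∀ β' : Ω p, β' ^ 2 = -b → ∃ t : Ω p, t ^ 6 + a * t + b = 0 ∧
      ∃ c, 0 < c ∧ ValGE (t ^ 3 / (p : Ω p) ^ e - β' / (p : Ω p) ^ e) c := by
    intro β' hβ'
    obtain ⟨ξ, hξ⟩ := exists_pow_eq (p := p) (n := 3) (by norm_num) β'
    have hξ6 : ξ ^ 6 + b = 0 := by
      linear_combination (ξ ^ 3 + β') * hξ + hβ'
    have hξr : ValEq ξ ((2 * e : ℕ) / 6) := by
      refine ValEq.of_pow (n := 6) (by norm_num) (r := (2 * e : ℕ)) ?_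
      rw [eq_neg_of_add_eq_zero_left hξ6]
      exact hb.neg
    obtain ⟨t, ht, c, hc, htc⟩ := exists_root_near_pow he0 ha hb hξ6
    have htr := valEq_root_of_le he0 ha hb ht
    refine ⟨t, ht, c - (2 * e : ℕ) / 6, by linarith, ?_⟩
    rw [← sub_div, ← hξ]
    refine ValGE.div (r := c + 2 * ((2 * e : ℕ) / 6)) ?_ hP (by push_cast; linarith)
    have h1 : t ^ 3 - ξ ^ 3 = (t - ξ) * (t ^ 2 + t * ξ + ξ ^ 2) := by ring
    rw [h1]
    refine htc.mul (s := 2 * ((2 * e : ℕ) / 6)) ?_ le_rfl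
    exact ((htr.pow 2).ge.add (htr.mul hξr (by ring)).ge).add
      (hξr.pow 2).ge
  obtain ⟨t1, ht1, c1, hc1, h1⟩ := key β hβ
  obtain ⟨t2, ht2, c2, hc2, h2⟩ := key (-β) (by linear_combination hβ)
  let τ : Fin 2 → Ω p := ![t1, t2]
  have hτ : ∀ j, τ j ^ 6 + a * τ j + b = 0 := by
    intro j; fin_cases j
    exacts [ht1, ht2]
  have hτr : ∀ j, ValEq (τ j) ((2 * e : ℕ) / (6 : ℕ)) := fun j => by
    exact_mod_cast valEq_root_of_le he0 ha hb (hτ j)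
  have hη0 : ∀ j, ValGE (τ j ^ 3 / (p : Ω p) ^ e) 0 := fun j =>
    ((hτr j).pow 3 rfl).ge.div hP (by push_cast; linarith)
  obtain ⟨η, hη⟩ : ∃ η : Fin 2 → Ω p, ∀ j, τ j ^ 3 / (p : Ω p) ^ e = η j :=
    ⟨_, fun _ => rfl⟩
  simp only [hη] at hη0
  have hres : ∀ d0 d1 : ℤ, (∀ j, ∃ s, 0 < s ∧
      ValGE ((d0 : Ω p) + (d1 : Ω p) * η j) s) →
      (p : ℤ) ∣ d0 ∧ (p : ℤ) ∣ d1 := by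
    intro d0 d1 h
    obtain ⟨s1, hs1, h3⟩ := h 0
    obtain ⟨s2, hs2, h4⟩ := h 1
    refine dvd_of_two_residues h3 hs1 h4 hs2 ?_ (hη0 0)
    have h5 : η 0 - η 1 =
        2 * (β / (p : Ω p) ^ e) + ((t1 ^ 3 / (p : Ω p) ^ e - β / (p : Ω p) ^ e) -
          (t2 ^ 3 / (p : Ω p) ^ e - -β / (p : Ω p) ^ e)) := by
      simp only [← hη, τ, Matrix.cons_val_zero, Matrix.cons_val_one]; ring
    rw [h5]
    refine ValEq.add (hp2.mul (hβe.div hP rfl) (by ring))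
      ((h1.mono (min_le_left c1 c2)).sub (h2.mono (min_le_right c1 c2))) (lt_min hc1 hc2)
  have hv := fun j i => valEq_pow_div_slope (p := p) (m := 6) (by norm_num) (hτr j) i
  refine dvd_of_groups (T := Fin 2) (γ := fun j i => τ j ^ (i : ℕ) / _) (fun j => hd _ (hτ j)) 6
    (fun i => (i : ℕ) * (2 * e) % 6) ![0, 1, 2, 0, 1, 2] (fun i => Nat.mod_lt _ (by norm_num)) ?_ ?_
    (fun j i => ![1, 1, 1, η j, η j, η j] i) ?_ ?_ ?_
  · rcases he with rfl | rfl <;> decide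
  · intro j i
    have h6 := hv j ((![0, 1, 2, 0, 1, 2] : Fin 6 → Fin 6) i)
    have h7 : ((![0, 1, 2, 0, 1, 2] : Fin 6 → Fin 6) i : ℕ) * (2 * e) % 6 = (i : ℕ) * (2 * e) % 6 := by
      clear h6
      rcases he with rfl | rfl <;> revert i <;> decide
    rw [h7] at h6
    exact h6
  · intro j i
    refine ⟨(((i : ℕ) * (2 * e) % 6 : ℕ) : ℝ) / (6 : ℕ) + 1, by linarith, ?_⟩
    have hpe := hP.ne_zero
    convert valGE_zero (p := p) _ using 1
    rcases he with rfl | rfl <;> fin_cases i <;> simp [slopeExp, ← hη] <;> field_simp <;> ring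
  · intro j i
    fin_cases i
    exacts [valEq_one.ge, valEq_one.ge, valEq_one.ge, hη0 j, hη0 j, hη0 j]
  · have h03 := hres (d 0) (d 3)
    have h14 := hres (d 1) (d 4)
    have h25 := hres (d 2) (d 5)
    intro i hi
    rcases he with rfl | rfl <;> fin_cases i <;>
      simp [Finset.sum_filter, Fin.sum_univ_six, -Fin.forall_fin_two] at hi ⊢ <;>
      first | exact (h03 hi).1 | exact (h14 hi).1 | exact (h25 hi).1 | exact (h03 hi).2 |
        exact (h14 hi).2 | exact (h25 hi).2

end Newton


section Newton

variable {p : ℕ} [hp : Fact p.Prime] {a b : ℤ}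

theorem exists_cube_root_of_unity (hp3 : ValEq (3 : Ω p) 0) :
    ∃ ω : Ω p, ω ^ 2 + ω + 1 = 0 ∧ ValEq ω 0 ∧ ValEq (ω - 1) 0 := by
  obtain ⟨s, hs⟩ := exists_pow_eq (p := p) (n := 2) (by norm_num) (-3)
  have hω : ((s - 1) / 2) ^ 2 + (s - 1) / 2 + 1 = 0 := by
    linear_combination hs / 4
  generalize (s - 1) / 2 = ω at hω
  have h3 : ω ^ 3 = 1 := by linear_combination (ω - 1) * hω
  have h0 : ValEq ω 0 :=
    ValEq.of_pow (n := 3) (r := 0) (by norm_num) (by rw [h3]; exact valEq_one)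
  refine ⟨ω, hω, h0, ValEq.of_pow (n := 2) (r := 0) (by norm_num) ?_⟩
  rw [show (ω - 1) ^ 2 = -(3 * ω) by linear_combination hω]
  exact (hp3.mul h0).neg

theorem saturatedFamily_six_of_three (hp3 : ValEq (3 : Ω p) 0)
    (ha : ValGE (a : Ω p) 3) (hb : ValEq (b : Ω p) 3) :
    SaturatedFamily p a b (fun _ => []) (slopeExp 3 6) := by
  refine SaturatedFamily.of_eq _ (fun t i => rfl) fun d hd => ?_
  simp only [tri_nil] at hd
  have hP := valEq_prime (p := p)
  obtain ⟨ω, hω, hω0, hω1⟩ := exists_cube_root_of_unity hp3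
  obtain ⟨β, hβ⟩ := exists_pow_eq (p := p) (n := 3) (by norm_num) (-(b : Ω p))
  have hβ1 : ValEq β 1 := by
    refine ValEq.of_pow (n := 3) (by norm_num) (r := 3) ?_
    rw [hβ]; exact hb.neg
  have key : ∀ β' : Ω p, β' ^ 3 = -b → ∃ t : Ω p, t ^ 6 + a * t + b = 0 ∧
      ∃ c, 0 < c ∧ ValGE (t ^ 2 / (p : Ω p) - β' / (p : Ω p)) c := by
    intro β' hβ'
    obtain ⟨ξ, hξ⟩ := exists_pow_eq (p := p) (n := 2) (by norm_num) β'
    have hξ6 : ξ ^ 6 + b = 0 := by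
      linear_combination (ξ ^ 4 + ξ ^ 2 * β' + β' ^ 2) * hξ + hβ'
    have hξr : ValEq ξ (3 / 6) := by
      refine ValEq.of_pow (n := 6) (by norm_num) (r := 3) ?_
      rw [eq_neg_of_add_eq_zero_left hξ6]
      exact hb.neg
    obtain ⟨t, ht, c, hc, htc⟩ := exists_root_near_pow (by norm_num) ha hb hξ6
    have htr := valEq_root_of_le (by norm_num) ha hb ht
    refine ⟨t, ht, c - 3 / 6, by linarith, ?_⟩
    rw [← sub_div, ← hξ]
    refine ValGE.div (r := c + 3 / 6) ?_ hP (by linarith)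
    rw [show t ^ 2 - ξ ^ 2 = (t - ξ) * (t + ξ) by ring]
    exact htc.mul (htr.ge.add hξr.ge) le_rfl
  obtain ⟨t1, ht1, c1, hc1, h1⟩ := key β hβ
  obtain ⟨t2, ht2, c2, hc2, h2⟩ := key (β * ω)
    (by linear_combination ω ^ 3 * hβ - b * (ω - 1) * hω)
  obtain ⟨t3, ht3, c3, hc3, h3⟩ := key (β * ω ^ 2)
    (by linear_combination ω ^ 6 * hβ - b * (ω ^ 3 + 1) * (ω - 1) * hω)
  let τ : Fin 3 → Ω p := ![t1, t2, t3]
  have hτ : ∀ j, τ j ^ 6 + a * τ j + b = 0 := by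
    intro j; fin_cases j
    exacts [ht1, ht2, ht3]
  have hτr : ∀ j, ValEq (τ j) ((3 : ℕ) / (6 : ℕ)) := fun j => by
    exact_mod_cast valEq_root_of_le (by norm_num) ha hb (hτ j)
  obtain ⟨η, hη⟩ : ∃ η : Fin 3 → Ω p, ∀ j, τ j ^ 2 / (p : Ω p) = η j :=
    ⟨_, fun _ => rfl⟩
  have hη0 : ∀ j, ValGE (η j) 0 := fun j => by
    rw [← hη]
    exact ((hτr j).pow 2 rfl).ge.div hP
  have hβp : ValEq (β / (p : Ω p)) 0 := hβ1.div hP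
  have hdiff : ∀ (x y β1 β2 : Ω p) (c c' : ℝ), 0 < c → 0 < c' →
      ValGE (x - β1 / (p : Ω p)) c → ValGE (y - β2 / (p : Ω p)) c' →
      ValEq ((β1 - β2) / (p : Ω p)) 0 → ValEq (x - y) 0 := by
    intro x y β1 β2 c c' hc hc' hx hy h
    have h4 := h.add ((hx.mono (min_le_left c c')).sub (hy.mono (min_le_right c c')))
      (lt_min hc hc')
    convert h4 using 1; ring
  have hres : ∀ d0 d1 d2 : ℤ, (∀ j, ∃ s, 0 < s ∧
      ValGE ((d0 : Ω p) + (d1 : Ω p) * η j + (d2 : Ω p) * η j ^ 2) s) →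
      (p : ℤ) ∣ d0 ∧ (p : ℤ) ∣ d1 ∧ (p : ℤ) ∣ d2 := by
    intro d0 d1 d2 h
    obtain ⟨s1, hs1, h4⟩ := h 0
    obtain ⟨s2, hs2, h5⟩ := h 1
    obtain ⟨s3, hs3, h6⟩ := h 2
    rw [hη 0 |>.symm] at h4
    refine dvd_of_three_residues (by rw [← hη 0]; exact h4) hs1 h5 hs2 h6 hs3 ?_ ?_ ?_ (hη0 0)
    · rw [← hη, ← hη]
      refine hdiff _ _ _ _ _ _ hc1 hc2 h1 h2 ?_
      rw [show (β - β * ω) / (p : Ω p) = -(β / p * (ω - 1)) by ring]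
      exact (hβp.mul hω1).neg
    · rw [← hη, ← hη]
      refine hdiff _ _ _ _ _ _ hc1 hc3 h1 h3 ?_
      rw [show (β - β * ω ^ 2) / (p : Ω p) = β / p * (ω - 1) * ω ^ 2 by
        linear_combination -(β / p) * (ω - 1) * hω]
      exact (hβp.mul hω1 (t := 0)).mul (hω0.pow 2 rfl)
    · rw [← hη, ← hη]
      refine hdiff _ _ _ _ _ _ hc2 hc3 h2 h3 ?_
      rw [show (β * ω - β * ω ^ 2) / (p : Ω p) = -(β / p * (ω - 1) * ω) by ring]
      exact ((hβp.mul hω1 (t := 0)).mul hω0).neg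
  have hv := fun j i => valEq_pow_div_slope (p := p) (m := 6) (by norm_num) (hτr j) i
  refine dvd_of_groups (T := Fin 3) (γ := fun j i => τ j ^ (i : ℕ) / _) (fun j => hd _ (hτ j)) 6
    (fun i => (i : ℕ) * 3 % 6) ![0, 1, 0, 1, 0, 1] (fun i => Nat.mod_lt _ (by norm_num)) ?_ ?_
    (fun j i => ![1, 1, η j, η j, η j ^ 2, η j ^ 2] i) ?_ ?_ ?_
  · decide
  · intro j i
    have h6 := hv j ((![0, 1, 0, 1, 0, 1] : Fin 6 → Fin 6) i)
    have h7 : ((![0, 1, 0, 1, 0, 1] : Fin 6 → Fin 6) i : ℕ) * 3 % 6 = (i : ℕ) * 3 % 6 := by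
      clear h6
      revert i; decide
    rw [h7] at h6
    exact h6
  · intro j i
    refine ⟨(((i : ℕ) * 3 % 6 : ℕ) : ℝ) / (6 : ℕ) + 1, by linarith, ?_⟩
    have hpe := hP.ne_zero
    convert valGE_zero (p := p) _ using 1
    fin_cases i <;> simp [slopeExp, ← hη] <;> field_simp <;> ring
  · intro j i
    have hη2 : ValGE (η j ^ 2) 0 := (hη0 j).pow 2
    fin_cases i
    exacts [valEq_one.ge, valEq_one.ge, hη0 j, hη0 j, hη2, hη2]
  · have h024 := hres (d 0) (d 2) (d 4)
    have h135 := hres (d 1) (d 3) (d 5)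
    intro i hi
    fin_cases i <;>
      simp [Finset.sum_filter, Fin.sum_univ_six] at hi ⊢ <;>
      first | exact (h024 hi).1 | exact (h024 hi).2.1 | exact (h024 hi).2.2 |
        exact (h135 hi).1 | exact (h135 hi).2.1 | exact (h135 hi).2.2

/-- If `s < 5` is the valuation of `a` and that of `b` is greater, a root has valuation at least one
or `s / 5`. -/
theorem valGE_one_or_valEq {s : ℝ} (hs : s < 5) (ha : ValEq (a : Ω p) s)
    (hb : ValGE (b : Ω p) (s + 1)) {t : Ω p} (ht : t ^ 6 + a * t + b = 0) :
    ValGE t 1 ∨ ValEq t (s / 5) := by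
  by_cases h0 : t = 0
  · left; rw [h0]; exact valGE_zero 1
  obtain ⟨w, hw⟩ := exists_valEq h0
  have hw0 : 0 ≤ w := hw.le_of_ge (root_valGE ht)
  have h6 := hw.pow 6 rfl
  have hat := ha.mul hw (t := s + w) rfl
  rcases lt_trichotomy w (s / 5) with hlt | rfl | hgt
  · exfalso
    refine h6.false_of_add_eq_zero (y := (a : Ω p) * t + (b : Ω p))
      (s := min (s + w) (s + 1)) ?_ ?_ (by rw [← add_assoc]; exact ht)
    · exact (hat.ge' (min_le_left _ _)).add (hb.mono (min_le_right _ _))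
    · push_cast; exact lt_min (by linarith) (by linarith)
  · exact Or.inr hw
  · left
    by_contra hw1
    have hw1 : w < 1 := by
      by_contra h; exact hw1 (hw.ge' (not_lt.mp h))
    refine hat.false_of_add_eq_zero (y := t ^ 6 + (b : Ω p))
      (s := min (6 * w) (s + 1)) ?_ ?_ (by rw [← ht]; ring)
    · exact (h6.ge' (by push_cast; exact min_le_left _ _)).add (hb.mono (min_le_right _ _))
    · exact lt_min (by linarith) (by linarith)

theorem exists_root_valGE_one {s : ℝ} (hs : s < 5) (ha : ValEq (a : Ω p) s)
    (hb : ValGE (b : Ω p) (s + 1)) :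
    ∃ t : Ω p, t ^ 6 + a * t + b = 0 ∧ ValGE t 1 := by
  refine exists_root_of_not_valEq (ξ := 0) (c := s / 5) (fun t ht => ?_) fun h => ?_
  · rw [zero_sub]
    exact (valGE_one_or_valEq hs ha hb ht).imp id fun h => h.neg
  · have := h.le_of_ge (s := s + 1) (by simpa using hb)
    linarith

theorem exists_root_valEq_div_five {s : ℝ} (hs : s < 5)
    (ha : ValEq (a : Ω p) s) (hb : ValGE (b : Ω p) (s + 1)) :
    ∃ t : Ω p, t ^ 6 + a * t + b = 0 ∧ ValEq t (s / 5) := by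
  obtain ⟨α, hα⟩ := exists_pow_eq (p := p) (n := 5) (by norm_num) (-(a : Ω p))
  have hαs : ValEq α (s / 5) := by
    refine ValEq.of_pow (n := 5) (by norm_num) (r := s) ?_
    rw [hα]; exact ha.neg
  refine exists_root_of_not_valEq (ξ := α) (c := s / 5) (fun t ht => ?_) fun h => ?_
  · rcases valGE_one_or_valEq hs ha hb ht with h | h
    · exact Or.inr (by simpa [sub_eq_add_neg] using hαs.add h.neg (by linarith))
    · exact Or.inl h
  · have := h.le_of_ge (s := s + 1) (by
      rw [show α ^ 6 + (a : Ω p) * α + (b : Ω p) = b by linear_combination α * hα]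
      exact hb)
    linarith

theorem integralFamily_five {s : ℕ} (hs : s < 5) (ha : ValEq (a : Ω p) s)
    (hb : ValGE (b : Ω p) (s + 1)) :
    IntegralFamily p a b (fun _ => []) (slopeExp s 5) := by
  refine IntegralFamily.of_eq _ (fun t i => rfl) fun t ht i => ?_
  simp only [tri_nil]
  rcases valGE_one_or_valEq (by exact_mod_cast hs) ha hb ht with h1 | h1
  · refine (h1.pow i (t := i) (by simp)).div (valEq_prime_pow _) ?_
    have h2 : slopeExp s 5 i ≤ i := by
      unfold slopeExp
      exact Nat.div_le_of_le_mul (by rw [mul_comm 5]; exact Nat.mul_le_mul_left _ hs.le)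
    have h3 : (slopeExp s 5 i : ℝ) ≤ (i : ℕ) := by exact_mod_cast h2
    linarith
  · exact (valEq_pow_div_slope (m := 5) (by norm_num) (by exact_mod_cast h1) i).ge' (by positivity)

theorem saturatedFamily_five {s : ℕ} (hs : 0 < s) (hs5 : s < 5) (ha : ValEq (a : Ω p) s)
    (hb : ValGE (b : Ω p) (s + 1)) :
    SaturatedFamily p a b (fun _ => []) (slopeExp s 5) := by
  refine SaturatedFamily.of_eq _ (fun t i => rfl) fun d hd => ?_
  simp only [tri_nil] at hd
  obtain ⟨t, ht, ht1⟩ := exists_root_valGE_one (by exact_mod_cast hs5) ha hb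
  obtain ⟨u, hu, hu1⟩ := exists_root_valEq_div_five (by exact_mod_cast hs5) ha hb
  have h0 : (p : ℤ) ∣ d 0 := by
    refine dvd_of_min (hd t ht) 0 (r := 0) one_pos (by simpa [slopeExp] using valEq_one) fun i hi => ?_
    refine Or.inr ⟨1, one_pos, (ht1.pow i (t := i) (by simp)).div (valEq_prime_pow _) ?_⟩
    have h2 : slopeExp s 5 i + 1 ≤ i := by
      have h4 : 0 < (i : ℕ) := Nat.pos_of_ne_zero fun h => hi (Fin.ext h)
      have h5 : (i : ℕ) * s < i * 5 := (Nat.mul_lt_mul_left h4).mpr hs5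
      unfold slopeExp
      omega
    have h3 : (slopeExp s 5 i : ℝ) + 1 ≤ (i : ℕ) := by exact_mod_cast h2
    linarith
  have hv := fun i => valEq_pow_div_slope (p := p) (m := 5) (t := u) (r := s) (by norm_num)
    (by exact_mod_cast hu1) i
  refine dvd_of_distinct (hd u hu) 5 (fun i => (i : ℕ) * s % 5) {0} ?_
    (fun i => Nat.mod_lt _ (by norm_num)) ?_ (fun i _ => hv i)
  · intro i hi
    rw [Finset.mem_singleton.mp hi]
    exact ⟨h0, (hv 0).ge' (by positivity)⟩
  · interval_cases s <;> decide

end Newton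

section Rows

variable {K : Type*} [Field K] [NumberField K] {p : ℕ} [hp : Fact p.Prime] {θ : K} {a b : ℤ}
  {n vdK : ℕ} {α : Fin 6 → K}

theorem rowHolds_five (hS : IsTrinomialGenerator θ a b) {s r : ℕ} (hs : 0 < s) (hs5 : s < 5)
    (ha : ValEq (a : Ω p) s) (hb : ValGE (b : Ω p) r) (hr : s + 1 ≤ r)
    (hD : padicValInt p Δ(a,b) = n)
    (hsum : vdK + 2 * ∑ i, slopeExp s 5 i = n)
    (hα : α = family p θ (fun _ => []) (slopeExp s 5)) :
    RowHolds p θ Δ(a,b) {n} vdK {α} :=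
  rowHolds_single hS hD hsum (integralFamily_five hs5 ha (hb.mono (by exact_mod_cast hr)))
    (saturatedFamily_five hs hs5 ha (hb.mono (by exact_mod_cast hr)))
    (slopeExp_zero _ _) (slopeExp_monotone _ _) hα

theorem rowHolds_six (hS : IsTrinomialGenerator θ a b) {s r : ℕ} (hr : 0 < r)
    (ha : ValGE (a : Ω p) s) (hb : ValEq (b : Ω p) r) (hsr : r ≤ s)
    (hM : ValGE (a : Ω p) r → SaturatedFamily p a b (fun _ => []) (slopeExp r 6))
    (hD : padicValInt p Δ(a,b) = n)
    (hsum : vdK + 2 * ∑ i, slopeExp r 6 i = n)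
    (hα : α = family p θ (fun _ => []) (slopeExp r 6)) :
    RowHolds p θ Δ(a,b) {n} vdK {α} :=
  rowHolds_single hS hD hsum (integralFamily_six hr (ha.mono (by exact_mod_cast hsr)) hb)
    (hM (ha.mono (by exact_mod_cast hsr))) (slopeExp_zero _ _) (slopeExp_monotone _ _) hα

theorem rowHolds_zero (hS : IsTrinomialGenerator θ a b)
    (hD : padicValInt p Δ(a,b) = 0) :
    RowHolds p θ Δ(a,b) {0} 0 {![1, θ, θ ^ 2, θ ^ 3, θ ^ 4, θ ^ 5]} := by
  refine rowHolds_of_le_one hS (k := fun _ => 0) (by norm_num) hD (by rw [hD]; rfl) ⟨_, rfl⟩ rfl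
    (fun _ _ _ => le_rfl) ?_
  rintro _ rfl
  refine ⟨fun _ => [], integralFamily_zero, ?_⟩
  ext i
  fin_cases i <;> simp [family, tri]

end Rows


section Classes

variable {p : ℕ} [hp : Fact p.Prime] {d : Fin 6 → ℤ}

/-- Suppose that the elements `γ (e c ρ)` are multiples of an element `δ c` of valuation `n c / m` at
all of the places considered, up to terms of greater valuation, and that the cofactors are linearly
independent modulo `p`. Then a combination of the `γ i` that is divisible by `p` has coefficients
divisible by `p`. -/
theorem dvd_of_classes {T C R : Type*} [Fintype C] [Fintype R] {γ : T → Fin 6 → Ω p}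
    (h : ∀ τ, ValGE (∑ i, (d i : Ω p) * γ τ i) 1) (e : C → R → Fin 6)
    (he : Function.Bijective (Function.uncurry e)) (m : ℕ) (n : C → ℕ) (hn : ∀ c, n c < m)
    (hinj : Function.Injective n) (δ : T → C → Ω p)
    (hδ : ∀ τ c, ValEq (δ τ c) ((n c : ℝ) / m)) (η : T → R → Ω p)
    (hη0 : ∀ τ r, ValGE (η τ r) 0)
    (hη : ∀ τ c r, γ τ (e c r) = δ τ c * η τ r ∨
      ∃ s, (n c : ℝ) / m < s ∧ ValGE (γ τ (e c r) - δ τ c * η τ r) s)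
    (hres : ∀ f : R → ℤ, (∀ τ, ∃ s, 0 < s ∧ ValGE (∑ r, (f r : Ω p) * η τ r) s) →
      ∀ r, (p : ℤ) ∣ f r) (i : Fin 6) : (p : ℤ) ∣ d i := by
  have hη' : ∀ τ c r, ∃ s, (n c : ℝ) / m < s ∧ ValGE (γ τ (e c r) - δ τ c * η τ r) s := by
    intro τ c r
    rcases hη τ c r with h1 | h1
    · exact ⟨(n c : ℝ) / m + 1, by linarith, by rw [h1, sub_self]; exact valGE_zero _⟩
    · exact h1
  have hm : ∀ c, (0 : ℝ) < m := fun c => by exact_mod_cast (Nat.zero_le _).trans_lt (hn c)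
  have hγ : ∀ τ c r, ValGE (γ τ (e c r)) ((n c : ℝ) / m) := by
    intro τ c r
    obtain ⟨s, hs, h1⟩ := hη' τ c r
    have h2 := (h1.mono hs.le).add ((hδ τ c).ge.mul (hη0 τ r) (t := (n c : ℝ) / m) (by linarith))
    rwa [sub_add_cancel] at h2
  suffices hall : ∀ c r, (p : ℤ) ∣ d (e c r) by
    obtain ⟨⟨c, r⟩, rfl⟩ := he.2 i
    exact hall c r
  by_contra! hnot
  classical
  obtain ⟨c0, hc0⟩ := hnot
  obtain ⟨c, hc, hmin⟩ := Finset.exists_min_image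
    (Finset.univ.filter fun c => ∃ r, ¬ (p : ℤ) ∣ d (e c r)) n ⟨c0, by simpa using hc0⟩
  simp only [Finset.mem_filter, Finset.mem_univ, true_and] at hc hmin
  obtain ⟨r, hr⟩ := hc
  refine hr (hres (fun r => d (e c r)) (fun τ => ?_) r)
  let g : Fin 6 → R := fun i => ((Equiv.ofBijective _ he).symm i).2
  have hg : ∀ c r, g (e c r) = r := by
    intro c r
    have h3 : (Equiv.ofBijective _ he).symm (e c r) = (c, r) :=
      (Equiv.symm_apply_eq _).mpr rfl
    simp only [g, h3]
  have heinj : Function.Injective (e c) := fun r r' hrr => by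
    rw [← hg c r, hrr, hg]
  suffices h4 : ∃ s, 0 < s ∧ ValGE (∑ i ∈ Finset.univ.map ⟨e c, heinj⟩,
      (d i : Ω p) * η τ (g i)) s by
    simpa [hg] using h4
  refine exists_pos_valGE_sum (h τ) (r := (n c : ℝ) / m)
    (by rw [div_lt_one (hm c)]; exact_mod_cast hn c) _ (hδ τ c) (fun i => η τ (g i)) ?_ ?_
  · intro i hi
    obtain ⟨r', -, rfl⟩ := Finset.mem_map.mp hi
    simpa [hg] using hη' τ c r'
  · intro i hi
    obtain ⟨⟨c', r'⟩, rfl⟩ := he.2 i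
    simp only [Function.uncurry] at hi ⊢
    have hcc : c' ≠ c := by
      rintro rfl
      exact hi (by simp)
    by_cases hd : (p : ℤ) ∣ d (e c' r')
    · exact Or.inl ⟨hd, (hγ τ c' r').mono (div_nonneg (Nat.cast_nonneg _) (hm c).le)⟩
    · refine Or.inr ⟨_, ?_, hγ τ c' r'⟩
      rw [div_lt_div_iff_of_pos_right (hm c)]
      exact_mod_cast lt_of_le_of_ne (hmin c' ⟨r', hd⟩) fun h => hcc (hinj h).symm

theorem dvd_of_pairs {C : Type*} [Fintype C] {γ : Fin 2 → Fin 6 → Ω p}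
    (h : ∀ τ, ValGE (∑ i, (d i : Ω p) * γ τ i) 1) (e : C → Fin 2 → Fin 6)
    (he : Function.Bijective (Function.uncurry e)) (m : ℕ) (n : C → ℕ) (hn : ∀ c, n c < m)
    (hinj : Function.Injective n) (δ : Fin 2 → C → Ω p)
    (hδ : ∀ τ c, ValEq (δ τ c) ((n c : ℝ) / m)) (x : Fin 2 → Ω p)
    (hx0 : ∀ τ, ValGE (x τ) 0) (hx : ValEq (x 0 - x 1) 0)
    (hη : ∀ τ c r, γ τ (e c r) = δ τ c * (![1, x τ] : Fin 2 → Ω p) r ∨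
      ∃ s, (n c : ℝ) / m < s ∧ ValGE (γ τ (e c r) - δ τ c * (![1, x τ] : Fin 2 → Ω p) r) s)
    (i : Fin 6) : (p : ℤ) ∣ d i := by
  refine dvd_of_classes h e he m n hn hinj δ hδ (fun τ => ![1, x τ]) ?_ hη ?_ i
  · intro τ r
    fin_cases r
    exacts [valEq_one.ge, hx0 τ]
  · intro f hf
    obtain ⟨s, hs, h1⟩ := hf 0
    obtain ⟨s', hs', h2⟩ := hf 1
    simp only [Fin.sum_univ_two, Matrix.cons_val_zero, Matrix.cons_val_one, mul_one] at h1 h2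
    obtain ⟨h3, h4⟩ := dvd_of_two_residues h1 hs h2 hs' hx (hx0 0)
    intro r
    fin_cases r
    exacts [h3, h4]

theorem dvd_of_triples {C : Type*} [Fintype C] {γ : Fin 3 → Fin 6 → Ω p}
    (h : ∀ τ, ValGE (∑ i, (d i : Ω p) * γ τ i) 1) (e : C → Fin 3 → Fin 6)
    (he : Function.Bijective (Function.uncurry e)) (m : ℕ) (n : C → ℕ) (hn : ∀ c, n c < m)
    (hinj : Function.Injective n) (δ : Fin 3 → C → Ω p)
    (hδ : ∀ τ c, ValEq (δ τ c) ((n c : ℝ) / m)) (x : Fin 3 → Ω p)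
    (hx0 : ∀ τ, ValGE (x τ) 0) (hx01 : ValEq (x 0 - x 1) 0) (hx02 : ValEq (x 0 - x 2) 0)
    (hx12 : ValEq (x 1 - x 2) 0)
    (hη : ∀ τ c r, γ τ (e c r) = δ τ c * (![1, x τ, x τ ^ 2] : Fin 3 → Ω p) r ∨
      ∃ s, (n c : ℝ) / m < s ∧
        ValGE (γ τ (e c r) - δ τ c * (![1, x τ, x τ ^ 2] : Fin 3 → Ω p) r) s)
    (i : Fin 6) : (p : ℤ) ∣ d i := by
  refine dvd_of_classes h e he m n hn hinj δ hδ (fun τ => ![1, x τ, x τ ^ 2]) ?_ hη ?_ i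
  · intro τ r
    have h2 : ValGE (x τ ^ 2) 0 := (hx0 τ).pow 2
    fin_cases r
    exacts [valEq_one.ge, hx0 τ, h2]
  · intro f hf
    obtain ⟨s, hs, h1⟩ := hf 0
    obtain ⟨s', hs', h2⟩ := hf 1
    obtain ⟨s'', hs'', h3⟩ := hf 2
    simp only [Fin.sum_univ_three, Matrix.cons_val_zero, Matrix.cons_val_one, Matrix.cons_val_two,
      Matrix.head_cons, Matrix.tail_cons, mul_one] at h1 h2 h3
    obtain ⟨h4, h5, h6⟩ := dvd_of_three_residues h1 hs h2 hs' h3 hs'' hx01 hx02 hx12 (hx0 0)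
    intro r
    fin_cases r
    exacts [h4, h5, h6]

end Classes

section Distinct

variable {p : ℕ} [hp : Fact p.Prime] {a b : ℤ} {l : Fin 6 → List ℤ} {k : Fin 6 → ℕ}

theorem families_of_distinct (γ : Ω p → Fin 6 → Ω p)
    (hγ : ∀ t i, tri l t i / (p : Ω p) ^ k i = γ t i) (m : ℕ) (n : Fin 6 → ℕ)
    (hn : ∀ i, n i < m) (hinj : ∀ i j, n i = n j → i = j)
    (hv : ∀ t : Ω p, t ^ 6 + a * t + b = 0 → ∀ i, ValEq (γ t i) ((n i : ℝ) / m)) :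
    IntegralFamily p a b l k ∧ SaturatedFamily p a b l k := by
  refine ⟨.of_eq γ hγ fun t ht i => (hv t ht i).ge' (by positivity), .of_eq γ hγ fun d hd => ?_⟩
  obtain ⟨t, ht⟩ := exists_root p a b
  exact dvd_of_distinct (hd t ht) m n ∅ (by simp) hn (fun i _ j _ => hinj i j) fun i _ => hv t ht i

end Distinct

section Trace

variable {a b : ℤ}

/-- For `p = 2`, a function of the roots with integral values and odd trace takes values that are not
congruent to each other. -/
theorem exists_unit_sub_of_trace {F : Ω 2 → Ω 2}
    (hF : ∀ t : Ω 2, t ^ 6 + a * t + b = 0 → ValGE (F t) 0)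
    (htr : ∀ r : Fin 6 → Ω 2, (∑ i, r i = 0) → (∑ i, r i ^ 2 = 0) → (∑ i, r i ^ 3 = 0) →
      (∑ i, r i ^ 4 = 0) → (∑ i, r i ^ 5 = -5 * a) → ValEq (∑ i, F (r i)) 0) :
    ∃ τ : Fin 2 → Ω 2, (∀ j, τ j ^ 6 + a * τ j + b = 0) ∧ ValEq (F (τ 0) - F (τ 1)) 0 := by
  obtain ⟨r, hr, -, h1, h2, h3, h4, h5⟩ := exists_roots (a : Ω 2) (b : Ω 2)
  have htr := htr r h1 h2 h3 h4 h5
  by_contra! hno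
  have hsmall : ∀ i, ∃ s, 0 < s ∧ ValGE (F (r i) - F (r 0)) s := by
    intro i
    have h6 := hno ![r i, r 0] (by intro j; fin_cases j; exacts [hr i, hr 0])
    have h7 : ValGE (F (r i) - F (r 0)) 0 := (hF _ (hr i)).sub (hF _ (hr 0))
    refine exists_gt_valGE (lt_of_le_of_ne h7 ?_)
    simpa [ValEq] using h6
  obtain ⟨s, hs, h8⟩ := exists_gt_valGE_sum (T := Finset.univ) (f := fun i => F (r i) - F (r 0))
    fun i _ => hsmall i
  have h9 : ∑ i, F (r i) = ∑ i, (F (r i) - F (r 0)) + 2 * (3 * F (r 0)) := by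
    rw [Finset.sum_sub_distrib]
    simp
    ring
  have h10 : ValGE ((2 : Ω 2) * (3 * F (r 0))) 1 :=
    valEq_two.ge.mul ((valGE_ofNat 3).mul (hF _ (hr 0)) (t := 0))
  have h11 := htr.le_of_ge (s := min s 1) (by
    rw [h9]
    exact (h8.mono (min_le_left _ _)).add (h10.mono (min_le_right _ _)))
  have : 0 < min s 1 := lt_min hs one_pos
  linarith

end Trace


section Two

variable {K : Type*} [Field K] [NumberField K] {θ : K} {a b : ℤ}

theorem valEq_six_two : ValEq (6 : Ω 2) ((1 : ℕ) : ℝ) := by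
  simpa using valEq_of_emultiplicity (p := 2) (n := 6) (k := 1)
    (by rw [emultiplicity_eq_coe]; decide)

theorem valEq_five_two : ValEq (5 : Ω 2) ((0 : ℕ) : ℝ) := by
  simpa using valEq_of_emultiplicity (p := 2) (n := 5) (k := 0)
    (by rw [emultiplicity_eq_coe]; decide)

theorem valEq_four_two : ValEq (4 : Ω 2) 2 := by
  have := valEq_two.pow 2 (t := 2)
  norm_num at this
  exact this

theorem valEq_three_two : ValEq (3 : Ω 2) 0 := by
  simpa using valEq_intCast (p := 2) (n := 3) (by decide)

theorem valEq_odd {n : ℤ} (h : Odd n) : ValEq (n : Ω 2) 0 :=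
  valEq_intCast (p := 2) (by rw [Nat.cast_ofNat, ← even_iff_two_dvd, Int.not_even_iff_odd]; exact h)

theorem valGE_even {n : ℤ} (h : Even n) : ValGE (n : Ω 2) 1 :=
  valGE_one_of_dvd (p := 2) (by exact_mod_cast h.two_dvd)

theorem valEq_two_mul {n : ℤ} {x : Ω 2} {r : ℝ} (hn : Odd n) (hx : ValEq x r) :
    ValEq ((n : Ω 2) * x) r :=
  (valEq_odd hn).mul hx (by ring)

section SlopeThird

variable {a₁ b₀ : ℤ} {t : Ω 2}

/-- The element `θ³ / 2 + 1`, for a root of valuation `1 / 3`. -/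
theorem sq_cube_div_two_add_one (ha : a = 4 * a₁) (hb : b = 4 * b₀)
    (ht : t ^ 6 + a * t + b = 0) :
    (t ^ 3 / 2 + 1) ^ 2 = 2 * (t ^ 3 / 2 + 1) + (-(1 + b₀) - a₁ * t) := by
  rw [ha, hb] at ht
  push_cast at ht
  linear_combination ht / 4

theorem valEq_root_four (ha : a = 4 * a₁) (hb : b = 4 * b₀) (hb0 : Odd b₀)
    (ht : t ^ 6 + a * t + b = 0) : ValEq t (1 / 3) := by
  refine (valEq_root_of_le (r := 2) (by norm_num) ?_ ?_ ht).congr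
  · rw [ha]; push_cast; exact valEq_four_two.ge.mul (valGE_intCast _)
  · rw [hb]; push_cast; exact valEq_four_two.mul (valEq_odd hb0)

theorem padicValInt_discr_b4 {n : ℕ} {s : ℝ} (ha : ValGE (a : Ω 2) s) (hb : b = 4 * b₀)
    (hb0 : Odd b₀) (hs : 16 < 6 * s) (hn : n = 16) :
    padicValInt 2 Δ(a,b) = n := by
  refine padicValInt_of_gt valEq_five_two.ge valEq_six_two ha (r := 2) ?_ (by norm_num; linarith)
    (by rw [hn]; norm_num)
  rw [hb]; push_cast
  exact valEq_four_two.mul (valEq_odd hb0)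

theorem rowHolds_b4_a4 (hS : IsTrinomialGenerator θ a b) (ha : a = 4 * a₁) (hb : b = 4 * b₀)
    (ha1 : Odd a₁) (hb0 : Odd b₀) :
    RowHolds 2 θ Δ(a,b) {12} 6
      {![1, θ, θ ^ 2, θ ^ 3 / 2, θ ^ 4 / 2, θ ^ 5 / 2]} := by
  have haV : ValEq (a : Ω 2) 2 := by
    rw [ha]; push_cast; exact valEq_four_two.mul (valEq_odd ha1)
  have hbV : ValEq (b : Ω 2) 2 := by
    rw [hb]; push_cast; exact valEq_four_two.mul (valEq_odd hb0)
  have hfacts : ∀ t : Ω 2, t ^ 6 + a * t + b = 0 →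
      ValEq t (1 / 3) ∧ ValEq (t ^ 3 / 2 + 1) (1 / 6) := by
    intro t ht
    have h1 := valEq_root_four ha hb hb0 ht
    refine ⟨h1, ValEq.of_pow (n := 2) (r := 1 / 3) (by norm_num) ?_⟩
    have hη : ValGE (t ^ 3 / 2) 0 := (h1.pow 3 rfl).ge.div valEq_two
    have hc : ValGE ((1 + b₀ : ℤ) : Ω 2) 1 := valGE_even (by
      rw [add_comm]; exact hb0.add_odd odd_one)
    rw [show (t ^ 3 / 2 + 1) ^ 2 = -(a₁ * t) + (2 * (t ^ 3 / 2 + 1) - ((1 + b₀ : ℤ) : Ω 2)) by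
      rw [sq_cube_div_two_add_one ha hb ht]; push_cast; ring]
    exact (valEq_two_mul ha1 h1).neg.add
      ((valEq_two.ge.mul (hη.add valEq_one.ge)).sub hc)
  obtain ⟨hI, hM⟩ := families_of_distinct (p := 2) (a := a) (b := b)
    (l := ![[], [], [], [2], [0, 2], [0, 0, 2]]) (k := slopeExp 2 6)
    (fun t => ![1, t, t ^ 2, t ^ 3 / 2 + 1, t * (t ^ 3 / 2 + 1), t ^ 2 * (t ^ 3 / 2 + 1)])
    (by intro t i; fin_cases i <;> simp [tri, Finset.sum_range_succ, slopeExp] <;> ring)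
    6 ![0, 2, 4, 1, 3, 5] (by decide) (by decide) (by
      intro t ht i
      obtain ⟨h1, h2⟩ := hfacts t ht
      have h3 := h1.pow 2 rfl
      fin_cases i
      exacts [valEq_one.congr (by simp), h1.congr, h3.congr,
        h2.congr, h1.mul h2, h3.mul h2])
  exact rowHolds_single' hS
    (padicValInt_of_lt valEq_five_two valEq_six_two.ge haV hbV.ge (by norm_num)) rfl
    hI hM (integralFamily_six (by norm_num) haV.ge hbV) (slopeExp_zero _ _) (slopeExp_monotone _ _)
    (by ext i; fin_cases i <;> simp [family, tri, slopeExp])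

theorem rowHolds_b4_a8 {a₂ c : ℤ} (hS : IsTrinomialGenerator θ a b) (ha : a = 8 * a₂)
    (hb : b = 4 * b₀) (ha2 : Odd a₂) (hb0 : Odd b₀) (hc : 1 + b₀ = 4 * c) :
    RowHolds 2 θ Δ(a,b) {16} 6
      {![1, θ, θ ^ 2, θ ^ 3 / 2, (2 * θ + θ ^ 4) / 2 ^ 2, (2 * θ ^ 2 + θ ^ 5) / 2 ^ 2]} := by
  have haV : ValEq (a : Ω 2) 3 := by
    rw [ha, show (8 * a₂ : ℤ) = 4 * (2 * a₂) by ring]; push_cast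
    exact valEq_four_two.mul (valEq_two.mul (valEq_odd ha2) rfl)
  have hcC : (1 : Ω 2) + b₀ = 4 * c := by exact_mod_cast congrArg (Int.cast (R := Ω 2)) hc
  have hfacts : ∀ t : Ω 2, t ^ 6 + a * t + b = 0 →
      ValEq t (1 / 3) ∧ ValGE (t ^ 3 / 2) 0 ∧ ValEq (t * (t ^ 3 / 2 + 1) / 2) 0 ∧
      ValEq (t * (t ^ 3 / 2 + 1) / 2 + 1) (1 / 6) ∧
      ValEq (t ^ 3 / 2 + 1 - t ^ 2) (5 / 6) := by
    intro t ht
    have h1 := valEq_root_four (a₁ := 2 * a₂) (by rw [ha]; ring) hb hb0 ht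
    have hη : ValEq (t ^ 3 / 2) 0 := (h1.pow 3 rfl).div valEq_two
    have h2 : (t ^ 3 / 2 + 1) ^ 2 = 2 * (t ^ 3 / 2 + 1) + -(4 * (c : Ω 2) + 2 * (a₂ * t)) := by
      rw [sq_cube_div_two_add_one (a₁ := 2 * a₂) (by rw [ha]; ring) hb ht]
      push_cast
      linear_combination -hcC
    have h4c : ValGE (4 * (c : Ω 2)) 2 := valEq_four_two.ge.mul (valGE_intCast c)
    have h2a : ValEq (2 * ((a₂ : Ω 2) * t)) (4 / 3) := valEq_two.mul (valEq_two_mul ha2 h1)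
    have h3 : ValGE (t ^ 3 / 2 + 1) (2 / 3) :=
      valGE_of_sq_eq h2 (valEq_two.ge')
        ((h4c.mono).add (h2a.ge')).neg
    have h4 : ValEq (t ^ 3 / 2 + 1) (2 / 3) := by
      refine ValEq.of_pow (n := 2) (r := 4 / 3) (by norm_num) ?_
      rw [h2, show 2 * (t ^ 3 / 2 + 1) + -(4 * (c : Ω 2) + 2 * (a₂ * t)) =
        -(2 * (a₂ * t)) + (2 * (t ^ 3 / 2 + 1) - 4 * c) by ring]
      exact h2a.neg.add (s := 5 / 3)
        ((valEq_two.ge.mul h3).sub (h4c.mono))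
    have hζ : ValEq (t * (t ^ 3 / 2 + 1) / 2) 0 :=
      (h1.mul h4 rfl).div valEq_two
    have hκ0 : ValGE (t * (t ^ 3 / 2 + 1) / 2 + 1) 0 := hζ.ge.add valEq_one.ge
    have h5 : ValEq (t * (t ^ 3 / 2 + 1) / 2 + 1) (1 / 6) := by
      refine ValEq.of_pow (n := 2) (r := 1 / 3) (by norm_num) ?_
      have h6 : (t * (t ^ 3 / 2 + 1) / 2 + 1) ^ 2 = t * (t * (t ^ 3 / 2 + 1) / 2) +
          (2 * (t * (t ^ 3 / 2 + 1) / 2 + 1) + ((a₂ - 1 : ℤ) : Ω 2) - a₂ * (t ^ 3 / 2 + 1)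
            - c * t ^ 2) := by
        push_cast
        linear_combination t ^ 2 / 4 * h2
      rw [h6]
      refine (h1.mul hζ (t := 1 / 3)).add (s := 2 / 3) ?_
      refine ValGE.sub (ValGE.sub (ValGE.add ?_ ?_) ?_) ?_
      · exact valEq_two.ge.mul hκ0
      · exact (valGE_even (ha2.sub_odd odd_one)).mono
      · exact (valGE_intCast a₂).mul h4.ge
      · exact (valGE_intCast c).mul (h1.pow 2 rfl).ge
    refine ⟨h1, hη.ge, hζ, h5, ?_⟩
    refine ValEq.of_mul (y := t ^ 3 / 2) (r := 5 / 6) ?_ hη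
    rw [show (t ^ 3 / 2 + 1 - t ^ 2) * (t ^ 3 / 2) = t ^ 2 * ((t * (t ^ 3 / 2 + 1) / 2 + 1) +
      -(t ^ 3 / 2 + 1)) by ring]
    exact (h1.pow 2 rfl).mul (h5.add h4.neg.ge)
  obtain ⟨hI, hM⟩ := families_of_distinct (p := 2) (a := a) (b := b)
    (l := ![[], [], [], [2, 0, -2], [4, 2], [0, 4, 2]]) (k := ![0, 0, 0, 1, 2, 2])
    (fun t => ![1, t, t ^ 2, t ^ 3 / 2 + 1 - t ^ 2, t * (t ^ 3 / 2 + 1) / 2 + 1,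
      t * (t * (t ^ 3 / 2 + 1) / 2 + 1)])
    (by intro t i; fin_cases i <;> simp [tri, Finset.sum_range_succ] <;> ring)
    6 ![0, 2, 4, 5, 1, 3] (by decide) (by decide) (by
      intro t ht i
      obtain ⟨h1, -, -, h2, h4⟩ := hfacts t ht
      have h3 := h1.pow 2 rfl
      fin_cases i
      exacts [valEq_one.congr (by simp), h1.congr, h3.congr,
        h4.congr, h2.congr, h1.mul h2])
  refine rowHolds_single' hS (padicValInt_discr_b4 haV.ge hb hb0 (by norm_num) rfl) rfl hI hM
    (l' := ![[], [], [], [], [0, 2], [0, 0, 2]]) (.of_eq (fun t => ![1, t, t ^ 2, t ^ 3 / 2,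
      t * (t ^ 3 / 2 + 1) / 2, t * (t * (t ^ 3 / 2 + 1) / 2)]) ?_ ?_) rfl (by decide) ?_
  · intro t i; fin_cases i <;> simp [tri, Finset.sum_range_succ] <;> ring
  · intro t ht i
    obtain ⟨h1, h2, h3, -⟩ := hfacts t ht
    fin_cases i
    exacts [valEq_one.ge, h1.ge', h1.ge.pow 2, h2, h3.ge,
      h1.ge.mul h3.ge]
  · ext i; fin_cases i <;> simp [family, tri, Finset.sum_range_succ]

theorem rowHolds_b4_a16 {a₃ c : ℤ} (hS : IsTrinomialGenerator θ a b) (ha : a = 16 * a₃)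
    (hb : b = 4 * b₀) (hb0 : Odd b₀) (hc : 1 + b₀ = 4 * c) :
    RowHolds 2 θ Δ(a,b) {16} 4
      {![1, θ, θ ^ 2, (2 + θ ^ 3) / 2 ^ 2, (2 * θ + θ ^ 4) / 2 ^ 2,
        (2 * θ ^ 2 + θ ^ 5) / 2 ^ 2]} := by
  have haV : ValGE (a : Ω 2) 4 := by
    rw [ha, show (16 * a₃ : ℤ) = 4 * (4 * a₃) by ring]; push_cast
    exact valEq_four_two.ge.mul (valEq_four_two.ge.mul (valGE_intCast a₃) le_rfl)
  have hcC : (1 : Ω 2) + b₀ = 4 * c := by exact_mod_cast congrArg (Int.cast (R := Ω 2)) hc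
  have hfacts : ∀ t : Ω 2, t ^ 6 + a * t + b = 0 →
      ValEq t (1 / 3) ∧ ValGE ((t ^ 3 + 2) / 4) 0 := by
    intro t ht
    have h1 := valEq_root_four (a₁ := 4 * a₃) (by rw [ha]; ring) hb hb0 ht
    refine ⟨h1, valGE_of_sq_eq (u := 1) (v := -(c + a₃ * t)) ?_ valEq_one.ge ?_⟩
    · have := sq_cube_div_two_add_one (a₁ := 4 * a₃) (by rw [ha]; ring) hb ht
      push_cast at this
      linear_combination this / 4 - hcC / 4
    · exact ((valGE_intCast c).add ((valGE_intCast a₃).mul h1.ge)).neg.mono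
  have hγ : ∀ (t : Ω 2) i, tri ![[], [], [], [2], [0, 2], [0, 0, 2]] t i /
      ((2 : ℕ) : Ω 2) ^ (![0, 0, 0, 2, 2, 2] : Fin 6 → ℕ) i = (![1, t, t ^ 2,
        (t ^ 3 + 2) / 4, t * ((t ^ 3 + 2) / 4), t ^ 2 * ((t ^ 3 + 2) / 4)] : Fin 6 → Ω 2) i := by
    intro t i; fin_cases i <;> simp [tri, Finset.sum_range_succ] <;> ring
  refine rowHolds_single hS (padicValInt_discr_b4 haV hb hb0 (by norm_num) rfl) rfl
    (.of_eq _ hγ ?_) (.of_eq _ hγ ?_) rfl (by decide)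
    (by ext i; fin_cases i <;> simp [family, tri, Finset.sum_range_succ])
  · intro t ht i
    obtain ⟨h1, h2⟩ := hfacts t ht
    fin_cases i
    exacts [valEq_one.ge, h1.ge', h1.ge.pow 2, h2,
      h1.ge.mul h2, (h1.pow 2 rfl).ge.mul h2]
  · intro d hd
    obtain ⟨τ, hτ, hx⟩ := exists_unit_sub_of_trace (F := fun t => (t ^ 3 + 2) / 4)
      (fun t ht => (hfacts t ht).2) (fun r _ _ h3 _ _ => by
        rw [← Finset.sum_div, Finset.sum_add_distrib, h3]
        norm_num
        exact valEq_three_two)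
    refine dvd_of_pairs (fun j => hd _ (hτ j)) ![![0, 3], ![1, 4], ![2, 5]] (by decide) 3 ![0, 1, 2]
      (by decide) (by decide) (fun j => ![1, τ j, τ j ^ 2]) ?_ _ (fun j => (hfacts _ (hτ j)).2) hx ?_
    · intro j c
      have h1 := (hfacts _ (hτ j)).1
      fin_cases c
      exacts [valEq_one.congr (by simp), h1.congr, h1.pow 2]
    · intro j c r
      left
      fin_cases c <;> fin_cases r <;> simp

theorem rowHolds_b4_of_one {a₂ c : ℤ} (hS : IsTrinomialGenerator θ a b) (ha : a = 8 * a₂)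
    (hb : b = 4 * b₀) (hb0 : Odd b₀) (hc : 1 + b₀ = 2 * c) (hc1 : Odd c) :
    RowHolds 2 θ Δ(a,b) {16} 8
      {![1, θ, θ ^ 2, θ ^ 3 / 2, θ ^ 4 / 2, (2 * θ ^ 2 + θ ^ 5) / 2 ^ 2]} := by
  have haV : ValGE (a : Ω 2) 3 := by
    rw [ha, show (8 * a₂ : ℤ) = 4 * (2 * a₂) by ring]; push_cast
    exact valEq_four_two.ge.mul (valEq_two.ge.mul (valGE_intCast a₂) le_rfl)
  have hcC : (1 : Ω 2) + b₀ = 2 * c := by exact_mod_cast congrArg (Int.cast (R := Ω 2)) hc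
  have hfacts : ∀ t : Ω 2, t ^ 6 + a * t + b = 0 →
      ValEq t (1 / 3) ∧ ValEq (t ^ 3 / 2 + 1) (1 / 2) := by
    intro t ht
    have h1 := valEq_root_four (a₁ := 2 * a₂) (by rw [ha]; ring) hb hb0 ht
    have h2 : (t ^ 3 / 2 + 1) ^ 2 = 2 * (t ^ 3 / 2 + 1) + -(2 * (c : Ω 2) + 2 * (a₂ * t)) := by
      rw [sq_cube_div_two_add_one (a₁ := 2 * a₂) (by rw [ha]; ring) hb ht]
      push_cast
      linear_combination -hcC
    have h2c : ValEq (2 * (c : Ω 2)) 1 := valEq_two.mul (valEq_odd hc1)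
    have h2a : ValGE (2 * ((a₂ : Ω 2) * t)) (4 / 3) :=
      valEq_two.ge.mul ((valGE_intCast a₂).mul h1.ge le_rfl)
    have h3 : ValGE (t ^ 3 / 2 + 1) (1 / 2) :=
      valGE_of_sq_eq h2 (valEq_two.ge')
        ((h2c.ge').add (h2a.mono)).neg
    refine ⟨h1, ValEq.of_pow (n := 2) (r := 1) (by norm_num) ?_⟩
    rw [h2, show 2 * (t ^ 3 / 2 + 1) + -(2 * (c : Ω 2) + 2 * (a₂ * t)) =
      -(2 * (c : Ω 2)) + (2 * (t ^ 3 / 2 + 1) - 2 * (a₂ * t)) by ring]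
    exact h2c.neg.add (s := 4 / 3)
      ((valEq_two.ge.mul h3).sub h2a)
  obtain ⟨hI, hM⟩ := families_of_distinct (p := 2) (a := a) (b := b)
    (l := ![[], [], [], [2], [0, 2], [0, 0, 2]]) (k := ![0, 0, 0, 1, 1, 2])
    (fun t => ![1, t, t ^ 2, t ^ 3 / 2 + 1, t * (t ^ 3 / 2 + 1), t ^ 2 * (t ^ 3 / 2 + 1) / 2])
    (by intro t i; fin_cases i <;> simp [tri, Finset.sum_range_succ] <;> ring)
    6 ![0, 2, 4, 3, 5, 1] (by decide) (by decide) (by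
      intro t ht i
      obtain ⟨h1, h2⟩ := hfacts t ht
      have h3 := h1.pow 2 rfl
      fin_cases i
      exacts [valEq_one.congr (by simp), h1.congr, h3.congr,
        h2.congr, h1.mul h2, (h3.mul h2 rfl).div valEq_two])
  refine rowHolds_single' hS (padicValInt_discr_b4 haV hb hb0 (by norm_num) rfl) rfl hI hM
    (l' := ![[], [], [], [], [], [0, 0, 2]]) (.of_eq (fun t => ![1, t, t ^ 2, t ^ 3 / 2,
      t * (t ^ 3 / 2), t ^ 2 * (t ^ 3 / 2 + 1) / 2]) ?_ ?_) rfl (by decide) ?_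
  · intro t i; fin_cases i <;> simp [tri, Finset.sum_range_succ] <;> ring
  · intro t ht i
    obtain ⟨h1, h2⟩ := hfacts t ht
    have h3 := h1.pow 2 rfl
    have hη : ValGE (t ^ 3 / 2) 0 := (h1.pow 3 rfl).ge.div valEq_two
    fin_cases i
    exacts [valEq_one.ge, h1.ge', h3.ge', hη,
      h1.ge.mul hη, ((h3.mul h2 rfl).div valEq_two rfl).ge']
  · ext i; fin_cases i <;> simp [family, tri, Finset.sum_range_succ]

end SlopeThird

end Two


section TwoSlopeTwoThirds

variable {K : Type*} [Field K] [NumberField K] {θ : K} {a b a₁ b₀ : ℤ} {t : Ω 2}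

theorem valEq_sixteen_two : ValEq (16 : Ω 2) 4 := by
  have := valEq_two.pow 4 (t := 4)
  norm_num at this
  exact this

/-- The element `θ³ / 4 + 1`, for a root of valuation `2 / 3`. -/
theorem sq_cube_div_four_add_one (ha : a = 16 * a₁) (hb : b = 16 * b₀)
    (ht : t ^ 6 + a * t + b = 0) :
    (t ^ 3 / 4 + 1) ^ 2 = 2 * (t ^ 3 / 4 + 1) + (-(1 + b₀) - a₁ * t) := by
  rw [ha, hb] at ht
  push_cast at ht
  linear_combination ht / 16

theorem valEq_root_sixteen (ha : a = 16 * a₁) (hb : b = 16 * b₀) (hb0 : Odd b₀)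
    (ht : t ^ 6 + a * t + b = 0) : ValEq t (2 / 3) := by
  refine (valEq_root_of_le (r := 4) (by norm_num) ?_ ?_ ht).congr
  · rw [ha]; push_cast; exact valEq_sixteen_two.ge.mul (valGE_intCast _)
  · rw [hb]; push_cast; exact valEq_sixteen_two.mul (valEq_odd hb0)

theorem padicValInt_discr_b16 {n : ℕ} {s : ℝ} (ha : ValGE (a : Ω 2) s) (hb : b = 16 * b₀)
    (hb0 : Odd b₀) (hs : 26 < 6 * s) (hn : n = 26) :
    padicValInt 2 Δ(a,b) = n := by
  refine padicValInt_of_gt valEq_five_two.ge valEq_six_two ha (r := 4) ?_ (by norm_num; linarith)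
    (by rw [hn]; norm_num)
  rw [hb]; push_cast
  exact valEq_sixteen_two.mul (valEq_odd hb0)

theorem padicValInt_discr_b16_a16 (ha : a = 16 * a₁) (ha1 : Odd a₁) (hb : b = 16 * b₀) :
    padicValInt 2 Δ(a,b) = 24 := by
  refine padicValInt_of_lt valEq_five_two valEq_six_two.ge (s := 4) (r := 4) ?_ ?_
  · rw [ha]; push_cast; exact valEq_sixteen_two.mul (valEq_odd ha1)
  · rw [hb]; push_cast; exact valEq_sixteen_two.ge.mul (valGE_intCast b₀)

/-- If `a / 16` is odd, `s = θ³ / 4 + 1` has valuation `1 / 3`. -/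
theorem valEq_cube_div_four_add_one {c : ℤ} (ha : a = 16 * a₁) (ha1 : Odd a₁) (hb : b = 16 * b₀)
    (hb0 : Odd b₀) (hc : 1 + b₀ = 2 * c) (ht : t ^ 6 + a * t + b = 0) :
    ValEq (t ^ 3 / 4 + 1) (1 / 3) := by
  have hcC : (1 : Ω 2) + b₀ = 2 * c := by
    exact_mod_cast congrArg (Int.cast (R := Ω 2)) hc
  have h1 := valEq_root_sixteen ha hb hb0 ht
  have hη : ValGE (t ^ 3 / 4) 0 := (h1.pow 3 rfl).ge.div valEq_four_two
  refine ValEq.of_pow (n := 2) (r := 2 / 3) (by norm_num) ?_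
  rw [sq_cube_div_four_add_one ha hb ht, hcC, show 2 * (t ^ 3 / 4 + 1) +
    (-(2 * (c : Ω 2)) - a₁ * t) = -(a₁ * t) + 2 * (t ^ 3 / 4 + 1 - c) by ring]
  exact (valEq_two_mul ha1 h1).neg.add (valEq_two.ge.mul ((hη.add valEq_one.ge).sub
    (valGE_intCast c)) (t := 1))

theorem rowHolds_b16_a16_of_three {c : ℤ} (hS : IsTrinomialGenerator θ a b) (ha : a = 16 * a₁)
    (hb : b = 16 * b₀) (ha1 : Odd a₁) (hb0 : Odd b₀) (hc : 1 + b₀ = 4 * c) :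
    RowHolds 2 θ Δ(a,b) {24} 6
      {![1, θ, θ ^ 2 / 2, θ ^ 3 / 2 ^ 2, (4 * θ + θ ^ 4) / 2 ^ 3,
        (4 * θ ^ 2 + θ ^ 5) / 2 ^ 3]} := by
  have hcC : (1 : Ω 2) + b₀ = 4 * c := by
    exact_mod_cast congrArg (Int.cast (R := Ω 2)) hc
  have hfacts : ∀ t : Ω 2, t ^ 6 + a * t + b = 0 →
      ValEq t (2 / 3) ∧ ValGE (t ^ 3 / 4) 0 ∧ ValEq (t * (t ^ 3 / 4 + 1) / 2) 0 ∧
      ValEq (t * (t ^ 3 / 4 + 1) / 2 + 1) (1 / 6) ∧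
      ValEq (t ^ 3 / 4 + 1 + t ^ 2 / 2) (1 / 2) := by
    intro t ht
    have h1 := valEq_root_sixteen ha hb hb0 ht
    have hη : ValEq (t ^ 3 / 4) 0 := (h1.pow 3 rfl).div valEq_four_two
    have h2 := sq_cube_div_four_add_one ha hb ht
    have hs := valEq_cube_div_four_add_one (c := 2 * c) ha ha1 hb hb0 (by rw [hc]; ring) ht
    have hζ : ValEq (t * (t ^ 3 / 4 + 1) / 2) 0 := (h1.mul hs rfl).div valEq_two
    have hκ0 : ValGE (t * (t ^ 3 / 4 + 1) / 2 + 1) 0 := hζ.ge.add valEq_one.ge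
    have hκ : ValEq (t * (t ^ 3 / 4 + 1) / 2 + 1) (1 / 6) := by
      refine ValEq.of_pow (n := 2) (r := 1 / 3) (by norm_num) ?_
      have h6 : (t * (t ^ 3 / 4 + 1) / 2 + 1) ^ 2 = -(a₁ * (t ^ 3 / 4 + 1)) +
          (t * (t * (t ^ 3 / 4 + 1) / 2) + 2 * (t * (t ^ 3 / 4 + 1) / 2 + 1) +
            ((a₁ - 1 : ℤ) : Ω 2) - c * t ^ 2) := by
        push_cast
        linear_combination t ^ 2 / 4 * h2 - t ^ 2 / 4 * hcC
      rw [h6]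
      refine (valEq_two_mul ha1 hs).neg.add (s := 2 / 3) ?_
      refine ValGE.sub (ValGE.add (ValGE.add ?_ ?_) ?_) ?_
      · exact h1.ge.mul hζ.ge
      · exact valEq_two.ge.mul hκ0
      · exact (valGE_even (ha1.sub_odd odd_one)).mono
      · exact (valGE_intCast c).mul (h1.pow 2 rfl).ge
    refine ⟨h1, hη.ge, hζ, hκ, ?_⟩
    refine ValEq.of_mul (y := t) (r := 7 / 6) ?_ h1
    rw [show (t ^ 3 / 4 + 1 + t ^ 2 / 2) * t = 2 * (t * (t ^ 3 / 4 + 1) / 2 + 1 +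
      (t ^ 3 / 4 + 1 - 2)) by ring]
    exact valEq_two.mul (hκ.add (hs.ge.sub (valEq_two.ge')))
  obtain ⟨hI, hM⟩ := families_of_distinct (p := 2) (a := a) (b := b)
    (l := ![[], [], [], [4, 0, 2], [8, 4], [0, 8, 4]]) (k := ![0, 0, 1, 2, 3, 3])
    (fun t => ![1, t, t ^ 2 / 2, t ^ 3 / 4 + 1 + t ^ 2 / 2, t * (t ^ 3 / 4 + 1) / 2 + 1,
      t * (t * (t ^ 3 / 4 + 1) / 2 + 1)])
    (by intro t i; fin_cases i <;> simp [tri, Finset.sum_range_succ] <;> ring)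
    6 ![0, 4, 2, 3, 1, 5] (by decide) (by decide) (by
      intro t ht i
      obtain ⟨h1, -, -, h2, h4⟩ := hfacts t ht
      fin_cases i
      exacts [valEq_one.congr (by simp), h1.congr,
        (h1.pow 2 rfl).div valEq_two, h4.congr, h2.congr,
        h1.mul h2])
  refine rowHolds_single' hS (padicValInt_discr_b16_a16 ha ha1 hb) rfl hI hM
    (l' := ![[], [], [], [], [0, 4], [0, 0, 4]]) (.of_eq (fun t => ![1, t, t ^ 2 / 2, t ^ 3 / 4,
      t * (t ^ 3 / 4 + 1) / 2, t * (t * (t ^ 3 / 4 + 1) / 2)]) ?_ ?_) rfl (by decide) ?_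
  · intro t i; fin_cases i <;> simp [tri, Finset.sum_range_succ] <;> ring
  · intro t ht i
    obtain ⟨h1, h2, h3, -⟩ := hfacts t ht
    fin_cases i
    exacts [valEq_one.ge, h1.ge', ((h1.pow 2 rfl).div valEq_two rfl).ge',
      h2, h3.ge, h1.ge.mul h3.ge]
  · ext i; fin_cases i <;> simp [family, tri, Finset.sum_range_succ]

theorem rowHolds_b16_a16_of_one {c : ℤ} (hS : IsTrinomialGenerator θ a b) (ha : a = 16 * a₁)
    (hb : b = 16 * b₀) (ha1 : Odd a₁) (hb0 : Odd b₀) (hc : 1 + b₀ = 2 * c) (hc1 : Odd c) :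
    RowHolds 2 θ Δ(a,b) {24} 4
      {![1, θ, θ ^ 2 / 2, θ ^ 3 / 2 ^ 2, (4 * θ + θ ^ 4) / 2 ^ 3,
        (8 * θ + 4 * θ ^ 2 + θ ^ 5) / 2 ^ 4]} := by
  have hcC : (1 : Ω 2) + b₀ = 2 * c := by
    exact_mod_cast congrArg (Int.cast (R := Ω 2)) hc
  have hfacts : ∀ t : Ω 2, t ^ 6 + a * t + b = 0 →
      ValEq t (2 / 3) ∧ ValEq (t ^ 3 / 4) 0 ∧ ValEq (t ^ 3 / 4 + 1) (1 / 3) ∧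
      ValGE (t * (t ^ 3 / 4 + 1) / 2) 0 ∧
      ValGE (t / 2 * (t * (t ^ 3 / 4 + 1) / 2 + 1)) 0 := by
    intro t ht
    have h1 := valEq_root_sixteen ha hb hb0 ht
    have hη : ValEq (t ^ 3 / 4) 0 := (h1.pow 3 rfl).div valEq_four_two
    have h2 := sq_cube_div_four_add_one ha hb ht
    have hs := valEq_cube_div_four_add_one ha ha1 hb hb0 hc ht
    have hζ : ValEq (t * (t ^ 3 / 4 + 1) / 2) 0 := (h1.mul hs rfl).div valEq_two
    have hT : ValEq (t / 2) (-1 / 3) := h1.div valEq_two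
    refine ⟨h1, hη, hs, hζ.ge, ?_⟩
    refine valGE_of_sq_eq (u := t - a₁) (v := (t ^ 3 / 4 + 1 - ((1 + c : ℤ) : Ω 2)) *
      (t * (t ^ 3 / 4 + 1) / 2) + ((c + a₁ : ℤ) : Ω 2) * (t / 2) +
      ((a₁ - 1 : ℤ) : Ω 2) * (t / 2) ^ 2) ?_ ?_ ?_
    · push_cast
      linear_combination t ^ 4 / 16 * h2 - t ^ 4 / 16 * hcC
    · exact (h1.ge').sub (valGE_intCast a₁)
    · refine ValGE.add (ValGE.add ?_ ?_) ?_
      · refine ValGE.mul (ValGE.sub (hs.ge' (s := 0)) ?_) hζ.ge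
        exact valGE_intCast _
      · exact (valGE_even (hc1.add_odd ha1)).mul hT.ge
      · exact (valGE_even (ha1.sub_odd odd_one)).mul (hT.pow 2 rfl).ge
  have hbase : IntegralFamily 2 a b ![[], [], [], [4, 4, 2], [8, 4], [0, 8, 4]]
      ![0, 0, 1, 2, 3, 4] ∧ IntegralFamily 2 a b ![[], [], [], [], [0, 4], [0, 8, 4]]
      ![0, 0, 1, 2, 3, 4] := by
    constructor
    · refine .of_eq (fun t => ![1, t, t ^ 2 / 2, t ^ 3 / 4 + 1 + t ^ 2 / 2 + t,
        t * (t ^ 3 / 4 + 1) / 2 + 1, t / 2 * (t * (t ^ 3 / 4 + 1) / 2 + 1)]) ?_ ?_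
      · intro t i; fin_cases i <;> simp [tri, Finset.sum_range_succ] <;> ring
      · intro t ht i
        obtain ⟨h1, h2, h3, h4, h5⟩ := hfacts t ht
        have h6 : ValGE (t ^ 2 / 2) 0 := ((h1.pow 2 rfl).div valEq_two rfl).ge'
        have h7 : ValGE t 0 := h1.ge'
        fin_cases i
        exacts [valEq_one.ge, h7, h6, ((h3.ge').add h6).add h7,
          h4.add valEq_one.ge, h5]
    · refine .of_eq (fun t => ![1, t, t ^ 2 / 2, t ^ 3 / 4,
        t * (t ^ 3 / 4 + 1) / 2, t / 2 * (t * (t ^ 3 / 4 + 1) / 2 + 1)]) ?_ ?_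
      · intro t i; fin_cases i <;> simp [tri, Finset.sum_range_succ] <;> ring
      · intro t ht i
        obtain ⟨h1, h2, h3, h4, h5⟩ := hfacts t ht
        have h6 : ValGE (t ^ 2 / 2) 0 := ((h1.pow 2 rfl).div valEq_two rfl).ge'
        have h7 : ValGE t 0 := h1.ge'
        fin_cases i
        exacts [valEq_one.ge, h7, h6, h2.ge, h4, h5]
  refine rowHolds_single' hS (padicValInt_discr_b16_a16 ha ha1 hb) rfl hbase.1 ?_ hbase.2
    rfl (by decide) ?_
  · refine .of_eq (fun t => ![1, t, t ^ 2 / 2, t ^ 3 / 4 + 1 + t ^ 2 / 2 + t,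
      t * (t ^ 3 / 4 + 1) / 2 + 1, t / 2 * (t * (t ^ 3 / 4 + 1) / 2 + 1)]) ?_ ?_
    · intro t i; fin_cases i <;> simp [tri, Finset.sum_range_succ] <;> ring
    · intro d hd
      obtain ⟨τ, hτ, hx⟩ := exists_unit_sub_of_trace
        (F := fun t => t / 2 * (t * (t ^ 3 / 4 + 1) / 2 + 1))
        (fun t ht => (hfacts t ht).2.2.2.2) (fun r h1 h2 _ _ h5 => by
          have h6 : ∑ i, r i / 2 * (r i * (r i ^ 3 / 4 + 1) / 2 + 1) = ((-5 * a₁ : ℤ) : Ω 2) := by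
            calc _ = ∑ i, (r i ^ 5 / 16 + r i ^ 2 / 4 + r i / 2) :=
                  Finset.sum_congr rfl fun i _ => by ring
              _ = _ := by
                rw [Finset.sum_add_distrib, Finset.sum_add_distrib, ← Finset.sum_div,
                  ← Finset.sum_div, ← Finset.sum_div, h1, h2, h5, ha]
                push_cast
                ring
          rw [h6]
          exact valEq_odd (by simpa using (by decide : Odd (-5 : ℤ)).mul ha1))
      refine dvd_of_pairs (fun j => hd _ (hτ j)) ![![0, 5], ![2, 4], ![1, 3]] (by decide) 3
        ![0, 1, 2] (by decide) (by decide) (fun j => ![1, 2 / τ j, (2 / τ j) ^ 2]) ?_ _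
        (fun j => (hfacts _ (hτ j)).2.2.2.2) hx ?_
      · intro j c
        have h1 := valEq_two.div (hfacts _ (hτ j)).1 rfl
        fin_cases c
        exacts [valEq_one.congr (by simp), h1.congr, h1.pow 2]
      · intro j c r
        obtain ⟨h1, h2, h3, h4, h5⟩ := hfacts _ (hτ j)
        have ht0 := h1.ne_zero
        have hτ1 := valEq_two.div h1 (t := 1 / 3)
        have hs2 : ValGE (τ j ^ 3 / 4 + 1 - 2) (1 / 3) := h3.ge.sub (valEq_two.ge')
        fin_cases c <;> fin_cases r
        · left; simp
        · left; simp
        · refine Or.inr ⟨2 / 3, by norm_num, ?_⟩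
          have : τ j ^ 2 / 2 - 2 / τ j * 1 = 2 / τ j * (τ j ^ 3 / 4 + 1 - 2) := by field_simp; ring
          simp only [Matrix.cons_val_zero, Matrix.cons_val_one, Matrix.cons_val, Fin.zero_eta,
            Fin.mk_one, Fin.isValue]
          rw [this]
          exact hτ1.ge.mul hs2
        · left
          simp
          field_simp
        · refine Or.inr ⟨1, by norm_num, ?_⟩
          have : τ j - (2 / τ j) ^ 2 * 1 = (2 / τ j) ^ 2 * (τ j ^ 3 / 4 + 1 - 2) := by
            field_simp; ring
          simp only [Matrix.cons_val_zero, Matrix.cons_val_one, Matrix.cons_val, Fin.zero_eta,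
            Fin.isValue, Fin.reduceFinMk]
          rw [this]
          exact (hτ1.pow 2 rfl).ge.mul hs2
        · refine Or.inr ⟨1, by norm_num, ?_⟩
          have : τ j ^ 3 / 4 + 1 + τ j ^ 2 / 2 + τ j - (2 / τ j) ^ 2 *
              (τ j / 2 * (τ j * (τ j ^ 3 / 4 + 1) / 2 + 1)) = (2 / τ j) ^ 2 * (τ j ^ 3 / 4 + 1 - 2) +
              (2 / τ j) ^ 3 * (τ j / 2 * (τ j * (τ j ^ 3 / 4 + 1) / 2 + 1)) - 2 * (2 / τ j) := by
            field_simp; ring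
          simp only [Matrix.cons_val_zero, Matrix.cons_val_one, Matrix.cons_val, Fin.mk_one,
            Fin.isValue, Fin.reduceFinMk]
          rw [this]
          exact (((hτ1.pow 2 rfl).ge.mul hs2).add
            ((hτ1.pow 3 rfl).ge.mul h5)).sub (valEq_two.ge.mul hτ1.ge)
  · ext i; fin_cases i <;> simp [family, tri, Finset.sum_range_succ]

theorem rowHolds_b16_a32_of_three {a₂ c : ℤ} (hS : IsTrinomialGenerator θ a b) (ha : a = 32 * a₂)
    (hb : b = 16 * b₀) (ha2 : Odd a₂) (hb0 : Odd b₀) (hc : 1 + b₀ = 4 * c) :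
    RowHolds 2 θ Δ(a,b) {26} 6
      {![1, θ, θ ^ 2 / 2, θ ^ 3 / 2 ^ 2, (4 * θ + θ ^ 4) / 2 ^ 3,
        (4 * θ ^ 2 + θ ^ 5) / 2 ^ 4]} := by
  have ha' : a = 16 * (2 * a₂) := by rw [ha]; ring
  have haV : ValGE (a : Ω 2) 5 := by
    rw [ha']; push_cast
    exact valEq_sixteen_two.ge.mul (valEq_two.ge.mul (valGE_intCast a₂) le_rfl)
  have hcC : (1 : Ω 2) + b₀ = 4 * c := by
    exact_mod_cast congrArg (Int.cast (R := Ω 2)) hc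
  have hfacts : ∀ t : Ω 2, t ^ 6 + a * t + b = 0 →
      ValEq t (2 / 3) ∧ ValEq (t ^ 3 / 4 + 1) (5 / 6) := by
    intro t ht
    have h1 := valEq_root_sixteen ha' hb hb0 ht
    have h2 : (t ^ 3 / 4 + 1) ^ 2 = 2 * (t ^ 3 / 4 + 1) + -(4 * (c : Ω 2) + 2 * (a₂ * t)) := by
      rw [sq_cube_div_four_add_one ha' hb ht]
      push_cast
      linear_combination -hcC
    have h4c : ValGE (4 * (c : Ω 2)) 2 := valEq_four_two.ge.mul (valGE_intCast c)
    have h2a : ValEq (2 * ((a₂ : Ω 2) * t)) (5 / 3) :=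
      valEq_two.mul (valEq_two_mul ha2 h1)
    have h3 : ValGE (t ^ 3 / 4 + 1) (5 / 6) :=
      valGE_of_sq_eq h2 (valEq_two.ge')
        ((h4c.mono).add (h2a.ge')).neg
    refine ⟨h1, ValEq.of_pow (n := 2) (r := 5 / 3) (by norm_num) ?_⟩
    rw [h2, show 2 * (t ^ 3 / 4 + 1) + -(4 * (c : Ω 2) + 2 * (a₂ * t)) =
      -(2 * (a₂ * t)) + (2 * (t ^ 3 / 4 + 1) - 4 * c) by ring]
    exact h2a.neg.add (s := 11 / 6)
      ((valEq_two.ge.mul h3).sub (h4c.mono))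
  obtain ⟨hI, hM⟩ := families_of_distinct (p := 2) (a := a) (b := b)
    (l := ![[], [], [], [4], [0, 4], [0, 0, 4]]) (k := ![0, 0, 1, 2, 3, 4])
    (fun t => ![1, t, t ^ 2 / 2, t ^ 3 / 4 + 1, t * (t ^ 3 / 4 + 1) / 2,
      t ^ 2 * (t ^ 3 / 4 + 1) / 4])
    (by intro t i; fin_cases i <;> simp [tri, Finset.sum_range_succ] <;> ring)
    6 ![0, 4, 2, 5, 3, 1] (by decide) (by decide) (by
      intro t ht i
      obtain ⟨h1, h2⟩ := hfacts t ht
      have h3 := h1.pow 2 rfl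
      fin_cases i
      exacts [valEq_one.congr (by simp), h1.congr, h3.div valEq_two,
        h2.congr, (h1.mul h2 rfl).div valEq_two,
        (h3.mul h2 rfl).div valEq_four_two])
  refine rowHolds_single' hS (padicValInt_discr_b16 haV hb hb0 (by norm_num) rfl) rfl hI hM
    (l' := ![[], [], [], [], [0, 4], [0, 0, 4]]) (.of_eq (fun t => ![1, t, t ^ 2 / 2, t ^ 3 / 4,
      t * (t ^ 3 / 4 + 1) / 2, t ^ 2 * (t ^ 3 / 4 + 1) / 4]) ?_ ?_) rfl (by decide) ?_
  · intro t i; fin_cases i <;> simp [tri, Finset.sum_range_succ] <;> ring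
  · intro t ht i
    obtain ⟨h1, h2⟩ := hfacts t ht
    have h3 := h1.pow 2 rfl
    fin_cases i
    exacts [valEq_one.ge, h1.ge', (h3.div valEq_two rfl).ge',
      ((h1.pow 3 rfl).div valEq_four_two rfl).ge',
      ((h1.mul h2 rfl).div valEq_two rfl).ge',
      ((h3.mul h2 rfl).div valEq_four_two rfl).ge']
  · ext i; fin_cases i <;> simp [family, tri, Finset.sum_range_succ]

theorem rowHolds_b16_a64 {a₃ c : ℤ} (hS : IsTrinomialGenerator θ a b) (ha : a = 64 * a₃)
    (hb : b = 16 * b₀) (hb0 : Odd b₀) (hc : 1 + b₀ = 4 * c) :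
    RowHolds 2 θ Δ(a,b) {26} 4
      {![1, θ, θ ^ 2 / 2, (4 + θ ^ 3) / 2 ^ 3, (4 * θ + θ ^ 4) / 2 ^ 3,
        (4 * θ ^ 2 + θ ^ 5) / 2 ^ 4]} := by
  have ha' : a = 16 * (4 * a₃) := by rw [ha]; ring
  have haV : ValGE (a : Ω 2) 6 := by
    rw [ha']; push_cast
    exact valEq_sixteen_two.ge.mul (valEq_four_two.ge.mul (valGE_intCast a₃) le_rfl)
  have hcC : (1 : Ω 2) + b₀ = 4 * c := by
    exact_mod_cast congrArg (Int.cast (R := Ω 2)) hc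
  have hfacts : ∀ t : Ω 2, t ^ 6 + a * t + b = 0 →
      ValEq t (2 / 3) ∧ ValGE ((t ^ 3 + 4) / 8) 0 := by
    intro t ht
    have h1 := valEq_root_sixteen ha' hb hb0 ht
    refine ⟨h1, valGE_of_sq_eq (u := 1) (v := -(c + a₃ * t)) ?_ valEq_one.ge ?_⟩
    · have := sq_cube_div_four_add_one ha' hb ht
      push_cast at this
      linear_combination this / 4 - hcC / 4
    · exact ((valGE_intCast c).add ((valGE_intCast a₃).mul h1.ge)).neg.mono
  have hγ : ∀ (t : Ω 2) i, tri ![[], [], [], [4], [0, 4], [0, 0, 4]] t i /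
      ((2 : ℕ) : Ω 2) ^ (![0, 0, 1, 3, 3, 4] : Fin 6 → ℕ) i = (![1, t, t ^ 2 / 2,
        (t ^ 3 + 4) / 8, t * ((t ^ 3 + 4) / 8), t ^ 2 / 2 * ((t ^ 3 + 4) / 8)] :
          Fin 6 → Ω 2) i := by
    intro t i; fin_cases i <;> simp [tri, Finset.sum_range_succ] <;> ring
  refine rowHolds_single hS (padicValInt_discr_b16 haV hb hb0 (by norm_num) rfl) rfl
    (.of_eq _ hγ ?_) (.of_eq _ hγ ?_) rfl (by decide)
    (by ext i; fin_cases i <;> simp [family, tri, Finset.sum_range_succ])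
  · intro t ht i
    obtain ⟨h1, h2⟩ := hfacts t ht
    have h3 := (h1.pow 2 rfl).div valEq_two rfl
    fin_cases i
    exacts [valEq_one.ge, h1.ge', h3.ge', h2,
      h1.ge.mul h2, h3.ge.mul h2]
  · intro d hd
    obtain ⟨τ, hτ, hx⟩ := exists_unit_sub_of_trace (F := fun t => (t ^ 3 + 4) / 8)
      (fun t ht => (hfacts t ht).2) (fun r _ _ h3 _ _ => by
        rw [← Finset.sum_div, Finset.sum_add_distrib, h3]
        norm_num
        exact valEq_three_two)
    refine dvd_of_pairs (fun j => hd _ (hτ j)) ![![0, 3], ![1, 4], ![2, 5]] (by decide) 3 ![0, 2, 1]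
      (by decide) (by decide) (fun j => ![1, τ j, τ j ^ 2 / 2]) ?_ _ (fun j => (hfacts _ (hτ j)).2)
      hx ?_
    · intro j c
      have h1 := (hfacts _ (hτ j)).1
      fin_cases c
      exacts [valEq_one.congr (by simp), h1.congr,
        (h1.pow 2 rfl).div valEq_two]
    · intro j c r
      left
      fin_cases c <;> fin_cases r <;> simp

theorem rowHolds_b16_a32_of_one {a₂ c : ℤ} (hS : IsTrinomialGenerator θ a b) (ha : a = 32 * a₂)
    (hb : b = 16 * b₀) (hb0 : Odd b₀) (hc : 1 + b₀ = 2 * c) (hc1 : Odd c) :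
    RowHolds 2 θ Δ(a,b) {26} 8
      {![1, θ, θ ^ 2 / 2, θ ^ 3 / 2 ^ 2, (4 * θ + θ ^ 4) / 2 ^ 3, θ ^ 5 / 2 ^ 3]} := by
  have ha' : a = 16 * (2 * a₂) := by rw [ha]; ring
  have haV : ValGE (a : Ω 2) 5 := by
    rw [ha']; push_cast
    exact valEq_sixteen_two.ge.mul (valEq_two.ge.mul (valGE_intCast a₂) le_rfl)
  have hcC : (1 : Ω 2) + b₀ = 2 * c := by
    exact_mod_cast congrArg (Int.cast (R := Ω 2)) hc
  have hfacts : ∀ t : Ω 2, t ^ 6 + a * t + b = 0 →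
      ValEq t (2 / 3) ∧ ValEq (t ^ 3 / 4 + 1) (1 / 2) := by
    intro t ht
    have h1 := valEq_root_sixteen ha' hb hb0 ht
    have h2 : (t ^ 3 / 4 + 1) ^ 2 = 2 * (t ^ 3 / 4 + 1) + -(2 * (c : Ω 2) + 2 * (a₂ * t)) := by
      rw [sq_cube_div_four_add_one ha' hb ht]
      push_cast
      linear_combination -hcC
    have h2c : ValEq (2 * (c : Ω 2)) 1 := valEq_two.mul (valEq_odd hc1)
    have h2a : ValGE (2 * ((a₂ : Ω 2) * t)) (5 / 3) :=
      valEq_two.ge.mul ((valGE_intCast a₂).mul h1.ge le_rfl)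
    have h3 : ValGE (t ^ 3 / 4 + 1) (1 / 2) :=
      valGE_of_sq_eq h2 (valEq_two.ge')
        ((h2c.ge').add (h2a.mono)).neg
    refine ⟨h1, ValEq.of_pow (n := 2) (r := 1) (by norm_num) ?_⟩
    rw [h2, show 2 * (t ^ 3 / 4 + 1) + -(2 * (c : Ω 2) + 2 * (a₂ * t)) =
      -(2 * (c : Ω 2)) + (2 * (t ^ 3 / 4 + 1) - 2 * (a₂ * t)) by ring]
    exact h2c.neg.add (s := 3 / 2)
      ((valEq_two.ge.mul h3).sub (h2a.mono))
  obtain ⟨hI, hM⟩ := families_of_distinct (p := 2) (a := a) (b := b)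
    (l := ![[], [], [], [4], [0, 4], [0, 0, 4]]) (k := ![0, 0, 1, 2, 3, 3])
    (fun t => ![1, t, t ^ 2 / 2, t ^ 3 / 4 + 1, t * (t ^ 3 / 4 + 1) / 2,
      t ^ 2 * (t ^ 3 / 4 + 1) / 2])
    (by intro t i; fin_cases i <;> simp [tri, Finset.sum_range_succ] <;> ring)
    6 ![0, 4, 2, 3, 1, 5] (by decide) (by decide) (by
      intro t ht i
      obtain ⟨h1, h2⟩ := hfacts t ht
      have h3 := h1.pow 2 rfl
      fin_cases i
      exacts [valEq_one.congr (by simp), h1.congr, h3.div valEq_two,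
        h2.congr, (h1.mul h2 rfl).div valEq_two,
        (h3.mul h2 rfl).div valEq_two])
  refine rowHolds_single' hS (padicValInt_discr_b16 haV hb hb0 (by norm_num) rfl) rfl hI hM
    (l' := ![[], [], [], [], [0, 4], []]) (.of_eq (fun t => ![1, t, t ^ 2 / 2, t ^ 3 / 4,
      t * (t ^ 3 / 4 + 1) / 2, t ^ 5 / 8]) ?_ ?_) rfl (by decide) ?_
  · intro t i; fin_cases i <;> simp [tri, Finset.sum_range_succ] <;> ring
  · intro t ht i
    obtain ⟨h1, h2⟩ := hfacts t ht
    have h8 : ValEq (8 : Ω 2) 3 := by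
      have := valEq_two.pow 3 (t := 3)
      norm_num at this
      exact this
    fin_cases i
    exacts [valEq_one.ge, h1.ge', ((h1.pow 2 rfl).div valEq_two rfl).ge',
      ((h1.pow 3 rfl).div valEq_four_two rfl).ge',
      ((h1.mul h2 rfl).div valEq_two rfl).ge',
      ((h1.pow 5 rfl).div h8 rfl).ge']
  · ext i; fin_cases i <;> simp [family, tri, Finset.sum_range_succ]

end TwoSlopeTwoThirds


section UnitConstant

variable {p : ℕ} [hp : Fact p.Prime] {a b : ℤ}

theorem valEq_root_of_unit (hb : ValEq (b : Ω p) 0) {t : Ω p}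
    (ht : t ^ 6 + a * t + b = 0) : ValEq t 0 := by
  have h0 : t ≠ 0 := by
    rintro rfl
    exact hb.ne_zero (by simpa using ht)
  obtain ⟨w, hw⟩ := exists_valEq h0
  have hw0 : 0 ≤ w := hw.le_of_ge (root_valGE ht)
  rcases hw0.eq_or_lt with rfl | hpos
  · exact hw
  · exfalso
    refine hb.false_of_add_eq_zero (y := t ^ 6 + (a : Ω p) * t) (s := w) ?_ hpos
      (by rw [add_comm]; exact ht)
    exact ((hw.pow 6 rfl).ge' (by push_cast; linarith)).add
      ((valGE_intCast a).mul hw.ge (by linarith))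

/-- A unit at which the trinomial is not a unit is congruent to a root, if `b` is a unit. -/
theorem exists_root_congr (hb : ValEq (b : Ω p) 0) {ξ : Ω p} (hξ : ValEq ξ 0) {s : ℝ}
    (hs : 0 < s) (h : ValGE (ξ ^ 6 + (a : Ω p) * ξ + (b : Ω p)) s) :
    ∃ t : Ω p, t ^ 6 + a * t + b = 0 ∧ ∃ c, 0 < c ∧ ValGE (t - ξ) c :=
  exists_root_near (ξ' := 0) h (r := 0) (by simpa using hb) hs (by rw [zero_sub]; exact hξ.neg)

theorem padicValInt_eq_of_mul {n m : ℤ} {k : ℕ} (h : n = (p : ℤ) ^ k * m) (hm : ¬ (p : ℤ) ∣ m) :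
    padicValInt p n = k := by
  refine padicValInt_eq_of_valEq ?_
  rw [h]; push_cast
  exact (valEq_prime_pow k).mul (valEq_intCast hm) (by simp)

end UnitConstant

section TwoUnit

variable {K : Type*} [Field K] [NumberField K] {θ : K} {a b A c : ℤ}

theorem valEq_cube_add_one (ha : a = 2 * A) (hb : b = 1 - 2 * c) (hAc : Odd (A + c + 1))
    {t : Ω 2} (ht : t ^ 6 + a * t + b = 0) : ValEq (t ^ 3 + 1) (1 / 2) := by
  have hbV : ValEq (b : Ω 2) 0 := valEq_odd (by rw [hb]; exact odd_one.sub_even ⟨c, by ring⟩)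
  have h0 := valEq_root_of_unit hbV ht
  have h1 : (t ^ 3 + 1) ^ 2 = 2 * ((t ^ 3 + 1) + ((c - 1 : ℤ) - A * t)) := by
    rw [ha, hb] at ht
    push_cast at ht ⊢
    linear_combination ht
  have h2 : ValGE (t ^ 3 + 1) (1 / 2) := by
    refine ValGE.of_pow (n := 2) (r := 1) (by norm_num) ?_
    rw [h1]
    exact valEq_two.ge.mul (((h0.pow 3 (t := 0)).ge.add valEq_one.ge).add
      ((valGE_intCast _).sub ((valGE_intCast A).mul h0.ge)))
  have h3 : ValEq (((c - 1 : ℤ) : Ω 2) - (A : Ω 2) * t) 0 := by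
    rcases Int.even_or_odd A with hA | hA
    · have hc : Odd (c - 1) := by
        have := hAc.sub_even (hA.add (⟨1, rfl⟩ : Even (2 : ℤ)))
        rwa [show A + c + 1 - (A + 2) = c - 1 by ring] at this
      rw [sub_eq_add_neg]
      exact (valEq_odd hc).add ((valGE_even hA).mul h0.ge (t := 1)).neg one_pos
    · have hc : Even (c - 1) := by
        have := hAc.sub_odd (hA.add_even (⟨1, rfl⟩ : Even (2 : ℤ)))
        rwa [show A + c + 1 - (A + 2) = c - 1 by ring] at this
      rw [sub_eq_neg_add]
      exact (valEq_two_mul hA h0).neg.add (valGE_even hc) one_pos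
  refine ValEq.of_pow (n := 2) (r := 1) (by norm_num) ?_
  rw [h1, add_comm (t ^ 3 + 1)]
  exact valEq_two.mul (h3.add h2)

theorem rowHolds_two_unit {n : ℕ} (hS : IsTrinomialGenerator θ a b) (ha : a = 2 * A)
    (hb : b = 1 - 2 * c) (hAc : Odd (A + c + 1))
    (hD : padicValInt 2 Δ(a,b) = n) :
    RowHolds 2 θ Δ(a,b) {n} n
      {![1, θ, θ ^ 2, θ ^ 3, θ ^ 4, θ ^ 5]} := by
  have hbV : ValEq (b : Ω 2) 0 := valEq_odd (by rw [hb]; exact odd_one.sub_even ⟨c, by ring⟩)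
  have hγ : ∀ (t : Ω 2) i, tri ![[], [], [], [1], [0, 1], [0, 0, 1]] t i /
      ((2 : ℕ) : Ω 2) ^ (0 : ℕ) = (![1, t, t ^ 2,
        t ^ 3 + 1, t * (t ^ 3 + 1), t ^ 2 * (t ^ 3 + 1)] : Fin 6 → Ω 2) i := by
    intro t i; fin_cases i <;> simp [tri, Finset.sum_range_succ] <;> ring
  refine rowHolds_single' hS (k := fun _ => 0) hD (by simp) (.of_eq _ hγ ?_) (.of_eq _ hγ ?_)
    integralFamily_zero rfl (fun _ _ _ => le_rfl)
    (by ext i; fin_cases i <;> simp [family, tri])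
  · intro t ht i
    have h1 := valEq_root_of_unit hbV ht
    have h2 := h1.pow 2 (t := 0)
    have h3 := valEq_cube_add_one ha hb hAc ht
    fin_cases i
    exacts [valEq_one.ge, h1.ge, h2.ge, h3.ge', h1.ge.mul h3.ge,
      h2.ge.mul h3.ge]
  · intro d hd
    obtain ⟨ω, hω, hω0, hω1⟩ := exists_cube_root_of_unity valEq_three_two
    have hω3 : ω ^ 3 = 1 := by linear_combination (ω - 1) * hω
    have key : ∀ ξ : Ω 2, ValEq ξ 0 → ξ ^ 3 = 1 → ∃ t : Ω 2, t ^ 6 + a * t + b = 0 ∧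
        ∃ c, 0 < c ∧ ValGE (t - ξ) c := by
      intro ξ hξ hξ3
      refine exists_root_congr hbV hξ one_pos ?_
      have : ξ ^ 6 + (a : Ω 2) * ξ + (b : Ω 2) = 2 * (1 - c + A * ξ) := by
        rw [ha, hb]; push_cast; linear_combination (ξ ^ 3 + 1) * hξ3
      rw [this]
      exact valEq_two.ge.mul ((valEq_one.ge.sub (valGE_intCast c)).add
        ((valGE_intCast A).mul hξ.ge (t := 0)))
    obtain ⟨t1, ht1, c1, hc1, h1⟩ := key 1 valEq_one (by norm_num)
    obtain ⟨t2, ht2, c2, hc2, h2⟩ := key ω hω0 hω3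
    obtain ⟨t3, ht3, c3, hc3, h3⟩ := key (ω ^ 2) (hω0.pow 2)
      (by linear_combination (ω ^ 3 + 1) * hω3)
    have hdiff : ∀ (x y ξ ξ' : Ω 2) (c c' : ℝ), 0 < c → 0 < c' →
        ValGE (x - ξ) c → ValGE (y - ξ') c' → ValEq (ξ - ξ') 0 → ValEq (x - y) 0 := by
      intro x y ξ ξ' c c' hc hc' hx hy h
      have h4 := h.add ((hx.mono (min_le_left c c')).sub (hy.mono (min_le_right c c')))
        (lt_min hc hc')
      convert h4 using 1; ring
    have hτ : ∀ j, (![t1, t2, t3] : Fin 3 → Ω 2) j ^ 6 +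
        a * (![t1, t2, t3] : Fin 3 → Ω 2) j + b = 0 := by
      intro j; fin_cases j
      exacts [ht1, ht2, ht3]
    refine dvd_of_triples (fun j => hd _ (hτ j)) ![![0, 1, 2], ![3, 4, 5]] (by decide) 2 ![0, 1]
      (by decide) (by decide) (fun j => ![1, (![t1, t2, t3] : Fin 3 → Ω 2) j ^ 3 + 1]) ?_
      ![t1, t2, t3] (fun j => (valEq_root_of_unit hbV (hτ j)).ge) ?_ ?_ ?_ ?_
    · intro j i
      have h4 := valEq_cube_add_one ha hb hAc (hτ j)
      fin_cases i
      exacts [valEq_one.congr (by simp), h4.congr]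
    · exact hdiff t1 t2 _ _ _ _ hc1 hc2 h1 h2 (by simpa using hω1.neg)
    · refine hdiff t1 t3 _ _ _ _ hc1 hc3 h1 h3 ?_
      rw [show 1 - ω ^ 2 = (ω - 1) * ω ^ 2 by linear_combination -(ω - 1) * hω]
      exact hω1.mul (hω0.pow 2 rfl)
    · refine hdiff t2 t3 _ _ _ _ hc2 hc3 h2 h3 ?_
      rw [show ω - ω ^ 2 = -((ω - 1) * ω) by ring]
      exact (hω1.mul hω0).neg
    · intro j i r
      left
      fin_cases i <;> fin_cases r <;> simp <;> ring

theorem rowHolds_two_half_cube {A c : ℤ} (hS : IsTrinomialGenerator θ a b) (ha : a = 4 * A)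
    (hb : b = 4 * c - 1) :
    RowHolds 2 θ Δ(a,b) {6} 0
      {![1, θ, θ ^ 2, (1 + θ ^ 3) / 2, (θ + θ ^ 4) / 2, (θ ^ 2 + θ ^ 5) / 2]} := by
  have hbV : ValEq (b : Ω 2) 0 :=
    valEq_odd (by rw [hb]; exact Even.sub_odd ⟨2 * c, by ring⟩ odd_one)
  have haV : ValGE (a : Ω 2) 2 := by
    rw [ha]; push_cast; exact valEq_four_two.ge.mul (valGE_intCast A)
  have hD : padicValInt 2 Δ(a,b) = 6 :=
    padicValInt_of_gt valEq_five_two.ge valEq_six_two haV hbV (by norm_num)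
  refine rowHolds_of_le_one hS (k := ![0, 0, 0, 1, 1, 1]) (by norm_num) hD (by rw [hD]; rfl)
    ⟨_, rfl⟩ rfl (by decide) ?_
  rintro _ rfl
  refine ⟨![[], [], [], [1], [0, 1], [0, 0, 1]], .of_eq (fun t => ![1, t, t ^ 2, (t ^ 3 + 1) / 2,
    t * ((t ^ 3 + 1) / 2), t ^ 2 * ((t ^ 3 + 1) / 2)]) ?_ ?_,
    by ext i; fin_cases i <;> simp [family, tri, Finset.sum_range_succ]⟩
  · intro t i; fin_cases i <;> simp [tri, Finset.sum_range_succ] <;> ring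
  · intro t ht i
    have h1 := (valEq_root_of_unit hbV ht).ge
    have h2 := h1.pow 2 (t := 0)
    have h3 : ValGE ((t ^ 3 + 1) / 2) 0 := by
      refine valGE_of_sq_eq (u := 1) (v := -(A * t + c)) ?_ valEq_one.ge ?_
      · rw [ha, hb] at ht
        push_cast at ht
        linear_combination ht / 4
      · exact (((valGE_intCast A).mul h1).add
          ((valGE_intCast c).mono)).neg
    fin_cases i
    exacts [valEq_one.ge, h1, h2, h3, h1.mul h3, h2.mul h3]

end TwoUnit


/-- The quotient of `f (x + z) - f x - f' x * z` by `z ^ 2`, for a sextic trinomial `f`. -/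
def quartic {R : Type*} [CommRing R] (x z : R) : R :=
  15 * x ^ 4 + 20 * x ^ 3 * z + 15 * x ^ 2 * z ^ 2 + 6 * x * z ^ 3 + z ^ 4

/-- The numerator of `lastElt`. -/
def lastNum {R : Type*} [CommRing R] (x t : R) : R :=
  -5 * x ^ 5 + x ^ 4 * t + x ^ 3 * t ^ 2 + x ^ 2 * t ^ 3 + x * t ^ 4 + t ^ 5

/-- Coefficient lists of `1, θ, θ ^ 2, θ ^ 3, θ ^ 4` and the numerator of `lastElt`. -/
def lastList (x : ℤ) : Fin 6 → List ℤ :=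
  ![[], [], [], [], [], [-5 * x ^ 5, x ^ 4, x ^ 3, x ^ 2, x]]

theorem exists_dvd_mul_add {p : ℕ} [hp : Fact p.Prime] {u : ℤ} (hu : ¬ (p : ℤ) ∣ u) (c : ℤ)
    (N : ℕ) : ∃ x : ℤ, (p : ℤ) ^ N ∣ u * x + c := by
  obtain ⟨v, w, h⟩ : IsCoprime u ((p : ℤ) ^ N) :=
    (((Nat.prime_iff_prime_int.mp hp.out).coprime_iff_not_dvd.mpr hu).symm).pow_right
  refine ⟨-(c * v), w * c, ?_⟩
  linear_combination -c * h

theorem family_last {K : Type*} [Field K] {p k : ℕ} (θ : K) (x : ℤ) :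
    ![1, θ, θ ^ 2, θ ^ 3, θ ^ 4, lastElt p θ x k] =
      family p θ (lastList x) ![0, 0, 0, 0, 0, k] := by
  ext i; fin_cases i <;> simp [family, tri, lastList, lastElt, Finset.sum_range_succ]

section

variable {p : ℕ} [hp : Fact p.Prime]

section Field

variable {x t a b : Ω p}

theorem sub_mul_lastNum (ht : t ^ 6 + a * t + b = 0) :
    (t - x) * (lastNum x t + (6 * x ^ 5 + a)) = -(x ^ 6 + a * x + b) := by
  unfold lastNum; linear_combination ht

theorem lastNum_eq : lastNum x t = (t - x) * quartic x (t - x) := by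
  unfold lastNum quartic; ring

theorem lastNum_sq (ht : t ^ 6 + a * t + b = 0) :
    lastNum x t ^ 2 = -(6 * x ^ 5 + a) * lastNum x t +
      -((x ^ 6 + a * x + b) * quartic x (t - x)) := by
  linear_combination quartic x (t - x) * sub_mul_lastNum (x := x) ht + (lastNum x t +
    (6 * x ^ 5 + a)) * lastNum_eq (x := x) (t := t)

theorem lastNum_add_sq (ht : t ^ 6 + a * t + b = 0) :
    (lastNum x t + (6 * x ^ 5 + a)) ^ 2 = (6 * x ^ 5 + a) * (lastNum x t + (6 * x ^ 5 + a)) +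
      -((x ^ 6 + a * x + b) * quartic x (t - x)) := by
  linear_combination lastNum_sq (x := x) ht

theorem lastNum_valGE {k : ℝ} (ht : t ^ 6 + a * t + b = 0) (hd : ValGE (6 * x ^ 5 + a) k)
    (hv : ValGE ((x ^ 6 + a * x + b) * quartic x (t - x)) (2 * k)) : ValGE (lastNum x t) k :=
  valGE_of_sq_eq (lastNum_sq ht) hd.neg hv.neg

theorem lastNum_add_valGE {s c : ℝ} (ht : t ^ 6 + a * t + b = 0)
    (hv : ValGE (x ^ 6 + a * x + b) s) (hz : ValEq (t - x) c) :
    ValGE (lastNum x t + (6 * x ^ 5 + a)) (s - c) := by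
  refine ValGE.of_mul (x := lastNum x t + (6 * x ^ 5 + a)) (y := t - x) (r := s) ?_ hz le_rfl
  rw [mul_comm, sub_mul_lastNum ht]
  exact hv.neg

theorem quartic_valGE (hx : ValGE x 0) (hz : ValGE t 0) : ValGE (quartic x t) 0 := by
  have h (n : ℕ) : ValGE (x ^ n) 0 := hx.pow n (by simp)
  have h' (n : ℕ) : ValGE (t ^ n) 0 := hz.pow n (by simp)
  unfold quartic
  exact (((((valGE_ofNat 15).mul (h 4) (t := 0)).add
    (((valGE_ofNat 20).mul (h 3) (t := 0)).mul hz)).add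
    (((valGE_ofNat 15).mul (h 2) (t := 0)).mul (h' 2))).add
    (((valGE_ofNat 6).mul hx (t := 0)).mul (h' 3))).add (h' 4)

theorem deriv_formula (x a b : Ω p) :
    (6 * x ^ 5 + a) * (5 * a) ^ 5 = Δ(a,b) +
      6 * ((5 * a * x + 6 * b) * (5 * (6 * b) ^ 4 - 10 * (6 * b) ^ 3 * (5 * a * x + 6 * b) +
        10 * (6 * b) ^ 2 * (5 * a * x + 6 * b) ^ 2 - 5 * (6 * b) * (5 * a * x + 6 * b) ^ 3 +
        (5 * a * x + 6 * b) ^ 4)) := by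
  ring

theorem value_formula (x a b : Ω p) :
    (x ^ 6 + a * x + b) * (5 * a) ^ 6 =
      Δ(a,b) * (5 * a * x + 5 * b) +
      (5 * a * x + 6 * b) ^ 2 * (15 * (6 * b) ^ 4 - 20 * (6 * b) ^ 3 * (5 * a * x + 6 * b) +
        15 * (6 * b) ^ 2 * (5 * a * x + 6 * b) ^ 2 - 6 * (6 * b) * (5 * a * x + 6 * b) ^ 3 +
        (5 * a * x + 6 * b) ^ 4) := by
  ring

variable {α e d β : ℝ}

theorem form_valGE {u v : Ω p} (hu : ValGE u α) (hv : ValGE v α) (c₀ c₁ c₂ c₃ : ℕ) :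
    ValGE ((c₀ : Ω p) * u ^ 4 - (c₁ : Ω p) * u ^ 3 * v +
      (c₂ : Ω p) * u ^ 2 * v ^ 2 - (c₃ : Ω p) * u * v ^ 3 + v ^ 4)
      (4 * α) := by
  have h (n : ℕ) : ValGE (u ^ n) (n * α) := hu.pow n le_rfl
  have h' (n : ℕ) : ValGE (v ^ n) (n * α) := hv.pow n le_rfl
  have h4 := (((valGE_natCast c₀).mul (h 4) (t := 4 * α) (by push_cast; linarith)).sub
    (((valGE_natCast c₁).mul (h 3) (t := 3 * α) (by push_cast; linarith)).mul hv (by linarith)))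
  have h2 := ((valGE_natCast c₂).mul (h 2) (t := 2 * α) (by push_cast; linarith)).mul (h' 2)
    (t := 4 * α) (by push_cast; linarith)
  have h1 := ((valGE_natCast c₃).mul hu (t := α) (by linarith)).mul (h' 3) (t := 4 * α)
    (by push_cast; linarith)
  exact ((h4.add h2).sub h1).add ((h' 4).mono (by push_cast; linarith))

theorem deriv_error_valGE (hb : ValGE (6 * b) α) (he : ValGE (5 * a * x + 6 * b) e) (hαe : α ≤ e) :
    ValGE (6 * ((5 * a * x + 6 * b) * (5 * (6 * b) ^ 4 - 10 * (6 * b) ^ 3 * (5 * a * x + 6 * b) +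
        10 * (6 * b) ^ 2 * (5 * a * x + 6 * b) ^ 2 - 5 * (6 * b) * (5 * a * x + 6 * b) ^ 3 +
        (5 * a * x + 6 * b) ^ 4))) (e + 4 * α) := by
  have h := form_valGE hb (he.mono hαe) 5 10 10 5
  push_cast at h
  exact (valGE_ofNat 6).mul (he.mul h le_rfl) (by linarith)

theorem value_error_valGE (hb : ValGE (6 * b) α) (he : ValGE (5 * a * x + 6 * b) e) (hαe : α ≤ e) :
    ValGE ((5 * a * x + 6 * b) ^ 2 * (15 * (6 * b) ^ 4 - 20 * (6 * b) ^ 3 * (5 * a * x + 6 * b) +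
        15 * (6 * b) ^ 2 * (5 * a * x + 6 * b) ^ 2 - 6 * (6 * b) * (5 * a * x + 6 * b) ^ 3 +
        (5 * a * x + 6 * b) ^ 4)) (2 * e + 4 * α) := by
  have h := form_valGE hb (he.mono hαe) 15 20 15 6
  push_cast at h
  exact (he.pow 2 le_rfl).mul h (by push_cast; linarith)

theorem deriv_valGE {s : ℝ} (ha : ValEq (5 * a) α) (hb : ValGE (6 * b) α)
    (he : ValGE (5 * a * x + 6 * b) e) (hαe : α ≤ e)
    (hD : ValGE Δ(a,b) d) (h1 : s + 5 * α ≤ d) (h2 : s + α ≤ e) :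
    ValGE (6 * x ^ 5 + a) s := by
  refine ValGE.of_mul (y := (5 * a) ^ 5) (r := s + 5 * α) ?_ (ha.pow 5 rfl) (by push_cast; linarith)
  rw [deriv_formula x a b]
  exact (hD.mono h1).add ((deriv_error_valGE hb he hαe).mono (by linarith))

theorem value_valGE {s : ℝ} (ha : ValEq (5 * a) α) (hb : ValGE (6 * b) α) (hβ : ValGE b β)
    (he : ValGE (5 * a * x + 6 * b) e) (hαe : α ≤ e) (hβe : β ≤ e)
    (hD : ValGE Δ(a,b) d) (h1 : s + 6 * α ≤ d + β)
    (h2 : s + 2 * α ≤ 2 * e) : ValGE (x ^ 6 + a * x + b) s := by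
  refine ValGE.of_mul (y := (5 * a) ^ 6) (r := s + 6 * α) ?_ (ha.pow 6 rfl) (by push_cast; linarith)
  rw [value_formula x a b]
  refine (hD.mul (s := β) ?_ h1).add ((value_error_valGE hb he hαe).mono (by linarith))
  rw [show 5 * a * x + 5 * b = 5 * a * x + 6 * b - b by ring]
  exact (he.mono hβe).sub hβ

theorem deriv_valEq (ha : ValEq (5 * a) α) (hb : ValGE (6 * b) α)
    (he : ValGE (5 * a * x + 6 * b) e) (hαe : α ≤ e)
    (hD : ValEq Δ(a,b) d) (hde : d < e + 4 * α) :
    ValEq (6 * x ^ 5 + a) (d - 5 * α) := by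
  refine ValEq.of_mul (y := (5 * a) ^ 5) (r := d) ?_ (ha.pow 5 rfl) (by push_cast; linarith)
  rw [deriv_formula x a b]
  exact hD.add (deriv_error_valGE hb he hαe) hde

theorem value_valEq (ha : ValEq (5 * a) α) (hb : ValGE (6 * b) α) (hβ : ValEq b β)
    (he : ValGE (5 * a * x + 6 * b) e) (hαe : α ≤ e) (hβe : β < e)
    (hD : ValEq Δ(a,b) d) (hde : d + β < 2 * e + 4 * α) :
    ValEq (x ^ 6 + a * x + b) (d + β - 6 * α) := by
  refine ValEq.of_mul (y := (5 * a) ^ 6) (r := d + β) ?_ (ha.pow 6 rfl) (by push_cast; linarith)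
  rw [value_formula x a b]
  refine (hD.mul (s := β) ?_ rfl).add (value_error_valGE hb he hαe) hde
  rw [show 5 * a * x + 5 * b = -b + (5 * a * x + 6 * b) by ring]
  exact hβ.neg.add he hβe

end Field

section Integer

variable {a b : ℤ} {k : ℕ}

theorem integralFamily_of_last {c₀ c₁ c₂ c₃ c₄ : ℤ}
    (h : ∀ t : Ω p, t ^ 6 + a * t + b = 0 → ValGE ((c₀ : Ω p) +
      (c₁ : Ω p) * t + (c₂ : Ω p) * t ^ 2 + (c₃ : Ω p) * t ^ 3 +
      (c₄ : Ω p) * t ^ 4 + t ^ 5) k) :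
    IntegralFamily p a b ![[], [], [], [], [], [c₀, c₁, c₂, c₃, c₄]] ![0, 0, 0, 0, 0, k] := by
  intro t ht i
  have h0 := root_valGE ht
  fin_cases i
  · simpa [tri] using valEq_one.ge
  · simpa [tri] using h0
  · simpa [tri, Finset.sum_range_succ] using h0.pow 2 (t := 0)
  · simpa [tri, Finset.sum_range_succ] using h0.pow 3 (t := 0)
  · simpa [tri, Finset.sum_range_succ] using h0.pow 4 (t := 0)
  · simpa [tri, Finset.sum_range_succ] using h t ht

theorem integralFamily_last {x : ℤ} (h : ∀ t : Ω p, t ^ 6 + a * t + b = 0 →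
    ValGE (lastNum (x : Ω p) t) k) :
    IntegralFamily p a b (lastList x) ![0, 0, 0, 0, 0, k] := by
  refine integralFamily_of_last fun t ht => ?_
  convert h t ht using 1
  unfold lastNum
  push_cast
  ring

theorem monotone_last (k : ℕ) : Monotone (![0, 0, 0, 0, 0, k] : Fin 6 → ℕ) := by
  refine Fin.monotone_iff_le_succ.mpr fun i => ?_
  fin_cases i <;> simp

theorem modEq_cast_valGE {m n : ℤ} (h : m ≡ n [ZMOD (p : ℤ) ^ k]) :
    ValGE ((m : Ω p) - (n : Ω p)) k := by
  have := valGE_of_dvd (p := p) h.symm.dvd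
  push_cast at this
  exact this

theorem cast_discr_valEq {d : ℕ} (hD0 : Δ(a,b) ≠ 0)
    (hD : padicValInt p Δ(a,b) = d) :
    ValEq (5 ^ 5 * (a : Ω p) ^ 6 - 6 ^ 6 * (b : Ω p) ^ 5) d := by
  have := valEq_padicValInt (p := p) hD0
  rw [hD] at this
  convert this using 1
  push_cast
  ring

end Integer

section General

variable {K : Type*} [Field K] [NumberField K] {θ : K} {a b : ℤ}

theorem rowHolds_generalBases (hS : IsTrinomialGenerator θ a b) (hp5 : 5 < p)
    (ha : ¬ (p : ℤ) ∣ a) {m e : ℕ} (he : e ≤ 1) {vD : Set ℕ}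
    (hvD : padicValInt p Δ(a,b) ∈ vD)
    (hD : padicValInt p Δ(a,b) = e + 2 * m) :
    RowHolds p θ Δ(a,b) vD e (generalBases p a b θ m) := by
  have hpp := Nat.prime_iff_prime_int.mp hp.out
  have h5 : ¬ (p : ℤ) ∣ 5 := fun h => by
    have := Int.le_of_dvd (by norm_num) h; omega
  have h6 : ¬ (p : ℤ) ∣ 6 := fun h => by
    have h6 := Int.le_of_dvd (by norm_num) h
    obtain rfl : p = 6 := by omega
    exact absurd hp.out (by norm_num)
  have h5a : ¬ (p : ℤ) ∣ 5 * a := hpp.not_dvd_mul h5 ha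
  have h5aV : ValEq (5 * (a : Ω p)) 0 := by
    have := valEq_intCast h5a; push_cast at this; exact this
  have hDV := cast_discr_valEq hS.discr_ne_zero hD
  have key : ∀ X : ℤ, (p : ℤ) ^ m ∣ 5 * a * X + 6 * b →
      ValGE (6 * (X : Ω p) ^ 5 + (a : Ω p)) m ∧
      ∀ t : Ω p, t ^ 6 + a * t + b = 0 → ValGE (lastNum (X : Ω p) t) m := by
    intro X hX
    have hε := valGE_of_dvd hX
    push_cast at hε
    have h6b : ValGE (6 * (b : Ω p)) 0 := (valGE_ofNat 6).mul (valGE_intCast b) (by simp)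
    have h1 := deriv_valGE (s := m) h5aV h6b hε (by simp) hDV.ge (by push_cast; linarith)
      (by linarith)
    refine ⟨h1, fun t ht => lastNum_valGE ht h1 ?_⟩
    have h2 := value_valGE (s := 2 * m) h5aV h6b (valGE_intCast b) hε (by simp) (by simp) hDV.ge
      (by push_cast; linarith) (by linarith)
    exact h2.mul (quartic_valGE (valGE_intCast X) ((root_valGE ht).sub (valGE_intCast X)))
      (by linarith)
  refine rowHolds_of_le_one hS (k := ![0, 0, 0, 0, 0, m]) he hvD ?_ ?_ rfl ?_ ?_
  · rw [hD]; simp [Fin.sum_univ_succ]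
  · obtain ⟨X, hX⟩ := exists_dvd_mul_add (p := p) h5a (6 * b) m
    obtain ⟨y, hy⟩ := exists_dvd_mul_add (p := p) h6 (-(5 * a)) m
    have hmod : 5 * a * X ≡ -(6 * b) [ZMOD (p : ℤ) ^ m] :=
      (Int.modEq_iff_dvd.mpr (by convert hX using 1; ring)).symm
    have hpow (n : ℕ) : (5 * a) ^ n * X ^ n ≡ (-(6 * b)) ^ n [ZMOD (p : ℤ) ^ m] := by
      rw [← mul_pow]; exact hmod.pow n
    refine ⟨_, y, X ^ 4, X ^ 3, X ^ 2, X, ?_, ?_, ?_, ?_, hmod, rfl⟩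
    · exact (Int.modEq_iff_dvd.mpr (by convert hy using 1; ring)).symm
    · simpa [Even.neg_pow (show Even 4 by decide)] using hpow 4
    · simpa [Odd.neg_pow (show Odd 3 by decide)] using hpow 3
    · simpa using hpow 2
  · exact monotone_last m
  · rintro _ ⟨x, y, z, v, w, hx, hy, hz, hv, hw, rfl⟩
    refine ⟨![[], [], [], [], [], [x, y, z, v, w]], ?_, ?_⟩
    swap
    · ext i; fin_cases i <;> simp [family, tri, Finset.sum_range_succ]
    obtain ⟨hd, hI⟩ := key w (by
      have := (hw.symm).dvd
      convert this using 1; ring)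
    have hmod (n : ℕ) : (5 * a) ^ n * w ^ n ≡ (-(6 * b)) ^ n [ZMOD (p : ℤ) ^ m] := by
      rw [← mul_pow]; exact hw.pow n
    have hcancel : ∀ (n : ℕ) (r : ℤ), (5 * a) ^ n * r ≡ (-(6 * b)) ^ n [ZMOD (p : ℤ) ^ m] →
        ValGE ((r : Ω p) - (w : Ω p) ^ n) m := by
      intro n r hr
      have h1 := modEq_cast_valGE (hr.trans (hmod n).symm)
      push_cast at h1
      rw [← mul_sub, mul_comm] at h1
      exact h1.of_mul (h5aV.pow n rfl) (by simp)
    have h4 := hcancel 4 y (by simpa [Even.neg_pow (show Even 4 by decide)] using hy)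
    have h3 := hcancel 3 z (by simpa [Odd.neg_pow (show Odd 3 by decide)] using hz)
    have h2 := hcancel 2 v (by simpa using hv)
    have h0 : ValGE ((x : Ω p) + 5 * (w : Ω p) ^ 5) m := by
      have h6V := valEq_intCast h6
      refine ValGE.of_mul (y := ((6 : ℤ) : Ω p)) (r := m) ?_ h6V (by simp)
      have := modEq_cast_valGE hx
      push_cast at this ⊢
      convert this.add ((valGE_ofNat 5).mul hd (t := (m : ℝ)) (by simp)) using 1
      ring
    refine integralFamily_of_last fun t ht => ?_
    have hpow (n : ℕ) : ValGE (t ^ n) 0 := (root_valGE ht).pow n (by simp)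
    convert (hI t ht).add (((h0.add (h4.mul (root_valGE ht) (by simp))).add
      (h3.mul (hpow 2) (by simp))).add (h2.mul (hpow 3) (by simp))) using 1
    unfold lastNum
    ring

end General

end


section TwoLast

variable {K : Type*} [Field K] [NumberField K] {θ : K} {a b A c : ℤ}

/-- The triangular lists of `1, θ, q, qθ, q²` with `q = θ ^ 2 + θ + 1`, and of the numerator of
`lastElt` shifted by the derivative of the trinomial at `x`. -/
def shiftedList (a x : ℤ) : Fin 6 → List ℤ :=
  ![[], [], [1, 1], [0, 1, 1], [1, 2, 3, 2], [-5 * x ^ 5 + (6 * x ^ 5 + a), x ^ 4, x ^ 3, x ^ 2, x]]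

/-- The values at a root of the family with lists `shiftedList`. -/
noncomputable def shiftedValues (a x : ℤ) (k : ℕ) (t : Ω 2) : Fin 6 → Ω 2 :=
  ![1, t, t ^ 2 + t + 1, (t ^ 2 + t + 1) * t, (t ^ 2 + t + 1) ^ 2,
    (lastNum (x : Ω 2) t + (6 * (x : Ω 2) ^ 5 + (a : Ω 2))) / 2 ^ k]

theorem tri_shiftedList (a x : ℤ) (k : ℕ) (t : Ω 2) (i : Fin 6) :
    tri (shiftedList a x) t i / ((2 : ℕ) : Ω 2) ^ (![0, 0, 0, 0, 0, k] : Fin 6 → ℕ) i =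
      shiftedValues a x k t i := by
  fin_cases i <;>
    simp [tri, shiftedList, shiftedValues, lastNum, Finset.sum_range_succ] <;> ring

theorem shiftedValues_valGE {x : ℤ} {k : ℕ}
    (hf' : ValGE (6 * (x : Ω 2) ^ 5 + (a : Ω 2)) k)
    (hL : ∀ t : Ω 2, t ^ 6 + a * t + b = 0 → ValGE (lastNum (x : Ω 2) t) k)
    {t : Ω 2} (ht : t ^ 6 + a * t + b = 0) (i : Fin 6) :
    ValGE (shiftedValues a x k t i) 0 := by
  have h1 := root_valGE ht
  have hq : ValGE (t ^ 2 + t + 1) 0 := ((h1.pow 2 (by simp)).add h1).add valEq_one.ge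
  have h2 := (valEq_prime_pow (p := 2) k)
  fin_cases i
  exacts [valEq_one.ge, h1, hq, hq.mul h1 (by simp), hq.pow 2 (by simp),
    ((hL t ht).add hf').div h2 (by simp)]

theorem valEq_two_unit_data (ha : a = 2 * A) (hA : Odd A) (hb : b = 4 * c + 1) :
    ValEq (5 * (a : Ω 2)) 1 ∧ ValEq (6 * (b : Ω 2)) 1 ∧
      ValEq (b : Ω 2) 0 := by
  have hb0 : ValEq (b : Ω 2) 0 := valEq_odd (by rw [hb]; exact ⟨2 * c, by ring⟩)
  refine ⟨?_, valEq_six_two.mul hb0, hb0⟩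
  rw [ha]; push_cast
  exact valEq_five_two.mul (valEq_two.mul (valEq_odd hA) rfl)

theorem odd_of_even_combination {x : ℤ} (hb : b = 4 * c + 1)
    (h : Even (5 * A * x + 3 * b)) : Odd x := by
  have hb' : Odd (3 * b) := (show Odd (3 : ℤ) by decide).mul (by rw [hb]; exact ⟨2 * c, by ring⟩)
  have h1 := h.sub_odd hb'
  rw [add_sub_cancel_right] at h1
  exact (Int.odd_mul.mp h1).2

/-- At the two roots that are congruent to the primitive third roots of unity, `q` has valuation
`1 / 2`, and the first four coefficients have to be even. -/
theorem even_coeffs_of_shifted {x : ℤ} {k : ℕ} (ha : a = 2 * A) (hA : Odd A) (hb : b = 4 * c + 1)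
    (hx : Odd x) (hk : 1 ≤ k)
    (hf' : ValGE (6 * (x : Ω 2) ^ 5 + (a : Ω 2)) k)
    (hf : ValGE ((x : Ω 2) ^ 6 + (a : Ω 2) * (x : Ω 2) + (b : Ω 2)) (2 * k))
    (hL : ∀ t : Ω 2, t ^ 6 + a * t + b = 0 → ValGE (lastNum (x : Ω 2) t) k)
    {d : Fin 6 → ℤ} (hd : ∀ t : Ω 2, t ^ 6 + a * t + b = 0 →
      ValGE (∑ i, (d i : Ω 2) * shiftedValues a x k t i) 1) :
    ((2 : ℕ) : ℤ) ∣ d 0 ∧ ((2 : ℕ) : ℤ) ∣ d 1 ∧ ((2 : ℕ) : ℤ) ∣ d 2 ∧ ((2 : ℕ) : ℤ) ∣ d 3 := by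
  obtain ⟨-, -, hb0⟩ := valEq_two_unit_data ha hA hb
  have hk' : (1 : ℝ) ≤ k := by exact_mod_cast hk
  obtain ⟨ω, hω, hω0, hω1⟩ := exists_cube_root_of_unity valEq_three_two
  have place : ∀ ξ : Ω 2, ξ ^ 2 + ξ + 1 = 0 → ValEq ξ 0 → ValEq (ξ - 1) 0 →
      ∃ t : Ω 2, t ^ 6 + a * t + b = 0 ∧ (∃ s, 0 < s ∧ ValGE (t - ξ) s) ∧
        ValEq t 0 ∧ ValEq (t ^ 2 + t + 1) (1 / 2) ∧ ValGE (shiftedValues a x k t 5) 1 := by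
    intro ξ hξ hξ0 hξ1
    obtain ⟨t, ht, s, hs, hts⟩ := exists_root_congr (a := a) hb0 hξ0 one_pos (by
      rw [show ξ ^ 6 + (a : Ω 2) * ξ + b = 2 * ((A : Ω 2) * ξ + (2 * c + 1)) by
        rw [ha, hb]; push_cast; linear_combination (ξ ^ 4 - ξ ^ 3 + ξ - 1) * hξ]
      exact valEq_two.ge.mul (((valGE_intCast A).mul hξ0.ge (t := 0) (by simp)).add
        ((valEq_two.ge.mul (valGE_intCast c) (t := 0) (by simp)).add valEq_one.ge)) (by simp))
    have ht0 := valEq_root_of_unit hb0 ht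
    have hcongr : ∀ {y : Ω 2}, ValEq (ξ - y) 0 → ValEq (t - y) 0 := fun {y} h => by
      convert h.add hts hs using 1; ring
    refine ⟨t, ht, ⟨s, hs, hts⟩, ht0, ?_, ?_⟩
    · have hx1 : ValEq (t - 1) 0 := hcongr hξ1
      have hx2 : ValEq (t + 1) 0 := by
        convert hx1.add valEq_two.ge one_pos using 1; ring
      have hsq : (t ^ 2 + t + 1) ^ 2 = 2 * t * (t ^ 2 + t + 1) +
          2 * (-((A : Ω 2) * t + (2 * c + 1)) / ((t - 1) * (t + 1))) := by
        field_simp [hx1.ne_zero, hx2.ne_zero]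
        rw [ha, hb] at ht
        push_cast at ht
        linear_combination ht
      have hunit : ValEq ((A : Ω 2) * t + (2 * (c : Ω 2) + 1)) 0 := by
        have h1 : ValEq ((A : Ω 2) * t + 1) 0 := by
          obtain ⟨j, hj⟩ := hA
          convert hx2.add (valEq_two.ge.mul ((valGE_intCast j).mul ht0.ge (t := 0) (by simp))
            (t := 1) (by simp)) one_pos using 1
          rw [hj]; push_cast; ring
        convert h1.add (valEq_two.ge.mul (valGE_intCast c) (t := 1) (by simp)) one_pos using 1
        ring
      have hv := valEq_two.mul (hunit.neg.div (hx1.mul hx2 rfl) (t := 0) (by simp)) (t := 1)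
        (by simp)
      have hq := valGE_of_sq_eq (r := 1 / 2) hsq
        (valEq_two.ge.mul ht0.ge) (hv.ge')
      refine ValEq.of_pow (n := 2) (r := 1) two_ne_zero ?_
      rw [hsq, add_comm]
      exact hv.add ((valEq_two.ge.mul ht0.ge le_rfl).mul hq le_rfl)
    · have hz : ValEq (t - (x : Ω 2)) 0 := by
        refine hcongr ?_
        obtain ⟨j, hj⟩ := hx
        convert hξ1.add (valEq_two.ge.mul (valGE_intCast j).neg (t := 1) (by simp)) one_pos using 1
        rw [hj]; push_cast; ring
      exact (lastNum_add_valGE ht hf hz).div (valEq_prime_pow (p := 2) k) (by linarith)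
  obtain ⟨t1, ht1, ⟨s1, hs1, h1⟩, hu1, hq1, hl1⟩ := place ω hω hω0 hω1
  obtain ⟨t2, ht2, ⟨s2, hs2, h2⟩, hu2, hq2, hl2⟩ := place (ω ^ 2)
    (by linear_combination (ω ^ 2 - ω + 1) * hω) (hω0.pow 2 (by simp)) (by
      rw [show ω ^ 2 - 1 = -(ω - 1) * ω ^ 2 by linear_combination (ω - 1) * hω]
      exact hω1.neg.mul (hω0.pow 2 rfl) (by simp))
  have hdiff : ValEq (t1 - t2) 0 := by
    have h3 : ValEq (ω - ω ^ 2) 0 := by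
      rw [show ω - ω ^ 2 = -((ω - 1) * ω) by ring]
      exact (hω1.mul hω0 (by simp)).neg
    convert h3.add ((h1.mono (min_le_left s1 s2)).sub (h2.mono (min_le_right s1 s2)))
      (lt_min hs1 hs2) using 1
    ring
  have lin : ∀ (t : Ω 2) (i j : Fin 6) (δ : Ω 2) {r : ℝ}, i ≠ j → r < 1 →
      t ^ 6 + a * t + b = 0 → ValEq δ r → shiftedValues a x k t i = δ →
      shiftedValues a x k t j = δ * t → (∀ l, l ≠ i → l ≠ j → (((2 : ℕ) : ℤ) ∣ d l ∧
        ValGE (shiftedValues a x k t l) 0) ∨ ∃ s, r < s ∧ ValGE (shiftedValues a x k t l) s) →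
      ∃ s, 0 < s ∧ ValGE ((d i : Ω 2) + (d j : Ω 2) * t) s := by
    intro t i j δ r hij hr ht hδ hi hj hl
    have h := exists_pos_valGE_sum (hd t ht) hr {i, j} hδ (fun l => if l = i then 1 else t) ?_ ?_
    · simpa [Finset.sum_pair hij, hij.symm] using h
    · intro l hl
      refine ⟨r + 1, by linarith, ?_⟩
      rcases Finset.mem_insert.mp hl with rfl | hl
      · simpa [hi] using valGE_zero _
      · rw [Finset.mem_singleton.mp hl]
        simpa [hj, hij.symm] using valGE_zero _
    · intro l hl'
      simp only [Finset.mem_insert, Finset.mem_singleton, not_or] at hl'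
      exact hl l hl'.1 hl'.2
  have first : ∀ t : Ω 2, t ^ 6 + a * t + b = 0 → ValEq t 0 →
      ValEq (t ^ 2 + t + 1) (1 / 2) → ValGE (shiftedValues a x k t 5) 1 →
      ∃ s, 0 < s ∧ ValGE ((d 0 : Ω 2) + (d 1 : Ω 2) * t) s := by
    intro t ht hu hq hl
    refine lin t 0 1 1 (by decide) one_pos ht valEq_one rfl (one_mul t).symm ?_
    intro l hl0 hl1
    right
    fin_cases l
    exacts [absurd rfl hl0, absurd rfl hl1, ⟨_, by norm_num, hq.ge⟩,
      ⟨1 / 2, by norm_num, hq.ge.mul hu.ge⟩,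
      ⟨1, by norm_num, hq.ge.pow 2⟩, ⟨1, one_pos, hl⟩]
  obtain ⟨s, hs, e1⟩ := first t1 ht1 hu1 hq1 hl1
  obtain ⟨s', hs', e2⟩ := first t2 ht2 hu2 hq2 hl2
  obtain ⟨hd0, hd1⟩ := dvd_of_two_residues e1 hs e2 hs' hdiff hu1.ge
  have second : ∀ t : Ω 2, t ^ 6 + a * t + b = 0 → ValEq t 0 →
      ValEq (t ^ 2 + t + 1) (1 / 2) → ValGE (shiftedValues a x k t 5) 1 →
      ∃ s, 0 < s ∧ ValGE ((d 2 : Ω 2) + (d 3 : Ω 2) * t) s := by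
    intro t ht hu hq hl
    refine lin t 2 3 (t ^ 2 + t + 1) (by decide) (by norm_num) ht hq rfl rfl ?_
    intro l hl2 hl3
    fin_cases l
    exacts [.inl ⟨hd0, shiftedValues_valGE hf' hL ht _⟩,
      .inl ⟨hd1, shiftedValues_valGE hf' hL ht _⟩, absurd rfl hl2, absurd rfl hl3,
      .inr ⟨1, by norm_num, hq.ge.pow 2⟩, .inr ⟨1, by norm_num, hl⟩]
  obtain ⟨s, hs, e1⟩ := second t1 ht1 hu1 hq1 hl1
  obtain ⟨s', hs', e2⟩ := second t2 ht2 hu2 hq2 hl2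
  obtain ⟨hd2, hd3⟩ := dvd_of_two_residues e1 hs e2 hs' hdiff hu1.ge
  exact ⟨hd0, hd1, hd2, hd3⟩

/-- A root close to `x`, where `q` is a unit. -/
theorem exists_root_near_int {x : ℤ} {s : ℝ} (hb0 : ValEq (b : Ω 2) 0) (hx : Odd x)
    (hs : 0 < s)
    (hf : ValGE ((x : Ω 2) ^ 6 + (a : Ω 2) * (x : Ω 2) + (b : Ω 2)) s) :
    ∃ t : Ω 2, t ^ 6 + a * t + b = 0 ∧ (∃ s, 0 < s ∧ ValGE (t - (x : Ω 2)) s) ∧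
      ValEq (t ^ 2 + t + 1) 0 := by
  obtain ⟨t, ht, s, hs, h⟩ := exists_root_congr (a := a) hb0 (valEq_odd hx) hs hf
  refine ⟨t, ht, ⟨s, hs, h⟩, ?_⟩
  have h1 : ValEq ((x ^ 2 + x + 1 : ℤ) : Ω 2) 0 :=
    valEq_odd (by rw [show x ^ 2 + x + 1 = x * (x + 1) + 1 by ring]
                  exact (Int.even_mul_succ_self x).add_one)
  have h2 : ValGE (t + (x : Ω 2) + 1) 0 := ((root_valGE ht).add (valGE_intCast x)).add valEq_one.ge
  convert h1.add (h.mul h2 le_rfl) (by simpa using hs) using 1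
  push_cast; ring

theorem quartic_valEq {x t : Ω 2} {s : ℝ} (hx : ValEq x 0) (hs : 0 < s)
    (ht : ValGE (t - x) s) : ValEq (quartic x (t - x)) 0 := by
  have h15 : ValEq (15 * x ^ 4) 0 := by
    have : ValEq ((15 : ℤ) : Ω 2) 0 := valEq_odd (by decide)
    push_cast at this
    exact this.mul (hx.pow 4 rfl) (by simp)
  have h0 := ht.mono hs.le
  have h1 : ValGE (20 * x ^ 3 + 15 * x ^ 2 * (t - x) + 6 * x * (t - x) ^ 2 + (t - x) ^ 3) 0 :=
    ((((valGE_ofNat 20).mul (hx.ge.pow 3 le_rfl) (by simp)).add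
      (((valGE_ofNat 15).mul (hx.ge.pow 2 le_rfl) le_rfl).mul h0 (by simp))).add
      (((valGE_ofNat 6).mul hx.ge le_rfl).mul (h0.pow 2 le_rfl) (by simp))).add
      (h0.pow 3 (by simp))
  convert h15.add (ht.mul h1 le_rfl) (by simpa using hs) using 1
  unfold quartic; ring

theorem rowHolds_two_last {P : ℤ → Prop} {x : ℤ} {k vdK : ℕ} {vD : Set ℕ}
    (hS : IsTrinomialGenerator θ a b)
    (hD : padicValInt 2 Δ(a,b) ∈ vD)
    (hsum : padicValInt 2 Δ(a,b) = vdK + 2 * k)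
    (hI : ∀ x, P x → ∀ t : Ω 2, t ^ 6 + a * t + b = 0 →
      ValGE (lastNum (x : Ω 2) t) k) (hx : P x)
    (hf' : ValGE (6 * (x : Ω 2) ^ 5 + (a : Ω 2)) k)
    (hM : ∀ d : Fin 6 → ℤ, (∀ t : Ω 2, t ^ 6 + a * t + b = 0 →
      ValGE (∑ i, (d i : Ω 2) * shiftedValues a x k t i) 1) → ∀ i, ((2 : ℕ) : ℤ) ∣ d i) :
    RowHolds 2 θ Δ(a,b) vD vdK
      {α | ∃ x : ℤ, P x ∧ α = ![1, θ, θ ^ 2, θ ^ 3, θ ^ 4, lastElt 2 θ x k]} := by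
  refine rowHolds_of_saturated hS (l := shiftedList a x) (k := ![0, 0, 0, 0, 0, k]) hD
    (by rw [hsum]; simp [Fin.sum_univ_succ])
    (.of_eq _ (tri_shiftedList a x k) fun t ht => shiftedValues_valGE hf' (hI x hx) ht)
    (.of_eq _ (tri_shiftedList a x k) hM) ⟨_, x, hx, rfl⟩ rfl (monotone_last k) ?_
  rintro _ ⟨y, hy, rfl⟩
  exact ⟨lastList y, integralFamily_last (hI y hy), family_last θ y⟩

end TwoLast


section TwoLastRows

variable {K : Type*} [Field K] [NumberField K] {θ : K} {a b A c x : ℤ} {k : ℕ}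

theorem linear_valGE {N : ℕ} (ha : a = 2 * A) (h : (2 : ℤ) ^ N ∣ 5 * A * x + 3 * b) :
    ValGE (5 * (a : Ω 2) * (x : Ω 2) + 6 * (b : Ω 2)) ((N : ℝ) + 1) := by
  have h1 := valGE_of_dvd (p := 2) h
  convert valEq_two.ge.mul h1 (add_comm _ _).le using 1
  rw [ha]; push_cast; ring

theorem last_data_of_dvd {d : ℕ} (ha : a = 2 * A) (hA : Odd A) (hb : b = 4 * c + 1)
    (hD : ValEq (5 ^ 5 * (a : Ω 2) ^ 6 - 6 ^ 6 * (b : Ω 2) ^ 5) d)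
    (hd : 2 * k + 6 ≤ d) (hk : 1 ≤ k) (h : (2 : ℤ) ^ k ∣ 5 * A * x + 3 * b) :
    ValGE (6 * (x : Ω 2) ^ 5 + (a : Ω 2)) k ∧
    ValGE ((x : Ω 2) ^ 6 + (a : Ω 2) * (x : Ω 2) + (b : Ω 2)) (2 * k) ∧
    ∀ t : Ω 2, t ^ 6 + a * t + b = 0 → ValGE (lastNum (x : Ω 2) t) k := by
  obtain ⟨h5a, h6b, hb0⟩ := valEq_two_unit_data ha hA hb
  have hd' : 2 * (k : ℝ) + 6 ≤ d := by exact_mod_cast hd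
  have hk' : (1 : ℝ) ≤ k := by exact_mod_cast hk
  have hε := linear_valGE ha h
  have h1 := deriv_valGE (s := k) h5a h6b.ge hε (by linarith) hD.ge (by linarith) (by linarith)
  have h2 := value_valGE (s := 2 * k) h5a h6b.ge hb0.ge hε (by linarith) (by linarith) hD.ge
    (by linarith) (by linarith)
  refine ⟨h1, h2, fun t ht => lastNum_valGE ht h1 ?_⟩
  exact h2.mul (quartic_valGE (valGE_intCast x) ((root_valGE ht).sub (valGE_intCast x)))
    (by linarith)

theorem not_two_dvd_five_mul (hA : Odd A) : ¬ ((2 : ℕ) : ℤ) ∣ 5 * A := by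
  rw [Nat.cast_ofNat, ← even_iff_two_dvd, Int.not_even_iff_odd]
  exact (show Odd (5 : ℤ) by decide).mul hA

theorem dvd_of_last_values {d : Fin 6 → ℤ} {t : Ω 2}
    (h : ValGE (∑ i, (d i : Ω 2) * shiftedValues a x k t i) 1)
    (hγ : ∀ i, ValGE (shiftedValues a x k t i) 0)
    (h0 : ((2 : ℕ) : ℤ) ∣ d 0) (h1 : ((2 : ℕ) : ℤ) ∣ d 1) (h2 : ((2 : ℕ) : ℤ) ∣ d 2)
    (h3 : ((2 : ℕ) : ℤ) ∣ d 3) (hq : ValEq (t ^ 2 + t + 1) 0)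
    (h5 : ((2 : ℕ) : ℤ) ∣ d 5 ∨ ValEq (shiftedValues a x k t 5) (1 / 2)) (i : Fin 6) :
    ((2 : ℕ) : ℤ) ∣ d i := by
  have hq2 : ValEq (shiftedValues a x k t 4) 0 := hq.pow 2 (by simp)
  have h4 : ((2 : ℕ) : ℤ) ∣ d 4 := by
    refine dvd_of_min h 4 one_pos hq2 fun i hi => ?_
    fin_cases i
    exacts [.inl ⟨h0, hγ _⟩, .inl ⟨h1, hγ _⟩, .inl ⟨h2, hγ _⟩, .inl ⟨h3, hγ _⟩, absurd rfl hi,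
      h5.imp (fun h => ⟨h, hγ _⟩) fun h => ⟨_, by norm_num, h.ge⟩]
  have h5 : ((2 : ℕ) : ℤ) ∣ d 5 := by
    refine h5.elim id fun hv => dvd_of_min h 5 (by norm_num) hv fun i hi => ?_
    fin_cases i
    exacts [.inl ⟨h0, hγ _⟩, .inl ⟨h1, hγ _⟩, .inl ⟨h2, hγ _⟩, .inl ⟨h3, hγ _⟩,
      .inl ⟨h4, hγ _⟩, absurd rfl hi]
  fin_cases i
  exacts [h0, h1, h2, h3, h4, h5]

/-- The quadratic equation of the last shifted value. -/
theorem shiftedValues_sq {t : Ω 2} (ht : t ^ 6 + a * t + b = 0) :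
    shiftedValues a x k t 5 ^ 2 =
      (6 * (x : Ω 2) ^ 5 + (a : Ω 2)) / 2 ^ k * shiftedValues a x k t 5 +
      -(((x : Ω 2) ^ 6 + (a : Ω 2) * (x : Ω 2) + (b : Ω 2)) / 2 ^ (2 * k) *
        quartic (x : Ω 2) (t - x)) := by
  have h := lastNum_add_sq (x := (x : Ω 2)) ht
  change ((lastNum (x : Ω 2) t + (6 * (x : Ω 2) ^ 5 + (a : Ω 2))) / 2 ^ k) ^ 2
    = _ * ((lastNum (x : Ω 2) t + (6 * (x : Ω 2) ^ 5 + (a : Ω 2))) / 2 ^ k) + _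
  rw [div_pow, h, pow_mul' (2 : Ω 2) 2 k]
  field_simp

theorem valEq_two_pow (k : ℕ) : ValEq ((2 : Ω 2) ^ k) k := by
  exact_mod_cast valEq_prime_pow (p := 2) k

theorem rowHolds_two_last_odd (hS : IsTrinomialGenerator θ a b) (ha : a = 2 * A) (hA : Odd A)
    (hb : b = 4 * c + 1) (hk : 1 ≤ k)
    (hd : padicValInt 2 Δ(a,b) = 2 * k + 7) :
    RowHolds 2 θ Δ(a,b) {n | 9 ≤ n ∧ Odd n} 7
      {α | ∃ x : ℤ, 5 * A * x + 3 * b ≡ 0 [ZMOD 2 ^ k] ∧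
        α = ![1, θ, θ ^ 2, θ ^ 3, θ ^ 4, lastElt 2 θ x k]} := by
  obtain ⟨h5a, h6b, hb0⟩ := valEq_two_unit_data ha hA hb
  have hDV := cast_discr_valEq hS.discr_ne_zero hd
  push_cast at hDV
  have hk' : (1 : ℝ) ≤ k := by exact_mod_cast hk
  obtain ⟨x, hx⟩ := exists_dvd_mul_add (not_two_dvd_five_mul hA) (3 * b) (2 * k + 7)
  rw [Nat.cast_ofNat] at hx
  have hxk : (2 : ℤ) ^ k ∣ 5 * A * x + 3 * b := (pow_dvd_pow 2 (by omega)).trans hx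
  have hx1 : Odd x := odd_of_even_combination hb
    (even_iff_two_dvd.mpr ((dvd_pow_self 2 (by omega)).trans hx))
  have hI := fun y (hy : (2 : ℤ) ^ k ∣ 5 * A * y + 3 * b) =>
    last_data_of_dvd ha hA hb (cast_discr_valEq hS.discr_ne_zero hd) (by omega) hk hy
  obtain ⟨hf', hf, hL⟩ := hI x hxk
  refine rowHolds_two_last hS (x := x) (by rw [hd]; exact ⟨by omega, ⟨k + 3, by ring⟩⟩)
    (by rw [hd]; ring) (fun y hy => (hI y (Int.modEq_zero_iff_dvd.mp hy)).2.2)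
    (Int.modEq_zero_iff_dvd.mpr hxk) hf' ?_
  intro d hd
  obtain ⟨h0, h1, h2, h3⟩ := even_coeffs_of_shifted ha hA hb hx1 hk hf' hf hL hd
  obtain ⟨t, ht, ⟨s, hs, hts⟩, hq⟩ := exists_root_near_int hb0 hx1 (s := 2 * k) (by linarith) hf
  refine dvd_of_last_values (hd t ht) (shiftedValues_valGE hf' hL ht) h0 h1 h2 h3 hq (.inr ?_)
  have hε := linear_valGE ha hx
  push_cast at hε
  have hB := (deriv_valEq h5a h6b.ge hε (by linarith) hDV (by linarith)).div (valEq_two_pow k) rfl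
  have hA' := (value_valEq h5a h6b.ge hb0 hε (by linarith) (by linarith) hDV (by linarith)).div
    (valEq_two_pow (2 * k)) (t := 1) (by push_cast; ring)
  have hc := (hA'.mul (quartic_valEq (valEq_odd hx1) hs hts) (t := 1) (by simp)).neg
  have hsq := shiftedValues_sq (x := x) (k := k) ht
  have hv := valGE_of_sq_eq hsq (hB.ge' (s := 1 / 2) (by linarith)) (hc.ge')
  refine ValEq.of_pow (n := 2) (r := 1) two_ne_zero ?_
  rw [hsq, add_comm]
  exact hc.add (hB.ge.mul hv le_rfl) (by linarith)

theorem rowHolds_two_last_even {D₂ : ℤ} (hS : IsTrinomialGenerator θ a b) (ha : a = 2 * A)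
    (hA : Odd A) (hb : b = 4 * c + 1) (hk : 1 ≤ k)
    (hd : padicValInt 2 Δ(a,b) = 2 * k + 6)
    (hD₂ : Δ(a,b) = 2 ^ (2 * k + 6) * D₂) (hD₂' : D₂ ≡ 1 [ZMOD 4]) :
    RowHolds 2 θ Δ(a,b) {n | 8 ≤ n ∧ Even n} 6
      {α | ∃ x : ℤ, 5 * A * x + 3 * b ≡ 0 [ZMOD 2 ^ k] ∧
        α = ![1, θ, θ ^ 2, θ ^ 3, θ ^ 4, lastElt 2 θ x k]} := by
  obtain ⟨h5a, h6b, hb0⟩ := valEq_two_unit_data ha hA hb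
  have hDV := cast_discr_valEq hS.discr_ne_zero hd
  push_cast at hDV
  have hk' : (1 : ℝ) ≤ k := by exact_mod_cast hk
  obtain ⟨x, hx⟩ := exists_dvd_mul_add (not_two_dvd_five_mul hA) (3 * b) (2 * k + 7)
  rw [Nat.cast_ofNat] at hx
  have hxk : (2 : ℤ) ^ k ∣ 5 * A * x + 3 * b := (pow_dvd_pow 2 (by omega)).trans hx
  have hx1 : Odd x := odd_of_even_combination hb
    (even_iff_two_dvd.mpr ((dvd_pow_self 2 (by omega)).trans hx))
  have hI := fun y (hy : (2 : ℤ) ^ k ∣ 5 * A * y + 3 * b) =>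
    last_data_of_dvd ha hA hb (cast_discr_valEq hS.discr_ne_zero hd) (by omega) hk hy
  obtain ⟨hf', hf, hL⟩ := hI x hxk
  refine rowHolds_two_last hS (x := x) (by rw [hd]; exact ⟨by omega, ⟨k + 3, by ring⟩⟩)
    (by rw [hd]; ring) (fun y hy => (hI y (Int.modEq_zero_iff_dvd.mp hy)).2.2)
    (Int.modEq_zero_iff_dvd.mpr hxk) hf' ?_
  intro d hd
  obtain ⟨h0, h1, h2, h3⟩ := even_coeffs_of_shifted ha hA hb hx1 hk hf' hf hL hd
  obtain ⟨t, ht, ⟨s, hs, hts⟩, hq⟩ := exists_root_near_int hb0 hx1 (s := 2 * k) (by linarith) hf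
  have hε := linear_valGE ha hx
  push_cast at hε
  have hB := (deriv_valEq h5a h6b.ge hε (by linarith) hDV (by linarith)).div (valEq_two_pow k) rfl
  have hfV := value_valEq h5a h6b.ge hb0 hε (by linarith) (by linarith) hDV (by linarith)
  have hA' := hfV.div (valEq_two_pow (2 * k)) (t := 0) (by push_cast; ring)
  set B := (6 * (x : Ω 2) ^ 5 + (a : Ω 2)) / 2 ^ k with hBdef
  set A' := ((x : Ω 2) ^ 6 + (a : Ω 2) * (x : Ω 2) + (b : Ω 2)) /
    2 ^ (2 * k) with hAdef
  set L := shiftedValues a x k t 5 with hLdef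
  have hH := quartic_valEq (valEq_odd hx1) hs hts
  have hsq : L ^ 2 = B * L + -(A' * quartic (x : Ω 2) (t - x)) := shiftedValues_sq ht
  have hc := (hA'.mul hH (t := 0) (by simp)).neg
  have hL0 : ValEq L 0 := by
    refine ValEq.of_pow (n := 2) (r := 0) two_ne_zero ?_
    rw [hsq, add_comm]
    exact hc.add (hB.ge.mul (shiftedValues_valGE hf' hL ht 5) le_rfl) (by linarith)
  -- the root is close to `x`
  have hz : ValGE (t - (x : Ω 2)) 1 := by
    have h := sub_mul_lastNum (x := (x : Ω 2)) ht
    have hLn : ValEq (lastNum (x : Ω 2) t + (6 * (x : Ω 2) ^ 5 + (a : Ω 2))) k := by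
      have h4 := hL0.mul (valEq_two_pow k) (t := (k : ℝ)) (by simp)
      have h5 : L * 2 ^ k =
          lastNum (x : Ω 2) t + (6 * (x : Ω 2) ^ 5 + (a : Ω 2)) :=
        div_mul_cancel₀ _ (pow_ne_zero k valEq_two.ne_zero)
      rwa [h5] at h4
    refine ValGE.of_mul (x := t - (x : Ω 2)) (r := 2 * k) ?_ hLn (by linarith)
    rw [h]
    exact hfV.neg.ge' (by linarith)
  have hH1 : ValGE (quartic (x : Ω 2) (t - x) + 1) 2 := by
    have h4 : ValGE ((15 * x ^ 4 + 1 : ℤ) : Ω 2) 2 := by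
      refine valGE_of_dvd (p := 2) (k := 2) ?_
      obtain ⟨j, rfl⟩ := hx1
      refine ⟨60 * j ^ 4 + 120 * j ^ 3 + 90 * j ^ 2 + 30 * j + 4, ?_⟩
      push_cast; ring
    have hx0 := (valEq_odd hx1).ge
    have h5 : ValGE ((t - (x : Ω 2)) *
        (20 * (x : Ω 2) ^ 3 + 15 * (x : Ω 2) ^ 2 * (t - (x : Ω 2)) +
          6 * (x : Ω 2) * (t - (x : Ω 2)) ^ 2 + (t - (x : Ω 2)) ^ 3)) 2 := by
      refine hz.mul (s := 1) ?_
      have h20 : ValGE (20 : Ω 2) 1 := by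
        have := valGE_even (show Even (20 : ℤ) by decide)
        exact_mod_cast this
      exact (((h20.mul (hx0.pow 3 (t := 0) (by simp))).add
        (((valGE_ofNat 15).mul (hx0.pow 2 (t := 0) (by simp)) le_rfl).mul hz)).add
        (((valGE_ofNat 6).mul hx0 le_rfl).mul (hz.pow 2 (t := 1)))).add
        (hz.pow 3)
    convert h4.add h5 using 1
    unfold quartic; push_cast; ring
  have hA1 : ValGE (A' + 1) 2 := by
    have hint : ValGE (((D₂ * (2 * (5 * A * x + 3 * b) - b) + (5 * A) ^ 6 : ℤ)) : Ω 2) 2 := by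
      refine valGE_of_dvd (p := 2) (k := 2) ?_
      obtain ⟨e, he⟩ := (pow_dvd_pow (2 : ℤ) (show 1 ≤ 2 * k + 7 by omega)).trans hx
      obtain ⟨j, rfl⟩ := hA
      obtain ⟨g, hg⟩ := hD₂'.symm.dvd
      obtain rfl : D₂ = 4 * g + 1 := by linarith
      rw [he, hb]
      refine ⟨(4 * g + 1) * (e - c) - g + 1250000 * j ^ 6 * 0 + ((5 * (2 * j + 1)) ^ 6 - 1) / 4, ?_⟩
      have h8 : (4 : ℤ) ∣ (5 * (2 * j + 1)) ^ 6 - 1 := by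
        refine (Int.ModEq.dvd (a := 1) ?_)
        have h9 : (5 * (2 * j + 1)) ^ 2 ≡ 1 [ZMOD 4] :=
          (Int.modEq_iff_dvd.mpr ⟨25 * j ^ 2 + 25 * j + 6, by ring⟩ : (1 : ℤ) ≡ _ [ZMOD 4]).symm
        have := (h9.pow 3).symm
        rwa [← pow_mul, one_pow] at this
      have h10 := Int.ediv_mul_cancel h8
      push_cast
      linear_combination -h10
    have herr := value_error_valGE h6b.ge hε (by linarith)
    have hvf := value_formula (x : Ω 2) (a : Ω 2) (b : Ω 2)
    have hDc : 5 ^ 5 * (a : Ω 2) ^ 6 - 6 ^ 6 * (b : Ω 2) ^ 5 =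
        2 ^ (2 * k + 6) * D₂ := by exact_mod_cast congrArg (Int.cast : ℤ → Ω 2) hD₂
    have h2k : (2 : Ω 2) ^ (2 * k) ≠ 0 := (valEq_two_pow (2 * k)).ne_zero
    refine ValGE.of_mul (y := 2 ^ (2 * k) * (5 * (a : Ω 2)) ^ 6) (r := 2 * k + 8)
      (s := 2 * k + 6) ?_
      ((valEq_two_pow (2 * k)).mul (h5a.pow 6 rfl) (by push_cast; ring)) (by linarith)
    have h6 : (A' + 1) * (2 ^ (2 * k) * (5 * (a : Ω 2)) ^ 6) =
        ((x : Ω 2) ^ 6 + (a : Ω 2) * (x : Ω 2) + (b : Ω 2)) *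
          (5 * (a : Ω 2)) ^ 6 + 2 ^ (2 * k) * (5 * (a : Ω 2)) ^ 6 := by
      rw [hAdef]; field_simp
    rw [h6, hvf, hDc]
    convert ((valEq_two_pow (2 * k + 6)).ge.mul hint (t := 2 * k + 8) (by push_cast; linarith)).add
      (herr.mono (s := 2 * k + 8) (by linarith)) using 1
    rw [ha]; push_cast; ring
  -- a root of an Eisenstein-type equation
  have hμ : ValEq (L + 1) (1 / 2) := by
    have hμsq : (L + 1) ^ 2 = (2 + B) * (L + 1) +
        -(2 + (B + ((A' + 1) * quartic (x : Ω 2) (t - x) -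
          (quartic (x : Ω 2) (t - x) + 1)))) := by
      linear_combination hsq
    have hcst : ValEq (-(2 + (B + ((A' + 1) * quartic (x : Ω 2) (t - x) -
        (quartic (x : Ω 2) (t - x) + 1))))) 1 :=
      (valEq_two.add ((hB.ge' (s := 2) (by linarith)).add ((hA1.mul hH.ge).sub hH1))).neg
    have h2B : ValGE (2 + B) 1 := valEq_two.ge.add (hB.ge' (by linarith))
    have hv := valGE_of_sq_eq hμsq (h2B.mono (s := 1 / 2)) (hcst.ge')
    refine ValEq.of_pow (n := 2) (r := 1) two_ne_zero ?_
    rw [hμsq, add_comm]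
    exact hcst.add (h2B.mul hv le_rfl)
  have hγ := shiftedValues_valGE hf' hL ht
  have hq2 : ValGE (shiftedValues a x k t 4 - 1) 1 := by
    have h4 : ValGE (((x ^ 2 + x + 1) ^ 2 - 1 : ℤ) : Ω 2) 1 :=
      valGE_even (by
        rw [show x ^ 2 + x + 1 = x * (x + 1) + 1 by ring]
        exact ((Int.even_mul_succ_self x).add_one.pow (n := 2)).sub_odd odd_one)
    have h5 : ValGE ((t + (x : Ω 2) + 1) * ((t ^ 2 + t + 1) +
        ((x : Ω 2) ^ 2 + (x : Ω 2) + 1))) 0 := by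
      have hx0 := (valEq_odd hx1).ge
      exact (((root_valGE ht).add hx0).add valEq_one.ge).mul
        (hq.ge.add (((hx0.pow 2 (t := 0) (by simp)).add hx0).add valEq_one.ge)) (by simp)
    convert h4.add (hz.mul h5 (t := 1) (by simp)) using 1
    simp [shiftedValues]; ring
  have h45 : ((2 : ℕ) : ℤ) ∣ d 4 - d 5 := by
    obtain ⟨u, hu, h⟩ := exists_pos_valGE_sum (hd t ht) (r := 0) one_pos {4, 5} valEq_one
      (fun i => if i = 4 then 1 else -1) (by
        intro i hi
        rcases Finset.mem_insert.mp hi with rfl | hi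
        · exact ⟨1, one_pos, by simpa using hq2⟩
        · rw [Finset.mem_singleton.mp hi]
          exact ⟨1 / 2, by norm_num, by simpa using hμ.ge⟩) (by
        intro i hi
        left
        fin_cases i
        exacts [⟨h0, hγ _⟩, ⟨h1, hγ _⟩, ⟨h2, hγ _⟩, ⟨h3, hγ _⟩, absurd (by simp) hi,
          absurd (by simp) hi])
    refine dvd_of_valGE (r := u) ?_ hu
    convert h using 1
    rw [Finset.sum_pair (by decide)]
    simp [sub_eq_add_neg]
  have h5 : ((2 : ℕ) : ℤ) ∣ d 5 := by
    have h6 := hd t ht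
    have hdv : ∀ i, ((2 : ℕ) : ℤ) ∣ d i →
        ValGE ((d i : Ω 2) * shiftedValues a x k t i) 1 := fun i hi =>
      (valGE_one_of_dvd hi).mul (hγ i) (by simp)
    have hμ' : ValEq (shiftedValues a x k t 4 + L) (1 / 2) := by
      convert hμ.add hq2 (by norm_num) using 1; ring
    refine dvd_of_valGE_mul (t := 1) ?_ hμ' (by norm_num)
    convert ((((h6.sub (hdv 0 h0)).sub (hdv 1 h1)).sub (hdv 2 h2)).sub (hdv 3 h3)).sub
      ((valGE_one_of_dvd h45).mul (hγ 4) (t := 1) (by simp)) using 1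
    rw [Fin.sum_univ_six]
    push_cast
    ring
  exact dvd_of_last_values (hd t ht) hγ h0 h1 h2 h3 hq (.inl h5)

theorem four_dvd_of_halves {D₂ e u : ℤ} (hD₂ : D₂ ≡ 3 [ZMOD 4]) (hb : b = 4 * c + 1) (hu : Odd u) :
    (4 : ℤ) ∣ D₂ * (4 * e - b) + 15 * 81 * u ^ 2 * b ^ 4 := by
  have hb' : b ≡ 1 [ZMOD 4] := (Int.modEq_iff_dvd.mpr ⟨c, by rw [hb]; ring⟩ : 1 ≡ b [ZMOD 4]).symm
  have hu' : u ^ 2 ≡ 1 [ZMOD 4] := by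
    obtain ⟨j, rfl⟩ := hu
    exact (Int.modEq_iff_dvd.mpr ⟨j ^ 2 + j, by ring⟩ : 1 ≡ _ [ZMOD 4]).symm
  have he : 4 * e ≡ 0 [ZMOD 4] := Int.modEq_zero_iff_dvd.mpr ⟨e, rfl⟩
  have h := (hD₂.mul (he.sub hb')).add (((Int.ModEq.refl (15 * 81)).mul hu').mul (hb'.pow 4))
  exact Int.modEq_zero_iff_dvd.mp (h.trans (by decide))

theorem last_data_of_halves {D₂ y : ℤ} (hD0 : Δ(a,b) ≠ 0) (ha : a = 2 * A)
    (hA : Odd A) (hb : b = 4 * c + 1) (hk : 2 ≤ k)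
    (hd : padicValInt 2 Δ(a,b) = 2 * k + 4)
    (hD₂ : Δ(a,b) = 2 ^ (2 * k + 4) * D₂) (hD₂' : D₂ ≡ 3 [ZMOD 4])
    (hy : 5 * A * y - 2 ^ (k - 1) + 3 * b ≡ 0 [ZMOD 2 ^ k]) :
    Odd y ∧ ValEq (6 * (y : Ω 2) ^ 5 + (a : Ω 2)) k ∧
    ValGE ((y : Ω 2) ^ 6 + (a : Ω 2) * (y : Ω 2) + (b : Ω 2)) (2 * k) ∧
    ∀ t : Ω 2, t ^ 6 + a * t + b = 0 → ValGE (lastNum (y : Ω 2) t) k := by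
  obtain ⟨h5a, h6b, hb0⟩ := valEq_two_unit_data ha hA hb
  have hDV := cast_discr_valEq hD0 hd
  push_cast at hDV
  have hk' : (2 : ℝ) ≤ k := by exact_mod_cast hk
  obtain ⟨j, hj⟩ := Int.modEq_zero_iff_dvd.mp hy
  obtain ⟨m, rfl⟩ : ∃ m, k = m + 2 := ⟨k - 2, by omega⟩
  have hε : 5 * A * y + 3 * b = 2 ^ (m + 1) * (2 * j + 1) := by
    rw [show m + 2 - 1 = m + 1 by omega] at hj
    rw [pow_succ 2 (m + 1)] at hj
    linear_combination hj
  have hodd : Odd y := odd_of_even_combination hb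
    (even_iff_two_dvd.mpr ⟨2 ^ m * (2 * j + 1), by rw [hε]; ring⟩)
  have hεc : 5 * (a : Ω 2) * (y : Ω 2) + 6 * (b : Ω 2) =
      2 ^ (m + 2) * ((2 * j + 1 : ℤ) : Ω 2) := by
    have := congrArg (Int.cast : ℤ → Ω 2) hε
    push_cast at this ⊢
    rw [ha]; push_cast
    linear_combination 2 * this
  have hu : ValEq ((2 * j + 1 : ℤ) : Ω 2) 0 := valEq_odd ⟨j, rfl⟩
  have hεV : ValEq (5 * (a : Ω 2) * (y : Ω 2) + 6 * (b : Ω 2)) (m + 2) := by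
    rw [hεc]; exact (valEq_two_pow (m + 2)).mul hu (by push_cast; ring)
  push_cast at hk' hDV ⊢
  have h6 : ValEq (6 : Ω 2) 1 := valEq_six_two.congr
  have herr := form_valGE (h6b.ge) (hεV.ge' (s := 1) (by linarith)) 0 10 10 5
  have hf' : ValEq (6 * (y : Ω 2) ^ 5 + (a : Ω 2)) ((m : ℝ) + 2) := by
    refine ValEq.of_mul (y := (5 * (a : Ω 2)) ^ 5) (r := (m : ℝ) + 7) ?_ (h5a.pow 5 rfl)
      (by push_cast; ring)
    have h5 : ValEq (5 : Ω 2) 0 := valEq_five_two.congr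
    have h1 : ValEq (5 * (6 * (b : Ω 2)) ^ 4) 4 := h5.mul (h6b.pow 4 rfl)
    set ε := 5 * (a : Ω 2) * (y : Ω 2) + 6 * (b : Ω 2) with hεd
    have h2 : ValGE (-10 * (6 * (b : Ω 2)) ^ 3 + 10 * (6 * (b : Ω 2)) ^ 2 * ε -
        5 * (6 * (b : Ω 2)) * ε ^ 2 + ε ^ 3) 3 := by
      have hε1 := hεV.ge' (s := 1) (by linarith)
      exact (((((valGE_ofNat 10).neg.mul (h6b.ge.pow 3 le_rfl)).add
        (((valGE_ofNat 10).mul (h6b.ge.pow 2 le_rfl) le_rfl).mul hε1)).sub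
        (((valGE_ofNat 5).mul h6b.ge le_rfl).mul (hε1.pow 2 le_rfl)))).add
        (hε1.pow 3)
    have h3 := (h6.mul (hεV.mul (h1.add (hεV.ge.mul h2 le_rfl) (by linarith)) rfl)
      (t := (m : ℝ) + 7) (by ring))
    rw [deriv_formula, add_comm]
    convert h3.add hDV.ge (by linarith) using 1
    ring
  have hf : ValGE ((y : Ω 2) ^ 6 + (a : Ω 2) * (y : Ω 2) + (b : Ω 2))
      (2 * ((m : ℝ) + 2)) := by
    refine ValGE.of_mul (y := (5 * (a : Ω 2)) ^ 6) (r := 2 * (m : ℝ) + 10) ?_ (h5a.pow 6 rfl)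
      (by push_cast; linarith)
    have hint := valGE_of_dvd (p := 2) (k := 2)
      (four_dvd_of_halves (e := 2 ^ m * (2 * j + 1)) hD₂' hb (u := 2 * j + 1) ⟨j, rfl⟩)
    have hDc : 5 ^ 5 * (a : Ω 2) ^ 6 - 6 ^ 6 * (b : Ω 2) ^ 5 =
        2 ^ (2 * (m + 2) + 4) * D₂ := by exact_mod_cast congrArg (Int.cast : ℤ → Ω 2) hD₂
    rw [value_formula, hDc]
    set ε := 5 * (a : Ω 2) * (y : Ω 2) + 6 * (b : Ω 2) with hεd
    have h2 : ValGE (-20 * (6 * (b : Ω 2)) ^ 3 * ε +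
        15 * (6 * (b : Ω 2)) ^ 2 * ε ^ 2 -
        6 * (6 * (b : Ω 2)) * ε ^ 3 + ε ^ 4) 6 := by
      have hε2 := hεV.ge' (s := 2) (by linarith)
      have h20 : ValGE (20 : Ω 2) 1 := by
        have := valGE_even (show Even (20 : ℤ) by decide)
        exact_mod_cast this
      exact ((((h20.neg.mul (h6b.ge.pow 3 le_rfl) le_rfl).mul hε2).add
        (((valGE_ofNat 15).mul (h6b.ge.pow 2 le_rfl) le_rfl).mul (hε2.pow 2 le_rfl))).sub
        ((h6.ge.mul h6b.ge le_rfl).mul (hε2.pow 3 le_rfl))).add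
        (hε2.pow 4)
    convert ((valEq_two_pow (2 * (m + 2) + 4)).ge.mul hint (t := 2 * (m : ℝ) + 10)
      (by push_cast; linarith)).add
      ((hεV.ge.pow 2 le_rfl).mul h2 (t := 2 * (m : ℝ) + 10) (by push_cast; linarith)) using 1
    rw [show 5 * (a : Ω 2) * (y : Ω 2) + 5 * (b : Ω 2) = ε - b by
      rw [hεd]; ring, hεc]
    push_cast
    ring
  refine ⟨hodd, hf', hf, fun t ht => lastNum_valGE ht hf'.ge ?_⟩
  exact hf.mul (quartic_valGE (valGE_intCast y) ((root_valGE ht).sub (valGE_intCast y)))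
    (by linarith)

theorem rowHolds_two_last_halves {D₂ : ℤ} (hS : IsTrinomialGenerator θ a b) (ha : a = 2 * A)
    (hA : Odd A) (hb : b = 4 * c + 1) (hk : 2 ≤ k)
    (hd : padicValInt 2 Δ(a,b) = 2 * k + 4)
    (hD₂ : Δ(a,b) = 2 ^ (2 * k + 4) * D₂) (hD₂' : D₂ ≡ 3 [ZMOD 4]) :
    RowHolds 2 θ Δ(a,b) {n | 8 ≤ n ∧ Even n} 4
      {α | ∃ x : ℤ, 5 * A * x - 2 ^ (k - 1) + 3 * b ≡ 0 [ZMOD 2 ^ k] ∧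
        α = ![1, θ, θ ^ 2, θ ^ 3, θ ^ 4, lastElt 2 θ x k]} := by
  obtain ⟨-, -, hb0⟩ := valEq_two_unit_data ha hA hb
  have hk' : (2 : ℝ) ≤ k := by exact_mod_cast hk
  obtain ⟨x, hx⟩ := exists_dvd_mul_add (not_two_dvd_five_mul hA) (-2 ^ (k - 1) + 3 * b) k
  rw [Nat.cast_ofNat] at hx
  have hxP : 5 * A * x - 2 ^ (k - 1) + 3 * b ≡ 0 [ZMOD 2 ^ k] :=
    Int.modEq_zero_iff_dvd.mpr (by convert hx using 1; ring)
  have hI := fun y => last_data_of_halves (y := y) hS.discr_ne_zero ha hA hb hk hd hD₂ hD₂'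
  obtain ⟨hx1, hf', hf, hL⟩ := hI x hxP
  refine rowHolds_two_last hS (x := x) (by rw [hd]; exact ⟨by omega, ⟨k + 2, by ring⟩⟩)
    (by rw [hd]; ring) (fun y hy => (hI y hy).2.2.2) hxP hf'.ge ?_
  intro d hd
  obtain ⟨h0, h1, h2, h3⟩ := even_coeffs_of_shifted ha hA hb hx1 (by omega) hf'.ge hf hL hd
  obtain ⟨t, ht, -, hq⟩ := exists_root_near_int hb0 hx1 (s := 2 * k) (by linarith) hf
  refine dvd_of_last_values (hd t ht) (shiftedValues_valGE hf'.ge hL ht) h0 h1 h2 h3 hq (.inl ?_)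
  obtain ⟨r, hr, -, s1, s2, s3, s4, s5⟩ := exists_roots (a : Ω 2) (b : Ω 2)
  have htr : ValGE (∑ j, ((d 4 : Ω 2) * shiftedValues a x k (r j) 4 +
      (d 5 : Ω 2) * shiftedValues a x k (r j) 5)) 1 := by
    refine ValGE.sum fun j _ => ?_
    have hγ := shiftedValues_valGE hf'.ge hL (hr j)
    have hdv : ∀ i, ((2 : ℕ) : ℤ) ∣ d i →
        ValGE ((d i : Ω 2) * shiftedValues a x k (r j) i) 1 := fun i hi =>
      (valGE_one_of_dvd hi).mul (hγ i) (by simp)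
    convert ((((hd _ (hr j)).sub (hdv 0 h0)).sub (hdv 1 h1)).sub (hdv 2 h2)).sub (hdv 3 h3) using 1
    rw [Fin.sum_univ_six]
    ring
  have h4 : ∑ j, shiftedValues a x k (r j) 4 = 6 := by
    have : ∀ j, shiftedValues a x k (r j) 4 = r j ^ 4 + 2 * r j ^ 3 + 3 * r j ^ 2 + 2 * r j + 1 := by
      intro j; simp [shiftedValues]; ring
    simp only [this, Finset.sum_add_distrib, ← Finset.mul_sum, s1, s2, s3, s4]
    simp
  have h5 : ∑ j, shiftedValues a x k (r j) 5 =
      (6 * (x : Ω 2) ^ 5 + (a : Ω 2)) / 2 ^ k := by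
    have : ∀ j, shiftedValues a x k (r j) 5 = (((x : Ω 2) ^ 5 + a) +
        (x : Ω 2) ^ 4 * r j + (x : Ω 2) ^ 3 * r j ^ 2 + (x : Ω 2) ^ 2 * r j ^ 3 +
        (x : Ω 2) * r j ^ 4 + r j ^ 5) / 2 ^ k := by
      intro j; simp [shiftedValues, lastNum]; ring
    simp only [this, ← Finset.sum_div, Finset.sum_add_distrib, ← Finset.mul_sum, s1, s2, s3, s4, s5]
    simp
    ring
  rw [Finset.sum_add_distrib, ← Finset.mul_sum, ← Finset.mul_sum, h4, h5] at htr
  refine dvd_of_valGE_mul (t := 1) (r := 0) ?_ (hf'.div (valEq_two_pow k) (by simp)) one_pos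
  convert htr.sub ((valGE_intCast (d 4)).mul valEq_six_two.ge (t := 1)) using 1
  ring

end TwoLastRows


section Elimination

variable {p : ℕ} [hp : Fact p.Prime] {a b : ℤ} {d : Fin 6 → ℤ}

/-- Successive elimination: the coefficients outside `S` are shown to be divisible by `p` in the
order given by `rank`, the coefficient `d i` at the place `τ i`. -/
theorem dvd_of_rank {T : Type*} {γ : T → Fin 6 → Ω p}
    (h : ∀ τ, ValGE (∑ i, (d i : Ω p) * γ τ i) 1) (m : ℕ) (n : T → Fin 6 → ℕ)
    (hv : ∀ τ i, ValGE (γ τ i) ((n τ i : ℝ) / m)) (S : Finset (Fin 6))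
    (hS : ∀ i ∈ S, (p : ℤ) ∣ d i) (rank : Fin 6 → ℕ) (τ : Fin 6 → T)
    (heq : ∀ i, i ∉ S → ValEq (γ (τ i) i) ((n (τ i) i : ℝ) / m))
    (hn : ∀ i, i ∉ S → n (τ i) i < m ∧ ∀ j, j ∉ S → j ≠ i → rank i ≤ rank j →
      n (τ i) i < n (τ i) j) (i : Fin 6) : (p : ℤ) ∣ d i := by
  induction hr : rank i using Nat.strong_induction_on generalizing i with
  | _ r ih =>
    subst hr
    by_cases hi : i ∈ S
    · exact hS i hi
    have hm : (0 : ℝ) < m := by exact_mod_cast (Nat.zero_le _).trans_lt (hn i hi).1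
    have h0 : ∀ τ j, ValGE (γ τ j) 0 := fun τ j => (hv τ j).mono (by positivity)
    refine dvd_of_min (h (τ i)) i (by rw [div_lt_one hm]; exact_mod_cast (hn i hi).1) (heq i hi) ?_
    intro j hj
    by_cases hjS : j ∈ S
    · exact .inl ⟨hS j hjS, h0 _ _⟩
    rcases lt_or_ge (rank j) (rank i) with hlt | hge
    · exact .inl ⟨ih _ hlt j rfl, h0 _ _⟩
    · refine .inr ⟨_, ?_, hv _ _⟩
      rw [div_lt_div_iff_of_pos_right hm]
      exact_mod_cast (hn i hi).2 j hjS hj hge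

/-- An integral function of the roots whose trace is a unit takes a unit value. -/
theorem exists_root_valEq_of_trace {F : Ω p → Ω p}
    (hF : ∀ t : Ω p, t ^ 6 + a * t + b = 0 → ValGE (F t) 0)
    (htr : ∀ r : Fin 6 → Ω p, (∀ i, r i ^ 6 + a * r i + b = 0) → (∑ i, r i = 0) →
      (∑ i, r i ^ 2 = 0) → (∑ i, r i ^ 3 = 0) → (∑ i, r i ^ 4 = 0) → (∑ i, r i ^ 5 = -5 * a) →
      ValEq (∑ i, F (r i)) 0) :
    ∃ t : Ω p, t ^ 6 + a * t + b = 0 ∧ ValEq (F t) 0 := by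
  obtain ⟨r, hr, -, h1, h2, h3, h4, h5⟩ := exists_roots (a : Ω p) (b : Ω p)
  have htr := htr r hr h1 h2 h3 h4 h5
  by_contra! hno
  obtain ⟨s, hs, h8⟩ := exists_gt_valGE_sum (T := Finset.univ) (f := fun i => F (r i)) (r := 0)
    fun i _ => exists_gt_valGE (lt_of_le_of_ne (hF _ (hr i)) (by
      simpa [ValEq] using hno (r i) (hr i)))
  have := htr.le_of_ge h8
  linarith

/-- The roots close to an integer at which the Newton polygon of the trinomial has a segment of
slope `w` and length two, if `p` divides `15`. -/
theorem exists_root_near_pair {x z₀ : Ω p} {w e s : ℝ} (h15 : ValEq (15 : Ω p) 1)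
    (h20 : ValGE (20 : Ω p) e) (hx : ValEq x 0)
    (hf : ValEq (x ^ 6 + (a : Ω p) * x + (b : Ω p)) (1 + 2 * w))
    (hf' : ValGE (6 * x ^ 5 + (a : Ω p)) s) (hs : 1 + w < s) (he : 1 < e + w) (hw : 1 / 3 < w)
    (hz₀ : 15 * x ^ 4 * z₀ ^ 2 = -(x ^ 6 + a * x + b)) :
    ValEq z₀ w ∧ ∃ t : Ω p, t ^ 6 + a * t + b = 0 ∧ ∃ c, w < c ∧ ValGE (t - (x + z₀)) c := by
  have hz : ValEq z₀ w := by
    refine ValEq.of_pow (n := 2) (r := 2 * w) two_ne_zero ?_ (by push_cast; ring)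
    refine ValEq.of_mul (y := 15 * x ^ 4) (r := 1 + 2 * w) ?_ (h15.mul (hx.pow 4 rfl) rfl)
      (by push_cast; ring)
    rw [mul_comm, hz₀]
    exact hf.neg
  refine ⟨hz, exists_root_near (ξ := x + z₀) (ξ' := x) (s := min (min (s + w) (e + 3 * w))
    (min (1 + 4 * w) (5 * w))) (r := 1 + 2 * w) (c := w) ?_ hf ?_ ?_⟩
  · have hx0 (n : ℕ) : ValGE (x ^ n) 0 := hx.ge.pow n (by simp)
    have hzn (n : ℕ) : ValGE (z₀ ^ n) (n * w) := hz.ge.pow n le_rfl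
    set r := min (min (s + w) (e + 3 * w)) (min (1 + 4 * w) (5 * w))
    have r1 : r ≤ s + w := (min_le_left _ _).trans (min_le_left _ _)
    have r2 : r ≤ e + 3 * w := (min_le_left _ _).trans (min_le_right _ _)
    have r3 : r ≤ 1 + 4 * w := (min_le_right _ _).trans (min_le_left _ _)
    have r4 : r ≤ 5 * w := (min_le_right _ _).trans (min_le_right _ _)
    have e1 := hf'.mul hz.ge r1
    have e2 := (h20.mul (hx0 3) le_rfl).mul (hzn 3) (t := r) (by push_cast; linarith)
    have e3 := (h15.ge.mul (hx0 2) le_rfl).mul (hzn 4) (t := r) (by push_cast; linarith)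
    have e4 := (((valGE_ofNat 6).mul hx.ge le_rfl).add (hz.ge.mono (s := 0 + 0) (by linarith))).mul
      (hzn 5) (t := r) (by push_cast; linarith)
    convert ((e1.add e2).add e3).add e4 using 1
    linear_combination hz₀
  · exact lt_min (lt_min (by linarith) (by linarith)) (lt_min (by linarith) (by linarith))
  · rw [sub_add_cancel_left]
    exact hz.neg

theorem valEq_of_near {x y z : Ω p} {c w : ℝ} (hz : ValEq z w) (hc : w < c)
    (h : ValGE (x - (y + z)) c) : ValEq (x - y) w := by
  convert hz.add h hc using 1; ring

end Elimination

section Five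

variable {K : Type*} [Field K] [NumberField K] {θ : K} {a b β : ℤ}

theorem expansion_five {t a b : Ω 5} (ht : t ^ 6 + a * t + b = 0) :
    (t + a) ^ 5 * (t - 5 * a) = -((a ^ 6 - a ^ 2 + b) + (a - 6 * a ^ 5) * (t + a) +
      5 * (3 * a ^ 4 * (t + a) ^ 2 - 4 * a ^ 3 * (t + a) ^ 3 + 3 * a ^ 2 * (t + a) ^ 4)) := by
  linear_combination ht

theorem expansion_rest_valGE {a u : Ω 5} {w : ℝ} (ha : ValGE a 0) (hu : ValGE u w)
    (hw : 0 ≤ w) :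
    ValGE (5 * (3 * a ^ 4 * u ^ 2 - 4 * a ^ 3 * u ^ 3 + 3 * a ^ 2 * u ^ 4)) (1 + 2 * w) := by
  have ha' (n : ℕ) : ValGE (a ^ n) 0 := ha.pow n (by simp)
  have hu' (n : ℕ) (hn : 2 ≤ n) : ValGE (u ^ n) (2 * w) :=
    hu.pow n (mul_le_mul_of_nonneg_right (by exact_mod_cast hn) hw)
  exact valEq_five.ge.mul (((((valGE_ofNat 3).mul (ha' 4) (t := 0) (by simp)).mul (hu' 2 le_rfl)
    (t := 2 * w) (by simp)).sub (((valGE_ofNat 4).mul (ha' 3) (t := 0) (by simp)).mul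
      (hu' 3 (by norm_num)) (by simp))).add
    (((valGE_ofNat 3).mul (ha' 2) (t := 0) (by simp)).mul (hu' 4 (by norm_num)) (by simp))) le_rfl

theorem valEq_sub_five_mul {t : Ω 5} (ht : ValEq t 0) :
    ValEq (t - 5 * (a : Ω 5)) 0 := by
  rw [sub_eq_add_neg]
  exact ht.add (valEq_five.ge.mul (valGE_intCast a) (t := 1) (by simp)).neg one_pos

theorem add_valGE_five {t : Ω 5} {w₀ e₀ e₁ : ℝ} (ht : t ^ 6 + a * t + b = 0)
    (h0 : ValEq t 0)
    (hc₀ : ValGE ((a : Ω 5) ^ 6 - (a : Ω 5) ^ 2 + (b : Ω 5)) e₀)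
    (hc₁ : ValGE ((a : Ω 5) - 6 * (a : Ω 5) ^ 5) e₁)
    (h5 : 5 * w₀ ≤ e₀) (h4 : 4 * w₀ ≤ e₁) (h3 : 3 * w₀ ≤ 1) :
    ValGE (t + (a : Ω 5)) w₀ := by
  by_cases hu0 : t + (a : Ω 5) = 0
  · rw [hu0]; exact valGE_zero _
  obtain ⟨w, hw⟩ := exists_valEq hu0
  by_contra hcon
  have hlt : w < w₀ := by
    by_contra hge
    exact hcon (hw.ge' (not_lt.mp hge))
  have hw0 : 0 ≤ w := hw.le_of_ge (h0.ge.add (valGE_intCast a))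
  have h := expansion_five ht
  have h1 := ((hw.pow 5 rfl).mul (valEq_sub_five_mul (a := a) h0) rfl)
  rw [h] at h1
  set s := min e₀ (min (e₁ + w) (1 + 2 * w))
  have h2 := h1.le_of_ge (s := s) (((hc₀.mono (min_le_left _ _)).add ((hc₁.mul hw.ge le_rfl).mono
    ((min_le_right _ _).trans (min_le_left _ _)))).add
    ((expansion_rest_valGE (valGE_intCast a) hw.ge hw0).mono
      ((min_le_right _ _).trans (min_le_right _ _)))).neg
  have : 5 * w < s := lt_min (by linarith) (lt_min (by linarith) (by linarith))
  push_cast at h2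
  linarith

theorem add_valEq_five {t : Ω 5} (ht : t ^ 6 + a * t + b = 0) (h0 : ValEq t 0)
    (hc₀ : ValEq ((a : Ω 5) ^ 6 - (a : Ω 5) ^ 2 + (b : Ω 5)) 1)
    (hc₁ : ValGE ((a : Ω 5) - 6 * (a : Ω 5) ^ 5) 1) :
    ValEq (t + (a : Ω 5)) (1 / 5) := by
  have hu := add_valGE_five ht h0 hc₀.ge hc₁ (w₀ := 1 / 5) (by norm_num) (by norm_num) (by norm_num)
  refine ValEq.of_pow (n := 5) (r := 1) (by norm_num) ?_
  refine ValEq.of_mul (y := t - 5 * (a : Ω 5)) (r := 1) ?_ (valEq_sub_five_mul h0) (by simp)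
  rw [expansion_five ht]
  refine ((hc₀.add (s := 6 / 5) (hc₁.mul hu (by norm_num)) (by norm_num)).add (s := 6 / 5)
    ((expansion_rest_valGE (valGE_intCast a) hu (by norm_num)).mono (by norm_num))
    (by norm_num)).neg

theorem deriv_coeff_valGE_five (a : ℤ) :
    ValGE ((a : Ω 5) - 6 * (a : Ω 5) ^ 5) 1 := by
  have := valGE_one_of_dvd (p := 5) (n := a - 6 * a ^ 5) ?_
  · push_cast at this; exact this
  · have h : a ^ 5 ≡ a [ZMOD 5] := by
      have := ZMod.pow_card (p := 5) (a : ZMod 5)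
      exact (ZMod.intCast_eq_intCast_iff _ _ 5).mp (by push_cast; exact this)
    have h2 := (Int.ModEq.refl a).sub ((Int.ModEq.refl 6).mul h)
    refine Int.modEq_zero_iff_dvd.mp (h2.trans (Int.modEq_zero_iff_dvd.mpr ⟨-a, ?_⟩))
    ring

/-- The lists of the powers of `θ + a`. -/
def translateList (a : ℤ) : Fin 6 → List ℤ :=
  ![[], [a], [a ^ 2, 2 * a], [a ^ 3, 3 * a ^ 2, 3 * a], [a ^ 4, 4 * a ^ 3, 6 * a ^ 2, 4 * a],
    [a ^ 5, 5 * a ^ 4, 10 * a ^ 3, 10 * a ^ 2, 5 * a]]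

theorem rowHolds_five_uniformizer {n : ℕ} (hS : IsTrinomialGenerator θ a b) (ha : ¬ (5 : ℤ) ∣ a)
    (hb : (5 : ℤ) ∣ b) (hc : ValEq ((a ^ 6 - a ^ 2 + b : ℤ) : Ω 5) 1)
    (hD : padicValInt 5 Δ(a,b) = n) :
    RowHolds 5 θ Δ(a,b) {n} n {![1, θ, θ ^ 2, θ ^ 3, θ ^ 4, θ ^ 5]} := by
  have hγ : ∀ (t : Ω 5) i, tri (translateList a) t i / ((5 : ℕ) : Ω 5) ^ (0 : ℕ) =
      (fun i : Fin 6 => (t + (a : Ω 5)) ^ (i : ℕ)) i := by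
    intro t i; fin_cases i <;> simp [tri, translateList, Finset.sum_range_succ] <;> ring
  push_cast at hc
  have haV : ValEq (a : Ω 5) 0 := valEq_intCast (p := 5) (by exact_mod_cast ha)
  have hbV : ValGE (b : Ω 5) (0 + 1) := by
    simpa using valGE_one_of_dvd (p := 5) (by exact_mod_cast hb)
  refine rowHolds_single' hS (k := fun _ => 0) hD (by simp) (.of_eq _ hγ ?_) (.of_eq _ hγ ?_)
    integralFamily_zero rfl (fun _ _ _ => le_rfl)
    (by ext i; fin_cases i <;> simp [family, tri])
  · intro t ht i
    exact ((root_valGE ht).add haV.ge).pow _ (by simp)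
  · intro d hd
    obtain ⟨t1, ht1, h1⟩ := exists_root_valEq_div_five (by norm_num) haV hbV
    obtain ⟨t2, ht2, h2⟩ := exists_root_valGE_one (by norm_num) haV hbV
    have hu1 := add_valEq_five ht1 (h1.congr) hc (deriv_coeff_valGE_five a)
    have hu2 : ValEq (t2 + (a : Ω 5)) 0 := by
      rw [add_comm]; exact haV.add h2 one_pos
    refine dvd_of_rank (T := Fin 2) (γ := fun j i => ((![t1, t2] : Fin 2 → Ω 5) j +
      (a : Ω 5)) ^ (i : ℕ)) ?_ 5 ![![0, 1, 2, 3, 4, 5], ![0, 0, 0, 0, 0, 0]] ?_ ∅ (by simp)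
      (fun i => i) ![0, 0, 0, 0, 0, 1] ?_ (by decide)
    · intro j; fin_cases j
      exacts [hd t1 ht1, hd t2 ht2]
    · intro j i
      fin_cases j
      · exact hu1.ge.pow _ (by fin_cases i <;> norm_num)
      · exact hu2.ge.pow _ (by fin_cases i <;> norm_num)
    · intro i _
      fin_cases i
      exacts [hu1.pow 0, hu1.pow 1, hu1.pow 2,
        hu1.pow 3, hu1.pow 4, hu2.pow 5]

/-- The lists of `(θ + a) ^ i` for `i ≤ 4` and of `θ * (θ + a) ^ 4`. -/
def quarterList (a : ℤ) : Fin 6 → List ℤ :=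
  ![[], [a], [a ^ 2, 2 * a], [a ^ 3, 3 * a ^ 2, 3 * a], [a ^ 4, 4 * a ^ 3, 6 * a ^ 2, 4 * a],
    [0, a ^ 4, 4 * a ^ 3, 6 * a ^ 2, 4 * a]]

theorem pow_four_sub_one_valGE (ha : ¬ (5 : ℤ) ∣ a) : ValGE ((a : Ω 5) ^ 4 - 1) 1 := by
  have := valGE_one_of_dvd (p := 5) (n := a ^ 4 - 1) ?_
  · push_cast at this; exact this
  · have h0 : (a : ZMod 5) ≠ 0 := by
      rwa [Ne, ZMod.intCast_zmod_eq_zero_iff_dvd]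
    have h := ZMod.pow_card_sub_one_eq_one h0
    refine (ZMod.intCast_zmod_eq_zero_iff_dvd _ 5).mp ?_
    push_cast
    exact sub_eq_zero.mpr h

theorem rowHolds_five_quarter (hS : IsTrinomialGenerator θ a b) (ha : ¬ (5 : ℤ) ∣ a)
    (hb : b = 5 * β) (hc₀ : (25 : ℤ) ∣ a ^ 6 - a ^ 2 + b)
    (hc₁ : ValEq ((a : Ω 5) - 6 * (a : Ω 5) ^ 5) 1)
    (hβ : ¬ (5 : ℤ) ∣ 6 * β + 4 * a ^ 2)
    (hD : padicValInt 5 Δ(a,b) = 5) :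
    RowHolds 5 θ Δ(a,b) {5} 3
      {![1, θ, θ ^ 2, θ ^ 3, θ ^ 4,
        (θ - a ^ 3 * θ ^ 2 + a ^ 2 * θ ^ 3 - a * θ ^ 4 + θ ^ 5) / 5]} := by
  have haV : ValEq (a : Ω 5) 0 := valEq_intCast (p := 5) (by exact_mod_cast ha)
  have hbV : ValGE (b : Ω 5) (0 + 1) := by
    simpa using valGE_one_of_dvd (p := 5) (by exact_mod_cast Dvd.intro β hb.symm)
  have hc₀V : ValGE ((a : Ω 5) ^ 6 - (a : Ω 5) ^ 2 + (b : Ω 5)) 2 := by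
    have := valGE_of_dvd (p := 5) (k := 2) (by exact_mod_cast hc₀ : ((5 : ℕ) : ℤ) ^ 2 ∣ _)
    push_cast at this; exact this
  set V : Ω 5 → Fin 6 → Ω 5 := fun t => ![1, t + a, (t + a) ^ 2, (t + a) ^ 3,
    (t + a) ^ 4, t * (t + a) ^ 4 / 5] with hVdef
  have hγ : ∀ (t : Ω 5) i, tri (quarterList a) t i / ((5 : ℕ) : Ω 5) ^
      (![0, 0, 0, 0, 0, 1] : Fin 6 → ℕ) i = V t i := by
    intro t i; fin_cases i <;> simp [tri, quarterList, hVdef, Finset.sum_range_succ] <;> ring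
  have hcase : ∀ t : Ω 5, t ^ 6 + a * t + b = 0 →
      ValGE t 1 ∨ (ValEq t 0 ∧ ValGE (t + (a : Ω 5)) (1 / 4)) := by
    intro t ht
    refine (valGE_one_or_valEq (by norm_num) haV hbV ht).imp id fun h => ?_
    have h0 := h.congr (s := 0)
    exact ⟨h0, add_valGE_five ht h0 hc₀V hc₁.ge (by norm_num) (by norm_num) (by norm_num)⟩
  have hlast : ∀ t : Ω 5, t ^ 6 + a * t + b = 0 → ValGE (t * (t + (a : Ω 5)) ^ 4 / 5) 0 := by
    intro t ht
    have hu := (root_valGE ht).add haV.ge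
    rcases hcase t ht with h | ⟨h0, h⟩
    · exact (h.mul (hu.pow 4 le_rfl) le_rfl).div valEq_five
    · exact (h0.ge.mul (h.pow 4 le_rfl) le_rfl).div valEq_five
  have hVI : ∀ t : Ω 5, t ^ 6 + a * t + b = 0 → ∀ i, ValGE (V t i) 0 := by
    intro t ht i
    have hu := (root_valGE ht).add haV.ge
    fin_cases i
    exacts [valEq_one.ge, hu, hu.pow 2 (by simp), hu.pow 3 (by simp), hu.pow 4 (by simp),
      hlast t ht]
  refine rowHolds_single' hS (l := quarterList a) (l' := ![[], [], [], [], [], [0, 1, -a ^ 3, a ^ 2, -a]])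
    (k := ![0, 0, 0, 0, 0, 1]) hD (by decide) (.of_eq V hγ hVI) (.of_eq V hγ ?_) ?_ rfl
    (monotone_last 1) ?_
  · intro d hd
    obtain ⟨t1, ht1, h1⟩ := exists_root_valGE_one (by norm_num) haV hbV
    have hu1 : ValEq (t1 + (a : Ω 5)) 0 := by
      rw [add_comm]; exact haV.add h1 one_pos
    -- a root close to `-a`
    obtain ⟨t2, ht2, hu2⟩ : ∃ t : Ω 5, t ^ 6 + a * t + b = 0 ∧
        ValGE (t + (a : Ω 5)) (1 / 2) := by
      obtain ⟨η, hη⟩ := exists_pow_eq (p := 5) (n := 2) two_pos 5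
      have hηV : ValEq η (1 / 2) := .of_pow two_ne_zero (hη ▸ valEq_five)
      obtain ⟨t, ht, c, hc, h⟩ := exists_root_near (a := a) (b := b) (ξ := -(a : Ω 5))
        (ξ' := -(a : Ω 5) + η) (r := 3 / 2) (s := 2) (c := 1 / 2)
        (by convert hc₀V using 1; ring) (by
          have e1 := hc₁.mul hηV (t := 3 / 2) (by norm_num)
          have e2 := (expansion_rest_valGE haV.ge hηV.ge (by norm_num)).mono (s := 2) (by norm_num)
          have e3 : ValGE (η ^ 5 * (η - 6 * (a : Ω 5))) 2 :=
            (hηV.ge.pow 5 le_rfl).mul ((hηV.ge' (s := 0)).sub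
              ((valGE_ofNat 6).mul haV.ge))
          convert e1.add ((hc₀V.add e2).add e3) (by norm_num) using 1
          ring) (by norm_num) (by simpa using hηV)
      exact ⟨t, ht, by simpa using h.mono hc.le⟩
    -- a root at distance `1 / 4` from `-a`
    obtain ⟨t3, ht3, h3⟩ := exists_root_valEq_of_trace (p := 5) (a := a) (b := b)
      (F := fun t => t * (t * (t + (a : Ω 5)) ^ 4 / 5))
      (fun t ht => (root_valGE ht).mul (hlast t ht) (by simp)) (by
        intro r hr s1 s2 s3 s4 s5
        have : ∀ i, r i * (r i * (r i + (a : Ω 5)) ^ 4 / 5) = ((-(a : Ω 5) * r i - b) +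
            4 * (a : Ω 5) * r i ^ 5 + 6 * (a : Ω 5) ^ 2 * r i ^ 4 +
            4 * (a : Ω 5) ^ 3 * r i ^ 3 + (a : Ω 5) ^ 4 * r i ^ 2) / 5 := by
          intro i; linear_combination hr i / 5
        simp only [this, ← Finset.sum_div, Finset.sum_add_distrib, Finset.sum_sub_distrib,
          ← Finset.mul_sum, s1, s2, s3, s4, s5]
        convert (valEq_intCast (p := 5) (by exact_mod_cast hβ)).neg using 1
        rw [hb]; push_cast; simp; ring)
    have h3' : ValEq t3 0 ∧ ValEq (t3 + (a : Ω 5)) (1 / 4) := by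
      rcases hcase t3 ht3 with h | ⟨h0, h⟩
      · exfalso
        have := h3.le_of_ge (h.mul (hlast t3 ht3) le_rfl)
        norm_num at this
      · refine ⟨h0, .of_pow (n := 4) (r := 1) (by norm_num) ?_⟩
        refine ValEq.of_mul (y := t3 * t3 / 5) (r := 0) ?_ ((h0.mul h0 rfl).div valEq_five rfl)
        convert h3 using 1; ring
    obtain ⟨h30, hu3⟩ := h3'
    have hτ : ∀ j, (![t1, t2, t3] : Fin 3 → Ω 5) j ^ 6 +
        a * (![t1, t2, t3] : Fin 3 → Ω 5) j + b = 0 := by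
      intro j; fin_cases j
      exacts [ht1, ht2, ht3]
    refine dvd_of_rank (fun j => hd _ (hτ j)) 4 ![![0, 0, 0, 0, 0, 0], ![0, 2, 4, 4, 4, 4],
      ![0, 1, 2, 3, 4, 0]] ?_ ∅ (by simp) ![0, 2, 3, 4, 5, 1] ![1, 2, 2, 2, 0, 2] ?_ (by decide)
    · intro j i
      fin_cases j
      · exact (hVI t1 ht1 i).mono (by fin_cases i <;> norm_num)
      · fin_cases i
        exacts [valEq_one.ge', hu2.mono, hu2.pow 2,
          hu2.pow 3, hu2.pow 4,
          ((root_valGE ht2).mul (hu2.pow 4 le_rfl) le_rfl).div valEq_five]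
      · fin_cases i
        exacts [valEq_one.ge', hu3.ge', hu3.ge.pow 2,
          hu3.ge.pow 3, hu3.ge.pow 4, (hlast t3 ht3).mono]
    · intro i _
      fin_cases i
      exacts [valEq_one.congr,
        hu3.congr (s := ((1 : ℕ) : ℝ) / ((4 : ℕ) : ℝ)),
        hu3.pow 2 (t := ((2 : ℕ) : ℝ) / ((4 : ℕ) : ℝ)),
        hu3.pow 3 (t := ((3 : ℕ) : ℝ) / ((4 : ℕ) : ℝ)), hu1.pow 4,
        (h30.mul (hu3.pow 4 rfl) rfl).div valEq_five (t := ((0 : ℕ) : ℝ) / ((4 : ℕ) : ℝ))]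
  · refine integralFamily_of_last fun t ht => ?_
    have h0 := root_valGE ht
    have h5 : ValGE (5 : Ω 5) 1 := valEq_five.ge
    have e1 : ValGE (t * (t + (a : Ω 5)) ^ 4) 1 := by
      have := (hlast t ht).mul h5 (t := 1)
      rwa [div_mul_cancel₀ _ valEq_five.ne_zero] at this
    have e2 := (pow_four_sub_one_valGE ha).mul h0 (t := 1)
    have e3 : ValGE (5 * ((a : Ω 5) ^ 3 * t ^ 2 + (a : Ω 5) ^ 2 * t ^ 3 +
        (a : Ω 5) * t ^ 4)) 1 :=
      h5.mul ((((haV.ge.pow 3 le_rfl).mul (h0.pow 2 le_rfl) (t := 0)).add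
        ((haV.ge.pow 2 le_rfl).mul (h0.pow 3 le_rfl))).add
        (haV.ge.mul (h0.pow 4 le_rfl)))
    convert ((e1.sub e2).sub e3) using 1
    · push_cast; ring
    · norm_num
  · ext i; fin_cases i <;> simp [family, tri, Finset.sum_range_succ]
    ring

end Five


section FiveLast

variable {K : Type*} [Field K] [NumberField K] {θ : K} {a b β x : ℤ} {k d : ℕ}

theorem quartic_valGE_one_five {x z : Ω 5} (hx : ValGE x 0) (hz : ValGE z (1 / 3)) :
    ValGE (quartic x z) 1 := by
  have h0 := hz.mono (s := 0)
  have hx' (n : ℕ) : ValGE (x ^ n) 0 := hx.pow n (by simp)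
  have h1 : ValGE (5 * (3 * x ^ 4 + 4 * x ^ 3 * z + 3 * x ^ 2 * z ^ 2)) 1 :=
    valEq_five.ge.mul ((((valGE_ofNat 3).mul (hx' 4) (t := 0) (by simp)).add
      (((valGE_ofNat 4).mul (hx' 3) le_rfl).mul h0 (by simp))).add
      (((valGE_ofNat 3).mul (hx' 2) le_rfl).mul (h0.pow 2 le_rfl) (by simp))) (by simp)
  convert (h1.add (((valGE_ofNat 6).mul hx le_rfl).mul (hz.pow 3 le_rfl) (t := 1))).add (hz.pow 4 (t := 1)) using 1
  unfold quartic; ring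

/-- The standing assumptions of the case where the discriminant is divisible by `5 ^ 7`. -/
structure FiveSetting (a b β : ℤ) (k d : ℕ) : Prop where
  not_dvd : ¬ (5 : ℤ) ∣ a
  eq : b = 5 * β
  dvd_value : (25 : ℤ) ∣ a ^ 6 - a ^ 2 + b
  dvd_deriv : (25 : ℤ) ∣ a - 6 * a ^ 5
  dvd_sub : (5 : ℤ) ∣ β - a ^ 2
  discr_ne : Δ(a,b) ≠ 0
  valuation : padicValInt 5 Δ(a,b) = d
  one_le : 1 ≤ k
  le : 2 * k + 4 ≤ d
  le' : d ≤ 2 * k + 5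
  lt : 7 ≤ d

namespace FiveSetting

theorem valEq_a (h : FiveSetting a b β k d) : ValEq (a : Ω 5) 0 :=
  valEq_intCast (p := 5) (by exact_mod_cast h.not_dvd)

theorem valEq_b (h : FiveSetting a b β k d) : ValEq (b : Ω 5) 1 := by
  have hβ : ¬ ((5 : ℕ) : ℤ) ∣ β := by
    intro hdiv
    have h1 : (5 : ℤ) ∣ a ^ 2 := by
      have h2 := _root_.dvd_sub (by exact_mod_cast hdiv : (5 : ℤ) ∣ β) h.dvd_sub
      rwa [sub_sub_cancel] at h2
    exact h.not_dvd ((Int.prime_iff_natAbs_prime.mpr (by norm_num) : Prime (5 : ℤ)).dvd_of_dvd_pow h1)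
  rw [h.eq]; push_cast
  exact valEq_five.mul (valEq_intCast hβ) (by simp)

theorem valGE_value (h : FiveSetting a b β k d) :
    ValGE ((a : Ω 5) ^ 6 - (a : Ω 5) ^ 2 + (b : Ω 5)) 2 := by
  have := valGE_of_dvd (p := 5) (k := 2) (by exact_mod_cast h.dvd_value : ((5 : ℕ) : ℤ) ^ 2 ∣ _)
  push_cast at this; exact this

theorem valGE_deriv (h : FiveSetting a b β k d) :
    ValGE ((a : Ω 5) - 6 * (a : Ω 5) ^ 5) 2 := by
  have := valGE_of_dvd (p := 5) (k := 2) (by exact_mod_cast h.dvd_deriv : ((5 : ℕ) : ℤ) ^ 2 ∣ _)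
  push_cast at this; exact this

theorem root_cases (h : FiveSetting a b β k d) {t : Ω 5} (ht : t ^ 6 + a * t + b = 0) :
    ValGE t 1 ∨ (ValEq t 0 ∧ ValGE (t + (a : Ω 5)) (1 / 3)) := by
  refine (valGE_one_or_valEq (by norm_num) h.valEq_a (by simpa using h.valEq_b.ge) ht).imp id
    fun h1 => ?_
  have h0 := h1.congr (s := 0)
  exact ⟨h0, add_valGE_five ht h0 h.valGE_value h.valGE_deriv (by norm_num) (by norm_num)
    (by norm_num)⟩

theorem linear_valGE (h : FiveSetting a b β k d) {N : ℕ} (hx : (5 : ℤ) ^ N ∣ a * x + 6 * β) :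
    ValGE (5 * (a : Ω 5) * (x : Ω 5) + 6 * (b : Ω 5)) ((N : ℝ) + 1) := by
  have h1 := valGE_of_dvd (p := 5) (by exact_mod_cast hx : ((5 : ℕ) : ℤ) ^ N ∣ a * x + 6 * β)
  convert valEq_five.ge.mul h1 (add_comm _ _).le using 1
  rw [h.eq]; push_cast; ring

theorem data (h : FiveSetting a b β k d) : ValEq (5 * (a : Ω 5)) 1 ∧
    ValGE (6 * (b : Ω 5)) 1 ∧
    ValEq (5 ^ 5 * (a : Ω 5) ^ 6 - 6 ^ 6 * (b : Ω 5) ^ 5) d :=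
  ⟨valEq_five.mul h.valEq_a (by simp), (valGE_ofNat 6).mul h.valEq_b.ge (by simp),
    cast_discr_valEq h.discr_ne h.valuation⟩

theorem dvd_add (h : FiveSetting a b β k d) (hx : (5 : ℤ) ∣ a * x + 6 * β) : (5 : ℤ) ∣ x + a := by
  have h1 : (5 : ℤ) ∣ a * (x + a) := by
    obtain ⟨u, hu⟩ := hx
    obtain ⟨v, hv⟩ := h.dvd_sub
    exact ⟨u - v - β, by linear_combination hu - hv⟩
  exact ((Int.prime_iff_natAbs_prime.mpr (by norm_num) : Prime (5 : ℤ)).dvd_or_dvd h1).resolve_left h.not_dvd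

theorem valGE_add (h : FiveSetting a b β k d) (hx : (5 : ℤ) ∣ a * x + 6 * β) :
    ValGE ((x : Ω 5) + (a : Ω 5)) 1 := by
  have := valGE_one_of_dvd (p := 5) (by exact_mod_cast h.dvd_add hx : ((5 : ℕ) : ℤ) ∣ x + a)
  push_cast at this; exact this

theorem valEq_x (h : FiveSetting a b β k d) (hx : (5 : ℤ) ∣ a * x + 6 * β) :
    ValEq (x : Ω 5) 0 := by
  convert h.valEq_a.neg.add (h.valGE_add hx) one_pos using 1; ring

theorem last_valGE (h : FiveSetting a b β k d) (hx : (5 : ℤ) ^ k ∣ a * x + 6 * β) :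
    ValGE (6 * (x : Ω 5) ^ 5 + (a : Ω 5)) k ∧
    ∀ t : Ω 5, t ^ 6 + a * t + b = 0 → ValGE (lastNum (x : Ω 5) t) k := by
  obtain ⟨h5a, h6b, hD⟩ := h.data
  have hε := h.linear_valGE hx
  have hx1 := (dvd_pow_self 5 (Nat.one_le_iff_ne_zero.mp h.one_le)).trans hx
  have r1 : (1 : ℝ) ≤ k := by exact_mod_cast h.one_le
  have r2 : 2 * (k : ℝ) + 4 ≤ d := by exact_mod_cast h.le
  have r3 : (d : ℝ) ≤ 2 * k + 5 := by exact_mod_cast h.le'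
  have r4 : (7 : ℝ) ≤ d := by exact_mod_cast h.lt
  have hf' := deriv_valGE (s := k) h5a h6b hε (by linarith) hD.ge (by linarith) (by linarith)
  have hf := value_valGE (s := d - 5) h5a h6b h.valEq_b.ge hε (by linarith) (by linarith) hD.ge
    (by linarith) (by linarith)
  refine ⟨hf', fun t ht => ?_⟩
  rcases h.root_cases ht with h1 | ⟨-, h1⟩
  · have hz : ValEq (t - (x : Ω 5)) 0 := by
      convert (h.valEq_x hx1).neg.add h1 one_pos using 1; ring
    convert ((lastNum_add_valGE ht hf hz).mono (s := (k : ℝ)) (by linarith)).sub hf' using 1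
    ring
  · refine lastNum_valGE ht hf' (hf.mul (quartic_valGE_one_five (valGE_intCast x) ?_)
      (by linarith))
    convert h1.sub ((h.valGE_add hx1).mono) using 1
    ring

end FiveSetting

/-- The lists of `(θ + a) ^ i` for `i ≤ 3`, of `θ * (θ + a) ^ 3`, and of the shifted numerator of
`lastElt`. -/
def thirdList (a x : ℤ) : Fin 6 → List ℤ :=
  ![[], [a], [a ^ 2, 2 * a], [a ^ 3, 3 * a ^ 2, 3 * a], [0, a ^ 3, 3 * a ^ 2, 3 * a],
    [-5 * x ^ 5 + (6 * x ^ 5 + a), x ^ 4, x ^ 3, x ^ 2, x]]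

/-- The values at a root of the family with lists `thirdList`. -/
noncomputable def thirdValues (a x : ℤ) (k : ℕ) (t : Ω 5) : Fin 6 → Ω 5 :=
  ![1, t + a, (t + a) ^ 2, (t + a) ^ 3, t * (t + a) ^ 3 / 5,
    (lastNum (x : Ω 5) t + (6 * (x : Ω 5) ^ 5 + (a : Ω 5))) / 5 ^ k]

theorem tri_thirdList (a x : ℤ) (k : ℕ) (t : Ω 5) (i : Fin 6) :
    tri (thirdList a x) t i / ((5 : ℕ) : Ω 5) ^ (![0, 0, 0, 0, 1, k] : Fin 6 → ℕ) i =
      thirdValues a x k t i := by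
  fin_cases i <;>
    simp [tri, thirdList, thirdValues, lastNum, Finset.sum_range_succ] <;> ring

theorem monotone_last_two {k : ℕ} (hk : 1 ≤ k) : Monotone (![0, 0, 0, 0, 1, k] : Fin 6 → ℕ) := by
  refine Fin.monotone_iff_le_succ.mpr fun i => ?_
  fin_cases i <;> simp [hk]

theorem valEq_five_pow (k : ℕ) : ValEq ((5 : Ω 5) ^ k) k := by
  exact_mod_cast valEq_prime_pow (p := 5) k

namespace FiveSetting

theorem third_valGE (h : FiveSetting a b β k d) {t : Ω 5} (ht : t ^ 6 + a * t + b = 0) :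
    ValGE (t * (t + (a : Ω 5)) ^ 3 / 5) 0 := by
  rcases h.root_cases ht with h1 | ⟨h0, h1⟩
  · exact (h1.mul (((root_valGE ht).add h.valEq_a.ge).pow 3 le_rfl) le_rfl).div valEq_five
  · exact (h0.ge.mul (h1.pow 3 le_rfl) le_rfl).div valEq_five

theorem thirdValues_valGE (h : FiveSetting a b β k d) (hx : (5 : ℤ) ^ k ∣ a * x + 6 * β)
    {t : Ω 5} (ht : t ^ 6 + a * t + b = 0) (i : Fin 6) :
    ValGE (thirdValues a x k t i) 0 := by
  have hu := (root_valGE ht).add h.valEq_a.ge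
  obtain ⟨hf', hL⟩ := h.last_valGE hx
  fin_cases i
  exacts [valEq_one.ge, hu, hu.pow 2 (by simp), hu.pow 3 (by simp), h.third_valGE ht,
    ((hL t ht).add hf').div (valEq_five_pow k) (by simp)]

theorem integralFamily (h : FiveSetting a b β k d) (hx : (5 : ℤ) ^ k ∣ a * x + 6 * β) :
    IntegralFamily 5 a b ![[], [], [], [], [0, -4 * a ^ 3, 3 * a ^ 2, -2 * a],
      [-5 * x ^ 5, x ^ 4, x ^ 3, x ^ 2, x]] ![0, 0, 0, 0, 1, k] := by
  refine .of_eq (fun t => ![1, t, t ^ 2, t ^ 3,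
    t * (t + a) ^ 3 / 5 - ((a : Ω 5) ^ 3 * t + a * t ^ 3), lastNum (x : Ω 5) t / 5 ^ k])
    ?_ ?_
  · intro t i; fin_cases i <;> simp [tri, lastNum, Finset.sum_range_succ]
    ring
  · intro t ht i
    have h0 := root_valGE ht
    have ha := h.valEq_a.ge
    fin_cases i
    exacts [valEq_one.ge, h0, h0.pow 2 (by simp), h0.pow 3 (by simp),
      (h.third_valGE ht).sub (((ha.pow 3 le_rfl).mul h0 (by simp)).add
        (ha.mul (h0.pow 3 le_rfl) (by simp))),
      ((h.last_valGE hx).2 t ht).div (valEq_five_pow k) (by simp)]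

/-- A root at distance `1 / 3` from `-a`. -/
theorem exists_root_third (h : FiveSetting a b β k d) : ∃ t : Ω 5, t ^ 6 + a * t + b = 0 ∧
    ValEq t 0 ∧ ValEq (t + (a : Ω 5)) (1 / 3) := by
  obtain ⟨t, ht, h1⟩ := exists_root_valEq_of_trace (p := 5) (a := a) (b := b)
    (F := fun t => t * (t * (t + (a : Ω 5)) ^ 3 / 5))
    (fun t ht => (root_valGE ht).mul (h.third_valGE ht) (by simp)) (by
      intro r hr s1 s2 s3 s4 s5
      have : ∀ i, r i * (r i * (r i + (a : Ω 5)) ^ 3 / 5) = (r i ^ 5 +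
          3 * (a : Ω 5) * r i ^ 4 + 3 * (a : Ω 5) ^ 2 * r i ^ 3 +
          (a : Ω 5) ^ 3 * r i ^ 2) / 5 := by
        intro i; ring
      simp only [this, ← Finset.sum_div, Finset.sum_add_distrib, ← Finset.mul_sum, s2, s3, s4, s5]
      convert h.valEq_a.neg using 1
      ring)
  rcases h.root_cases ht with h2 | ⟨h0, h2⟩
  · exfalso
    have := h1.le_of_ge (h2.mul (h.third_valGE ht) le_rfl)
    norm_num at this
  · refine ⟨t, ht, h0, .of_pow (n := 3) (r := 1) (by norm_num) ?_⟩
    refine ValEq.of_mul (y := t * t / 5) (r := 0) ?_ ((h0.mul h0 rfl).div valEq_five rfl)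
    convert h1 using 1; ring

end FiveSetting

theorem not_five_pow (h : FiveSetting a b β k d) (N : ℕ) :
    ∃ x : ℤ, (5 : ℤ) ^ N ∣ a * x + 6 * β := by
  have := exists_dvd_mul_add (p := 5) (by exact_mod_cast h.not_dvd) (6 * β) N
  exact_mod_cast this

/-- The bases of the case where the discriminant is divisible by `5 ^ 7`. -/
theorem rowHolds_five_last {vD : Set ℕ} {vdK : ℕ} (hS : IsTrinomialGenerator θ a b)
    (h : FiveSetting a b β k d) (hD : d ∈ vD) (hsum : d = vdK + 2 * (k + 1))
    (hx : (5 : ℤ) ^ k ∣ a * x + 6 * β)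
    (hM : ∀ d : Fin 6 → ℤ, (∀ t : Ω 5, t ^ 6 + a * t + b = 0 →
      ValGE (∑ i, (d i : Ω 5) * thirdValues a x k t i) 1) → ∀ i, ((5 : ℕ) : ℤ) ∣ d i) :
    RowHolds 5 θ Δ(a,b) vD vdK
      {α | ∃ x : ℤ, a * x + 6 * β ≡ 0 [ZMOD 5 ^ k] ∧ α = ![1, θ, θ ^ 2, θ ^ 3,
          (-4 * a ^ 3 * θ + 3 * a ^ 2 * θ ^ 2 - 2 * a * θ ^ 3 + θ ^ 4) / 5, lastElt 5 θ x k]} := by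
  refine rowHolds_of_saturated hS (l := thirdList a x) (k := ![0, 0, 0, 0, 1, k])
    (by rw [h.valuation]; exact hD)
    (by rw [h.valuation, hsum]; simp [Fin.sum_univ_succ, add_comm])
    (.of_eq _ (tri_thirdList a x k) fun t ht => h.thirdValues_valGE hx ht)
    (.of_eq _ (tri_thirdList a x k) hM) ⟨_, x, Int.modEq_zero_iff_dvd.mpr hx, rfl⟩ rfl
    (monotone_last_two h.one_le) ?_
  rintro _ ⟨y, hy, rfl⟩
  refine ⟨_, h.integralFamily (Int.modEq_zero_iff_dvd.mp hy), ?_⟩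
  ext i; fin_cases i <;> simp [family, tri, lastElt, Finset.sum_range_succ]
  ring

/-- The data attached to an integer `x` of high precision. -/
theorem FiveSetting.precise (h : FiveSetting a b β k d) (hx : (5 : ℤ) ^ d ∣ a * x + 6 * β) :
    ValEq (6 * (x : Ω 5) ^ 5 + (a : Ω 5)) (d - 5) ∧
    ValEq ((x : Ω 5) ^ 6 + (a : Ω 5) * (x : Ω 5) + (b : Ω 5)) (d - 5) ∧
    ValEq (x : Ω 5) 0 ∧ ValGE ((x : Ω 5) + (a : Ω 5)) 1 := by
  obtain ⟨h5a, h6b, hD⟩ := h.data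
  have hε := h.linear_valGE hx
  have r4 : (7 : ℝ) ≤ d := by exact_mod_cast h.lt
  have hx1 := (dvd_pow_self 5 (n := d) (by have := h.lt; omega)).trans hx
  refine ⟨(deriv_valEq h5a h6b hε (by linarith) hD (by linarith)).congr (by ring),
    (value_valEq h5a h6b h.valEq_b hε (by linarith) (by linarith) hD (by linarith)).congr (by ring),
    h.valEq_x hx1, h.valGE_add hx1⟩

/-- The value of the shifted numerator of `lastElt` at a root at a given distance from `x`. -/
theorem lastNum_add_valEq {p : ℕ} [Fact p.Prime] {x t a b : Ω p} {s c r : ℝ}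
    (ht : t ^ 6 + a * t + b = 0) (hv : ValEq (x ^ 6 + a * x + b) s) (hz : ValEq (t - x) c)
    (hr : r = s - c) : ValEq (lastNum x t + (6 * x ^ 5 + a)) r := by
  refine ValEq.of_mul (x := lastNum x t + (6 * x ^ 5 + a)) (y := t - x) (r := s) ?_ hz hr
  rw [mul_comm, sub_mul_lastNum ht]
  exact hv.neg

/-- The values at a root at distance `1 / 3` from `-a`. -/
theorem FiveSetting.third_place (h : FiveSetting a b β k d) (hx : (5 : ℤ) ^ d ∣ a * x + 6 * β)
    {t : Ω 5} (ht : t ^ 6 + a * t + b = 0) (hu : ValEq (t + (a : Ω 5)) (1 / 3))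
    (hkd : k + 6 ≤ d) :
    ValGE (thirdValues a x k t 5) (2 / 3) := by
  obtain ⟨-, hf, -, hxa⟩ := h.precise hx
  have hz : ValEq (t - (x : Ω 5)) (1 / 3) := by
    convert hu.add hxa.neg (by norm_num) using 1; ring
  have : (k : ℝ) + 6 ≤ d := by exact_mod_cast hkd
  exact (lastNum_add_valEq ht hf hz rfl).ge.div (valEq_five_pow k) (by linarith)

theorem valEq_fifteen_five : ValEq (15 : Ω 5) 1 := by
  have := valEq_five.mul (valEq_intCast (p := 5) (n := 3) (by decide)) (t := 1) (by simp)
  norm_num at this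
  exact this

theorem valGE_twenty_five : ValGE (20 : Ω 5) 1 := by
  have := valEq_five.ge.mul (valGE_ofNat 4) (t := 1) (by simp)
  norm_num at this
  exact this

theorem FiveSetting.near_pair (h : FiveSetting a b β k d) (hx : (5 : ℤ) ^ d ∣ a * x + 6 * β)
    {z₀ : Ω 5} (hz₀ : 15 * (x : Ω 5) ^ 4 * z₀ ^ 2 =
      -((x : Ω 5) ^ 6 + a * x + b)) :
    ValEq z₀ ((d - 6) / 2) ∧ ∃ t : Ω 5, t ^ 6 + a * t + b = 0 ∧
      ∃ c, ((d : ℝ) - 6) / 2 < c ∧ ValGE (t - ((x : Ω 5) + z₀)) c := by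
  obtain ⟨hf', hf, hx0, hxa⟩ := h.precise hx
  have r4 : (7 : ℝ) ≤ d := by exact_mod_cast h.lt
  exact exists_root_near_pair valEq_fifteen_five valGE_twenty_five hx0 (hf.congr (by ring)) hf'.ge
    (by linarith) (by linarith) (by linarith) hz₀

theorem exists_sq_eq {p : ℕ} [Fact p.Prime] {x a b : Ω p} (h15 : ValEq (15 : Ω p) 1)
    (hx : ValEq x 0) : ∃ z₀ : Ω p, 15 * x ^ 4 * z₀ ^ 2 = -(x ^ 6 + a * x + b) := by
  obtain ⟨z₀, hz₀⟩ := exists_pow_eq two_pos (-(x ^ 6 + a * x + b) / (15 * x ^ 4))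
  exact ⟨z₀, by rw [hz₀, mul_div_cancel₀]; exact mul_ne_zero h15.ne_zero (pow_ne_zero _ hx.ne_zero)⟩

theorem rowHolds_five_last_odd (hS : IsTrinomialGenerator θ a b) (h : FiveSetting a b β k d)
    (hd : d = 2 * k + 5) :
    RowHolds 5 θ Δ(a,b) {n | 7 ≤ n ∧ Odd n} 3
      {α | ∃ x : ℤ, a * x + 6 * β ≡ 0 [ZMOD 5 ^ k] ∧ α = ![1, θ, θ ^ 2, θ ^ 3,
          (-4 * a ^ 3 * θ + 3 * a ^ 2 * θ ^ 2 - 2 * a * θ ^ 3 + θ ^ 4) / 5, lastElt 5 θ x k]} := by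
  obtain ⟨x, hx⟩ := not_five_pow h d
  have hk := h.one_le
  have hxk : (5 : ℤ) ^ k ∣ a * x + 6 * β := (pow_dvd_pow 5 (by omega)).trans hx
  have hdr : (d : ℝ) = 2 * k + 5 := by exact_mod_cast hd
  have hkr : (1 : ℝ) ≤ k := by exact_mod_cast hk
  obtain ⟨hf', hf, hx0, hxa⟩ := h.precise hx
  refine rowHolds_five_last (x := x) hS h ⟨h.lt, k + 2, by omega⟩ (by omega) hxk fun c hc => ?_
  obtain ⟨t1, ht1, h1⟩ := exists_root_valGE_one (by norm_num) h.valEq_a (by simpa using h.valEq_b.ge)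
  have hu1 : ValEq (t1 + (a : Ω 5)) 0 := by
    rw [add_comm]; exact h.valEq_a.add h1 one_pos
  obtain ⟨t3, ht3, h30, hu3⟩ := h.exists_root_third
  obtain ⟨z₀, hz₀⟩ := exists_sq_eq (a := (a : Ω 5)) (b := (b : Ω 5))
    valEq_fifteen_five hx0
  obtain ⟨hzV, t2, ht2, s, hs, hts⟩ := h.near_pair hx hz₀
  have hz2 := valEq_of_near hzV hs hts
  have hu2 : ValGE (t2 + (a : Ω 5)) (1 / 2) := by
    convert (hz2.ge' (s := 1 / 2) (by linarith)).add (hxa.mono) using 1; ring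
  have hl2 : ValEq (thirdValues a x k t2 5) (1 / 2) :=
    (lastNum_add_valEq ht2 hf hz2 rfl).div (valEq_five_pow k) (by rw [hdr]; ring)
  have hl3 := h.third_place hx ht3 hu3 (by omega)
  have hτ : ∀ j, (![t1, t2, t3] : Fin 3 → Ω 5) j ^ 6 +
      a * (![t1, t2, t3] : Fin 3 → Ω 5) j + b = 0 := by
    intro j; fin_cases j
    exacts [ht1, ht2, ht3]
  refine dvd_of_rank (fun j => hc _ (hτ j)) 6 ![![0, 0, 0, 0, 0, 0], ![0, 3, 6, 6, 3, 3],
    ![0, 2, 4, 6, 0, 4]] ?_ ∅ (by simp) ![0, 2, 4, 5, 1, 3] ![1, 2, 2, 0, 2, 1] ?_ (by decide)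
  · intro j i
    fin_cases j
    · exact (h.thirdValues_valGE hxk ht1 i).mono (by fin_cases i <;> norm_num)
    · fin_cases i
      exacts [valEq_one.ge', hu2.mono, hu2.pow 2,
        hu2.pow 3, ((root_valGE ht2).mul (hu2.pow 3 le_rfl) le_rfl).div valEq_five, hl2.ge']
    · fin_cases i
      exacts [valEq_one.ge', hu3.ge', hu3.ge.pow 2,
        hu3.ge.pow 3, (h.third_valGE ht3).mono, hl3.mono]
  · intro i _
    fin_cases i
    exacts [valEq_one.congr,
      hu3.congr (s := ((2 : ℕ) : ℝ) / ((6 : ℕ) : ℝ)),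
      hu3.pow 2 (t := ((4 : ℕ) : ℝ) / ((6 : ℕ) : ℝ)), hu1.pow 3,
      (h30.mul (hu3.pow 3 rfl) rfl).div valEq_five (t := ((0 : ℕ) : ℝ) / ((6 : ℕ) : ℝ)), hl2.congr]

/-- The shifted values of `lastElt` at two roots on opposite sides of `x` are not congruent. -/
theorem lastNum_sub_valEq {p : ℕ} [Fact p.Prime] {x t t' z₀ a b : Ω p} {s w c c' r : ℝ}
    (h2 : ValEq (2 : Ω p) 0) (ht : t ^ 6 + a * t + b = 0) (ht' : t' ^ 6 + a * t' + b = 0)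
    (hv : ValEq (x ^ 6 + a * x + b) s) (hz : ValEq z₀ w) (hc : w < c) (hc' : w < c')
    (h : ValGE (t - (x + z₀)) c) (h' : ValGE (t' - (x + -z₀)) c') (hr : r = s - w) :
    ValEq (lastNum x t - lastNum x t') r := by
  have hd : ValEq (t - t') w := by
    convert (h2.mul hz rfl).add ((h.mono (min_le_left c c')).sub (h'.mono (min_le_right c c')))
      (by rw [zero_add]; exact lt_min hc hc') using 1
    · ring
    · ring
  refine ValEq.of_mul (y := (t - x) * (t' - x)) (r := s + w) ?_
    ((valEq_of_near hz hc h).mul (valEq_of_near hz.neg hc' h') rfl) (by rw [hr]; ring)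
  convert hv.mul hd rfl using 1
  linear_combination (t' - x) * sub_mul_lastNum (x := x) ht - (t - x) * sub_mul_lastNum (x := x) ht'

theorem rowHolds_five_last_even (hS : IsTrinomialGenerator θ a b) (h : FiveSetting a b β k d)
    (hd : d = 2 * k + 4) :
    RowHolds 5 θ Δ(a,b) {n | 8 ≤ n ∧ Even n} 2
      {α | ∃ x : ℤ, a * x + 6 * β ≡ 0 [ZMOD 5 ^ k] ∧ α = ![1, θ, θ ^ 2, θ ^ 3,
          (-4 * a ^ 3 * θ + 3 * a ^ 2 * θ ^ 2 - 2 * a * θ ^ 3 + θ ^ 4) / 5, lastElt 5 θ x k]} := by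
  obtain ⟨x, hx⟩ := not_five_pow h d
  have hk : 2 ≤ k := by have := h.lt; omega
  have hxk : (5 : ℤ) ^ k ∣ a * x + 6 * β := (pow_dvd_pow 5 (by omega)).trans hx
  have hdr : (d : ℝ) = 2 * k + 4 := by exact_mod_cast hd
  have hkr : (2 : ℝ) ≤ k := by exact_mod_cast hk
  obtain ⟨hf', hf, hx0, hxa⟩ := h.precise hx
  refine rowHolds_five_last (x := x) hS h ⟨by omega, k + 2, by omega⟩ (by omega) hxk fun c hc => ?_
  obtain ⟨t1, ht1, h1⟩ := exists_root_valGE_one (by norm_num) h.valEq_a (by simpa using h.valEq_b.ge)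
  have hu1 : ValEq (t1 + (a : Ω 5)) 0 := by
    rw [add_comm]; exact h.valEq_a.add h1 one_pos
  obtain ⟨t3, ht3, h30, hu3⟩ := h.exists_root_third
  obtain ⟨z₀, hz₀⟩ := exists_sq_eq (a := (a : Ω 5)) (b := (b : Ω 5))
    valEq_fifteen_five hx0
  obtain ⟨hzV, t2, ht2, s, hs, hts⟩ := h.near_pair hx hz₀
  obtain ⟨-, t4, ht4, s', hs', hts'⟩ := h.near_pair hx (z₀ := -z₀) (by rw [neg_sq]; exact hz₀)
  have hpair : ∀ t : Ω 5, t ^ 6 + a * t + b = 0 →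
      ValEq (t - (x : Ω 5)) ((d - 6) / 2) →
      ∃ s, 0 < s ∧ ValGE ((c 0 : Ω 5) + (c 5 : Ω 5) * thirdValues a x k t 5) s := by
    intro t ht hz
    have hu : ValGE (t + (a : Ω 5)) 1 := by
      convert (hz.ge' (s := 1) (by linarith)).add hxa using 1; ring
    have h6 := exists_pos_valGE_sum (hc t ht) (r := 0) one_pos {0, 5} valEq_one
      (thirdValues a x k t) (fun i _ => ⟨1, one_pos, by simpa using valGE_zero _⟩) ?_
    · simpa [Finset.sum_pair (show (0 : Fin 6) ≠ 5 by decide), thirdValues] using h6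
    · intro i hi
      right
      fin_cases i
      exacts [absurd (by simp) hi, ⟨1, one_pos, hu⟩, ⟨1, one_pos, hu.pow 2⟩,
        ⟨1, one_pos, hu.pow 3⟩,
        ⟨1, one_pos, ((root_valGE ht).mul (hu.pow 3 le_rfl) le_rfl).div valEq_five⟩,
        absurd (by simp) hi]
  obtain ⟨r, hr, e⟩ := hpair t2 ht2 (valEq_of_near hzV hs hts)
  obtain ⟨r', hr', e'⟩ := hpair t4 ht4 (valEq_of_near hzV.neg hs' hts')
  have hdiff : ValEq (thirdValues a x k t2 5 - thirdValues a x k t4 5) 0 := by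
    have h2V : ValEq (2 : Ω 5) 0 := by
      simpa using valEq_intCast (p := 5) (n := 2) (by decide)
    convert (lastNum_sub_valEq h2V ht2 ht4 hf hzV hs hs' hts hts' rfl).div (valEq_five_pow k)
      (t := 0) (by rw [hdr]; ring) using 1
    simp [thirdValues]; ring
  obtain ⟨h0, h5⟩ := dvd_of_two_residues e hr e' hr' hdiff (h.thirdValues_valGE hxk ht2 5)
  have hl3 := h.third_place hx ht3 hu3 (by omega)
  have hτ : ∀ j, (![t1, t3] : Fin 2 → Ω 5) j ^ 6 +
      a * (![t1, t3] : Fin 2 → Ω 5) j + b = 0 := by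
    intro j; fin_cases j
    exacts [ht1, ht3]
  refine dvd_of_rank (fun j => hc _ (hτ j)) 6 ![![0, 0, 0, 0, 0, 0],
    ![0, 2, 4, 6, 0, 4]] ?_ {0, 5} ?_ ![0, 2, 4, 5, 1, 3] ![1, 1, 1, 0, 1, 1] ?_ (by decide)
  · intro j i
    fin_cases j
    · exact (h.thirdValues_valGE hxk ht1 i).mono (by fin_cases i <;> norm_num)
    · fin_cases i
      exacts [valEq_one.ge', hu3.ge', hu3.ge.pow 2,
        hu3.ge.pow 3, (h.third_valGE ht3).mono, hl3.mono]
  · intro i hi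
    rcases Finset.mem_insert.mp hi with rfl | hi
    · exact h0
    · rw [Finset.mem_singleton.mp hi]; exact h5
  · intro i hi
    fin_cases i
    exacts [absurd (by simp) hi, hu3.congr (s := ((2 : ℕ) : ℝ) / ((6 : ℕ) : ℝ)),
      hu3.pow 2 (t := ((4 : ℕ) : ℝ) / ((6 : ℕ) : ℝ)), hu1.pow 3,
      (h30.mul (hu3.pow 3 rfl) rfl).div valEq_five (t := ((0 : ℕ) : ℝ) / ((6 : ℕ) : ℝ)), absurd (by simp) hi]

end FiveLast


section Three

variable {K : Type*} [Field K] [NumberField K] {θ : K} {a b a' c e : ℤ}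

theorem valEq_int_three {n : ℤ} (h : ¬ (3 : ℤ) ∣ n) : ValEq (n : Ω 3) 0 :=
  valEq_intCast (p := 3) (by exact_mod_cast h)

theorem valGE_int_three {n : ℤ} (h : (3 : ℤ) ∣ n) : ValGE (n : Ω 3) 1 :=
  valGE_one_of_dvd (p := 3) (by exact_mod_cast h)

theorem valEq_five_three : ValEq (5 : Ω 3) 0 := by
  simpa using valEq_int_three (n := 5) (by decide)

theorem valEq_two_three : ValEq (2 : Ω 3) 0 := by
  simpa using valEq_int_three (n := 2) (by decide)

theorem valEq_six_three : ValEq (6 : Ω 3) 1 := by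
  have := valEq_two_three.mul valEq_three (t := 1) (by simp)
  norm_num at this
  exact this

theorem valEq_fifteen_three : ValEq (15 : Ω 3) 1 := by
  have := valEq_three.mul (valEq_int_three (n := 5) (by decide)) (t := 1) (by simp)
  norm_num at this
  exact this

theorem valEq_twenty_three : ValEq (20 : Ω 3) 0 := by
  simpa using valEq_int_three (n := 20) (by decide)

theorem valEq_unit_of_sq_eq_one (he : e ^ 2 = 1) : ValEq (e : Ω 3) 0 := by
  refine valEq_int_three fun h => ?_
  have : (3 : ℤ) ∣ 1 := he ▸ (dvd_pow h two_ne_zero)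
  exact absurd this (by decide)

theorem cube_eq_three (ha : a = 3 * a') (hb : b = e - 3 * c) (he : e ^ 2 = 1) {t : Ω 3}
    (ht : t ^ 6 + a * t + b = 0) :
    (t ^ 2 + (e : Ω 3)) ^ 3 =
      3 * ((e : Ω 3) * t ^ 2 * (t ^ 2 + e) + ((c : Ω 3) - a' * t)) := by
  have he' : (e : Ω 3) ^ 2 = 1 := by exact_mod_cast congrArg (Int.cast : ℤ → Ω 3) he
  rw [ha, hb] at ht
  push_cast at ht
  linear_combination ht + (e : Ω 3) * he'

theorem valEq_b_three (hb : b = e - 3 * c) (he : e ^ 2 = 1) : ValEq (b : Ω 3) 0 := by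
  rw [hb]; push_cast
  rw [sub_eq_add_neg]
  exact (valEq_unit_of_sq_eq_one he).add
    (valEq_three.ge.mul (valGE_intCast c) (t := 1) (by simp)).neg one_pos

theorem sq_add_valGE_three (ha : a = 3 * a') (hb : b = e - 3 * c) (he : e ^ 2 = 1)
    {t : Ω 3} (ht : t ^ 6 + a * t + b = 0) :
    ValGE (t ^ 2 + (e : Ω 3)) (1 / 3) := by
  refine ValGE.of_pow (n := 3) (r := 1) (by norm_num) ?_
  have h0 := root_valGE ht
  have h2 : ValGE (t ^ 2) 0 := h0.pow 2 (by simp)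
  rw [cube_eq_three ha hb he ht]
  exact valEq_three.ge.mul ((((valGE_intCast e).mul h2 le_rfl).mul (h2.add (valGE_intCast e))
    (t := 0) (by simp)).add ((valGE_intCast c).sub ((valGE_intCast a').mul h0 (by simp)))) (by simp)

theorem exists_sq_eq_neg_unit (he : e ^ 2 = 1) :
    ∃ ξ : Ω 3, ξ ^ 2 = -(e : Ω 3) ∧ ValEq ξ 0 := by
  obtain ⟨ξ, hξ⟩ := exists_pow_eq two_pos (-(e : Ω 3))
  exact ⟨ξ, hξ, .of_pow two_ne_zero (hξ ▸ (valEq_unit_of_sq_eq_one he).neg) (by simp)⟩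

/-- Pairs of roots with opposite residues. -/
theorem exists_opposite_roots (ha : a = 3 * a') (hb : b = e - 3 * c) (he : e ^ 2 = 1) :
    ∃ τ : Fin 2 → Ω 3, (∀ j, τ j ^ 6 + a * τ j + b = 0) ∧ ValEq (τ 0 - τ 1) 0 := by
  obtain ⟨ξ, hξ, hξ0⟩ := exists_sq_eq_neg_unit he
  have hb0 := valEq_b_three hb he
  have he' : (e : Ω 3) ^ 2 = 1 := by exact_mod_cast congrArg (Int.cast : ℤ → Ω 3) he
  have key : ∀ y : Ω 3, y ^ 2 = -(e : Ω 3) → ValEq y 0 →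
      ∃ t : Ω 3, t ^ 6 + a * t + b = 0 ∧ ∃ s, 0 < s ∧ ValGE (t - y) s := by
    intro y hy hy0
    refine exists_root_congr hb0 hy0 one_pos ?_
    rw [show y ^ 6 + (a : Ω 3) * y + b = 3 * ((a' : Ω 3) * y - c) by
      rw [ha, hb]; push_cast
      linear_combination (y ^ 4 - (e : Ω 3) * y ^ 2 + (e : Ω 3) ^ 2) * hy -
        (e : Ω 3) * he']
    exact valEq_three.ge.mul (((valGE_intCast a').mul hy0.ge (t := 0) (by simp)).sub
      (valGE_intCast c)) (by simp)
  obtain ⟨t, ht, s, hs, h⟩ := key ξ hξ hξ0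
  obtain ⟨t', ht', s', hs', h'⟩ := key (-ξ) (by rw [neg_sq, hξ]) hξ0.neg
  refine ⟨![t, t'], ?_, ?_⟩
  · intro j; fin_cases j
    exacts [ht, ht']
  · convert (valEq_two_three.mul hξ0 (t := 0) (by simp)).add
      ((h.mono (min_le_left s s')).sub (h'.mono (min_le_right s s'))) (lt_min hs hs') using 1
    simp; ring

theorem rowHolds_three_ramified {n : ℕ} (hS : IsTrinomialGenerator θ a b) (ha : a = 3 * a')
    (hb : b = e - 3 * c) (he : e ^ 2 = 1)
    (hu : ∀ t : Ω 3, t ^ 6 + a * t + b = 0 →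
      ValEq ((c : Ω 3) - (a' : Ω 3) * t) 0)
    (hD : padicValInt 3 Δ(a,b) = n) :
    RowHolds 3 θ Δ(a,b) {n} n {![1, θ, θ ^ 2, θ ^ 3, θ ^ 4, θ ^ 5]} := by
  have he' : (e : Ω 3) ^ 2 = 1 := by exact_mod_cast congrArg (Int.cast : ℤ → Ω 3) he
  have hγ : ∀ (t : Ω 3) i, tri ![[], [], [e], [0, e], [1, 0, 2 * e], [0, 1, 0, 2 * e]] t i /
      ((3 : ℕ) : Ω 3) ^ (0 : ℕ) = (![1, t, t ^ 2 + e, (t ^ 2 + e) * t, (t ^ 2 + e) ^ 2,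
        (t ^ 2 + e) ^ 2 * t] : Fin 6 → Ω 3) i := by
    intro t i; fin_cases i <;> simp [tri, Finset.sum_range_succ]
    · ring
    · ring
    · linear_combination -he'
    · linear_combination -t * he'
  have hq : ∀ t : Ω 3, t ^ 6 + a * t + b = 0 → ValEq (t ^ 2 + (e : Ω 3)) (1 / 3) := by
    intro t ht
    have h := sq_add_valGE_three ha hb he ht
    refine ValEq.of_pow (n := 3) (r := 1) (by norm_num) ?_
    rw [cube_eq_three ha hb he ht, add_comm ((e : Ω 3) * t ^ 2 * (t ^ 2 + e))]
    exact valEq_three.mul ((hu t ht).add (((valGE_intCast e).mul ((root_valGE ht).pow 2 le_rfl)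
      le_rfl).mul h le_rfl)) (by simp)
  refine rowHolds_single' hS (k := fun _ => 0) hD (by simp) (.of_eq _ hγ ?_) (.of_eq _ hγ ?_)
    integralFamily_zero rfl (fun _ _ _ => le_rfl)
    (by ext i; fin_cases i <;> simp [family, tri])
  · intro t ht i
    have h0 := root_valGE ht
    have h1 := (hq t ht).ge' (s := 0)
    fin_cases i
    exacts [valEq_one.ge, h0, h1, h1.mul h0 (by simp), h1.pow 2 (by simp),
      (h1.pow 2 (t := 0) (by simp)).mul h0 (by simp)]
  · intro d hd
    obtain ⟨τ, hτ, hdiff⟩ := exists_opposite_roots ha hb he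
    refine dvd_of_pairs (fun j => hd _ (hτ j)) ![![0, 1], ![2, 3], ![4, 5]] (by decide) 3 ![0, 1, 2]
      (by decide) (by decide) (fun j => ![1, τ j ^ 2 + e, (τ j ^ 2 + e) ^ 2]) ?_ τ
      (fun j => root_valGE (hτ j)) hdiff ?_
    · intro j i
      have h := hq _ (hτ j)
      fin_cases i
      exacts [valEq_one.congr, h.congr, h.pow 2]
    · intro j i r
      left
      fin_cases i <;> fin_cases r <;> simp

/-- If `9` divides `a`, a unit at which the trinomial has valuation at least two is close to a
root. -/
theorem exists_root_near_three (ha : ValGE (a : Ω 3) 2) {ξ : Ω 3} (hξ : ValEq ξ 0)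
    (hf : ValGE (ξ ^ 6 + (a : Ω 3) * ξ + (b : Ω 3)) 2) :
    ∃ t : Ω 3, t ^ 6 + a * t + b = 0 ∧ ∃ s, 2 / 3 < s ∧ ValGE (t - ξ) s := by
  obtain ⟨η, hη⟩ := exists_pow_eq (p := 3) (n := 3) (by norm_num) 9
  have h9 : ValEq (9 : Ω 3) 2 := by
    have := valEq_three.mul valEq_three rfl
    norm_num at this
    exact this
  have hηV : ValEq η (2 / 3) := .of_pow (by norm_num) (hη ▸ h9)
  refine exists_root_near (ξ := ξ) (ξ' := ξ + η) (r := 5 / 3) hf ?_ (by norm_num)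
    (by rwa [add_sub_cancel_left])
  have hx (n : ℕ) : ValGE (ξ ^ n) 0 := hξ.ge.pow n (by simp)
  have e1 : ValEq ((6 * ξ ^ 5 + (a : Ω 3)) * η) (5 / 3) :=
    ((valEq_six_three.mul (hξ.pow 5 rfl) rfl).add (s := 2) ha).mul hηV
  have e2 : ValGE (quartic ξ η) (2 / 3) := by
    unfold quartic
    exact ((((valEq_fifteen_three.ge.mul (hx 4)).add
      ((valEq_twenty_three.ge.mul (hx 3) le_rfl).mul hηV.ge)).add
      ((valEq_fifteen_three.ge.mul (hx 2) le_rfl).mul (hηV.ge.pow 2 le_rfl))).add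
      ((valEq_six_three.ge.mul hξ.ge le_rfl).mul (hηV.ge.pow 3 le_rfl))).add
      (hηV.ge.pow 4)
  convert e1.add (hf.add ((hηV.ge.pow 2 le_rfl).mul e2 (t := 2))) (by norm_num) using 1
  unfold quartic; ring

theorem rowHolds_three_split {a₂ c₂ : ℤ} (hS : IsTrinomialGenerator θ a b) (ha : a = 9 * a₂)
    (hb : b = e - 9 * c₂) (he : e ^ 2 = 1) :
    RowHolds 3 θ Δ(a,b) {6} 2
      {![1, θ, θ ^ 2, θ ^ 3, (1 - e * θ ^ 2 + θ ^ 4) / 3, (θ - e * θ ^ 3 + θ ^ 5) / 3]} := by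
  have he' : (e : Ω 3) ^ 2 = 1 := by exact_mod_cast congrArg (Int.cast : ℤ → Ω 3) he
  have heV := valEq_unit_of_sq_eq_one he
  have haV : ValGE (a : Ω 3) 2 := by
    rw [ha]
    exact valGE_of_dvd (p := 3) (k := 2) ⟨a₂, by norm_num⟩
  have hb' : b = e - 3 * (3 * c₂) := by rw [hb]; ring
  have ha' : a = 3 * (3 * a₂) := by rw [ha]; ring
  have hbV := valEq_b_three hb' he
  have h0 : ∀ {t : Ω 3}, t ^ 6 + a * t + b = 0 → ValEq t 0 := fun ht =>
    valEq_root_of_unit hbV ht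
  have hD : padicValInt 3 Δ(a,b) = 6 :=
    padicValInt_of_gt valEq_five_three.ge valEq_six_three haV hbV
  set α : Ω 3 → Ω 3 := fun t => (1 - (e : Ω 3) * t ^ 2 + t ^ 4) / 3 with hαdef
  have hα3 : ∀ t, 3 * α t = (t ^ 2 + (e : Ω 3)) ^ 2 - 3 * (e : Ω 3) * t ^ 2 := by
    intro t
    rw [hαdef]
    change 3 * ((1 - (e : Ω 3) * t ^ 2 + t ^ 4) / 3) = _
    rw [mul_div_cancel₀ _ valEq_three.ne_zero]
    linear_combination -he'
  have hmul : ∀ {t : Ω 3}, t ^ 6 + a * t + b = 0 →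
      ValGE ((t ^ 2 + (e : Ω 3)) * α t) 1 := by
    intro t ht
    refine ValGE.of_mul (x := (t ^ 2 + (e : Ω 3)) * α t) (y := 3) (r := 2) ?_ valEq_three
    have h1 : (t ^ 2 + (e : Ω 3)) * α t * 3 = 3 * (3 * ((c₂ : Ω 3) - a₂ * t)) := by
      have := cube_eq_three ha' hb' he ht
      push_cast at this
      linear_combination (t ^ 2 + (e : Ω 3)) * hα3 t + this
    rw [h1]
    exact valEq_three.ge.mul (valEq_three.ge.mul ((valGE_intCast c₂).sub
      ((valGE_intCast a₂).mul (h0 ht).ge (by simp))) (t := 1) (by simp))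
  -- the two kinds of roots
  have hcase : ∀ {t : Ω 3}, t ^ 6 + a * t + b = 0 →
      (ValEq (t ^ 2 + (e : Ω 3)) (1 / 2) ∧ ValGE (α t) (1 / 2)) ∨
      (ValEq (α t) 0 ∧ ValGE (t ^ 2 + (e : Ω 3)) 1) := by
    intro t ht
    have ht0 := h0 ht
    have h3 : ValEq (3 * (e : Ω 3) * t ^ 2) 1 :=
      (valEq_three.mul heV rfl).mul (ht0.pow 2 rfl)
    have hm := hmul ht
    by_cases hq0 : t ^ 2 + (e : Ω 3) = 0
    · right
      refine ⟨ValEq.of_mul (y := 3) (r := 1) ?_ valEq_three, hq0 ▸ valGE_zero _⟩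
      rw [mul_comm, hα3, hq0, zero_pow two_ne_zero, zero_sub]
      exact h3.neg
    obtain ⟨w, hw⟩ := exists_valEq hq0
    rcases lt_trichotomy w (1 / 2) with hlt | rfl | hgt
    · exfalso
      have h4 : ValEq (α t) (2 * w - 1) := by
        refine ValEq.of_mul (y := 3) (r := 2 * w) ?_ valEq_three rfl
        rw [mul_comm, hα3, sub_eq_add_neg]
        exact (hw.pow 2).add h3.neg.ge (by linarith)
      have h5 := (hw.mul h4 rfl).le_of_ge hm
      linarith
    · left
      refine ⟨hw, ValGE.of_mul (y := t ^ 2 + (e : Ω 3)) (r := 1) ?_ hw⟩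
      rw [mul_comm]; exact hm
    · right
      have h4 : ValEq (α t) 0 := by
        refine ValEq.of_mul (y := 3) (r := 1) ?_ valEq_three
        rw [mul_comm, hα3, sub_eq_neg_add]
        exact h3.neg.add (s := 2 * w) (hw.ge.pow 2) (by linarith)
      exact ⟨h4, ValGE.of_mul (r := 1) hm h4⟩
  have hαI : ∀ {t : Ω 3}, t ^ 6 + a * t + b = 0 → ValGE (α t) 0 := fun ht =>
    (hcase ht).elim (fun h => h.2.mono) fun h => h.1.ge
  set V : Ω 3 → Fin 6 → Ω 3 := fun t => ![1, t, t ^ 2 + e, (t ^ 2 + e) * t, α t,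
    α t * t] with hVdef
  have hγ : ∀ (t : Ω 3) i, tri ![[], [], [e], [0, e], [1, 0, -e], [0, 1, 0, -e]] t i /
      ((3 : ℕ) : Ω 3) ^ (![0, 0, 0, 0, 1, 1] : Fin 6 → ℕ) i = V t i := by
    intro t i; fin_cases i <;> simp [tri, hVdef, hαdef, Finset.sum_range_succ] <;> ring
  have hVI : ∀ {t : Ω 3}, t ^ 6 + a * t + b = 0 → ∀ i, ValGE (V t i) 0 := by
    intro t ht i
    have h1 := (h0 ht).ge
    have hq : ValGE (t ^ 2 + (e : Ω 3)) 0 := (h1.pow 2 (by simp)).add heV.ge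
    fin_cases i
    exacts [valEq_one.ge, h1, hq, hq.mul h1 (by simp), hαI ht, (hαI ht).mul h1 (by simp)]
  refine rowHolds_single' hS (l := ![[], [], [e], [0, e], [1, 0, -e], [0, 1, 0, -e]])
    (l' := ![[], [], [], [], [1, 0, -e], [0, 1, 0, -e]]) (k := ![0, 0, 0, 0, 1, 1]) hD (by decide)
    (.of_eq V hγ fun t ht => hVI ht) (.of_eq V hγ ?_)
    (.of_eq (fun t => ![1, t, t ^ 2, t ^ 3, α t, α t * t]) ?_ ?_) rfl (by decide) ?_
  · intro d hd
    have pair : ∀ (i j : Fin 6) (δ : Ω 3 → Ω 3) {r : ℝ}, i ≠ j → r < 1 →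
        ∀ t : Ω 3, t ^ 6 + a * t + b = 0 → ValEq (δ t) r → V t i = δ t → V t j = δ t * t →
        (∀ l, l ≠ i → l ≠ j → ((3 : ℕ) : ℤ) ∣ d l ∨ ∃ s, r < s ∧ ValGE (V t l) s) →
        ∃ s, 0 < s ∧ ValGE ((d i : Ω 3) + (d j : Ω 3) * t) s := by
      intro i j δ r hij hr t ht hδ hi hj hl
      have h := exists_pos_valGE_sum (hd t ht) hr {i, j} hδ (fun l => if l = i then 1 else t) ?_ ?_
      · simpa [Finset.sum_pair hij, hij.symm] using h
      · intro l hl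
        refine ⟨r + 1, by linarith, ?_⟩
        rcases Finset.mem_insert.mp hl with rfl | hl
        · simpa [hi] using valGE_zero _
        · rw [Finset.mem_singleton.mp hl]
          simpa [hj, hij.symm] using valGE_zero _
      · intro l hl'
        simp only [Finset.mem_insert, Finset.mem_singleton, not_or] at hl'
        exact (hl l hl'.1 hl'.2).imp (fun h => ⟨h, hVI ht l⟩) id
    -- roots of both kinds and both residues
    have near : ∀ ξ : Ω 3, ValEq ξ 0 →
        ValGE (ξ ^ 6 + (a : Ω 3) * ξ + (b : Ω 3)) 2 →
        ValGE ((-ξ) ^ 6 + (a : Ω 3) * (-ξ) + (b : Ω 3)) 2 →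
        ∃ t t' : Ω 3, t ^ 6 + a * t + b = 0 ∧ t' ^ 6 + a * t' + b = 0 ∧
          ValEq (t - t') 0 ∧ (∃ s, 2 / 3 < s ∧ ValGE (t ^ 2 - ξ ^ 2) s) ∧
          ∃ s, 2 / 3 < s ∧ ValGE (t' ^ 2 - ξ ^ 2) s := by
      intro ξ hξ h1 h2
      obtain ⟨t, ht, s, hs, h⟩ := exists_root_near_three haV hξ h1
      obtain ⟨t', ht', s', hs', h'⟩ := exists_root_near_three haV hξ.neg h2
      refine ⟨t, t', ht, ht', ?_, ⟨s, hs, ?_⟩, ⟨s', hs', ?_⟩⟩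
      · convert (valEq_two_three.mul hξ (t := 0) (by simp)).add
          ((h.mono (min_le_left s s')).sub (h'.mono (min_le_right s s')))
          (lt_min (by linarith) (by linarith)) using 1
        ring
      · convert h.mul ((h0 ht).ge.add hξ.ge) (t := s) (by simp) using 1
        ring
      · convert h'.mul ((h0 ht').ge.sub hξ.ge) (t := s') (by simp) using 1
        ring
    have hval : ∀ ξ : Ω 3, ValEq ξ 0 →
        (ξ ^ 2 + (e : Ω 3)) ^ 3 = 3 * (e : Ω 3) * ξ ^ 2 * (ξ ^ 2 + e) →
        ValGE (ξ ^ 6 + (a : Ω 3) * ξ + (b : Ω 3)) 2 := by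
      intro ξ hξ h
      have h9 : ValGE (9 * (c₂ : Ω 3)) 2 := by
        exact_mod_cast valGE_of_dvd (p := 3) (n := 9 * c₂) (k := 2) ⟨c₂, by norm_num⟩
      convert (haV.mul hξ.ge (t := 2) (by simp)).sub h9 using 1
      rw [hb]; push_cast
      linear_combination h - (e : Ω 3) * he'
    obtain ⟨ξ, hξ, hξ0⟩ := exists_sq_eq_neg_unit he
    have hξq : ξ ^ 2 + (e : Ω 3) = 0 := by rw [hξ, neg_add_cancel]
    obtain ⟨t1, t2, ht1, ht2, h12, ⟨s1, hs1, h1⟩, ⟨s2, hs2, h2⟩⟩ := near ξ hξ0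
      (hval _ hξ0 (by rw [hξq]; ring)) (hval _ hξ0.neg (by rw [neg_sq, hξq]; ring))
    have far : ∀ {t : Ω 3}, t ^ 6 + a * t + b = 0 →
        (∃ s, 2 / 3 < s ∧ ValGE (t ^ 2 - ξ ^ 2) s) →
        ValEq (α t) 0 ∧ ValGE (t ^ 2 + (e : Ω 3)) 1 := by
      rintro t ht ⟨s, hs, h⟩
      refine (hcase ht).resolve_left fun hc => ?_
      rw [hξ, sub_neg_eq_add] at h
      have := hc.1.le_of_ge h
      linarith
    obtain ⟨ρ, hρ⟩ := exists_pow_eq two_pos (3 * (e : Ω 3))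
    have hρV : ValEq ρ (1 / 2) :=
      .of_pow two_ne_zero (hρ ▸ valEq_three.mul heV rfl)
    obtain ⟨κ, hκ⟩ := exists_pow_eq two_pos (ρ ^ 2 - 4 * (e : Ω 3))
    obtain ⟨ζ, hζ⟩ : ∃ ζ : Ω 3, ζ ^ 2 = ρ * ζ + -(e : Ω 3) :=
      ⟨(ρ + κ) / 2, by linear_combination hκ / 4⟩
    have hζ0 : ValEq ζ 0 := by
      have h3 := valGE_of_sq_eq (r := 0) hζ (hρV.ge') (heV.neg.ge')
      refine .of_pow (n := 2) (r := 0) two_ne_zero ?_ (by simp)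
      rw [hζ, add_comm]
      exact heV.neg.add (hρV.ge.mul h3 le_rfl)
    have hζq : ζ ^ 2 + (e : Ω 3) = ρ * ζ := by rw [hζ]; ring
    have hζc : (ζ ^ 2 + (e : Ω 3)) ^ 3 = 3 * (e : Ω 3) * ζ ^ 2 * (ζ ^ 2 + e) := by
      rw [hζq]; linear_combination ρ * ζ ^ 3 * hρ
    obtain ⟨t3, t4, ht3, ht4, h34, hn3, hn4⟩ := near ζ hζ0 (hval _ hζ0 hζc)
      (hval _ hζ0.neg (by rw [neg_sq]; exact hζc))
    have mid : ∀ {t : Ω 3}, t ^ 6 + a * t + b = 0 →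
        (∃ s, 2 / 3 < s ∧ ValGE (t ^ 2 - ζ ^ 2) s) →
        ValEq (t ^ 2 + (e : Ω 3)) (1 / 2) ∧ ValGE (α t) (1 / 2) := by
      rintro t ht ⟨s, hs, h⟩
      refine (hcase ht).resolve_right fun hc => ?_
      have h4 : ValEq (t ^ 2 + (e : Ω 3)) (1 / 2) := by
        convert (hρV.mul hζ0 (t := 1 / 2)).add h (by linarith) using 1
        rw [← hζq]; ring
      have := h4.le_of_ge hc.2
      norm_num at this
    have first : ∀ {t : Ω 3}, t ^ 6 + a * t + b = 0 →
        (∃ s, 2 / 3 < s ∧ ValGE (t ^ 2 - ζ ^ 2) s) →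
        ∃ s, 0 < s ∧ ValGE ((d 0 : Ω 3) + (d 1 : Ω 3) * t) s := by
      intro t ht hn
      obtain ⟨hq, hα⟩ := mid ht hn
      have h5 := (h0 ht).ge
      refine pair 0 1 (fun _ => 1) (by decide) one_pos t ht valEq_one rfl (one_mul t).symm ?_
      intro l hl0 hl1
      right
      fin_cases l
      exacts [absurd rfl hl0, absurd rfl hl1, ⟨_, by norm_num, hq.ge⟩,
        ⟨1 / 2, by norm_num, hq.ge.mul h5⟩, ⟨1 / 2, by norm_num, hα⟩,
        ⟨1 / 2, by norm_num, hα.mul h5⟩]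
    obtain ⟨_, hs, e1⟩ := first ht3 hn3
    obtain ⟨_, hs', e2⟩ := first ht4 hn4
    obtain ⟨hd0, hd1⟩ := dvd_of_two_residues e1 hs e2 hs' h34 (h0 ht3).ge
    have second : ∀ {t : Ω 3}, t ^ 6 + a * t + b = 0 →
        (∃ s, 2 / 3 < s ∧ ValGE (t ^ 2 - ξ ^ 2) s) →
        ∃ s, 0 < s ∧ ValGE ((d 4 : Ω 3) + (d 5 : Ω 3) * t) s := by
      intro t ht hn
      obtain ⟨hα, hq⟩ := far ht hn
      refine pair 4 5 α (by decide) one_pos t ht hα rfl rfl ?_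
      intro l hl0 hl1
      fin_cases l
      exacts [.inl hd0, .inl hd1, .inr ⟨1, one_pos, hq⟩,
        .inr ⟨1, one_pos, hq.mul (h0 ht).ge⟩, absurd rfl hl0, absurd rfl hl1]
    obtain ⟨_, hs, e1⟩ := second ht1 ⟨s1, hs1, h1⟩
    obtain ⟨_, hs', e2⟩ := second ht2 ⟨s2, hs2, h2⟩
    obtain ⟨hd4, hd5⟩ := dvd_of_two_residues e1 hs e2 hs' h12 (h0 ht1).ge
    have third : ∀ {t : Ω 3}, t ^ 6 + a * t + b = 0 →
        (∃ s, 2 / 3 < s ∧ ValGE (t ^ 2 - ζ ^ 2) s) →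
        ∃ s, 0 < s ∧ ValGE ((d 2 : Ω 3) + (d 3 : Ω 3) * t) s := by
      intro t ht hn
      refine pair 2 3 (fun t => t ^ 2 + e) (by decide) (by norm_num) t ht (mid ht hn).1 rfl rfl ?_
      intro l hl0 hl1
      left
      fin_cases l
      exacts [hd0, hd1, absurd rfl hl0, absurd rfl hl1, hd4, hd5]
    obtain ⟨_, hs, e1⟩ := third ht3 hn3
    obtain ⟨_, hs', e2⟩ := third ht4 hn4
    obtain ⟨hd2, hd3⟩ := dvd_of_two_residues e1 hs e2 hs' h34 (h0 ht3).ge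
    intro i
    fin_cases i
    exacts [hd0, hd1, hd2, hd3, hd4, hd5]
  · intro t i; fin_cases i <;> simp [tri, hαdef, Finset.sum_range_succ] <;> ring
  · intro t ht i
    have h1 := (h0 ht).ge
    fin_cases i
    exacts [valEq_one.ge, h1, h1.pow 2 (by simp), h1.pow 3 (by simp), hαI ht,
      (hαI ht).mul h1 (by simp)]
  · ext i; fin_cases i <;> simp [family, tri, Finset.sum_range_succ] <;> ring

end Three


section ThreeLast

variable {K : Type*} [Field K] [NumberField K] {θ : K} {a b a' c x : ℤ}

theorem cubic_near_three {x t a b : Ω 3} (ht : t ^ 6 + a * t + b = 0) :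
    (t - x) ^ 3 * (20 * x ^ 3 + (15 * x ^ 2 * (t - x) + 6 * x * (t - x) ^ 2 + (t - x) ^ 3)) =
      -((x ^ 6 + a * x + b) + ((6 * x ^ 5 + a) * (t - x) + 15 * x ^ 4 * (t - x) ^ 2)) := by
  linear_combination ht

theorem valEq_cubic_three {x z : Ω 3} (hx : ValEq x 0) (hz : ValGE z (1 / 3)) :
    ValEq (20 * x ^ 3 + (15 * x ^ 2 * z + 6 * x * z ^ 2 + z ^ 3)) 0 := by
  have h1 : ValGE (15 * x ^ 2 * z) (1 / 3) :=
    ((valGE_ofNat 15).mul (hx.ge.pow 2 (t := 0) (by simp)) (t := 0) (by simp)).mul hz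
  have h2 : ValGE (6 * x * z ^ 2) (1 / 3) :=
    ((valGE_ofNat 6).mul hx.ge (t := 0) (by simp)).mul (hz.pow 2 le_rfl)
  exact (valEq_twenty_three.mul (hx.pow 3 (t := 0) (by simp)) (by simp)).add
    ((h1.add h2).add (hz.pow 3))

theorem valGE_sq_term_three {x z : Ω 3} (hx : ValEq x 0) {w s : ℝ} (hz : ValGE z w)
    (hs : s ≤ 1 + 2 * w) : ValGE (15 * x ^ 4 * z ^ 2) s :=
  (valEq_fifteen_three.ge.mul (hx.ge.pow 4 (t := 0) (by simp)) (t := 1) (by simp)).mul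
    (hz.pow 2 le_rfl) (by simpa using hs)

theorem sub_valGE_three {x t a b : Ω 3} {w₀ : ℝ} (ht : t ^ 6 + a * t + b = 0)
    (hx : ValEq x 0) (hz : ValGE (t - x) (1 / 3)) (hf : ValGE (x ^ 6 + a * x + b) (3 * w₀))
    (hf' : ValGE (6 * x ^ 5 + a) (2 * w₀)) (h1 : w₀ ≤ 1) : ValGE (t - x) w₀ := by
  by_cases h0 : t - x = 0
  · rw [h0]; exact valGE_zero _
  obtain ⟨w, hw⟩ := exists_valEq h0
  by_contra hcon
  have hlt : w < w₀ := by
    by_contra hge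
    exact hcon (hw.ge' (not_lt.mp hge))
  have h2 := (hw.pow 3 rfl).mul (valEq_cubic_three hx hz) rfl
  rw [cubic_near_three ht] at h2
  have h3 := h2.le_of_ge (((hf.mono (s := 2 * w + w₀) (by linarith)).add
    ((hf'.mul hw.ge (t := 2 * w + w₀) (by linarith)).add
      (valGE_sq_term_three hx hw.ge (by linarith)))).neg)
  push_cast at h3
  linarith

theorem valEq_sub_three {x t a b : Ω 3} {w s : ℝ} (ht : t ^ 6 + a * t + b = 0)
    (hx : ValEq x 0) (hz : ValGE (t - x) (1 / 3)) (hw : ValGE (t - x) w)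
    (hf : ValEq (x ^ 6 + a * x + b) (3 * w)) (hf' : ValGE (6 * x ^ 5 + a) s) (hs : 2 * w < s)
    (h1 : w < 1) : ValEq (t - x) w := by
  refine .of_pow (n := 3) (r := 3 * w) (by norm_num) ?_ (by push_cast; ring)
  refine .of_mul (r := 3 * w) ?_ (valEq_cubic_three hx hz) (by simp)
  rw [cubic_near_three ht]
  exact (hf.add ((hf'.mul hw (min_le_left _ (1 + 2 * w))).add
    (valGE_sq_term_three hx hw (min_le_right _ _)))
    (lt_min (by linarith) (by linarith))).neg

theorem root_cases_three (ha : a = 3 * a') (hb : b = -1 - 3 * c) (hx : ¬ (3 : ℤ) ∣ x)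
    {t : Ω 3} (ht : t ^ 6 + a * t + b = 0) :
    (ValEq (t - (x : Ω 3)) 0 ∧ ValGE (t + (x : Ω 3)) (1 / 3)) ∨
    (ValEq (t + (x : Ω 3)) 0 ∧ ValGE (t - (x : Ω 3)) (1 / 3)) := by
  have hxV := valEq_int_three hx
  have hx2 : ValGE ((x ^ 2 - 1 : ℤ) : Ω 3) 1 := by
    refine valGE_int_three ?_
    have : x % 3 = 1 ∨ x % 3 = 2 := by omega
    refine Int.dvd_of_emod_eq_zero ?_
    rcases this with h | h <;> simp [Int.sub_emod, pow_two, Int.mul_emod, h]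
  have hq : ValGE ((t - (x : Ω 3)) * (t + (x : Ω 3))) (1 / 3) := by
    convert (sq_add_valGE_three (e := -1) ha hb (by norm_num) ht).sub (hx2.mono) using 1
    push_cast; ring
  have h0 : ValGE (t - (x : Ω 3)) 0 := (root_valGE ht).sub hxV.ge
  by_cases hz : ValEq (t - (x : Ω 3)) 0
  · exact .inl ⟨hz, .of_mul (r := 1 / 3) (by rwa [mul_comm]) hz (by simp)⟩
  · obtain ⟨s, hs, h⟩ := exists_gt_valGE (x := t - (x : Ω 3)) (r := 0)
      (lt_of_le_of_ne h0 (by simpa [ValEq] using hz))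
    have hy : ValEq (t + (x : Ω 3)) 0 := by
      convert (valEq_two_three.mul hxV rfl).add h (by simpa using hs) using 1
      · ring
      · simp
    exact .inr ⟨hy, .of_mul hq hy (by simp)⟩

/-- A root at distance `1 / 3` from `-x`. -/
theorem exists_root_good_three (ha : a = 3 * a') (hb : b = -1 - 3 * c) (hx : ¬ (3 : ℤ) ∣ x)
    (ha' : ¬ (3 : ℤ) ∣ a')
    (hf : ValGE ((x : Ω 3) ^ 6 + (a : Ω 3) * (x : Ω 3) + (b : Ω 3)) 2) :
    ∃ t : Ω 3, t ^ 6 + a * t + b = 0 ∧ ValEq (t - (x : Ω 3)) 0 ∧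
      ValEq (t + (x : Ω 3)) (1 / 3) := by
  have hxV := valEq_int_three hx
  have haV : ValEq (a : Ω 3) 1 := by
    rw [ha]; push_cast
    exact valEq_three.mul (valEq_int_three ha') (by simp)
  have hf2 : ValEq ((-(x : Ω 3)) ^ 6 + (a : Ω 3) * -(x : Ω 3) +
      (b : Ω 3)) 1 := by
    convert ((valEq_two_three.mul haV (t := 1) (by simp)).mul hxV (t := 1) (by simp)).neg.add hf
      (by norm_num) using 1
    ring
  obtain ⟨t, ht, s, hs, h⟩ := exists_root_congr (valEq_b_three (e := -1) hb (by norm_num)) hxV.neg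
    one_pos hf2.ge
  rw [sub_neg_eq_add] at h
  rcases root_cases_three ha hb hx ht with ⟨h1, h2⟩ | ⟨h1, -⟩
  · refine ⟨t, ht, h1, ?_⟩
    have hf' : ValGE (6 * (-(x : Ω 3)) ^ 5 + (a : Ω 3)) 1 :=
      (valEq_six_three.ge.mul (hxV.neg.ge.pow 5 le_rfl) (by simp)).add haV.ge
    rw [← sub_neg_eq_add] at h2 ⊢
    exact valEq_sub_three ht hxV.neg h2 h2 (hf2.congr (by norm_num)) hf' (by norm_num) (by norm_num)
  · have := h1.le_of_ge h
    linarith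

/-- Values at a root in the case where the last basis element has denominator `3`. -/
noncomputable def fifthValues (x : ℤ) (t : Ω 3) : Fin 6 → Ω 3 :=
  ![1, t - x, (t - x) ^ 2, (t - x) ^ 2 * (t + x), (t - x) ^ 2 * (t + x) ^ 2,
    (t - x) ^ 2 * (t + x) ^ 3 / 3]

theorem rowHolds_three_fifth {n vdK : ℕ} (hS : IsTrinomialGenerator θ a b) (hx : x ^ 2 = 1)
    (hI : ∀ t : Ω 3, t ^ 6 + a * t + b = 0 →
      ValGE ((t - (x : Ω 3)) ^ 2 * (t + (x : Ω 3)) ^ 3 / 3) 0)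
    (hD : padicValInt 3 Δ(a,b) = n) (hn : vdK + 2 = n)
    (hM : ∀ d : Fin 6 → ℤ, (∀ t : Ω 3, t ^ 6 + a * t + b = 0 →
      ValGE (∑ i, (d i : Ω 3) * fifthValues x t i) 1) → ∀ i, ((3 : ℕ) : ℤ) ∣ d i) :
    RowHolds 3 θ Δ(a,b) {n} vdK
      {![1, θ, θ ^ 2, θ ^ 3, θ ^ 4, (x + θ + x * θ ^ 2 + θ ^ 3 + x * θ ^ 4 + θ ^ 5) / 3]} := by
  have hx' : (x : Ω 3) ^ 2 = 1 := by exact_mod_cast congrArg (Int.cast : ℤ → Ω 3) hx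
  have hxV := valEq_unit_of_sq_eq_one hx
  have h3 : (3 : Ω 3) ≠ 0 := valEq_three.ne_zero
  have hγ : ∀ (t : Ω 3) i, tri ![[], [-x], [x ^ 2, -2 * x], [x ^ 3, -x ^ 2, -x],
      [x ^ 4, 0, -2 * x ^ 2, 0], [x ^ 5, x ^ 4, -2 * x ^ 3, -2 * x ^ 2, x]] t i /
      ((3 : ℕ) : Ω 3) ^ (![0, 0, 0, 0, 0, 1] : Fin 6 → ℕ) i = fifthValues x t i := by
    intro t i; fin_cases i <;> simp [tri, fifthValues, Finset.sum_range_succ] <;> ring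
  refine rowHolds_single' hS (l := ![[], [-x], [x ^ 2, -2 * x], [x ^ 3, -x ^ 2, -x],
      [x ^ 4, 0, -2 * x ^ 2, 0], [x ^ 5, x ^ 4, -2 * x ^ 3, -2 * x ^ 2, x]])
    (l' := ![[], [], [], [], [], [x, 1, x, 1, x]])
    (k := ![0, 0, 0, 0, 0, 1]) hD (by simpa [Fin.sum_univ_succ] using hn)
    (.of_eq _ hγ ?_) (.of_eq _ hγ hM)
    (.of_eq (fun t => ![1, t, t ^ 2, t ^ 3, t ^ 4,
      (t - x) ^ 2 * (t + x) ^ 3 / 3 + (t ^ 3 + x * t ^ 2)]) ?_ ?_) rfl (by decide) ?_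
  · intro t ht i
    have hz := (root_valGE ht).sub hxV.ge
    have hy := (root_valGE ht).add hxV.ge
    fin_cases i
    exacts [valEq_one.ge, hz, hz.pow 2 (by simp), (hz.pow 2 (t := 0) (by simp)).mul hy (by simp),
      (hz.pow 2 (t := 0) (by simp)).mul (hy.pow 2 (t := 0) (by simp)) (by simp), hI t ht]
  · intro t i; fin_cases i <;> simp [tri, Finset.sum_range_succ]
    field_simp
    linear_combination (2 * t ^ 3 + 2 * x * t ^ 2 -
      ((x : Ω 3) ^ 2 + 1) * t - x * (x ^ 2 + 1)) * hx'
  · intro t ht i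
    have h1 := root_valGE ht
    fin_cases i
    exacts [valEq_one.ge, h1, h1.pow 2 (by simp), h1.pow 3 (by simp), h1.pow 4 (by simp),
      (hI t ht).add ((h1.pow 3 (by simp)).add (hxV.ge.mul (h1.pow 2 (t := 0) (by simp)) (by simp)))]
  · ext i; fin_cases i <;> simp [family, tri, Finset.sum_range_succ]

end ThreeLast


section ThreeFifth

variable {K : Type*} [Field K] [NumberField K] {θ : K} {a b a' c x : ℤ}

theorem fifthValues_five_valGE {t : Ω 3} (hxV : ValEq (x : Ω 3) 0)
    (ht : t ^ 6 + a * t + b = 0)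
    (h : ValGE (t + (x : Ω 3)) (1 / 3) ∨ ValGE (t - (x : Ω 3)) (1 / 2)) :
    ValGE ((t - (x : Ω 3)) ^ 2 * (t + (x : Ω 3)) ^ 3 / 3) 0 := by
  have hz := (root_valGE ht).sub hxV.ge
  have hy := (root_valGE ht).add hxV.ge
  rcases h with h | h
  · exact ((hz.pow 2 (t := 0) (by simp)).mul (h.pow 3 le_rfl) le_rfl).div valEq_three
  · exact ((h.pow 2 le_rfl).mul (hy.pow 3 (t := 0) (by simp)) le_rfl).div valEq_three

/-- `b ≡ 2 (mod 9)`, `a ≡ ± 3 (mod 9)`. -/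
theorem rowHolds_three_two (hS : IsTrinomialGenerator θ a b) (ha : a = 3 * a') (hx : x ^ 2 = 1)
    (hax : (3 : ℤ) ∣ a' + x) (hb : (9 : ℤ) ∣ b - 2)
    (hD : padicValInt 3 Δ(a,b) = 7) :
    RowHolds 3 θ Δ(a,b) {7} 5
      {![1, θ, θ ^ 2, θ ^ 3, θ ^ 4, (x + θ + x * θ ^ 2 + θ ^ 3 + x * θ ^ 4 + θ ^ 5) / 3]} := by
  have hxV := valEq_unit_of_sq_eq_one hx
  have hx' : (x : Ω 3) ^ 2 = 1 := by exact_mod_cast congrArg (Int.cast : ℤ → Ω 3) hx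
  have hx3 : ¬ (3 : ℤ) ∣ x := fun h => absurd (hx ▸ dvd_pow h two_ne_zero : (3 : ℤ) ∣ 1) (by decide)
  obtain ⟨u, hu⟩ := hax
  obtain ⟨m, hm⟩ := hb
  obtain rfl : a' = 3 * u - x := by linarith
  have hb' : b = -1 - 3 * (-1 - 3 * m) := by linarith
  have ha3 : ¬ (3 : ℤ) ∣ 3 * u - x := fun h => hx3 (by
    have := _root_.dvd_sub (dvd_mul_right 3 u) h
    rwa [sub_sub_cancel] at this)
  have hf : ValGE ((x : Ω 3) ^ 6 + (a : Ω 3) * (x : Ω 3) + (b : Ω 3)) 2 := by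
    have : x ^ 6 + a * x + b = ((3 : ℕ) : ℤ) ^ 2 * (u * x + m) := by
      rw [ha, hb']; push_cast; linear_combination (x ^ 4 + x ^ 2 - 2) * hx
    have h := valGE_of_dvd (p := 3) (Dvd.intro _ this.symm)
    push_cast at h; exact h
  have hf' : ValEq (6 * (x : Ω 3) ^ 5 + (a : Ω 3)) 1 := by
    have h6 : ((6 * x ^ 5 + a : ℤ) : Ω 3) = 3 * ((x + 3 * u : ℤ) : Ω 3) := by
      rw [ha]; push_cast
      linear_combination (6 * (x : Ω 3) * (x ^ 2 + 1)) * hx'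
    have h7 := valEq_three.mul (valEq_int_three (n := x + 3 * u) (by
      rwa [dvd_add_left (dvd_mul_right 3 u)])) (t := 1) (by simp)
    rw [← h6] at h7; push_cast at h7; exact h7
  have half : ∀ {t : Ω 3}, t ^ 6 + a * t + b = 0 → ValGE (t - (x : Ω 3)) (1 / 3) →
      ValGE (t - (x : Ω 3)) (1 / 2) := fun ht h =>
    sub_valGE_three ht hxV h (hf.mono (by norm_num)) (hf'.ge' (by norm_num)) (by norm_num)
  have hI : ∀ t : Ω 3, t ^ 6 + a * t + b = 0 →
      ValGE ((t - (x : Ω 3)) ^ 2 * (t + (x : Ω 3)) ^ 3 / 3) 0 := fun t ht =>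
    fifthValues_five_valGE hxV ht
      ((root_cases_three ha hb' hx3 ht).imp And.right fun h => half ht h.2)
  refine rowHolds_three_fifth hS hx hI hD rfl fun d hd => ?_
  -- a root very close to `x`
  obtain ⟨η, hη⟩ := exists_pow_eq (p := 3) (n := 4) (by norm_num) (3 ^ 3)
  have hηV : ValEq η (3 / 4) :=
    .of_pow (n := 4) (r := 3) (by norm_num) (hη ▸ valEq_three.pow 3)
  obtain ⟨t1, ht1, s1, hs1, h1⟩ := exists_root_near (a := a) (b := b) (ξ := (x : Ω 3))
    (ξ' := x + η) (r := 7 / 4) (c := 3 / 4) hf (by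
      have e1 : ValGE (15 * (x : Ω 3) ^ 4 * η ^ 2) 2 :=
        valGE_sq_term_three hxV hηV.ge (by norm_num)
      have e2 := (hηV.pow 3 rfl).mul (valEq_cubic_three hxV (hηV.ge')) rfl
      convert (hf'.mul hηV (t := 7 / 4)).add
        ((hf.add e1).add (e2.ge' (s := 2))) (by norm_num) using 1
      ring) (by norm_num) (by rwa [add_sub_cancel_left])
  have h1 := h1.mono (show (3 / 4 : ℝ) ≤ s1 by linarith)
  -- a root at distance `1 / 2`
  obtain ⟨t2, ht2, htr⟩ := exists_root_valEq_of_trace (p := 3) (a := a) (b := b)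
    (F := fun t => (t + (x : Ω 3)) * ((t - (x : Ω 3)) ^ 2 * (t + (x : Ω 3)) ^ 3 / 3))
    (fun t ht => ((root_valGE ht).add hxV.ge).mul (hI t ht) (by simp)) (by
      intro r hr s1 s2 s3 s4 s5
      have : ∀ i, (r i + (x : Ω 3)) * ((r i - (x : Ω 3)) ^ 2 *
          (r i + (x : Ω 3)) ^ 3 / 3) = (2 * x * r i ^ 5 - x ^ 2 * r i ^ 4 -
            4 * x ^ 3 * r i ^ 3 - x ^ 4 * r i ^ 2 + (2 * x ^ 5 - a) * r i + (x ^ 6 - b)) / 3 := by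
        intro i
        rw [← mul_div_assoc]
        congr 1
        linear_combination hr i
      simp only [this, ← Finset.sum_div, Finset.sum_add_distrib, Finset.sum_sub_distrib,
        ← Finset.mul_sum, s1, s2, s3, s4, s5]
      convert valEq_two_three.add (valEq_three.ge.mul
        (valGE_intCast (2 - 10 * u * x - 6 * m)) (t := 1) (by simp)) one_pos using 1
      rw [hb', ha]
      push_cast
      simp
      rw [div_eq_iff valEq_three.ne_zero]
      linear_combination (6 * (x : Ω 3) ^ 4 + 6 * x ^ 2 + 36) * hx')
  have hbad2 : ValEq (t2 + (x : Ω 3)) 0 ∧ ValEq (t2 - (x : Ω 3)) (1 / 2) := by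
    rcases root_cases_three ha hb' hx3 ht2 with ⟨-, h⟩ | ⟨h, h'⟩
    · have := htr.le_of_ge (h.mul (hI t2 ht2) le_rfl)
      norm_num at this
    · refine ⟨h, .of_pow (n := 2) (r := 1) two_ne_zero ?_⟩
      refine .of_mul (y := (t2 + (x : Ω 3)) ^ 4 / 3) (r := 0) ?_
        ((h.pow 4 rfl).div valEq_three rfl)
      convert htr using 1; ring
  obtain ⟨hy2, hz2⟩ := hbad2
  obtain ⟨t3, ht3, hz3, hy3⟩ := exists_root_good_three ha hb' hx3 ha3 hf
  have hy1 := (root_valGE ht1).add hxV.ge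
  have hτ : ∀ j, (![t1, t2, t3] : Fin 3 → Ω 3) j ^ 6 +
      a * (![t1, t2, t3] : Fin 3 → Ω 3) j + b = 0 := by
    intro j; fin_cases j
    exacts [ht1, ht2, ht3]
  refine dvd_of_rank (fun j => hd _ (hτ j)) 6 ![![0, 4, 6, 6, 6, 3], ![0, 3, 6, 6, 6, 0],
    ![0, 0, 0, 2, 4, 0]] ?_ ∅ (by simp) ![0, 2, 3, 4, 5, 1] ![0, 1, 2, 2, 2, 1] ?_ (by decide)
  · intro j i
    fin_cases j
    · have h12 : ValGE ((t1 - (x : Ω 3)) ^ 2) 1 := h1.pow 2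
      fin_cases i
      exacts [valEq_one.ge', h1.mono, h12.mono,
        h12.mul hy1, h12.mul (hy1.pow 2 (t := 0) (by simp)),
        ((h1.pow 2 le_rfl).mul (hy1.pow 3 (t := 0) (by simp)) le_rfl).div valEq_three]
    · have h22 : ValEq ((t2 - (x : Ω 3)) ^ 2) 1 := hz2.pow 2
      fin_cases i
      exacts [valEq_one.ge', hz2.ge', h22.ge',
        h22.ge.mul hy2.ge, h22.ge.mul (hy2.ge.pow 2 (t := 0) (by simp)),
        (hI t2 ht2).mono]
    · have h32 : ValEq ((t3 - (x : Ω 3)) ^ 2) 0 := hz3.pow 2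
      fin_cases i
      exacts [valEq_one.ge', hz3.ge', h32.ge',
        h32.ge.mul hy3.ge, h32.ge.mul (hy3.ge.pow 2 le_rfl),
        (hI t3 ht3).mono]
  · intro i _
    have h32 : ValEq ((t3 - (x : Ω 3)) ^ 2) 0 := hz3.pow 2
    fin_cases i
    exacts [valEq_one.congr,
      hz2.congr (s := ((3 : ℕ) : ℝ) / ((6 : ℕ) : ℝ)),
      h32.congr (s := ((0 : ℕ) : ℝ) / ((6 : ℕ) : ℝ)),
      h32.mul hy3 (t := ((2 : ℕ) : ℝ) / ((6 : ℕ) : ℝ)),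
      h32.mul (hy3.pow 2 rfl) (t := ((4 : ℕ) : ℝ) / ((6 : ℕ) : ℝ)),
      ((hz2.pow 2 rfl).mul (hy2.pow 3 rfl) rfl).div valEq_three
        (t := ((0 : ℕ) : ℝ) / ((6 : ℕ) : ℝ))]

end ThreeFifth


section ThreeLastPlaces

variable {K : Type*} [Field K] [NumberField K] {θ : K} {a b a' x ε : ℤ} {k d : ℕ}

/-- The standing assumptions of the case where the discriminant is divisible by `3 ^ 8`. -/
structure ThreeSetting (a b a' ε : ℤ) (k d : ℕ) : Prop where
  eq : a = 3 * a'
  sq_eq : ε ^ 2 = 1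
  dvd_sub : (3 : ℤ) ∣ a' - ε
  dvd_b : (9 : ℤ) ∣ b - 5
  discr_ne : Δ(a,b) ≠ 0
  valuation : padicValInt 3 Δ(a,b) = d
  one_le : 1 ≤ k
  le : 2 * k + 5 ≤ d
  le' : d ≤ 2 * k + 6
  lt : 8 ≤ d

namespace ThreeSetting

theorem eps_not_dvd (h : ThreeSetting a b a' ε k d) : ¬ (3 : ℤ) ∣ ε := fun h3 =>
  absurd (h.sq_eq ▸ dvd_pow h3 two_ne_zero : (3 : ℤ) ∣ 1) (by decide)

theorem not_dvd (h : ThreeSetting a b a' ε k d) : ¬ (3 : ℤ) ∣ a' := fun h3 => h.eps_not_dvd (by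
  have := _root_.dvd_sub h3 h.dvd_sub
  rwa [sub_sub_cancel] at this)

theorem valEq_a (h : ThreeSetting a b a' ε k d) : ValEq (a : Ω 3) 1 := by
  rw [h.eq]; push_cast
  exact valEq_three.mul (valEq_int_three h.not_dvd) (by simp)

theorem exists_b_eq (h : ThreeSetting a b a' ε k d) : ∃ c, b = -1 - 3 * c := by
  obtain ⟨m, hm⟩ := h.dvd_b
  exact ⟨-2 - 3 * m, by linarith⟩

theorem valEq_b (h : ThreeSetting a b a' ε k d) : ValEq (b : Ω 3) 0 := by
  obtain ⟨c, hc⟩ := h.exists_b_eq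
  exact valEq_b_three hc (by norm_num)

theorem data (h : ThreeSetting a b a' ε k d) : ValEq (5 * (a : Ω 3)) 1 ∧
    ValGE (6 * (b : Ω 3)) 1 ∧
    ValEq (5 ^ 5 * (a : Ω 3) ^ 6 - 6 ^ 6 * (b : Ω 3) ^ 5) d :=
  ⟨valEq_five_three.mul h.valEq_a (by simp), valEq_six_three.ge.mul h.valEq_b.ge (by simp),
    cast_discr_valEq h.discr_ne h.valuation⟩

theorem linear_valGE (h : ThreeSetting a b a' ε k d) {N : ℕ} (hx : (3 : ℤ) ^ N ∣ 5 * a' * x + 2 * b) :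
    ValGE (5 * (a : Ω 3) * (x : Ω 3) + 6 * (b : Ω 3)) ((N : ℝ) + 1) := by
  have h1 := valGE_of_dvd (p := 3) (by exact_mod_cast hx : ((3 : ℕ) : ℤ) ^ N ∣ 5 * a' * x + 2 * b)
  convert valEq_three.ge.mul h1 (add_comm _ _).le using 1
  rw [h.eq]; push_cast; ring

theorem dvd_x_sub (h : ThreeSetting a b a' ε k d) (hx : (3 : ℤ) ∣ 5 * a' * x + 2 * b) :
    (3 : ℤ) ∣ x - ε := by
  obtain ⟨u, hu⟩ := hx
  obtain ⟨v, hv⟩ := h.dvd_sub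
  obtain ⟨m, hm⟩ := h.dvd_b
  refine ⟨-ε * u + 5 * ε * v * x + 2 * x + 3 * ε + 6 * ε * m, ?_⟩
  linear_combination (-ε) * hu + 5 * x * ε * hv + 2 * ε * hm - (-5 * x) * h.sq_eq

theorem not_dvd_x (h : ThreeSetting a b a' ε k d) (hx : (3 : ℤ) ∣ x - ε) : ¬ (3 : ℤ) ∣ x :=
  fun h3 => h.eps_not_dvd (by
    have := _root_.dvd_sub h3 hx
    rwa [sub_sub_cancel] at this)

/-- The data attached to an integer `x` of high precision. -/
theorem precise (h : ThreeSetting a b a' ε k d) (hx : (3 : ℤ) ^ d ∣ 5 * a' * x + 2 * b) :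
    ValEq (6 * (x : Ω 3) ^ 5 + (a : Ω 3)) (d - 5) ∧
    ValEq ((x : Ω 3) ^ 6 + (a : Ω 3) * (x : Ω 3) + (b : Ω 3)) (d - 6) ∧
    (3 : ℤ) ∣ x - ε := by
  obtain ⟨h5a, h6b, hD⟩ := h.data
  have hε := h.linear_valGE hx
  have r4 : (8 : ℝ) ≤ d := by exact_mod_cast h.lt
  have hx1 := (dvd_pow_self 3 (n := d) (by have := h.lt; omega)).trans hx
  exact ⟨(deriv_valEq h5a h6b hε (by linarith) hD (by linarith)).congr (by ring),
    (value_valEq h5a h6b h.valEq_b hε (by linarith) (by linarith) hD (by linarith)).congr (by ring),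
    h.dvd_x_sub hx1⟩

theorem exists_precise (h : ThreeSetting a b a' ε k d) (N : ℕ) :
    ∃ x : ℤ, (3 : ℤ) ^ N ∣ 5 * a' * x + 2 * b := by
  have := exists_dvd_mul_add (p := 3) (u := 5 * a') (by
    intro h5
    rcases (Int.prime_iff_natAbs_prime.mpr (by norm_num) : Prime (3 : ℤ)).dvd_or_dvd
      (by exact_mod_cast h5) with h6 | h6
    · exact absurd h6 (by decide)
    · exact h.not_dvd h6) (2 * b) N
  exact_mod_cast this

/-- A root is close either to `-x` or to `x`. -/
theorem root_cases (h : ThreeSetting a b a' ε k d) (hx : (3 : ℤ) ∣ x - ε) {w : ℝ} (hw : w ≤ 1)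
    (hd : 3 * w ≤ d - 6) {t : Ω 3} (ht : t ^ 6 + a * t + b = 0) :
    (ValEq (t - (x : Ω 3)) 0 ∧ ValGE (t + (x : Ω 3)) (1 / 3)) ∨
    (ValEq (t + (x : Ω 3)) 0 ∧ ValGE (t - (x : Ω 3)) w) := by
  obtain ⟨c, hc⟩ := h.exists_b_eq
  obtain ⟨y, hy⟩ := h.exists_precise d
  obtain ⟨hf', hf, hyε⟩ := h.precise hy
  have r4 : (8 : ℝ) ≤ d := by exact_mod_cast h.lt
  refine (root_cases_three h.eq hc (h.not_dvd_x hx) ht).imp_right fun h1 => ⟨h1.1, ?_⟩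
  have hyx : ValGE ((y - x : ℤ) : Ω 3) 1 := valGE_int_three (by
    have := _root_.dvd_sub hyε hx
    rwa [sub_sub_sub_cancel_right] at this)
  push_cast at hyx
  have h2 : ValGE (t - (y : Ω 3)) (1 / 3) := by
    convert h1.2.sub (hyx.mono) using 1; ring
  have h3 := sub_valGE_three ht (valEq_int_three (h.not_dvd_x hyε)) h2 (hf.ge' hd)
    (hf'.ge' (by linarith)) hw
  convert h3.add (hyx.mono hw) using 1; ring

/-- `d = 8`. -/
theorem rowHolds_fifth (hS : IsTrinomialGenerator θ a b) (h : ThreeSetting a b a' ε 1 8) :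
    RowHolds 3 θ Δ(a,b) {8} 6
      {![1, θ, θ ^ 2, θ ^ 3, θ ^ 4, (ε + θ + ε * θ ^ 2 + θ ^ 3 + ε * θ ^ 4 + θ ^ 5) / 3]} := by
  have hεV := valEq_unit_of_sq_eq_one h.sq_eq
  have h0 : (3 : ℤ) ∣ ε - ε := by simp
  obtain ⟨c, hc⟩ := h.exists_b_eq
  obtain ⟨y, hy⟩ := h.exists_precise 8
  obtain ⟨hf', hf, hyε⟩ := h.precise hy
  have hyV := valEq_int_three (h.not_dvd_x hyε)
  have hyx := valGE_int_three hyε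
  push_cast at hyx
  have hI : ∀ t : Ω 3, t ^ 6 + a * t + b = 0 →
      ValGE ((t - (ε : Ω 3)) ^ 2 * (t + (ε : Ω 3)) ^ 3 / 3) 0 := fun t ht =>
    fifthValues_five_valGE hεV ht
      ((h.root_cases h0 (w := 1 / 2) (by norm_num) (by norm_num) ht).imp And.right And.right)
  refine rowHolds_three_fifth hS h.sq_eq hI h.valuation rfl fun d hd => ?_
  obtain ⟨η, hη⟩ := exists_pow_eq two_pos (3 : Ω 3)
  have hηV : ValEq η (1 / 2) := .of_pow two_ne_zero (hη ▸ valEq_three)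
  obtain ⟨t1, ht1, s1, hs1, h1⟩ := exists_root_near (a := a) (b := b) (ξ := (y : Ω 3))
    (ξ' := y + η) (r := 3 / 2) (c := 1 / 2) hf.ge (by
      have e1 : ValGE (15 * (y : Ω 3) ^ 4 * η ^ 2) 2 :=
        valGE_sq_term_three hyV hηV.ge (by norm_num)
      have e2 := (hηV.pow 3 rfl).mul (valEq_cubic_three hyV (hηV.ge')) rfl
      convert (e2.congr (s := 3 / 2)).add (((hf'.mul hηV rfl).ge' (s := 2)).add ((hf.ge' (s := 2)).add e1)) (by norm_num) using 1
      ring) (by norm_num) (by rwa [add_sub_cancel_left])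
  have hy1 : ValEq (t1 + (ε : Ω 3)) 0 ∧ ValEq (t1 - (ε : Ω 3)) (2 / 3) := by
    have h3 : ValGE (t1 - (ε : Ω 3)) (1 / 2) := by
      convert (h1.mono hs1.le).add (hyx.mono) using 1; ring
    rcases h.root_cases h0 (w := 2 / 3) (by norm_num) (by norm_num) ht1 with ⟨h4, -⟩ | ⟨h4, h5⟩
    · have := h4.le_of_ge h3
      norm_num at this
    · refine ⟨h4, ?_⟩
      have h6 : ValGE (t1 - (y : Ω 3)) (2 / 3) := by
        convert h5.sub (hyx.mono) using 1; ring
      convert (valEq_sub_three ht1 hyV (h6.mono (by norm_num)) h6 (hf.congr (by norm_num)) hf'.ge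
        (by norm_num) (by norm_num)).add hyx (by norm_num) using 1
      ring
  obtain ⟨hy1, hz1⟩ := hy1
  obtain ⟨t3, ht3, hz3, hy3⟩ : ∃ t : Ω 3, t ^ 6 + a * t + b = 0 ∧
      ValEq (t - (ε : Ω 3)) 0 ∧ ValEq (t + (ε : Ω 3)) (1 / 3) := by
    obtain ⟨t, ht, h2, h3⟩ := exists_root_good_three h.eq hc (h.not_dvd_x hyε) h.not_dvd
      (hf.ge')
    refine ⟨t, ht, ?_, ?_⟩
    · convert h2.add hyx one_pos using 1; ring
    · convert h3.add hyx.neg (by norm_num) using 1; ring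
  have hτ : ∀ j, (![t1, t3] : Fin 2 → Ω 3) j ^ 6 +
      a * (![t1, t3] : Fin 2 → Ω 3) j + b = 0 := by
    intro j; fin_cases j
    exacts [ht1, ht3]
  refine dvd_of_rank (fun j => hd _ (hτ j)) 3 ![![0, 2, 3, 3, 3, 1], ![0, 0, 0, 1, 2, 0]] ?_ ∅
    (by simp) ![0, 2, 3, 4, 5, 1] ![0, 0, 1, 1, 1, 0] ?_ (by decide)
  · intro j i
    fin_cases j
    · have h22 : ValEq ((t1 - (ε : Ω 3)) ^ 2) (4 / 3) := hz1.pow 2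
      fin_cases i
      exacts [valEq_one.ge', hz1.ge', h22.ge',
        h22.ge.mul hy1.ge, h22.ge.mul (hy1.ge.pow 2 (t := 0) (by simp)),
        (h22.ge.mul (hy1.ge.pow 3 le_rfl) le_rfl).div valEq_three]
    · have h32 : ValEq ((t3 - (ε : Ω 3)) ^ 2) 0 := hz3.pow 2
      fin_cases i
      exacts [valEq_one.ge', hz3.ge', h32.ge',
        h32.ge.mul hy3.ge, h32.ge.mul (hy3.ge.pow 2 le_rfl),
        (hI t3 ht3).mono]
  · intro i _
    have h32 : ValEq ((t3 - (ε : Ω 3)) ^ 2) 0 := hz3.pow 2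
    fin_cases i
    exacts [valEq_one.congr, hz1.congr,
      h32.congr (s := ((0 : ℕ) : ℝ) / ((3 : ℕ) : ℝ)),
      h32.mul hy3 (t := ((1 : ℕ) : ℝ) / ((3 : ℕ) : ℝ)),
      h32.mul (hy3.pow 2 rfl) (t := ((2 : ℕ) : ℝ) / ((3 : ℕ) : ℝ)),
      ((hz1.pow 2 rfl).mul (hy1.pow 3 rfl) rfl).div valEq_three]

end ThreeSetting

end ThreeLastPlaces


section ThreeLastRows

variable {K : Type*} [Field K] [NumberField K] {θ : K} {a b a' x ε : ℤ} {k d : ℕ}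

/-- The lists of `1, z, z * y, z * y ^ 2, z * y ^ 3` with `z = θ - x`, `y = θ + x`, and of the
shifted numerator of `lastElt`. -/
def oppositeList (a x : ℤ) : Fin 6 → List ℤ :=
  ![[], [-x], [-x ^ 2, 0], [-x ^ 3, -x ^ 2, x], [-x ^ 4, -2 * x ^ 3, 0, 2 * x],
    [-5 * x ^ 5 + (6 * x ^ 5 + a), x ^ 4, x ^ 3, x ^ 2, x]]

/-- The values at a root of the family with lists `oppositeList`. -/
noncomputable def oppositeValues (a x : ℤ) (k : ℕ) (t : Ω 3) : Fin 6 → Ω 3 :=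
  ![1, t - x, (t - x) * (t + x), (t - x) * (t + x) ^ 2, (t - x) * (t + x) ^ 3 / 3,
    (lastNum (x : Ω 3) t + (6 * (x : Ω 3) ^ 5 + (a : Ω 3))) / 3 ^ k]

theorem tri_oppositeList (a x : ℤ) (k : ℕ) (t : Ω 3) (i : Fin 6) :
    tri (oppositeList a x) t i / ((3 : ℕ) : Ω 3) ^ (![0, 0, 0, 0, 1, k] : Fin 6 → ℕ) i =
      oppositeValues a x k t i := by
  fin_cases i <;>
    simp [tri, oppositeList, oppositeValues, lastNum, Finset.sum_range_succ] <;> ring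

theorem valEq_three_pow (k : ℕ) : ValEq ((3 : Ω 3) ^ k) k := by
  exact_mod_cast valEq_prime_pow (p := 3) k

namespace ThreeSetting

theorem root_cases_one (h : ThreeSetting a b a' ε k d) (hk : 2 ≤ k) (hx : (3 : ℤ) ∣ x - ε)
    {t : Ω 3} (ht : t ^ 6 + a * t + b = 0) :
    (ValEq (t - (x : Ω 3)) 0 ∧ ValGE (t + (x : Ω 3)) (1 / 3)) ∨
    (ValEq (t + (x : Ω 3)) 0 ∧ ValGE (t - (x : Ω 3)) 1) := by
  refine h.root_cases hx le_rfl ?_ ht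
  have r2 : 2 * (k : ℝ) + 5 ≤ d := by exact_mod_cast h.le
  have : (2 : ℝ) ≤ k := by exact_mod_cast hk
  linarith

theorem fourth_valGE (h : ThreeSetting a b a' ε k d) (hk : 2 ≤ k) (hx : (3 : ℤ) ∣ x - ε)
    {t : Ω 3} (ht : t ^ 6 + a * t + b = 0) :
    ValGE ((t - (x : Ω 3)) * (t + (x : Ω 3)) ^ 3 / 3) 0 := by
  rcases h.root_cases_one hk hx ht with ⟨h1, h2⟩ | ⟨h1, h2⟩
  · exact (h1.ge.mul (h2.pow 3 le_rfl) le_rfl).div valEq_three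
  · exact (h2.mul (h1.ge.pow 3 le_rfl) le_rfl).div valEq_three

theorem quartic_valGE (hxV : ValEq (x : Ω 3) 0) {z : Ω 3} (hz : ValGE z 1) :
    ValGE (quartic (x : Ω 3) z) 1 := by
  have hx' (n : ℕ) : ValGE ((x : Ω 3) ^ n) 0 := hxV.ge.pow n (by simp)
  have hz0 := hz.mono (s := 0)
  unfold quartic
  exact ((((valEq_fifteen_three.ge.mul (hx' 4) (by simp)).add
    (((valGE_ofNat 20).mul (hx' 3) le_rfl).mul hz (by simp))).add
    ((valEq_fifteen_three.ge.mul (hx' 2) le_rfl).mul (hz0.pow 2 le_rfl) (by simp))).add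
    ((valEq_six_three.ge.mul hxV.ge le_rfl).mul (hz0.pow 3 le_rfl) (by simp))).add
    (hz.pow 4)

theorem last_valGE (h : ThreeSetting a b a' ε k d) (hk : 2 ≤ k)
    (hx : (3 : ℤ) ^ k ∣ 5 * a' * x + 2 * b) :
    ValGE (6 * (x : Ω 3) ^ 5 + (a : Ω 3)) k ∧
    ∀ t : Ω 3, t ^ 6 + a * t + b = 0 → ValGE (lastNum (x : Ω 3) t) k := by
  obtain ⟨h5a, h6b, hD⟩ := h.data
  have hε := h.linear_valGE hx
  have hx1 := h.dvd_x_sub ((dvd_pow_self 3 (Nat.one_le_iff_ne_zero.mp h.one_le)).trans hx)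
  have r1 : (2 : ℝ) ≤ k := by exact_mod_cast hk
  have r2 : 2 * (k : ℝ) + 5 ≤ d := by exact_mod_cast h.le
  have r3 : (d : ℝ) ≤ 2 * k + 6 := by exact_mod_cast h.le'
  have hf' := deriv_valGE (s := k) h5a h6b hε (by linarith) hD.ge (by linarith) (by linarith)
  have hf := value_valGE (s := d - 6) h5a h6b h.valEq_b.ge hε (by linarith) (by linarith) hD.ge
    (by linarith) (by linarith)
  refine ⟨hf', fun t ht => ?_⟩
  rcases h.root_cases_one hk hx1 ht with ⟨hz, -⟩ | ⟨-, hz⟩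
  · convert ((lastNum_add_valGE ht hf hz).mono (s := (k : ℝ)) (by linarith)).sub hf' using 1
    ring
  · exact lastNum_valGE ht hf' (hf.mul (quartic_valGE (valEq_int_three (h.not_dvd_x hx1)) hz)
      (by linarith))

theorem oppositeValues_valGE (h : ThreeSetting a b a' ε k d) (hk : 2 ≤ k)
    (hx : (3 : ℤ) ^ k ∣ 5 * a' * x + 2 * b)
    {t : Ω 3} (ht : t ^ 6 + a * t + b = 0) (i : Fin 6) :
    ValGE (oppositeValues a x k t i) 0 := by
  have hx1 := h.dvd_x_sub ((dvd_pow_self 3 (Nat.one_le_iff_ne_zero.mp h.one_le)).trans hx)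
  have hz := (root_valGE ht).sub (valGE_intCast x)
  have hy := (root_valGE ht).add (valGE_intCast x)
  obtain ⟨hf', hL⟩ := h.last_valGE hk hx
  fin_cases i
  exacts [valEq_one.ge, hz, hz.mul hy (by simp), hz.mul (hy.pow 2 (t := 0) (by simp)) (by simp),
    h.fourth_valGE hk hx1 ht, ((hL t ht).add hf').div (valEq_three_pow k) (by simp)]

theorem integralFamily (h : ThreeSetting a b a' ε k d) (hk : 2 ≤ k)
    (hx : (3 : ℤ) ^ k ∣ 5 * a' * x + 2 * b) :
    IntegralFamily 3 a b ![[], [], [], [], [-1, ε, 0, -ε], [-5 * x ^ 5, x ^ 4, x ^ 3, x ^ 2, x]]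
      ![0, 0, 0, 0, 1, k] := by
  have hε : (ε : Ω 3) ^ 2 = 1 := by
    exact_mod_cast congrArg (Int.cast : ℤ → Ω 3) h.sq_eq
  have h3 : (3 : Ω 3) ≠ 0 := valEq_three.ne_zero
  refine .of_eq (fun t => ![1, t, t ^ 2, t ^ 3,
    (t - ε) * (t + ε) ^ 3 / 3 - (ε * t ^ 3 - ε * t), lastNum (x : Ω 3) t / 3 ^ k]) ?_ ?_
  · intro t i; fin_cases i <;> simp [tri, lastNum, Finset.sum_range_succ]
    field_simp
    linear_combination ((ε : Ω 3) ^ 2 + 1 + 2 * ε * t) * hε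
  · intro t ht i
    have h0 := root_valGE ht
    have hεV := valGE_intCast (p := 3) ε
    fin_cases i
    exacts [valEq_one.ge, h0, h0.pow 2 (by simp), h0.pow 3 (by simp),
      (h.fourth_valGE hk (by simp) ht).sub ((hεV.mul (h0.pow 3 le_rfl) (by simp)).sub
        (hεV.mul h0 (by simp))),
      ((h.last_valGE hk hx).2 t ht).div (valEq_three_pow k) (by simp)]

end ThreeSetting

/-- The bases of the case where the discriminant is divisible by `3 ^ 9`. -/
theorem rowHolds_three_last {vD : Set ℕ} {vdK : ℕ} (hS : IsTrinomialGenerator θ a b)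
    (h : ThreeSetting a b a' ε k d) (hk : 2 ≤ k) (hD : d ∈ vD) (hsum : d = vdK + 2 * (k + 1))
    (hx : (3 : ℤ) ^ k ∣ 5 * a' * x + 2 * b)
    (hM : ∀ d : Fin 6 → ℤ, (∀ t : Ω 3, t ^ 6 + a * t + b = 0 →
      ValGE (∑ i, (d i : Ω 3) * oppositeValues a x k t i) 1) → ∀ i, ((3 : ℕ) : ℤ) ∣ d i) :
    RowHolds 3 θ Δ(a,b) vD vdK
      {α | ∃ x : ℤ, 5 * a' * x + 2 * b ≡ 0 [ZMOD 3 ^ k] ∧ α = ![1, θ, θ ^ 2, θ ^ 3,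
          (-1 + ε * θ - ε * θ ^ 3 + θ ^ 4) / 3, lastElt 3 θ x k]} := by
  refine rowHolds_of_saturated hS (l := oppositeList a x) (k := ![0, 0, 0, 0, 1, k])
    (by rw [h.valuation]; exact hD)
    (by rw [h.valuation, hsum]; simp [Fin.sum_univ_succ, add_comm])
    (.of_eq _ (tri_oppositeList a x k) fun t ht => h.oppositeValues_valGE hk hx ht)
    (.of_eq _ (tri_oppositeList a x k) hM) ⟨_, x, Int.modEq_zero_iff_dvd.mpr hx, rfl⟩ rfl
    (monotone_last_two h.one_le) ?_
  rintro _ ⟨y, hy, rfl⟩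
  refine ⟨_, h.integralFamily hk (Int.modEq_zero_iff_dvd.mp hy), ?_⟩
  ext i; fin_cases i <;> simp [family, tri, lastElt, Finset.sum_range_succ]
  ring

/-- The elimination of the coefficients `d 1`, `d 2`, `d 3` at a root at distance `1 / 3` from
`-x`. -/
theorem ThreeSetting.dvd_of_last (h : ThreeSetting a b a' ε k d) (hk : 2 ≤ k)
    (hx : (3 : ℤ) ^ d ∣ 5 * a' * x + 2 * b) {c : Fin 6 → ℤ}
    (hc : ∀ t : Ω 3, t ^ 6 + a * t + b = 0 →
      ValGE (∑ i, (c i : Ω 3) * oppositeValues a x k t i) 1)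
    (h0 : ((3 : ℕ) : ℤ) ∣ c 0) (h4 : ((3 : ℕ) : ℤ) ∣ c 4) (h5 : ((3 : ℕ) : ℤ) ∣ c 5) (i : Fin 6) :
    ((3 : ℕ) : ℤ) ∣ c i := by
  obtain ⟨e, he⟩ := h.exists_b_eq
  obtain ⟨hf', hf, hxε⟩ := h.precise hx
  have r1 : (2 : ℝ) ≤ k := by exact_mod_cast hk
  have r2 : 2 * (k : ℝ) + 5 ≤ d := by exact_mod_cast h.le
  have hxk : (3 : ℤ) ^ k ∣ 5 * a' * x + 2 * b := (pow_dvd_pow 3 (by have := h.le; omega)).trans hx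
  obtain ⟨t, ht, hz, hy⟩ := exists_root_good_three h.eq he (h.not_dvd_x hxε) h.not_dvd
    (hf.ge' (by linarith))
  refine dvd_of_rank (T := Unit) (fun _ => hc t ht) 3 (fun _ => ![0, 0, 1, 2, 0, 0]) ?_ {0, 4, 5} ?_
    ![0, 0, 1, 2, 0, 0] (fun _ => ()) ?_ (by decide) i
  · intro _ i
    fin_cases i
    exacts [valEq_one.ge', hz.ge', hz.ge.mul hy.ge,
      hz.ge.mul (hy.ge.pow 2 le_rfl),
      (h.oppositeValues_valGE hk hxk ht 4).mono,
      (h.oppositeValues_valGE hk hxk ht 5).mono]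
  · intro i hi
    simp only [Finset.mem_insert, Finset.mem_singleton] at hi
    rcases hi with rfl | rfl | rfl
    exacts [h0, h4, h5]
  · intro i hi
    fin_cases i
    exacts [absurd (by simp) hi, hz.congr, hz.mul hy,
      hz.mul (hy.pow 2 rfl), absurd (by simp) hi, absurd (by simp) hi]

/-- The values at a root close to `x`. -/
theorem ThreeSetting.near_values (h : ThreeSetting a b a' ε k d)
    (hx : (3 : ℤ) ^ d ∣ 5 * a' * x + 2 * b) {t : Ω 3} (ht : t ^ 6 + a * t + b = 0) {w : ℝ}
    (hz : ValEq (t - (x : Ω 3)) w) (hw : 0 < w) :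
    ValEq (t + (x : Ω 3)) 0 ∧ ValEq (oppositeValues a x k t 1) w ∧
    ValEq (oppositeValues a x k t 2) w ∧ ValEq (oppositeValues a x k t 3) w ∧
    ValEq (oppositeValues a x k t 4) (w - 1) ∧ ValEq (oppositeValues a x k t 5) (d - 6 - k - w) := by
  obtain ⟨hf', hf, hxε⟩ := h.precise hx
  have hxV := valEq_int_three (h.not_dvd_x hxε)
  have hy : ValEq (t + (x : Ω 3)) 0 := by
    convert (valEq_two_three.mul hxV (t := 0) (by simp)).add hz.ge hw using 1; ring
  exact ⟨hy, hz, hz.mul hy (by simp), hz.mul (hy.pow 2 rfl) (by simp),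
    (hz.mul (hy.pow 3 rfl) rfl).div valEq_three (by simp),
    (lastNum_add_valEq ht hf hz rfl).div (valEq_three_pow k) (by ring)⟩

/-- The roots close to `x` on the long segment of the Newton polygon at `x`. -/
theorem ThreeSetting.near_pair (h : ThreeSetting a b a' ε k d) (hd : 10 ≤ d)
    (hx : (3 : ℤ) ^ d ∣ 5 * a' * x + 2 * b)
    {z₀ : Ω 3} (hz₀ : 15 * (x : Ω 3) ^ 4 * z₀ ^ 2 =
      -((x : Ω 3) ^ 6 + a * x + b)) :
    ValEq z₀ ((d - 7) / 2) ∧ ∃ t : Ω 3, t ^ 6 + a * t + b = 0 ∧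
      ∃ c, ((d : ℝ) - 7) / 2 < c ∧ ValGE (t - ((x : Ω 3) + z₀)) c := by
  obtain ⟨hf', hf, hxε⟩ := h.precise hx
  have r4 : (10 : ℝ) ≤ d := by exact_mod_cast hd
  exact exists_root_near_pair valEq_fifteen_three valEq_twenty_three.ge
    (valEq_int_three (h.not_dvd_x hxε)) (hf.congr (by ring)) hf'.ge
    (by linarith) (by linarith) (by linarith) hz₀

/-- A root at distance `1` from `x`. -/
theorem ThreeSetting.exists_root_one (h : ThreeSetting a b a' ε k d) (hd : 10 ≤ d)
    (hx : (3 : ℤ) ^ d ∣ 5 * a' * x + 2 * b) :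
    ∃ t : Ω 3, t ^ 6 + a * t + b = 0 ∧ ValEq (t - (x : Ω 3)) 1 := by
  obtain ⟨hf', hf, hxε⟩ := h.precise hx
  have r4 : (10 : ℝ) ≤ d := by exact_mod_cast hd
  have hxV := valEq_int_three (h.not_dvd_x hxε)
  have c1 : ValGE ((117612 : ℤ) : Ω 3) 4 := by
    exact_mod_cast valGE_of_dvd (p := 3) (k := 4) (n := 117612) (by norm_num)
  have c2 : ValEq ((4077 : ℤ) : Ω 3) 3 := by
    exact_mod_cast valEq_of_dvd_of_not (p := 3) (k := 3) (n := 4077) (by norm_num) (by norm_num)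
  push_cast at c1 c2
  obtain ⟨t, ht, s, hs, h1⟩ := exists_root_near (a := a) (b := b) (ξ := 7 * (x : Ω 3))
    (ξ' := 4 * (x : Ω 3)) (r := 3) (s := 4) (c := 1) (by
      convert ((hf.ge' (s := 4) (by linarith)).add ((hf'.ge.mul (valEq_six_three.ge.mul hxV.ge le_rfl)
        (t := 4) (by linarith)))).add (c1.mul (hxV.ge.pow 6 (t := 0) (by simp)) (t := 4) (by simp))
        using 1
      ring) (by
      convert (c2.mul (hxV.pow 6 (t := 0) (by simp)) (t := 3) (by simp)).add
        ((hf.ge' (s := 4) (by linarith)).add (hf'.ge.mul (valEq_three.ge.mul hxV.ge le_rfl)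
        (t := 4) (by linarith))) (by norm_num) using 1
      ring) (by norm_num) (by
      convert (valEq_three.mul hxV (t := 1) (by simp)).neg using 1; ring)
  refine ⟨t, ht, ?_⟩
  convert (valEq_six_three.mul hxV (t := 1) (by simp)).add h1 hs using 1
  ring

theorem rowHolds_three_last_even (hS : IsTrinomialGenerator θ a b) (h : ThreeSetting a b a' ε k d)
    (hk : 2 ≤ k) (hd : d = 2 * k + 6) :
    RowHolds 3 θ Δ(a,b) {n | 10 ≤ n ∧ Even n} 4
      {α | ∃ x : ℤ, 5 * a' * x + 2 * b ≡ 0 [ZMOD 3 ^ k] ∧ α = ![1, θ, θ ^ 2, θ ^ 3,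
          (-1 + ε * θ - ε * θ ^ 3 + θ ^ 4) / 3, lastElt 3 θ x k]} := by
  obtain ⟨x, hx⟩ := h.exists_precise d
  have hxk : (3 : ℤ) ^ k ∣ 5 * a' * x + 2 * b := (pow_dvd_pow 3 (by omega)).trans hx
  have hdr : (d : ℝ) = 2 * k + 6 := by exact_mod_cast hd
  have hkr : (2 : ℝ) ≤ k := by exact_mod_cast hk
  obtain ⟨hf', hf, hxε⟩ := h.precise hx
  have hxV := valEq_int_three (h.not_dvd_x hxε)
  refine rowHolds_three_last (x := x) hS h hk ⟨by omega, k + 3, by omega⟩ (by omega) hxk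
    fun c hc => ?_
  obtain ⟨z₀, hz₀⟩ := exists_sq_eq (a := (a : Ω 3)) (b := (b : Ω 3))
    valEq_fifteen_three hxV
  obtain ⟨hzV, t1, ht1, s, hs, hts⟩ := h.near_pair (by omega) hx hz₀
  obtain ⟨t2, ht2, hz2⟩ := h.exists_root_one (by omega) hx
  obtain ⟨-, p1, p2, p3, p4, p5⟩ := h.near_values hx ht1 (valEq_of_near hzV hs hts) (by linarith)
  obtain ⟨-, o1, o2, o3, o4, o5⟩ := h.near_values hx ht2 hz2 one_pos
  have v1 := h.oppositeValues_valGE hk hxk ht1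
  have v2 := h.oppositeValues_valGE hk hxk ht2
  have h0 : ((3 : ℕ) : ℤ) ∣ c 0 := by
    refine dvd_of_min (hc t1 ht1) 0 one_pos valEq_one fun j hj => .inr ?_
    fin_cases j
    exacts [absurd rfl hj, ⟨_, by linarith, p1.ge⟩, ⟨_, by linarith, p2.ge⟩, ⟨_, by linarith, p3.ge⟩,
      ⟨_, by linarith, p4.ge⟩, ⟨_, by linarith, p5.ge⟩]
  have h4 : ((3 : ℕ) : ℤ) ∣ c 4 := by
    refine dvd_of_min (hc t2 ht2) 4 (r := 1 - 1) (by norm_num) o4 fun j hj => ?_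
    fin_cases j
    exacts [.inl ⟨h0, v2 0⟩, .inr ⟨_, by linarith, o1.ge⟩, .inr ⟨_, by linarith, o2.ge⟩,
      .inr ⟨_, by linarith, o3.ge⟩, absurd rfl hj, .inr ⟨_, by linarith, o5.ge⟩]
  refine h.dvd_of_last hk hx hc h0 h4 (dvd_of_min (hc t1 ht1) 5 (by linarith) p5 fun j hj => ?_)
  fin_cases j
  exacts [.inl ⟨h0, v1 0⟩, .inr ⟨_, by linarith, p1.ge⟩, .inr ⟨_, by linarith, p2.ge⟩,
    .inr ⟨_, by linarith, p3.ge⟩, .inl ⟨h4, v1 4⟩, absurd rfl hj]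

theorem rowHolds_three_last_odd (hS : IsTrinomialGenerator θ a b) (h : ThreeSetting a b a' ε k d)
    (hk : 3 ≤ k) (hd : d = 2 * k + 5) :
    RowHolds 3 θ Δ(a,b) {n | 11 ≤ n ∧ Odd n} 3
      {α | ∃ x : ℤ, 5 * a' * x + 2 * b ≡ 0 [ZMOD 3 ^ k] ∧ α = ![1, θ, θ ^ 2, θ ^ 3,
          (-1 + ε * θ - ε * θ ^ 3 + θ ^ 4) / 3, lastElt 3 θ x k]} := by
  have hk2 : 2 ≤ k := by omega
  obtain ⟨x, hx⟩ := h.exists_precise d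
  have hxk : (3 : ℤ) ^ k ∣ 5 * a' * x + 2 * b := (pow_dvd_pow 3 (by omega)).trans hx
  have hdr : (d : ℝ) = 2 * k + 5 := by exact_mod_cast hd
  have hkr : (3 : ℝ) ≤ k := by exact_mod_cast hk
  obtain ⟨hf', hf, hxε⟩ := h.precise hx
  have hxV := valEq_int_three (h.not_dvd_x hxε)
  refine rowHolds_three_last (x := x) hS h hk2 ⟨by omega, k + 2, by omega⟩ (by omega) hxk
    fun c hc => ?_
  obtain ⟨z₀, hz₀⟩ := exists_sq_eq (a := (a : Ω 3)) (b := (b : Ω 3))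
    valEq_fifteen_three hxV
  obtain ⟨hzV, t1, ht1, s, hs, hts⟩ := h.near_pair (by omega) hx hz₀
  obtain ⟨-, t3, ht3, s', hs', hts'⟩ := h.near_pair (by omega) hx (z₀ := -z₀)
    (by rw [neg_sq]; exact hz₀)
  obtain ⟨t2, ht2, hz2⟩ := h.exists_root_one (by omega) hx
  obtain ⟨-, o1, o2, o3, o4, o5⟩ := h.near_values hx ht2 hz2 one_pos
  have v2 := h.oppositeValues_valGE hk2 hxk ht2
  have hpair : ∀ t : Ω 3, t ^ 6 + a * t + b = 0 →
      ValEq (t - (x : Ω 3)) ((d - 7) / 2) →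
      ∃ s, 0 < s ∧ ValGE ((c 0 : Ω 3) + (c 5 : Ω 3) * oppositeValues a x k t 5) s := by
    intro t ht hz
    obtain ⟨-, p1, p2, p3, p4, -⟩ := h.near_values hx ht hz (by linarith)
    have h6 := exists_pos_valGE_sum (hc t ht) (r := 0) one_pos {0, 5} valEq_one
      (oppositeValues a x k t) (fun i _ => ⟨1, one_pos, by simpa using valGE_zero _⟩) ?_
    · simpa [Finset.sum_pair (show (0 : Fin 6) ≠ 5 by decide), oppositeValues] using h6
    · intro i hi
      right
      fin_cases i
      exacts [absurd (by simp) hi, ⟨_, by linarith, p1.ge⟩, ⟨_, by linarith, p2.ge⟩,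
        ⟨_, by linarith, p3.ge⟩, ⟨_, by linarith, p4.ge⟩, absurd (by simp) hi]
  obtain ⟨r, hr, e⟩ := hpair t1 ht1 (valEq_of_near hzV hs hts)
  obtain ⟨r', hr', e'⟩ := hpair t3 ht3 (valEq_of_near hzV.neg hs' hts')
  have hdiff : ValEq (oppositeValues a x k t1 5 - oppositeValues a x k t3 5) 0 := by
    convert (lastNum_sub_valEq valEq_two_three ht1 ht3 hf hzV hs hs' hts hts' rfl).div
      (valEq_three_pow k) (t := 0) (by rw [hdr]; ring) using 1
    simp [oppositeValues]; ring
  obtain ⟨h0, h5⟩ := dvd_of_two_residues e hr e' hr' hdiff (h.oppositeValues_valGE hk2 hxk ht1 5)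
  refine h.dvd_of_last hk2 hx hc h0 ?_ h5
  refine dvd_of_min (hc t2 ht2) 4 (r := 1 - 1) (by norm_num) o4 fun j hj => ?_
  fin_cases j
  exacts [.inl ⟨h0, v2 0⟩, .inr ⟨_, by linarith, o1.ge⟩, .inr ⟨_, by linarith, o2.ge⟩,
    .inr ⟨_, by linarith, o3.ge⟩, absurd rfl hj, .inr ⟨_, by linarith, o5.ge⟩]

/-- Unit roots of a cubic polynomial without linear term are pairwise incongruent modulo `3` if
the quadratic coefficient is a unit. -/
theorem sub_valEq_of_cubic {u v w : Ω 3} (hu : ValEq u 0) (hv : ValGE v 0) (hw : ValGE w 0)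
    (h1 : ValEq (u + v + w) 0) (h2 : u * v + u * w + v * w = 0) : ValEq (u - v) 0 := by
  by_contra hcon
  obtain ⟨s, hs, h⟩ := exists_gt_valGE (x := u - v) (r := 0)
    (lt_of_le_of_ne (hu.ge.sub hv) (by simpa [ValEq] using hcon))
  have hm := min_le_left s 1
  have h3 : ValGE (u - w) (min s 1) := by
    refine ValGE.of_mul (y := u) (r := min s 1) ?_ hu (by simp)
    convert ((hu.ge.add hw).mul (h.mono hm) (t := min s 1) (by simp)).sub
      ((valEq_three.ge.mul (hu.ge.mul hw le_rfl) le_rfl).mono (s := min s 1) (by simp)) using 1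
    linear_combination h2
  have h4 : ValGE (u + v + w) (min s 1) := by
    convert ((valEq_three.ge.mul hu.ge le_rfl).mono (s := min s 1) (by simp)).sub
      ((h.mono hm).add h3) using 1
    ring
  have h5 := h1.le_of_ge h4
  have : (0 : ℝ) < min s 1 := lt_min hs one_pos
  linarith

theorem exists_cubic_roots {p : ℕ} [Fact p.Prime] (A C : Ω p) :
    ∃ ρ : Fin 3 → Ω p, (∀ i, ρ i ^ 3 + A * ρ i ^ 2 + C = 0) ∧
      ρ 0 + ρ 1 + ρ 2 = -A ∧ ρ 0 * ρ 1 + ρ 0 * ρ 2 + ρ 1 * ρ 2 = 0 := by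
  have hdeg : (X ^ 3 + Polynomial.C A * X ^ 2 + Polynomial.C C : (Ω p)[X]).degree = 3 := by
    compute_degree!
  obtain ⟨u, hu⟩ := IsAlgClosed.exists_root
    (X ^ 3 + Polynomial.C A * X ^ 2 + Polynomial.C C : (Ω p)[X]) (by rw [hdeg]; norm_num)
  have hu : u ^ 3 + A * u ^ 2 + C = 0 := by simpa [IsRoot] using hu
  obtain ⟨s, hs⟩ := exists_pow_eq two_pos ((A + u) ^ 2 - 4 * (u * (A + u)))
  refine ⟨![u, (-(A + u) + s) / 2, (-(A + u) - s) / 2], ?_, ?_, ?_⟩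
  · intro i
    fin_cases i
    · exact hu
    · simp
      linear_combination hu + ((-(A + u) + s) / 2 - u) / 4 * hs
    · simp
      linear_combination hu + ((-(A + u) - s) / 2 - u) / 4 * hs
  · simp; ring
  · simp
    linear_combination -hs / 4

/-- `d = 9`. -/
theorem rowHolds_three_nine (hS : IsTrinomialGenerator θ a b) (h : ThreeSetting a b a' ε 2 9) :
    RowHolds 3 θ Δ(a,b) {9} 3
      {α | ∃ x : ℤ, 5 * a' * x + 2 * b ≡ 0 [ZMOD 3 ^ 2] ∧ α = ![1, θ, θ ^ 2, θ ^ 3,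
          (-1 + ε * θ - ε * θ ^ 3 + θ ^ 4) / 3, lastElt 3 θ x 2]} := by
  obtain ⟨x, hx⟩ := h.exists_precise 9
  have hxk : (3 : ℤ) ^ 2 ∣ 5 * a' * x + 2 * b := (pow_dvd_pow 3 (by omega)).trans hx
  obtain ⟨hf', hf, hxε⟩ := h.precise hx
  have hxV := valEq_int_three (h.not_dvd_x hxε)
  refine rowHolds_three_last (x := x) hS h le_rfl rfl rfl hxk fun c hc => ?_
  set f : Ω 3 := (x : Ω 3) ^ 6 + a * x + b with hfdef
  have h20x : ValEq (20 * (x : Ω 3) ^ 3) 0 := valEq_twenty_three.mul (hxV.pow 3 rfl) (by simp)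
  have hf27 : ValEq (f / 27) 0 := by
    have h27 : ValEq (27 : Ω 3) 3 := by
      have := valEq_three_pow 3
      norm_num at this; exact this
    exact hf.div h27
  obtain ⟨ρ, hρ', hs1, hs2⟩ := exists_cubic_roots ((x : Ω 3) / 4)
    (f / 27 / (20 * (x : Ω 3) ^ 3))
  have hρ : ∀ i, 20 * (x : Ω 3) ^ 3 * ρ i ^ 3 + 5 * x ^ 4 * ρ i ^ 2 + f / 27 = 0 := by
    intro i
    have := mul_div_cancel₀ (f / 27) h20x.ne_zero
    linear_combination 20 * (x : Ω 3) ^ 3 * hρ' i - this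
  have h5x : ValEq (5 * (x : Ω 3) ^ 4) 0 := valEq_five_three.mul (hxV.pow 4 rfl) (by simp)
  have hρV : ∀ i, ValEq (ρ i) 0 := by
    intro i
    have h0 : ρ i ≠ 0 := by
      intro h0
      have := hρ i
      rw [h0] at this
      exact hf27.ne_zero (by linear_combination this)
    obtain ⟨w, hw⟩ := exists_valEq h0
    rcases lt_trichotomy w 0 with hlt | rfl | hgt
    · refine ((h20x.mul (hw.pow 3 rfl) rfl).false_of_add_eq_zero
        (((h5x.mul (hw.pow 2 rfl) rfl).ge' (s := 2 * w)).add
        (hf27.ge' (s := 2 * w) (by linarith))) (by push_cast; linarith) ?_).elim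
      rw [← add_assoc]; exact hρ i
    · exact hw
    · refine (hf27.false_of_add_eq_zero (((h20x.mul (hw.pow 3 rfl) rfl).ge' (s := 2 * w)
        (by push_cast; linarith)).add ((h5x.mul (hw.pow 2 rfl) rfl).ge' (s := 2 * w)))
        (by linarith) ?_).elim
      rw [add_comm]; exact hρ i
  have h4V : ValEq (4 : Ω 3) 0 := by simpa using valEq_int_three (n := 4) (by decide)
  have hsum : ValEq (ρ 0 + ρ 1 + ρ 2) 0 := by
    rw [hs1]; exact (hxV.div h4V (by simp)).neg
  have place : ∀ i, ∃ s, 0 < s ∧ ValGE (((c 0 : ℤ) : Ω 3) +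
      ((8 * x ^ 3 * c 4 + 5 * x ^ 4 * c 5 : ℤ) : Ω 3) * ρ i +
      ((20 * x ^ 3 * c 5 : ℤ) : Ω 3) * ρ i ^ 2) s := by
    intro i
    have h3ρ : ValEq (3 * ρ i) 1 := valEq_three.mul (hρV i) (by simp)
    have h81 : ValGE (81 : Ω 3) 4 := by
      have := (valEq_three_pow 4).ge
      norm_num at this; exact this
    have hρn (n : ℕ) : ValGE (ρ i ^ n) 0 := (hρV i).ge.pow n (by simp)
    obtain ⟨t, ht, s, hs, h1⟩ := exists_root_near (a := a) (b := b) (ξ := (x : Ω 3) + 3 * ρ i)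
      (ξ' := (x : Ω 3)) (r := 3) (s := 4) (c := 1) (by
        convert (hf'.ge.mul h3ρ.ge (t := 4) (by norm_num)).add
          (h81.mul ((((valGE_ofNat 15).mul (hxV.ge.pow 2 (t := 0) (by simp)) (t := 0) (by simp)).mul
            (hρn 4) (t := 0) (by simp)).add ((((valGE_ofNat 18).mul hxV.ge (t := 0) (by simp)).mul
            (hρn 5) (by simp)).add ((valGE_ofNat 9).mul (hρn 6) (by simp)))) (by simp)) using 1
        linear_combination 27 * hρ i) (hf.congr (by norm_num)) (by norm_num)
        (by rw [sub_add_cancel_left]; exact h3ρ.neg)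
    have hz := valEq_of_near h3ρ hs h1
    have hy0 : ValGE (t + (x : Ω 3)) 0 := (root_valGE ht).add hxV.ge
    obtain ⟨hy, p1, p2, p3, p4, p5⟩ := h.near_values hx ht hz one_pos
    have hzρ : ValGE ((t - (x : Ω 3)) / 3 - ρ i) (s - 1) := by
      convert h1.div valEq_three le_rfl using 1
      rw [sub_div, sub_div, add_div, mul_div_cancel_left₀ _ valEq_three.ne_zero]
      ring
    have hm1 := min_le_left (s - 1) 1
    have hm2 := min_le_right (s - 1) 1
    have hm : 0 < min (s - 1) 1 := lt_min (by linarith) one_pos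
    have e4 : ValGE (oppositeValues a x 2 t 4 - 8 * (x : Ω 3) ^ 3 * ρ i)
        (min (s - 1) 1) := by
      have hyx : ValGE ((t + (x : Ω 3)) ^ 2 + 2 * (x : Ω 3) * (t + (x : Ω 3)) +
          4 * (x : Ω 3) ^ 2) 0 := ((hy0.pow 2 (by simp)).add (((valGE_ofNat 2).mul hxV.ge
          (t := 0) (by simp)).mul hy0 (by simp))).add (h4V.ge.mul (hxV.ge.pow 2 (t := 0) (by simp))
          (by simp))
      convert (hzρ.mul (hy0.pow 3 (t := 0) (by simp)) (t := min (s - 1) 1) (by simp)).add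
        ((hρV i).ge.mul (hz.ge.mul hyx (t := 1) (by simp)) (by simp)) using 1
      simp only [oppositeValues]
      change (t - x) * (t + x) ^ 3 / 3 - _ = _
      ring
    have e5 : ValGE (oppositeValues a x 2 t 5 - (5 * (x : Ω 3) ^ 4 * ρ i +
        20 * (x : Ω 3) ^ 3 * ρ i ^ 2)) (min (s - 1) 1) := by
      refine ValGE.of_mul (y := ρ i) (r := s - 1) ?_ (hρV i) (by simp)
      convert (p5.ge.mul hzρ (t := s - 1)).neg using 1
      have h27 : 27 * (f / 27) = f := mul_div_cancel₀ _ (by norm_num)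
      have hsub : (t - (x : Ω 3)) * oppositeValues a x 2 t 5 = -(f / 27) * 3 := by
        simp only [oppositeValues]
        change (t - (x : Ω 3)) * ((lastNum (x : Ω 3) t + (6 * x ^ 5 + a)) / 3 ^ 2) = _
        rw [mul_div_assoc', sub_mul_lastNum ht, div_eq_iff (valEq_three_pow 2).ne_zero]
        linear_combination -h27
      have h3 : (3 : Ω 3) * 3⁻¹ = 1 := mul_inv_cancel₀ valEq_three.ne_zero
      linear_combination -hρ i + 3⁻¹ * hsub - f / 27 * h3
    obtain ⟨r, hr, h6⟩ := exists_pos_valGE_sum (hc t ht) (r := 0) one_pos {0, 4, 5} valEq_one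
      ![1, 0, 0, 0, 8 * (x : Ω 3) ^ 3 * ρ i,
        5 * (x : Ω 3) ^ 4 * ρ i + 20 * (x : Ω 3) ^ 3 * ρ i ^ 2] (by
        intro i hi
        refine ⟨min (s - 1) 1, hm, ?_⟩
        simp only [Finset.mem_insert, Finset.mem_singleton] at hi
        rcases hi with rfl | rfl | rfl
        · simpa [oppositeValues] using valGE_zero _
        · simpa using e4
        · simpa using e5) (by
        intro i hi
        right
        fin_cases i
        exacts [absurd (by simp) hi, ⟨_, one_pos, p1.ge⟩, ⟨_, one_pos, p2.ge⟩,
          ⟨_, one_pos, p3.ge⟩, absurd (by simp) hi, absurd (by simp) hi])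
    refine ⟨r, hr, ?_⟩
    rw [Finset.sum_insert (by decide), Finset.sum_pair (by decide)] at h6
    convert h6 using 1
    simp
    ring
  obtain ⟨r0, hr0, q0⟩ := place 0
  obtain ⟨r1, hr1, q1⟩ := place 1
  obtain ⟨r2, hr2, q2⟩ := place 2
  obtain ⟨h0, h45, h5⟩ := dvd_of_three_residues q0 hr0 q1 hr1 q2 hr2
    (sub_valEq_of_cubic (hρV 0) (hρV 1).ge (hρV 2).ge hsum hs2)
    (sub_valEq_of_cubic (hρV 0) (hρV 2).ge (hρV 1).ge (by convert hsum using 1; ring)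
      (by linear_combination hs2))
    (sub_valEq_of_cubic (hρV 1) (hρV 2).ge (hρV 0).ge (by convert hsum using 1; ring)
      (by linear_combination hs2)) (hρV 0).ge
  have hp : Prime ((3 : ℕ) : ℤ) := Int.prime_iff_natAbs_prime.mpr (by norm_num)
  have hx3 : ¬ ((3 : ℕ) : ℤ) ∣ x := by exact_mod_cast h.not_dvd_x hxε
  have h5' : ((3 : ℕ) : ℤ) ∣ c 5 := by
    rcases hp.dvd_or_dvd h5 with h5 | h5
    · rcases hp.dvd_or_dvd h5 with h5 | h5
      · exact absurd h5 (by decide)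
      · exact absurd (hp.dvd_of_dvd_pow h5) hx3
    · exact h5
  refine h.dvd_of_last le_rfl hx hc h0 ?_ h5'
  rw [_root_.dvd_add_left (dvd_mul_of_dvd_right h5' _)] at h45
  rcases hp.dvd_or_dvd h45 with h5 | h5
  · rcases hp.dvd_or_dvd h5 with h5 | h5
    · exact absurd h5 (by decide)
    · exact absurd (hp.dvd_of_dvd_pow h5) hx3
  · exact h5

end ThreeLastRows


section ThreeHalf

variable {K : Type*} [Field K] [NumberField K] {θ : K} {a b a₁ a₂ B m : ℤ}

theorem cube_sq_div_three {t : Ω 3} (hb : b = 27 * B) (ht : t ^ 6 + a * t + b = 0) :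
    (t ^ 2 / 3 + (B : Ω 3)) ^ 3 = (((B ^ 3 - B : ℤ) : Ω 3) - (a : Ω 3) / 27 * t) +
      3 * B * (t ^ 2 / 3) * (t ^ 2 / 3 + (B : Ω 3)) := by
  rw [hb] at ht
  push_cast at ht ⊢
  linear_combination ht / 27

theorem valEq_27 (hB : ¬ (3 : ℤ) ∣ B) (hb : b = 27 * B) : ValEq (b : Ω 3) 3 := by
  rw [hb]; push_cast
  have h27 := valEq_three_pow 3
  norm_num at h27
  exact h27.mul (valEq_int_three hB) (by simp)

theorem padicValInt_discr_27 {s : ℝ} (hbV : ValEq (b : Ω 3) 3)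
    (ha : ValGE (a : Ω 3) s) (hs : 4 ≤ s) :
    padicValInt 3 Δ(a,b) = 21 :=
  padicValInt_of_gt valEq_five_three.ge valEq_six_three ha hbV (by norm_num; linarith)

theorem cube_sub_dvd (B : ℤ) : (3 : ℤ) ∣ B ^ 3 - B := by
  have : B % 3 = 0 ∨ B % 3 = 1 ∨ B % 3 = 2 := by omega
  refine Int.dvd_of_emod_eq_zero ?_
  rcases this with h | h | h <;> simp [Int.sub_emod, pow_succ, Int.mul_emod, h]

theorem tri_27 (t : Ω 3) (i : Fin 6) :
    tri ![[], [], [3 * B], [0, 3 * B], [9 * B ^ 2, 0, 6 * B], [0, 9 * B ^ 2, 0, 6 * B]] t i /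
      ((3 : ℕ) : Ω 3) ^ (slopeExp 3 6 i) =
    ![1, t, t ^ 2 / 3 + (B : Ω 3), t * (t ^ 2 / 3 + (B : Ω 3)), (t ^ 2 / 3 + (B : Ω 3)) ^ 2, t * (t ^ 2 / 3 + (B : Ω 3)) ^ 2] i := by
  fin_cases i <;> simp [tri, Finset.sum_range_succ, slopeExp] <;> ring

theorem rowHolds_b27_a27 (hS : IsTrinomialGenerator θ a b) (ha : a = 27 * a₁) (hb : b = 27 * B)
    (ha₁ : ¬ (3 : ℤ) ∣ a₁) (hB : ¬ (3 : ℤ) ∣ B) :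
    RowHolds 3 θ Δ(a,b) {18} 6
      {![1, θ, θ ^ 2 / 3, θ ^ 3 / 3, θ ^ 4 / 3 ^ 2, θ ^ 5 / 3 ^ 2]} := by
  have haV : ValEq (a : Ω 3) 3 := valEq_27 ha₁ ha
  have hbV := valEq_27 hB hb
  obtain ⟨hI, hM⟩ := families_of_distinct (a := a) (b := b) _ (tri_27 (B := B)) 6 ![0, 3, 1, 4, 2, 5]
    (by decide) (by decide) (by
      intro t ht i
      have h1 : ValEq t (1 / 2) :=
        (valEq_root_of_le (by norm_num) haV.ge hbV ht).congr
      have hη : ValEq (t ^ 2 / 3) 0 := (h1.pow 2 rfl).div valEq_three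
      have hBV := valEq_int_three hB
      have h2 : ValEq (t ^ 2 / 3 + (B : Ω 3)) (1 / 6) := by
        refine .of_pow (n := 3) (r := 1 / 2) (by norm_num) ?_
        have e1 : ValEq ((a₁ : Ω 3) * t) (1 / 2) := (valEq_int_three ha₁).mul h1
        have e2 : ValGE (3 * (B : Ω 3) * (t ^ 2 / 3) * (t ^ 2 / 3 + (B : Ω 3))) 1 :=
          (((valEq_three.ge.mul hBV.ge le_rfl).mul hη.ge le_rfl).mul (hη.ge.add hBV.ge) (by simp))
        convert e1.neg.add ((valGE_int_three (cube_sub_dvd B)).add e2) (by norm_num) using 1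
        rw [cube_sq_div_three hb ht, ha]
        push_cast; ring
      fin_cases i
      exacts [valEq_one.congr, h1.congr, h2.congr,
        h1.mul h2, h2.pow 2, h1.mul (h2.pow 2 rfl)])
  exact rowHolds_single' hS
    (padicValInt_of_lt valEq_five_three valEq_six_three.ge haV hbV.ge (by norm_num)) rfl
    hI hM (integralFamily_six (by norm_num) haV.ge hbV) (slopeExp_zero _ _) (slopeExp_monotone _ _)
    (by ext i; fin_cases i <;> simp [family, tri, slopeExp])

theorem valGE_81 (ha : a = 81 * a₂) : ValGE (a : Ω 3) 4 := by
  exact_mod_cast valGE_of_dvd (p := 3) (k := 4) (n := a) ⟨a₂, by rw [ha]; norm_num⟩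

theorem root_facts_27 (hB : ¬ (3 : ℤ) ∣ B) (hb : b = 27 * B) (ha : a = 81 * a₂) {t : Ω 3}
    (ht : t ^ 6 + a * t + b = 0) : ValEq t (1 / 2) ∧ ValEq (t ^ 2 / 3) 0 ∧
      ValGE (t ^ 2 / 3 + (B : Ω 3)) 0 ∧ ValGE ((a : Ω 3) / 27 * t) (3 / 2) := by
  have haV := valGE_81 ha
  have h1 : ValEq t (1 / 2) :=
    (valEq_root_of_le (by norm_num) (haV.mono) (valEq_27 hB hb) ht).congr
  have hη : ValEq (t ^ 2 / 3) 0 := (h1.pow 2 rfl).div valEq_three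
  refine ⟨h1, hη, hη.ge.add (valGE_intCast B), ?_⟩
  have : (a : Ω 3) / 27 = 3 * a₂ := by rw [ha]; push_cast; ring
  rw [this]
  exact (valEq_three.ge.mul (valGE_intCast a₂) le_rfl).mul h1.ge

theorem rowHolds_b27_of_one (hS : IsTrinomialGenerator θ a b) (ha : a = 81 * a₂) (hb : b = 27 * B)
    (hB : ¬ (3 : ℤ) ∣ B) (hm : B ^ 3 - B = 3 * m) (hm3 : ¬ (3 : ℤ) ∣ m) :
    RowHolds 3 θ Δ(a,b) {21} 7
      {![1, θ, θ ^ 2 / 3, θ ^ 3 / 3, θ ^ 4 / 3 ^ 2, (θ ^ 2 + 3 * B) ^ 2 * θ / 3 ^ 3]} := by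
  have hBV := valEq_int_three hB
  have hfacts : ∀ t : Ω 3, t ^ 6 + a * t + b = 0 →
      ValEq t (1 / 2) ∧ ValEq (t ^ 2 / 3 + (B : Ω 3)) (1 / 3) := by
    intro t ht
    obtain ⟨h1, hη, hs, hat⟩ := root_facts_27 hB hb ha ht
    have h3 : ValEq (3 * (m : Ω 3)) 1 := valEq_three.mul (valEq_int_three hm3) (by simp)
    have e2 : ValEq (3 * (B : Ω 3) * (t ^ 2 / 3)) 1 :=
      (valEq_three.mul hBV rfl).mul hη (by simp)
    have hmc : ((B ^ 3 - B : ℤ) : Ω 3) = 3 * m := by rw [hm]; push_cast; ring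
    have hcube := cube_sq_div_three hb ht
    rw [hmc] at hcube
    have hs1 : ValGE (t ^ 2 / 3 + (B : Ω 3)) (1 / 3) := by
      refine .of_pow (n := 3) (r := 1) (by norm_num) ?_
      rw [hcube]
      exact (h3.ge.sub (hat.mono)).add (e2.ge.mul hs (by simp))
    refine ⟨h1, .of_pow (n := 3) (r := 1) (by norm_num) ?_⟩
    rw [hcube, sub_eq_add_neg, add_assoc]
    exact h3.add (s := 4 / 3) ((hat.mono).neg.add (e2.ge.mul hs1))
  obtain ⟨hI, hM⟩ := families_of_distinct (p := 3) (a := a) (b := b)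
    (l := ![[], [], [3 * B], [0, 3 * B], [9 * B ^ 2, 0, 6 * B], [0, 9 * B ^ 2, 0, 6 * B]])
    (k := ![0, 0, 1, 1, 2, 3])
    (fun t => ![1, t, t ^ 2 / 3 + (B : Ω 3), t * (t ^ 2 / 3 + (B : Ω 3)), (t ^ 2 / 3 + (B : Ω 3)) ^ 2,
      t * (t ^ 2 / 3 + (B : Ω 3)) ^ 2 / 3])
    (by intro t i; fin_cases i <;> simp [tri, Finset.sum_range_succ] <;> ring)
    6 ![0, 3, 2, 5, 4, 1] (by decide) (by decide) (by
      intro t ht i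
      obtain ⟨h1, h2⟩ := hfacts t ht
      fin_cases i
      exacts [valEq_one.congr, h1.congr, h2.congr,
        h1.mul h2, h2.pow 2,
        (h1.mul (h2.pow 2 rfl) rfl).div valEq_three])
  refine rowHolds_single' hS (l' := ![[], [], [], [], [], [0, 9 * B ^ 2, 0, 6 * B]])
    (padicValInt_discr_27 (valEq_27 hB hb) (valGE_81 ha) le_rfl) rfl hI hM
    (.of_eq (fun t => ![1, t, t ^ 2 / 3, t * (t ^ 2 / 3), (t ^ 2 / 3) ^ 2,
      t * (t ^ 2 / 3 + (B : Ω 3)) ^ 2 / 3]) ?_ ?_) rfl (by decide) ?_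
  · intro t i; fin_cases i <;> simp [tri, Finset.sum_range_succ] <;> ring
  · intro t ht i
    obtain ⟨h1, h2⟩ := hfacts t ht
    have hη := (root_facts_27 hB hb ha ht).2.1.ge
    fin_cases i
    exacts [valEq_one.ge, h1.ge', hη, h1.ge.mul hη, hη.pow 2 (by simp),
      ((h1.ge.mul (h2.ge.pow 2 le_rfl) le_rfl).div valEq_three)]
  · ext i; fin_cases i <;> simp [family, tri, Finset.sum_range_succ]
    ring

/-- If an integral function of the roots has trace zero and the sum of its squares is a unit, its
values fill three residue classes modulo `3`. -/
theorem exists_three_residues {F : Ω 3 → Ω 3} {N : Ω 3}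
    (hF : ∀ t : Ω 3, t ^ 6 + a * t + b = 0 → ValGE (F t) 0) (hN : ValEq N 0)
    (htr : ∀ r : Fin 6 → Ω 3, (∀ i, r i ^ 6 + a * r i + b = 0) → (∑ i, r i = 0) →
      (∑ i, r i ^ 2 = 0) → (∑ i, r i ^ 3 = 0) → (∑ i, r i ^ 4 = 0) → (∑ i, r i ^ 5 = -5 * a) →
      ∑ i, F (r i) = 0 ∧ ∑ i, F (r i) ^ 2 = N) :
    ∃ t : Fin 3 → Ω 3, (∀ i, t i ^ 6 + a * t i + b = 0) ∧ ValEq (F (t 0) - F (t 1)) 0 ∧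
      ValEq (F (t 0) - F (t 2)) 0 ∧ ValEq (F (t 1) - F (t 2)) 0 := by
  have key : ∀ ρ C : Ω 3, ValGE ρ 0 → ValGE C 0 →
      ∃ t : Ω 3, t ^ 6 + a * t + b = 0 ∧ ValEq ((F t - ρ) ^ 2 - C) 0 := by
    intro ρ C hρ hC
    refine exists_root_valEq_of_trace (p := 3) (a := a) (b := b)
      (F := fun t => (F t - ρ) ^ 2 - C)
      (fun t ht => (((hF t ht).sub hρ).pow 2 (by simp)).sub hC) fun r hr s1 s2 s3 s4 s5 => ?_
    obtain ⟨h1, h2⟩ := htr r hr s1 s2 s3 s4 s5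
    have : ∀ i, (F (r i) - ρ) ^ 2 - C = F (r i) ^ 2 - 2 * ρ * F (r i) + (ρ ^ 2 - C) := by
      intro i; ring
    simp only [this, Finset.sum_add_distrib, Finset.sum_sub_distrib, ← Finset.mul_sum, h1, h2]
    convert hN.add (valEq_six_three.ge.mul ((hρ.pow 2 (by simp)).sub hC) (t := 1) (by simp))
      one_pos using 1
    simp; ring
  obtain ⟨t0, h0⟩ := exists_root 3 a b
  have hF0 := hF t0 h0
  obtain ⟨t1, h1, h01⟩ := key (F t0) 0 hF0 (valGE_zero _)
  have hF1 := hF t1 h1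
  have e01 : ValEq (F t0 - F t1) 0 := .of_pow (n := 2) (r := 0) two_ne_zero
    (by convert h01 using 1; ring) (by simp)
  obtain ⟨t2, h2, h02⟩ := key (2 * F t0 - F t1) ((F t1 - F t0) ^ 2)
    (((valGE_ofNat 2).mul hF0 (by simp)).sub hF1) ((hF1.sub hF0).pow 2 (by simp))
  have hF2 := hF t2 h2
  have e02 : ValEq ((F t0 - F t2) * (F t1 - F t2)) 0 := by
    convert h02.add ((valEq_three.ge.mul ((hF0.sub hF2).mul (hF1.sub hF0) (t := 0) (by simp))
      (t := 1) (by simp))) one_pos using 1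
    ring
  have unit : ∀ {x y : Ω 3}, ValGE x 0 → ValGE y 0 → ValEq (x * y) 0 → ValEq x 0 := by
    intro x y hx hy hxy
    obtain ⟨u, hu⟩ := exists_valEq (left_ne_zero_of_mul hxy.ne_zero)
    obtain ⟨v, hv⟩ := exists_valEq (right_ne_zero_of_mul hxy.ne_zero)
    have h3 := (hu.mul hv rfl).unique hxy
    have h4 := hu.le_of_ge hx
    have h5 := hv.le_of_ge hy
    exact hu.congr (by linarith)
  refine ⟨![t0, t1, t2], ?_, e01, unit (hF0.sub hF2) (hF1.sub hF2) e02,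
    unit (hF1.sub hF2) (hF0.sub hF2) (by rwa [mul_comm])⟩
  intro i; fin_cases i
  exacts [h0, h1, h2]

theorem rowHolds_b27_of_two (hS : IsTrinomialGenerator θ a b) (ha : a = 81 * a₂) (hb : b = 27 * B)
    (hB : ¬ (3 : ℤ) ∣ B) (hm : B ^ 3 - B = 9 * m) :
    RowHolds 3 θ Δ(a,b) {21} 3
      {![1, θ, θ ^ 2 / 3, (θ ^ 2 + 3 * B) * θ / 3 ^ 2, (θ ^ 2 + 3 * B) ^ 2 / 3 ^ 3,
        (θ ^ 2 + 3 * B) ^ 2 * θ / 3 ^ 3]} := by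
  have hBV := valEq_int_three hB
  have hB2 : ValGE (1 - (B : Ω 3) ^ 2) 1 := by
    have h : (3 : ℤ) ∣ 1 - B ^ 2 := by
      have : B % 3 = 1 ∨ B % 3 = 2 := by omega
      refine Int.dvd_of_emod_eq_zero ?_
      rcases this with h | h <;> simp [Int.sub_emod, pow_succ, Int.mul_emod, h]
    have := valGE_int_three h
    push_cast at this; exact this
  have hfacts : ∀ t : Ω 3, t ^ 6 + a * t + b = 0 →
      ValEq t (1 / 2) ∧ ValEq (t ^ 2 / 3) 0 ∧ ValGE (t ^ 2 / 3 + (B : Ω 3)) (1 / 2) := by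
    intro t ht
    obtain ⟨h1, hη, hs, hat⟩ := root_facts_27 hB hb ha ht
    refine ⟨h1, hη, ?_⟩
    have hcube := cube_sq_div_three hb ht
    by_cases h0 : t ^ 2 / 3 + (B : Ω 3) = 0
    · rw [h0]; exact valGE_zero _
    obtain ⟨w, hw⟩ := exists_valEq h0
    by_contra hcon
    have hlt : w < 1 / 2 := by
      by_contra hge
      exact hcon (hw.ge' (not_lt.mp hge))
    have e1 : ValGE (((B ^ 3 - B : ℤ) : Ω 3) - (a : Ω 3) / 27 * t) (3 / 2) := by
      have h9 : ValGE ((B ^ 3 - B : ℤ) : Ω 3) 2 := by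
        have h := valGE_of_dvd (p := 3) (k := 2) ⟨m, hm⟩
        rwa [Nat.cast_ofNat] at h
      exact (h9.mono).sub hat
    have e2 : ValGE (3 * (B : Ω 3) * (t ^ 2 / 3) * (t ^ 2 / 3 + (B : Ω 3))) (1 + w) :=
      ((valEq_three.ge.mul hBV.ge le_rfl).mul hη.ge le_rfl).mul hw.ge (by simp)
    have h3 := (hw.pow 3 rfl).le_of_ge (s := 1 + w)
      (by rw [hcube]; exact (e1.mono (by linarith)).add e2)
    push_cast at h3
    linarith
  set u : Ω 3 → Ω 3 := fun t => (t ^ 2 / 3 + (B : Ω 3)) * t / 3 with hu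
  have hu0 : ∀ t : Ω 3, t ^ 6 + a * t + b = 0 → ValGE (u t) 0 := by
    intro t ht
    obtain ⟨h1, -, h2⟩ := hfacts t ht
    exact (h2.mul h1.ge le_rfl).div valEq_three
  have hγ : ∀ (t : Ω 3) i, tri ![[], [], [3 * B], [0, 3 * B], [9 * B ^ 2, 0, 6 * B],
      [0, 9 * B ^ 2, 0, 6 * B]] t i / ((3 : ℕ) : Ω 3) ^ (![0, 0, 1, 2, 3, 3] : Fin 6 → ℕ) i =
      ![1, t, t ^ 2 / 3 + (B : Ω 3), u t, (t ^ 2 / 3 + (B : Ω 3)) ^ 2 / 3, t * ((t ^ 2 / 3 + (B : Ω 3)) ^ 2 / 3)] i := by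
    intro t i; fin_cases i <;> simp [tri, hu, Finset.sum_range_succ] <;> ring
  have hI : ∀ t : Ω 3, t ^ 6 + a * t + b = 0 → ∀ i, ValGE ((![1, t, t ^ 2 / 3 + (B : Ω 3), u t,
      (t ^ 2 / 3 + (B : Ω 3)) ^ 2 / 3, t * ((t ^ 2 / 3 + (B : Ω 3)) ^ 2 / 3)] : Fin 6 → Ω 3) i) 0 := by
    intro t ht i
    obtain ⟨h1, hη, h2⟩ := hfacts t ht
    have h4 : ValGE ((t ^ 2 / 3 + (B : Ω 3)) ^ 2 / 3) 0 :=
      (h2.pow 2 le_rfl).div valEq_three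
    fin_cases i
    exacts [valEq_one.ge, h1.ge', h2.mono, hu0 t ht, h4,
      h1.ge.mul h4]
  refine rowHolds_single' hS (l' := ![[], [], [], [0, 3 * B], [9 * B ^ 2, 0, 6 * B],
      [0, 9 * B ^ 2, 0, 6 * B]]) (padicValInt_discr_27 (valEq_27 hB hb) (valGE_81 ha) le_rfl) rfl
    (.of_eq _ hγ hI) (.of_eq _ hγ fun d hd => ?_)
    (.of_eq (fun t => ![1, t, t ^ 2 / 3, u t, (t ^ 2 / 3 + (B : Ω 3)) ^ 2 / 3,
      t * ((t ^ 2 / 3 + (B : Ω 3)) ^ 2 / 3)]) ?_ ?_) rfl (by decide) ?_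
  · obtain ⟨τ, hτ, e01, e02, e12⟩ := exists_three_residues (N := -2 * (B : Ω 3)) hu0
      (valEq_two_three.neg.mul hBV (by simp)) (by
        intro r hr s1 s2 s3 s4 s5
        have h1 : ∀ i, u (r i) = (r i ^ 3 + 3 * B * r i) / 9 := by intro i; rw [hu]; ring
        have h2 : ∀ i, u (r i) ^ 2 = (6 * B * r i ^ 4 + 9 * B ^ 2 * r i ^ 2 - a * r i - b) / 81 := by
          intro i; rw [h1]; linear_combination hr i / 81
        simp only [h2]
        simp only [h1]
        simp only [← Finset.sum_div, Finset.sum_add_distrib, Finset.sum_sub_distrib,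
          ← Finset.mul_sum, s1, s2, s3, s4]
        rw [hb]
        constructor
        · simp
        · simp; ring)
    have hη1 : ∀ t : Ω 3, t ^ 6 + a * t + b = 0 →
        ValGE (1 + (B : Ω 3) * (t ^ 2 / 3)) (1 / 2) := by
      intro t ht
      convert (hB2.mono).add (hBV.ge.mul (hfacts t ht).2.2 (t := 1 / 2))
        using 1
      ring
    have e4 : ∀ t : Ω 3, t ^ 6 + a * t + b = 0 →
        ValGE ((t ^ 2 / 3 + (B : Ω 3)) ^ 2 / 3 - -(B : Ω 3) * u t ^ 2) (1 / 2) := by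
      intro t ht
      convert (hI t ht 4).mul (hη1 t ht) (t := 1 / 2) (by norm_num) using 1
      simp [hu]
      ring
    have first : ∀ i, ∃ s, 0 < s ∧ ValGE (((d 0 : ℤ) : Ω 3) + ((d 3 : ℤ) : Ω 3) * u (τ i)
        + ((-B * d 4 : ℤ) : Ω 3) * u (τ i) ^ 2) s := by
      intro i
      obtain ⟨h1, hη, h2⟩ := hfacts _ (hτ i)
      obtain ⟨r, hr, h6⟩ := exists_pos_valGE_sum (hd _ (hτ i)) (r := 0) one_pos {0, 3, 4} valEq_one
        ![1, 0, 0, u (τ i), -B * u (τ i) ^ 2, 0] (by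
          intro j hj
          refine ⟨1 / 2, by norm_num, ?_⟩
          simp only [Finset.mem_insert, Finset.mem_singleton] at hj
          rcases hj with rfl | rfl | rfl
          · simpa using valGE_zero _
          · simpa using valGE_zero _
          · simpa using e4 _ (hτ i)) (by
          intro j hj
          right
          fin_cases j
          exacts [absurd (by simp) hj, ⟨_, by norm_num, h1.ge⟩, ⟨_, by norm_num, h2⟩,
            absurd (by simp) hj, absurd (by simp) hj,
            ⟨1 / 2, by norm_num, h1.ge.mul (hI _ (hτ i) 4) (by simp)⟩])
      refine ⟨r, hr, ?_⟩
      rw [Finset.sum_insert (by decide), Finset.sum_pair (by decide)] at h6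
      convert h6 using 1
      simp
      ring
    have cancel : ∀ n : ℤ, ((3 : ℕ) : ℤ) ∣ -B * n → ((3 : ℕ) : ℤ) ∣ n := fun n hn =>
      ((Int.prime_iff_natAbs_prime.mpr (by norm_num) : Prime ((3 : ℕ) : ℤ)).dvd_or_dvd
        hn).resolve_left (by rw [dvd_neg]; exact_mod_cast hB)
    obtain ⟨r0, hr0, q0⟩ := first 0
    obtain ⟨r1, hr1, q1⟩ := first 1
    obtain ⟨r2, hr2, q2⟩ := first 2
    obtain ⟨h0, h3, h4⟩ := dvd_of_three_residues q0 hr0 q1 hr1 q2 hr2 e01 e02 e12 (hu0 _ (hτ 0))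
    have h4 := cancel _ h4
    have second : ∀ i, ∃ s, 0 < s ∧ ValGE (((d 1 : ℤ) : Ω 3) +
        ((-B * d 2 : ℤ) : Ω 3) * u (τ i) + ((-B * d 5 : ℤ) : Ω 3) * u (τ i) ^ 2) s := by
      intro i
      obtain ⟨h1, hη, h2⟩ := hfacts _ (hτ i)
      obtain ⟨r, hr, h6⟩ := exists_pos_valGE_sum (hd _ (hτ i)) (r := 1 / 2) (by norm_num) {1, 2, 5} h1
        ![0, 1, -B * u (τ i), 0, 0, -B * u (τ i) ^ 2] (by
          intro j hj
          refine ⟨1, by norm_num, ?_⟩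
          simp only [Finset.mem_insert, Finset.mem_singleton] at hj
          rcases hj with rfl | rfl | rfl
          · simpa using valGE_zero _
          · convert h2.mul (hη1 _ (hτ i)) (t := 1) (by norm_num) using 1
            simp [hu]
            ring
          · convert h1.ge.mul (e4 _ (hτ i)) (t := 1) (by norm_num) using 1
            simp
            ring) (by
          intro j hj
          have hIj := hI _ (hτ i) j
          fin_cases j
          exacts [.inl ⟨h0, hIj⟩, absurd (by simp) hj, absurd (by simp) hj, .inl ⟨h3, hIj⟩,
            .inl ⟨h4, hIj⟩, absurd (by simp) hj])
      refine ⟨r, hr, ?_⟩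
      rw [Finset.sum_insert (by decide), Finset.sum_pair (by decide)] at h6
      convert h6 using 1
      simp
      ring
    obtain ⟨r0, hr0, q0⟩ := second 0
    obtain ⟨r1, hr1, q1⟩ := second 1
    obtain ⟨r2, hr2, q2⟩ := second 2
    obtain ⟨h1, h2, h5⟩ := dvd_of_three_residues q0 hr0 q1 hr1 q2 hr2 e01 e02 e12 (hu0 _ (hτ 0))
    intro i
    fin_cases i
    exacts [h0, h1, cancel _ h2, h3, h4, cancel _ h5]
  · intro t i; fin_cases i <;> simp [tri, hu, Finset.sum_range_succ] <;> ring
  · intro t ht i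
    fin_cases i
    exacts [hI t ht 0, hI t ht 1, (hfacts t ht).2.1.ge, hI t ht 3, hI t ht 4, hI t ht 5]
  · ext i; fin_cases i <;> simp [family, tri, Finset.sum_range_succ] <;> ring

end ThreeHalf


/-- Up to the bound `6`, the multiplicity of `q` in `n` can be replaced by a natural number. -/
theorem exists_truncated_emultiplicity (q n : ℤ) : ∃ A ≤ 6,
    ((emultiplicity q n = 0 ↔ A = 0) ∧ (emultiplicity q n = 1 ↔ A = 1) ∧
    (emultiplicity q n = 2 ↔ A = 2) ∧ (emultiplicity q n = 3 ↔ A = 3) ∧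
    (emultiplicity q n = 4 ↔ A = 4) ∧ (emultiplicity q n = 5 ↔ A = 5) ∧
    (1 ≤ emultiplicity q n ↔ 1 ≤ A) ∧ (2 ≤ emultiplicity q n ↔ 2 ≤ A) ∧
    (3 ≤ emultiplicity q n ↔ 3 ≤ A) ∧ (4 ≤ emultiplicity q n ↔ 4 ≤ A) ∧
    (5 ≤ emultiplicity q n ↔ 5 ≤ A) ∧ (6 ≤ emultiplicity q n ↔ 6 ≤ A)) ∧
    ∀ k ≤ 6, q ^ k ∣ n ↔ k ≤ A := by
  simp_rw [pow_dvd_iff_le_emultiplicity]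
  induction emultiplicity q n using ENat.recTopCoe with
  | top => exact ⟨6, le_rfl, by simp, by simp⟩
  | coe m =>
    refine ⟨min m 6, min_le_right _ _, ?_, fun k hk => by norm_cast; omega⟩
    norm_cast
    omega

theorem exists_eq_pow_mul {q n : ℤ} (k : ℕ) (h : emultiplicity q n = k) :
    ∃ m, n = q ^ k * m ∧ ¬ q ∣ m := by
  obtain ⟨m, rfl⟩ := pow_dvd_of_le_emultiplicity h.ge
  refine ⟨m, rfl, fun ⟨j, hj⟩ => ?_⟩
  have h1 : ((k + 1 : ℕ) : ℕ∞) ≤ emultiplicity q (q ^ k * m) :=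
    le_emultiplicity_of_pow_dvd ⟨j, by rw [hj]; ring⟩
  rw [h] at h1
  exact absurd (Nat.cast_le.mp h1) (by omega)

section Newton

variable {K : Type*} [Field K] [NumberField K] {p : ℕ} [hp : Fact p.Prime] {θ : K} {a b : ℤ}
  {α : Fin 6 → K} {e5 e6 : ℝ}

theorem rowHolds_six_of_lt (hS : IsTrinomialGenerator θ a b) (s r n vdK : ℕ)
    (h5 : ValEq (5 : Ω p) e5) (h6 : ValEq (6 : Ω p) e6)
    (ha : emultiplicity (p : ℤ) a = s) (hb : emultiplicity (p : ℤ) b = r)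
    (hM : ValGE (a : Ω p) r → ValEq (b : Ω p) r →
      SaturatedFamily p a b (fun _ => []) (slopeExp r 6))
    (hr : 0 < r := by norm_num) (hsr : r ≤ s := by norm_num)
    (hlt : 5 * e5 + 6 * s < 6 * e6 + 5 * r := by norm_num) (hn : (n : ℝ) = 5 * e5 + 6 * s := by norm_num)
    (hsum : vdK + 2 * ∑ i, slopeExp r 6 i = n := by rfl)
    (hα : α = family p θ (fun _ => []) (slopeExp r 6) := by
      ext i; fin_cases i <;> simp [family, tri, slopeExp]) :
    RowHolds p θ Δ(a,b) {n} vdK {α} := by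
  have ha' := valEq_of_emultiplicity ha
  have hb' := valEq_of_emultiplicity hb
  exact rowHolds_six hS hr ha'.ge hb' hsr (fun h => hM h hb')
    (padicValInt_of_lt h5 h6.ge ha' hb'.ge hlt hn) hsum hα

theorem rowHolds_six_of_gt (hS : IsTrinomialGenerator θ a b) (s r n vdK : ℕ)
    (h5 : ValEq (5 : Ω p) e5) (h6 : ValEq (6 : Ω p) e6)
    (ha : s ≤ emultiplicity (p : ℤ) a) (hb : emultiplicity (p : ℤ) b = r)
    (hM : ValGE (a : Ω p) r → ValEq (b : Ω p) r →
      SaturatedFamily p a b (fun _ => []) (slopeExp r 6))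
    (hr : 0 < r := by norm_num) (hsr : r ≤ s := by norm_num)
    (hlt : 6 * e6 + 5 * r < 5 * e5 + 6 * s := by norm_num) (hn : (n : ℝ) = 6 * e6 + 5 * r := by norm_num)
    (hsum : vdK + 2 * ∑ i, slopeExp r 6 i = n := by rfl)
    (hα : α = family p θ (fun _ => []) (slopeExp r 6) := by
      ext i; fin_cases i <;> simp [family, tri, slopeExp]) :
    RowHolds p θ Δ(a,b) {n} vdK {α} := by
  have ha' := valGE_of_le_emultiplicity ha
  have hb' := valEq_of_emultiplicity hb
  exact rowHolds_six hS hr ha' hb' hsr (fun h => hM h hb')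
    (padicValInt_of_gt h5.ge h6 ha' hb' hlt hn) hsum hα

theorem rowHolds_five_of_lt (hS : IsTrinomialGenerator θ a b) (s r n vdK : ℕ)
    (h5 : ValEq (5 : Ω p) e5) (h6 : ValEq (6 : Ω p) e6)
    (ha : emultiplicity (p : ℤ) a = s) (hb : r ≤ emultiplicity (p : ℤ) b)
    (hs : 0 < s := by norm_num) (hs5 : s < 5 := by norm_num) (hsr : s + 1 ≤ r := by norm_num)
    (hlt : 5 * e5 + 6 * s < 6 * e6 + 5 * r := by norm_num) (hn : (n : ℝ) = 5 * e5 + 6 * s := by norm_num)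
    (hsum : vdK + 2 * ∑ i, slopeExp s 5 i = n := by rfl)
    (hα : α = family p θ (fun _ => []) (slopeExp s 5) := by
      ext i; fin_cases i <;> simp [family, tri, slopeExp]) :
    RowHolds p θ Δ(a,b) {n} vdK {α} := by
  have ha' := valEq_of_emultiplicity ha
  have hb' := valGE_of_le_emultiplicity hb
  exact rowHolds_five hS hs hs5 ha' hb' hsr (padicValInt_of_lt h5 h6.ge ha' hb' hlt hn)
    hsum hα

theorem rowHolds_five_of_gt (hS : IsTrinomialGenerator θ a b) (s r n vdK : ℕ)
    (h5 : ValEq (5 : Ω p) e5) (h6 : ValEq (6 : Ω p) e6)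
    (ha : emultiplicity (p : ℤ) a = s) (hb : emultiplicity (p : ℤ) b = r)
    (hs : 0 < s := by norm_num) (hs5 : s < 5 := by norm_num) (hsr : s + 1 ≤ r := by norm_num)
    (hlt : 6 * e6 + 5 * r < 5 * e5 + 6 * s := by norm_num) (hn : (n : ℝ) = 6 * e6 + 5 * r := by norm_num)
    (hsum : vdK + 2 * ∑ i, slopeExp s 5 i = n := by rfl)
    (hα : α = family p θ (fun _ => []) (slopeExp s 5) := by
      ext i; fin_cases i <;> simp [family, tri, slopeExp]) :
    RowHolds p θ Δ(a,b) {n} vdK {α} := by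
  have ha' := valEq_of_emultiplicity ha
  have hb' := valEq_of_emultiplicity hb
  exact rowHolds_five hS hs hs5 ha' hb'.ge hsr (padicValInt_of_gt h5.ge h6 ha'.ge hb' hlt hn)
    hsum hα

end Newton

theorem not_dvd_ediv_pow_padicValInt {p : ℕ} [Fact p.Prime] {n : ℤ} (hn : n ≠ 0) :
    ¬ (p : ℤ) ∣ n / p ^ padicValInt p n := by
  rintro ⟨m, hm⟩
  have h1 := Int.mul_ediv_cancel' (padicValInt_dvd (p := p) n)
  have h2 : (p : ℤ) ^ (padicValInt p n + 1) ∣ n := ⟨m, by rw [pow_succ, mul_assoc, ← hm, h1]⟩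
  rcases (padicValInt_dvd_iff _ _).mp h2 with h | h
  · exact hn h
  · omega

theorem le_padicValInt {p : ℕ} [Fact p.Prime] {n : ℤ} (hn : n ≠ 0) {k : ℕ} (h : (p : ℤ) ^ k ∣ n) :
    k ≤ padicValInt p n :=
  ((padicValInt_dvd_iff _ _).mp h).resolve_left hn


section TableTwo

variable {K : Type*} [Field K] [NumberField K] {θ : K} {a b : ℤ}

theorem discr_bracket_two {A : ℤ} (hA : Odd A) (hb : Odd b) :
    (5 ^ 5 * A ^ 6 - 3 ^ 6 * b ^ 5) ≡ 5 - b [ZMOD 8] := by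
  have h (m : ℤ) (hm : Odd m) : m ^ 2 ≡ 1 [ZMOD 8] :=
    (Int.modEq_iff_dvd.mpr (Int.eight_dvd_sq_sub_one_of_odd hm)).symm
  have h1 : A ^ 6 ≡ 1 [ZMOD 8] := by simpa [← pow_mul] using (h A hA).pow 3
  have h2 : b ^ 5 ≡ b [ZMOD 8] := by
    have := ((h b hb).pow 2).mul_right b
    rwa [one_pow, one_mul, ← pow_mul, ← pow_succ] at this
  refine ((h1.mul_left _).sub (h2.mul_left _)).trans ?_
  rw [Int.ModEq]
  omega

theorem discr_two_eq {A : ℤ} : 5 ^ 5 * (2 * A) ^ 6 - 6 ^ 6 * b ^ 5 =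
    ((2 : ℕ) : ℤ) ^ 6 * (5 ^ 5 * A ^ 6 - 3 ^ 6 * b ^ 5) := by
  push_cast; ring

theorem exists_row_two (hS : IsTrinomialGenerator θ a b) (hnorm : ¬ (2 ^ 5 ∣ a ∧ 2 ^ 6 ∣ b)) :
    ∃ r ∈ tableI a b Δ(a,b) θ, r.cond := by
  have hD₂ := not_dvd_ediv_pow_padicValInt (p := 2) hS.discr_ne_zero
  obtain ⟨A, hA6, hA, hA'⟩ := exists_truncated_emultiplicity 2 a
  obtain ⟨B, hB6, hB, hB'⟩ := exists_truncated_emultiplicity 2 b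
  simp only [tableI, List.mem_cons, List.not_mem_nil, exists_eq_or_imp, or_false,
    exists_eq_left, hA, hB, Int.ModEq, Nat.odd_iff, Nat.even_iff]
  rw [Nat.cast_ofNat] at hD₂
  have h1 := hB' 1 (by norm_num)
  have h2 := hB' 2 (by norm_num)
  have h3 := hB' 3 (by norm_num)
  have h4 := hB' 4 (by norm_num)
  have h5 := hB' 5 (by norm_num)
  rw [hA' 5 (by norm_num), hB' 6 le_rfl] at hnorm
  clear hA hB hA' hB' hS
  generalize Δ(a,b) / 2 ^ padicValInt 2 Δ(a,b) = D₂
    at hD₂ ⊢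
  generalize padicValInt 2 Δ(a,b) = d
  interval_cases B <;> interval_cases A <;> simp at hnorm h1 h2 h3 h4 h5 ⊢ <;> omega

theorem describes_two (hS : IsTrinomialGenerator θ a b) (hnorm : ¬ (2 ^ 5 ∣ a ∧ 2 ^ 6 ∣ b)) :
    Describes 2 Δ(a,b) θ
      (tableI a b Δ(a,b) θ) := by
  have h3 : ValEq (3 : Ω 2) 0 := by
    exact_mod_cast valEq_intCast (p := 2) (n := 3) (by norm_num)
  have hA (k : ℕ) (h : emultiplicity (2 : ℤ) a = k) : ∃ m, a = 2 ^ k * m ∧ Odd m := by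
    obtain ⟨m, hm, hm'⟩ := exists_eq_pow_mul k h
    exact ⟨m, hm, by rw [Int.odd_iff]; omega⟩
  have hA' (k : ℕ) (h : k ≤ emultiplicity (2 : ℤ) a) : ∃ m, a = 2 ^ k * m :=
    pow_dvd_of_le_emultiplicity h
  have hB (k : ℕ) (h : emultiplicity (2 : ℤ) b = k) :
      b = 2 ^ k * (b / 2 ^ k) ∧ Odd (b / 2 ^ k) := by
    obtain ⟨m, hm, hm'⟩ := exists_eq_pow_mul k h
    have hm2 : b / 2 ^ k = m := by rw [hm, Int.mul_ediv_cancel_left _ (by positivity)]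
    rw [hm2]
    exact ⟨hm, by rw [Int.odd_iff]; omega⟩
  have hb4 (h : b ≡ 1 [ZMOD 4]) : b = 4 * (b / 4) + 1 := by rw [Int.ModEq] at h; omega
  have hd (h : emultiplicity (2 : ℤ) a = 1) (hb : b ≡ 1 [ZMOD 4]) :
      8 ≤ padicValInt 2 Δ(a,b) := by
    obtain ⟨m, hm, hm'⟩ := hA 1 h
    have h1 := discr_bracket_two hm' (b := b) (by rw [Int.odd_iff]; rw [Int.ModEq] at hb; omega)
    refine le_padicValInt hS.discr_ne_zero ?_
    rw [hm, pow_one, discr_two_eq, show 8 = 6 + 2 from rfl, pow_add]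
    refine mul_dvd_mul_left _ ?_
    rw [Int.ModEq] at h1 hb
    push_cast
    omega
  have hD₂ := Int.mul_ediv_cancel'
    (padicValInt_dvd (p := 2) Δ(a,b))
  rw [Nat.cast_ofNat] at hD₂
  refine ⟨exists_row_two hS hnorm, ?_⟩
  simp only [tableI, List.forall_mem_cons]
  refine ⟨?_, ?_, ?_, ?_, ?_, ?_, ?_, ?_, ?_, ?_, ?_, ?_, ?_, ?_, ?_, ?_, ?_, ?_, ?_, ?_, ?_, ?_, ?_,
    ?_, ?_, ?_, by simp⟩ <;> intro h
  · have ha := valEq_of_emultiplicity (p := 2) (k := 0) h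
    exact rowHolds_zero hS (padicValInt_of_lt valEq_five_two valEq_six_two.ge ha
      (valGE_intCast b) (by norm_num))
  · exact rowHolds_six_of_lt hS 1 1 6 6 valEq_five_two valEq_six_two h.2 h.1
      (saturatedFamily_six_of_coprime (Or.inl rfl))
  · exact rowHolds_six_of_gt hS 2 1 11 11 valEq_five_two valEq_six_two h.2 h.1
      (saturatedFamily_six_of_coprime (Or.inl rfl))
  · exact rowHolds_five_of_lt hS 1 2 6 4 valEq_five_two valEq_six_two h.2 h.1
  · exact rowHolds_five_of_lt hS 2 3 12 4 valEq_five_two valEq_six_two h.2 h.1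
  · exact rowHolds_six_of_lt hS 3 3 18 6 valEq_five_two valEq_six_two h.2 h.1 (fun h h' =>
      saturatedFamily_six_of_three h3 h h')
  · exact rowHolds_six_of_gt hS 4 3 21 9 valEq_five_two valEq_six_two h.2 h.1 (fun h h' =>
      saturatedFamily_six_of_three h3 h h')
  · exact rowHolds_five_of_lt hS 3 4 18 4 valEq_five_two valEq_six_two h.2 h.1
  · exact rowHolds_five_of_lt hS 4 5 24 4 valEq_five_two valEq_six_two h.2 h.1
  · exact rowHolds_six_of_lt hS 5 5 30 10 valEq_five_two valEq_six_two h.2 h.1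
      (saturatedFamily_six_of_coprime (Or.inr rfl))
  · exact rowHolds_six_of_gt hS 6 5 31 11 valEq_five_two valEq_six_two h.2 h.1
      (saturatedFamily_six_of_coprime (Or.inr rfl))
  · obtain ⟨A, ha, hAo⟩ := hA 1 h.1
    have hb := h.2
    rw [Int.ModEq] at hb
    have h1 := discr_bracket_two hAo (b := b) (by rw [Int.odd_iff]; omega)
    rw [Int.ModEq] at h1
    refine rowHolds_two_unit (c := (1 - b) / 2) hS ha (by omega)
      (by rw [Int.odd_iff] at hAo ⊢; omega)
      (padicValInt_eq_of_mul (k := 7) (m := (5 ^ 5 * A ^ 6 - 3 ^ 6 * b ^ 5) / 2) ?_ ?_)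
    · rw [ha, pow_one, discr_two_eq, pow_succ _ 6, mul_assoc, Nat.cast_ofNat, Int.mul_ediv_cancel']
      omega
    · push_cast
      omega
  · obtain ⟨A, ha, hAo⟩ := hA 1 h.1
    have hd' := hd h.1 h.2.1
    have hp := Nat.odd_iff.mp h.2.2
    rw [show a / 2 = A by omega]
    exact rowHolds_two_last_odd hS ha hAo (hb4 h.2.1) (by omega) (by omega)
  · obtain ⟨A, ha, hAo⟩ := hA 1 h.1
    have hd' := hd h.1 h.2.1
    have hp := Nat.even_iff.mp h.2.2.1
    rw [show a / 2 = A by omega,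
      show (padicValInt 2 Δ(a,b) - 6) / 2 =
        (padicValInt 2 Δ(a,b) - 4) / 2 - 1 by omega]
    have e : padicValInt 2 Δ(a,b) =
      2 * ((padicValInt 2 Δ(a,b) - 4) / 2) + 4 := by omega
    exact rowHolds_two_last_halves hS ha hAo (hb4 h.2.1) (by omega) e
      (by rw [← e]; exact hD₂.symm) h.2.2.2
  · obtain ⟨A, ha, hAo⟩ := hA 1 h.1
    have hd' := hd h.1 h.2.1
    have hp := Nat.even_iff.mp h.2.2.1
    rw [show a / 2 = A by omega]
    have e : padicValInt 2 Δ(a,b) =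
      2 * ((padicValInt 2 Δ(a,b) - 6) / 2) + 6 := by omega
    exact rowHolds_two_last_even hS ha hAo (hb4 h.2.1) (by omega) e
      (by rw [← e]; exact hD₂.symm) h.2.2.2
  · obtain ⟨A, ha⟩ := hA' 2 h.1
    have hb := hb4 h.2
    refine rowHolds_two_unit (A := 2 * A) (c := -(2 * (b / 4))) hS (by rw [ha]; ring) (by omega)
      ⟨A - b / 4, by ring⟩
      (padicValInt_of_gt (n := 6) (s := (2 : ℕ)) (r := 0) valEq_five_two.ge valEq_six_two
        (valGE_of_dvd ⟨A, by exact_mod_cast ha⟩)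
        (valEq_odd (by rw [Int.odd_iff]; omega)) (by norm_num))
  · obtain ⟨A, ha⟩ := hA' 2 h.1
    have hb := h.2
    rw [Int.ModEq] at hb
    exact rowHolds_two_half_cube (c := (b + 1) / 4) hS ha (by omega)
  · obtain ⟨A, ha, hAo⟩ := hA 2 h.2
    obtain ⟨hb, hBo⟩ := hB 2 h.1
    exact rowHolds_b4_a4 hS ha hb hAo hBo
  · obtain ⟨A, ha, hAo⟩ := hA 3 h.2.1
    obtain ⟨hb, hBo⟩ := hB 2 h.1
    have hm := h.2.2
    rw [Int.ModEq] at hm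
    exact rowHolds_b4_a8 (c := (1 + b / 4) / 4) hS ha hb hAo hBo (by norm_num; omega)
  · obtain ⟨A, ha⟩ := hA' 4 h.2.1
    obtain ⟨hb, hBo⟩ := hB 2 h.1
    have hm := h.2.2
    rw [Int.ModEq] at hm
    exact rowHolds_b4_a16 (c := (1 + b / 4) / 4) hS ha hb hBo (by norm_num; omega)
  · obtain ⟨A, ha⟩ := hA' 3 h.2.1
    obtain ⟨hb, hBo⟩ := hB 2 h.1
    have hm := h.2.2
    rw [Int.ModEq] at hm
    exact rowHolds_b4_of_one (c := (1 + b / 4) / 2) hS ha hb hBo (by norm_num; omega)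
      (by rw [Int.odd_iff]; omega)
  · obtain ⟨A, ha, hAo⟩ := hA 4 h.2.1
    obtain ⟨hb, hBo⟩ := hB 4 h.1
    have hm := h.2.2
    rw [Int.ModEq] at hm
    exact rowHolds_b16_a16_of_one (c := (1 + b / 16) / 2) hS ha hb hAo hBo (by norm_num; omega)
      (by rw [Int.odd_iff]; omega)
  · obtain ⟨A, ha, hAo⟩ := hA 4 h.2.1
    obtain ⟨hb, hBo⟩ := hB 4 h.1
    have hm := h.2.2
    rw [Int.ModEq] at hm
    exact rowHolds_b16_a16_of_three (c := (1 + b / 16) / 4) hS ha hb hAo hBo (by norm_num; omega)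
  · obtain ⟨A, ha, hAo⟩ := hA 5 h.2.1
    obtain ⟨hb, hBo⟩ := hB 4 h.1
    have hm := h.2.2
    rw [Int.ModEq] at hm
    exact rowHolds_b16_a32_of_three (c := (1 + b / 16) / 4) hS ha hb hAo hBo (by norm_num; omega)
  · obtain ⟨A, ha⟩ := hA' 6 h.2.1
    obtain ⟨hb, hBo⟩ := hB 4 h.1
    have hm := h.2.2
    rw [Int.ModEq] at hm
    exact rowHolds_b16_a64 (c := (1 + b / 16) / 4) hS ha hb hBo (by norm_num; omega)
  · obtain ⟨A, ha⟩ := hA' 5 h.2.1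
    obtain ⟨hb, hBo⟩ := hB 4 h.1
    have hm := h.2.2
    rw [Int.ModEq] at hm
    exact rowHolds_b16_a32_of_one (c := (1 + b / 16) / 2) hS ha hb hBo (by norm_num; omega)
      (by rw [Int.odd_iff]; omega)

end TableTwo


section TableThree

variable {K : Type*} [Field K] [NumberField K] {θ : K} {a b : ℤ}

theorem rowHolds_three_of_not_dvd {a' c e : ℤ} {n : ℕ} (hS : IsTrinomialGenerator θ a b)
    (ha : a = 3 * a') (hb : b = e - 3 * c) (he : e ^ 2 = 1) (hu : ¬ 3 ∣ c ^ 2 + e * a' ^ 2)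
    (hD : padicValInt 3 Δ(a,b) = n) :
    RowHolds 3 θ Δ(a,b) {n} n {![1, θ, θ ^ 2, θ ^ 3, θ ^ 4, θ ^ 5]} := by
  refine rowHolds_three_ramified hS ha hb he (fun t ht => ?_) hD
  have h0 := root_valGE ht
  have h1 : ValEq (((c : Ω 3) - (a' : Ω 3) * t) * ((c : Ω 3) + (a' : Ω 3) * t)) 0 := by
    convert (valEq_int_three hu).add (((valGE_intCast (a' ^ 2)).mul
      (sq_add_valGE_three ha hb he ht) (t := 1 / 3)).neg) (by norm_num) using 1
    push_cast
    ring
  have h2 : ValGE ((a' : Ω 3) * t) 0 := (valGE_intCast a').mul h0 (by simp)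
  have h3 := (valGE_intCast c).sub h2
  have h4 := (valGE_intCast c).add h2
  obtain ⟨r, hr⟩ := exists_valEq (left_ne_zero_of_mul h1.ne_zero)
  obtain ⟨s, hs⟩ := exists_valEq (right_ne_zero_of_mul h1.ne_zero)
  have h5 := hr.le_of_ge h3
  have h6 := hs.le_of_ge h4
  have h7 := h1.unique (hr.mul hs rfl)
  exact hr.congr (by linarith)

theorem discr_three_eq {A : ℤ} : 5 ^ 5 * (3 * A) ^ 6 - 6 ^ 6 * b ^ 5 =
    ((3 : ℕ) : ℤ) ^ 6 * (5 ^ 5 * A ^ 6 - 64 * b ^ 5) := by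
  push_cast; ring

theorem discr_bracket_three {A : ℤ} (hA : ¬ 3 ∣ A) :
    (5 ^ 5 * A ^ 6 - 64 * b ^ 5) ≡ 2 - b ^ 5 [ZMOD 9] := by
  have h1 : A ^ 6 ≡ 1 [ZMOD 9] := by
    have h : A ≡ 1 [ZMOD 9] ∨ A ≡ 2 [ZMOD 9] ∨ A ≡ 4 [ZMOD 9] ∨ A ≡ 5 [ZMOD 9] ∨
        A ≡ 7 [ZMOD 9] ∨ A ≡ 8 [ZMOD 9] := by simp only [Int.ModEq]; omega
    rcases h with h | h | h | h | h | h <;> exact (h.pow 6).trans rfl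
  refine ((h1.mul_left _).sub_right _).trans ?_
  rw [Int.ModEq]
  omega

theorem padicValInt_three_seven (ha : 3 ∣ a) (ha' : ¬ 9 ∣ a)
    (hb : b ≡ 2 [ZMOD 9] ∨ b ≡ -1 [ZMOD 9]) :
    padicValInt 3 Δ(a,b) = 7 := by
  obtain ⟨A, rfl⟩ := ha
  have h1 := discr_bracket_three (A := A) (b := b) (by omega)
  have h2 : 2 - b ^ 5 ≡ 3 [ZMOD 9] ∨ 2 - b ^ 5 ≡ 6 [ZMOD 9] := by
    rcases hb with hb | hb
    · exact .inr ((Int.ModEq.sub_left 2 (hb.pow 5)).trans rfl)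
    · exact .inl ((Int.ModEq.sub_left 2 (hb.pow 5)).trans rfl)
  have h3 := h2.imp (h1.trans ·) (h1.trans ·)
  simp only [Int.ModEq] at h3
  refine padicValInt_eq_of_mul (k := 7) (m := (5 ^ 5 * A ^ 6 - 64 * b ^ 5) / 3) ?_ ?_
  · rw [discr_three_eq, pow_succ _ 6, mul_assoc, Nat.cast_ofNat, Int.mul_ediv_cancel']
    omega
  · push_cast
    omega

theorem eight_le_padicValInt_three (hS : IsTrinomialGenerator θ a b) (ha : 3 ∣ a) (ha' : ¬ 9 ∣ a)
    (hb : b ≡ 5 [ZMOD 9]) : 8 ≤ padicValInt 3 Δ(a,b) := by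
  refine le_padicValInt hS.discr_ne_zero ?_
  obtain ⟨A, rfl⟩ := ha
  have h1 := (discr_bracket_three (A := A) (b := b) (by omega)).trans
    ((Int.ModEq.sub_left 2 (hb.pow 5)).trans (show (2 - 5 ^ 5 : ℤ) ≡ 0 [ZMOD 9] from rfl))
  rw [discr_three_eq, show 8 = 6 + 2 from rfl, pow_add]
  exact mul_dvd_mul_left _ (by simpa using Int.modEq_zero_iff_dvd.mp h1)

theorem three_dvd_cube_sub (B : ℤ) : 3 ∣ B ^ 3 - B := by
  have h : B % 3 = 0 ∨ B % 3 = 1 ∨ B % 3 = 2 := by omega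
  rw [Int.dvd_iff_emod_eq_zero]
  rcases h with h | h | h <;> simp [pow_succ, Int.sub_emod, Int.mul_emod, h]

theorem exists_row_three (hS : IsTrinomialGenerator θ a b) (hnorm : ¬ (3 ^ 5 ∣ a ∧ 3 ^ 6 ∣ b)) :
    ∃ r ∈ tableII a b Δ(a,b) θ, r.cond := by
  have hd := eight_le_padicValInt_three hS
  obtain ⟨A, hA6, hA, hA'⟩ := exists_truncated_emultiplicity 3 a
  obtain ⟨B, hB6, hB, hB'⟩ := exists_truncated_emultiplicity 3 b
  obtain ⟨M, hM6, hM, hM'⟩ := exists_truncated_emultiplicity 3 ((b / 3 ^ 3) ^ 3 - b / 3 ^ 3)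
  have hM1 := (hM' 1 (by norm_num)).mp (by rw [pow_one]; exact three_dvd_cube_sub _)
  simp only [tableII, List.mem_cons, List.not_mem_nil, exists_eq_or_imp, or_false,
    exists_eq_left, hA, hB, hM, Int.ModEq, Nat.odd_iff, Nat.even_iff]
  rw [Int.ModEq] at hd
  have h1 := hB' 1 (by norm_num)
  have h2 := hA' 1 (by norm_num)
  have h3 := hA' 2 (by norm_num)
  rw [hA' 5 (by norm_num), hB' 6 le_rfl] at hnorm
  clear hA hB hA' hB' hS hM hM'
  generalize padicValInt 3 Δ(a,b) = d at hd ⊢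
  have hM2 : M = 1 ∨ 2 ≤ M := by omega
  rcases Nat.eq_zero_or_pos B with rfl | hB0
  · have hb9 : b % 9 = 1 ∨ b % 9 = 2 ∨ b % 9 = 4 ∨ b % 9 = 5 ∨ b % 9 = 7 ∨ b % 9 = 8 := by omega
    obtain rfl | rfl | hA2 : A = 0 ∨ A = 1 ∨ 2 ≤ A := by omega
    · simp
    · have ha9 : a % 9 = 3 ∨ a % 9 = 6 := by omega
      have hd8 (h : b % 9 = 5) : 8 ≤ d := hd (by omega) (by omega) h
      clear hd
      rcases hb9 with h | h | h | h | h | h <;> rcases ha9 with h' | h' <;>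
        simp [h, h'] at hd8 ⊢ <;> omega
    · rcases hb9 with h | h | h | h | h | h <;> simp [h, hA2]
  · clear h1 h2 h3 hd
    rcases hM2 with h | h <;> interval_cases B <;> interval_cases A <;> simp [h] at hnorm ⊢

end TableThree


section TableThree

variable {K : Type*} [Field K] [NumberField K] {θ : K} {a b : ℤ}

theorem RowHolds.congr_bases {p : ℕ} [Fact p.Prime] {D : ℤ} {vD : Set ℕ} {vdK : ℕ}
    {s t : Set (Fin 6 → K)} (h : RowHolds p θ D vD vdK s) (e : t = s) : RowHolds p θ D vD vdK t :=
  e ▸ h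

theorem sq_emod_three (n : ℤ) : n ^ 2 % 3 = 0 ∧ 3 ∣ n ∨ n ^ 2 % 3 = 1 ∧ ¬ 3 ∣ n := by
  have h : n ≡ 0 [ZMOD 3] ∨ n ≡ 1 [ZMOD 3] ∨ n ≡ 2 [ZMOD 3] := by simp only [Int.ModEq]; omega
  rcases h with h | h | h <;> have h' := h.pow 2 <;> simp only [Int.ModEq] at h h' <;> omega

theorem threeSetting_of_sign {a' ε : ℤ} {k : ℕ} (hS : IsTrinomialGenerator θ a b) (ha : a = 3 * a')
    (hε : a ≡ -3 [ZMOD 9] ∧ ε = -1 ∨ a ≡ 3 [ZMOD 9] ∧ ε = 1) (hb : b ≡ 5 [ZMOD 9]) (hk : 1 ≤ k)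
    (h1 : 2 * k + 5 ≤ padicValInt 3 Δ(a,b))
    (h2 : padicValInt 3 Δ(a,b) ≤ 2 * k + 6) :
    ThreeSetting a b a' ε k (padicValInt 3 Δ(a,b)) := by
  have h9 := eight_le_padicValInt_three hS (by omega) (by simp only [Int.ModEq] at hε; omega) hb
  refine ⟨ha, ?_, ?_, ?_, hS.discr_ne_zero, rfl, hk, h1, h2, h9⟩
  · rcases hε with ⟨-, rfl⟩ | ⟨-, rfl⟩ <;> rfl
  · simp only [Int.ModEq] at hε; omega
  · simp only [Int.ModEq] at hb; omega

theorem describes_three (hS : IsTrinomialGenerator θ a b) (hnorm : ¬ (3 ^ 5 ∣ a ∧ 3 ^ 6 ∣ b)) :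
    Describes 3 Δ(a,b) θ
      (tableII a b Δ(a,b) θ) := by
  have hA' (k : ℕ) (h : k ≤ emultiplicity (3 : ℤ) a) : ∃ m, a = 3 ^ k * m :=
    pow_dvd_of_le_emultiplicity h
  have hB (h : emultiplicity (3 : ℤ) b = 3) : b = 27 * (b / 3 ^ 3) ∧ ¬ 3 ∣ b / 3 ^ 3 := by
    obtain ⟨m, hm, hm'⟩ := exists_eq_pow_mul 3 h
    have hm2 : b / 3 ^ 3 = m := by rw [hm, Int.mul_ediv_cancel_left _ (by positivity)]
    rw [hm2]
    exact ⟨hm, hm'⟩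
  have hD6 (ha : 2 ≤ emultiplicity (3 : ℤ) a) (hb : ¬ 3 ∣ b) :
      padicValInt 3 Δ(a,b) = 6 :=
    padicValInt_of_gt (n := 6) (s := (2 : ℕ)) valEq_five_three.ge valEq_six_three
      (valGE_of_le_emultiplicity (by exact_mod_cast ha)) (valEq_int_three hb)
      (by norm_num)
  have hε (h : a ≡ 3 [ZMOD 9] ∨ a ≡ -3 [ZMOD 9]) :
      ∃ e : ℤ, a ≡ -3 [ZMOD 9] ∧ e = -1 ∨ a ≡ 3 [ZMOD 9] ∧ e = 1 :=
    h.elim (fun h => ⟨1, .inr ⟨h, rfl⟩⟩) (fun h => ⟨-1, .inl ⟨h, rfl⟩⟩)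
  have huniq {e e' : ℤ} (h : a ≡ -3 [ZMOD 9] ∧ e = -1 ∨ a ≡ 3 [ZMOD 9] ∧ e = 1)
      (h' : a ≡ -3 [ZMOD 9] ∧ e' = -1 ∨ a ≡ 3 [ZMOD 9] ∧ e' = 1) : e' = e := by
    simp only [Int.ModEq] at h h'
    omega
  have ha3 (h : a ≡ 3 [ZMOD 9] ∨ a ≡ -3 [ZMOD 9]) : a = 3 * (a / 3) := by
    simp only [Int.ModEq] at h
    omega
  refine ⟨exists_row_three hS hnorm, ?_⟩
  simp only [tableII, List.forall_mem_cons]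
  refine ⟨?_, ?_, ?_, ?_, ?_, ?_, ?_, ?_, ?_, ?_, ?_, ?_, ?_, ?_, ?_, ?_, ?_, ?_, ?_, ?_, ?_, ?_, ?_,
    ?_, ?_, ?_, ?_, by simp⟩ <;> intro h
  · have ha := valEq_of_emultiplicity (p := 3) (k := 0) h
    exact rowHolds_zero hS (padicValInt_of_lt valEq_five_three valEq_six_three.ge ha
      (valGE_intCast b) (by norm_num))
  · exact rowHolds_six_of_lt hS 1 1 6 6 valEq_five_three valEq_six_three h.2 h.1
      (saturatedFamily_six_of_coprime (Or.inl rfl))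
  · exact rowHolds_six_of_gt hS 2 1 11 11 valEq_five_three valEq_six_three h.2 h.1
      (saturatedFamily_six_of_coprime (Or.inl rfl))
  · exact rowHolds_five_of_lt hS 1 2 6 4 valEq_five_three valEq_six_three h.2 h.1
  · exact rowHolds_six_of_lt hS 2 2 12 6 valEq_five_three valEq_six_three h.2 h.1
      (saturatedFamily_six_of_two (e := 1) (Or.inl rfl) valEq_two_three)
  · exact rowHolds_six_of_gt hS 3 2 16 10 valEq_five_three valEq_six_three h.2 h.1
      (saturatedFamily_six_of_two (e := 1) (Or.inl rfl) valEq_two_three)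
  · exact rowHolds_five_of_lt hS 2 3 12 4 valEq_five_three valEq_six_three h.2 h.1
  · exact rowHolds_five_of_lt hS 3 4 18 4 valEq_five_three valEq_six_three h.2 h.1
  · exact rowHolds_six_of_lt hS 4 4 24 8 valEq_five_three valEq_six_three h.2 h.1
      (saturatedFamily_six_of_two (e := 2) (Or.inr rfl) valEq_two_three)
  · exact rowHolds_six_of_gt hS 5 4 26 10 valEq_five_three valEq_six_three h.2 h.1
      (saturatedFamily_six_of_two (e := 2) (Or.inr rfl) valEq_two_three)
  · exact rowHolds_five_of_lt hS 4 5 24 4 valEq_five_three valEq_six_three h.2 h.1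
  · exact rowHolds_six_of_lt hS 5 5 30 10 valEq_five_three valEq_six_three h.2 h.1
      (saturatedFamily_six_of_coprime (Or.inr rfl))
  · exact rowHolds_six_of_gt hS 6 5 31 11 valEq_five_three valEq_six_three h.2 h.1
      (saturatedFamily_six_of_coprime (Or.inr rfl))
  · obtain ⟨A, ha, hA⟩ := exists_eq_pow_mul 1 h.1
    rw [pow_one] at ha
    have hb := h.2
    have hb5 := hb.pow 5
    have h1 := discr_bracket_three (b := b) hA
    simp only [Int.ModEq] at hb hb5 h1
    refine rowHolds_three_of_not_dvd (e := 1) (c := (1 - b) / 3) hS ha (by omega) rfl ?_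
      (padicValInt_eq_of_mul (k := 6) (m := 5 ^ 5 * A ^ 6 - 64 * b ^ 5)
        (by rw [ha, discr_three_eq]) (by push_cast; omega))
    have h2 := sq_emod_three A
    have h3 := sq_emod_three ((1 - b) / 3)
    omega
  · obtain ⟨A, ha⟩ := hA' 2 h.1
    have hb := h.2
    simp only [Int.ModEq] at hb
    refine rowHolds_three_of_not_dvd (a' := 3 * A) (e := 1) (c := (1 - b) / 3) hS
      (by rw [ha]; ring) (by omega) rfl ?_ (hD6 h.1 (by omega))
    have h2 := sq_emod_three (3 * A)
    have h3 := sq_emod_three ((1 - b) / 3)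
    omega
  · obtain ⟨A, ha⟩ := hA' 2 h.1
    have hb := h.2
    rw [Int.ModEq] at hb
    have := rowHolds_three_split (e := 1) (c₂ := (1 - b) / 9) hS ha (by omega) rfl
    rwa [Int.cast_one, one_mul, one_mul] at this
  · obtain ⟨A, ha⟩ := hA' 2 h.1
    have hb := h.2
    simp only [Int.ModEq] at hb
    refine rowHolds_three_of_not_dvd (a' := 3 * A) (e := -1) (c := (-1 - b) / 3) hS
      (by rw [ha]; ring) (by omega) rfl ?_ (hD6 h.1 (by omega))
    have h2 := sq_emod_three (3 * A)
    have h3 := sq_emod_three ((-1 - b) / 3)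
    omega
  · obtain ⟨A, ha⟩ := hA' 2 h.1
    have hb := h.2
    rw [Int.ModEq] at hb
    have := rowHolds_three_split (e := -1) (c₂ := (-1 - b) / 9) hS ha (by omega) rfl
    simp only [Int.cast_neg, Int.cast_one, neg_mul, one_mul, sub_neg_eq_add] at this
    exact this
  · obtain ⟨e, he⟩ := hε h.2
    have hb := h.1
    have he' := he
    simp only [Int.ModEq] at he' hb
    have hD := padicValInt_three_seven (a := a) (b := b) (by omega) (by omega) (.inl h.1)
    refine (rowHolds_three_two (x := -e) hS (ha3 h.2) ?_ (by omega) (by omega) hD).congr_bases ?_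
    · rcases he with ⟨-, rfl⟩ | ⟨-, rfl⟩ <;> rfl
    · ext α
      refine ⟨?_, fun hα => ⟨-e, ?_, hα⟩⟩
      · rintro ⟨ε, hε', rfl⟩
        obtain rfl : ε = -e := by simp only [Int.ModEq] at hε'; omega
        rfl
      · simp only [Int.ModEq]
        omega
  · have ha := h.2
    have hb := h.1
    simp only [Int.ModEq] at ha hb
    refine rowHolds_three_of_not_dvd (a' := a / 3) (e := -1) (c := (-1 - b) / 3) hS (ha3 h.2)
      (by omega) rfl ?_ (padicValInt_three_seven (by omega) (by omega) (.inr h.1))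
    have h2 := sq_emod_three (a / 3)
    have h3 := sq_emod_three ((-1 - b) / 3)
    omega
  · obtain ⟨e, he⟩ := hε h.2.1
    have hset := threeSetting_of_sign (k := 1) hS (ha3 h.2.1) he h.1 le_rfl
      (by have := h.2.2; omega) (by have := h.2.2; omega)
    rw [h.2.2] at hset
    refine (hset.rowHolds_fifth hS).congr_bases ?_
    ext α
    refine ⟨?_, fun hα => ⟨e, he, hα⟩⟩
    rintro ⟨ε, hε', rfl⟩
    rw [huniq he hε']
    rfl
  · obtain ⟨e, he⟩ := hε h.2.1
    have hset := threeSetting_of_sign (k := 2) hS (ha3 h.2.1) he h.1 (by norm_num)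
      (by have := h.2.2; omega) (by have := h.2.2; omega)
    rw [h.2.2] at hset
    refine (rowHolds_three_nine hS hset).congr_bases ?_
    ext α
    refine ⟨?_, fun ⟨x, hx, hα⟩ => ⟨e, x, he, by exact_mod_cast hx, hα⟩⟩
    rintro ⟨ε, x, hε', hx, rfl⟩
    rw [huniq he hε']
    exact ⟨x, by exact_mod_cast hx, rfl⟩
  · obtain ⟨e, he⟩ := hε h.2.1
    have hd := h.2.2.1
    have hp := Nat.even_iff.mp h.2.2.2
    have hset := threeSetting_of_sign
      (k := (padicValInt 3 Δ(a,b) - 6) / 2) hS (ha3 h.2.1) he h.1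
      (by omega) (by omega) (by omega)
    refine (rowHolds_three_last_even hS hset (by omega) (by omega)).congr_bases ?_
    ext α
    refine ⟨?_, fun ⟨x, hx, hα⟩ => ⟨e, x, he, hx, hα⟩⟩
    rintro ⟨ε, x, hε', hx, rfl⟩
    rw [huniq he hε']
    exact ⟨x, hx, rfl⟩
  · obtain ⟨e, he⟩ := hε h.2.1
    have hd := h.2.2.1
    have hp := Nat.odd_iff.mp h.2.2.2
    have hset := threeSetting_of_sign
      (k := (padicValInt 3 Δ(a,b) - 5) / 2) hS (ha3 h.2.1) he h.1
      (by omega) (by omega) (by omega)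
    refine (rowHolds_three_last_odd hS hset (by omega) (by omega)).congr_bases ?_
    ext α
    refine ⟨?_, fun ⟨x, hx, hα⟩ => ⟨e, x, he, hx, hα⟩⟩
    rintro ⟨ε, x, hε', hx, rfl⟩
    rw [huniq he hε']
    exact ⟨x, hx, rfl⟩
  · obtain ⟨A, ha, hA⟩ := exists_eq_pow_mul 3 h.2
    exact rowHolds_b27_a27 hS ha (hB h.1).1 hA (hB h.1).2
  · obtain ⟨A, ha⟩ := hA' 4 h.2.1
    obtain ⟨m, hm, hm'⟩ := exists_eq_pow_mul 1 h.2.2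
    exact rowHolds_b27_of_one hS ha (hB h.1).1 (hB h.1).2 hm hm'
  · obtain ⟨A, ha⟩ := hA' 4 h.2.1
    obtain ⟨m, hm⟩ := pow_dvd_of_le_emultiplicity (k := 2) h.2.2
    exact rowHolds_b27_of_two hS ha (hB h.1).1 (hB h.1).2 hm

end TableThree


section TableFive

variable {K : Type*} [Field K] [NumberField K] {θ : K} {a b : ℤ}

theorem exists_fourth_pow_eq (n : ℤ) (h : ¬ 5 ∣ n) :
    ∃ u, n ^ 4 = 1 + 5 * u := by
  have h1 : n ≡ 1 [ZMOD 5] ∨ n ≡ 2 [ZMOD 5] ∨ n ≡ 3 [ZMOD 5] ∨ n ≡ 4 [ZMOD 5] := by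
    simp only [Int.ModEq]; omega
  have h2 : n ^ 4 ≡ 1 [ZMOD 5] := by
    rcases h1 with h | h | h | h <;> exact (h.pow 4).trans rfl
  obtain ⟨u, hu⟩ := h2.symm.dvd
  exact ⟨u, by linarith⟩

theorem prime_five_int : Prime (5 : ℤ) := Nat.prime_iff_prime_int.mp Nat.prime_five

theorem not_five_dvd_pow {n : ℤ} (h : ¬ (5 : ℤ) ∣ n) (k : ℕ) : ¬ (5 : ℤ) ∣ n ^ k :=
  fun h' => h (prime_five_int.dvd_of_dvd_pow h')

theorem exists_row_five {K : Type*} [Field K] (θ : K) (hnorm : ¬ (5 ^ 5 ∣ a ∧ 5 ^ 6 ∣ b)) :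
    ∃ r ∈ tableIII a b Δ(a,b) θ, r.cond := by
  obtain ⟨A, hA6, hA, hA'⟩ := exists_truncated_emultiplicity 5 a
  obtain ⟨B, hB6, hB, hB'⟩ := exists_truncated_emultiplicity 5 b
  simp only [tableIII, List.mem_cons, List.not_mem_nil, exists_eq_or_imp, or_false,
    exists_eq_left, hA, hB]
  rw [hA' 5 (by norm_num), hB' 6 le_rfl] at hnorm
  clear hA hB hA' hB'
  have hd := Nat.even_or_odd (padicValInt 5 Δ(a,b))
  generalize padicValInt 5 Δ(a,b) = d at hd ⊢
  generalize (a ^ 4 ≡ 21 [ZMOD 25]) = p₁, (b ≡ a ^ 2 - a ^ 6 [ZMOD 25]) = p₂,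
    (a ^ 2 ≡ b / 5 [ZMOD 5]) = p₃, (a ^ 4 ≡ 1 [ZMOD 25]) = p₄, Even d = p₅, Odd d = p₆ at hd ⊢
  interval_cases B <;> interval_cases A <;> simp at hnorm ⊢ <;> tauto

theorem discr_five_eq {β : ℤ} : 5 ^ 5 * a ^ 6 - 6 ^ 6 * (5 * β) ^ 5 =
    ((5 : ℕ) : ℤ) ^ 5 * (a ^ 6 - 6 ^ 6 * β ^ 5) := by
  push_cast; ring

theorem pow_five_modEq (n : ℤ) : n ^ 5 ≡ n [ZMOD 5] := by
  have h : n ≡ 0 [ZMOD 5] ∨ n ≡ 1 [ZMOD 5] ∨ n ≡ 2 [ZMOD 5] ∨ n ≡ 3 [ZMOD 5] ∨ n ≡ 4 [ZMOD 5] := by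
    simp only [Int.ModEq]; omega
  rcases h with h | h | h | h | h <;> exact ((h.pow 5).trans rfl).trans h.symm

theorem pow_six_modEq (n : ℤ) : n ^ 6 ≡ n ^ 2 [ZMOD 5] := by
  have h := (pow_five_modEq n).mul_right n
  rwa [← pow_succ, ← sq] at h

theorem padicValInt_five_five {β : ℤ} (hb : b = 5 * β) (h : ¬ 5 ∣ β - a ^ 2) :
    padicValInt 5 Δ(a,b) = 5 := by
  rw [hb]
  refine padicValInt_eq_of_mul discr_five_eq ?_
  have h1 := pow_six_modEq a
  have h2 := pow_five_modEq β
  simp only [Int.ModEq] at h1 h2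
  push_cast
  omega

/-- The discriminant divided by `5 ^ 5`, modulo `25`, in the degenerate case. -/
theorem discr_bracket_five {β : ℤ} (h : 5 ∣ β - a ^ 2) :
    a ^ 6 - 6 ^ 6 * β ^ 5 ≡ a ^ 6 * (1 - 6 * a ^ 4) [ZMOD 25] := by
  obtain ⟨w, hw⟩ := h
  obtain rfl : β = a ^ 2 + 5 * w := by linarith
  refine (Int.modEq_iff_dvd.mpr ⟨1866 * a ^ 10 + 46656 * (a ^ 8 * w + 10 * a ^ 6 * w ^ 2 +
    50 * a ^ 4 * w ^ 3 + 125 * a ^ 2 * w ^ 4 + 125 * w ^ 5), ?_⟩)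
  ring

theorem valEq_one_five {n : ℤ} (h : 5 ∣ n) (h' : ¬ 25 ∣ n) : ValEq (n : Ω 5) 1 := by
  simpa using valEq_of_dvd_of_not (p := 5) (k := 1) (n := n) (by simpa using h) (by norm_num; exact h')

theorem fourth_pow_modEq_iff {u : ℤ} (hu : a ^ 4 = 1 + 5 * u) :
    a ^ 4 ≡ 21 [ZMOD 25] ↔ 5 ∣ u + 1 := by
  rw [hu, Int.ModEq]
  omega

theorem value_five {u : ℤ} (hu : a ^ 4 = 1 + 5 * u) (β : ℤ) :
    a ^ 6 - a ^ 2 + 5 * β = 5 * (u * a ^ 2 + β) := by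
  linear_combination a ^ 2 * hu

theorem sub_five {u : ℤ} (hu : a ^ 4 = 1 + 5 * u) : a - 6 * a ^ 5 = -(5 * (a * (1 + 6 * u))) := by
  linear_combination -6 * a * hu

theorem b_modEq_iff {u β : ℤ} (hu : a ^ 4 = 1 + 5 * u) (hb : b = 5 * β) :
    b ≡ a ^ 2 - a ^ 6 [ZMOD 25] ↔ 5 ∣ u * a ^ 2 + β := by
  have h := value_five hu β
  rw [hb, Int.ModEq]
  omega

theorem five_dvd_mul_left_iff (ha : ¬ 5 ∣ a) {m : ℤ} : 5 ∣ a ^ 2 * m ↔ 5 ∣ m :=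
  ⟨fun h => (prime_five_int.dvd_or_dvd h).resolve_left (not_five_dvd_pow ha 2), (·.mul_left _)⟩

/-- The conditions on `a` and `b` under which `a ^ 4 ≡ 21` is equivalent to `b / 5 ≡ a ^ 2`. -/
theorem dvd_sub_sq_iff {u β : ℤ} (ha : ¬ 5 ∣ a) (h : 5 ∣ u * a ^ 2 + β) :
    5 ∣ β - a ^ 2 ↔ 5 ∣ u + 1 := by
  rw [← five_dvd_mul_left_iff ha (m := u + 1), show a ^ 2 * (u + 1) = u * a ^ 2 + β - (β - a ^ 2) by ring]
  exact (dvd_sub_right h).symm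

theorem fiveSetting_of_dvd {u β : ℤ} {k : ℕ} (hS : IsTrinomialGenerator θ a b) (ha : ¬ 5 ∣ a)
    (hb : b = 5 * β) (hu : a ^ 4 = 1 + 5 * u) (hu' : 5 ∣ u + 1) (hv : 5 ∣ u * a ^ 2 + β) :
    7 ≤ padicValInt 5 Δ(a,b) ∧
    (2 * k + 4 ≤ padicValInt 5 Δ(a,b) →
      padicValInt 5 Δ(a,b) ≤ 2 * k + 5 →
      FiveSetting a b β k (padicValInt 5 Δ(a,b))) := by
  have hβ := (dvd_sub_sq_iff ha hv).mpr hu'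
  have h7 : 7 ≤ padicValInt 5 Δ(a,b) := by
    refine le_padicValInt hS.discr_ne_zero ?_
    rw [hb, discr_five_eq, show 7 = 5 + 2 from rfl, pow_add]
    refine mul_dvd_mul_left _ (Int.modEq_zero_iff_dvd.mp ((discr_bracket_five hβ).trans ?_))
    refine Int.modEq_zero_iff_dvd.mpr (Dvd.dvd.mul_left ?_ _)
    rw [hu]
    omega
  refine ⟨h7, fun h1 h2 => ⟨ha, hb, ?_, ?_, hβ, hS.discr_ne_zero, rfl, by omega, h1, h2, h7⟩⟩
  · rw [hb, value_five hu]
    omega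
  · rw [sub_five hu]
    have : 5 ∣ a * (1 + 6 * u) := Dvd.dvd.mul_left (by omega) _
    omega

theorem padicValInt_five_six {u β : ℤ} (ha : ¬ 5 ∣ a) (hb : b = 5 * β) (hu : a ^ 4 = 1 + 5 * u)
    (hu' : ¬ 5 ∣ u + 1) (hβ : 5 ∣ β - a ^ 2) :
    padicValInt 5 Δ(a,b) = 6 := by
  have h1 := discr_bracket_five hβ
  have h2 : ¬ 5 ∣ a ^ 6 * (1 + 6 * u) := fun h => by
    rcases prime_five_int.dvd_or_dvd h with h | h
    · exact not_five_dvd_pow ha 6 h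
    · omega
  have h3 : a ^ 6 * (1 - 6 * a ^ 4) = -(5 * (a ^ 6 * (1 + 6 * u))) := by
    linear_combination -6 * a ^ 6 * hu
  rw [h3, Int.ModEq] at h1
  refine padicValInt_eq_of_mul (k := 6) (m := (a ^ 6 - 6 ^ 6 * β ^ 5) / 5) ?_ ?_
  · rw [hb, discr_five_eq, Nat.cast_ofNat, pow_succ (5 : ℤ) 5, mul_assoc, Int.mul_ediv_cancel']
    omega
  · push_cast
    omega

theorem rowHolds_five_of_not_dvd {u β : ℤ} {n : ℕ} (hS : IsTrinomialGenerator θ a b) (ha : ¬ 5 ∣ a)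
    (hb : b = 5 * β) (hu : a ^ 4 = 1 + 5 * u) (hv : ¬ 5 ∣ u * a ^ 2 + β)
    (hD : padicValInt 5 Δ(a,b) = n) :
    RowHolds 5 θ Δ(a,b) {n} n {![1, θ, θ ^ 2, θ ^ 3, θ ^ 4, θ ^ 5]} := by
  refine rowHolds_five_uniformizer hS ha ⟨β, hb⟩ ?_ hD
  rw [hb, value_five hu]
  exact valEq_one_five (dvd_mul_right _ _) (by omega)

theorem rowHolds_five_quarter_of_dvd {u β : ℤ} (hS : IsTrinomialGenerator θ a b) (ha : ¬ 5 ∣ a)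
    (hb : b = 5 * β) (hu : a ^ 4 = 1 + 5 * u) (hu' : ¬ 5 ∣ u + 1) (hv : 5 ∣ u * a ^ 2 + β) :
    RowHolds 5 θ Δ(a,b) {5} 3
      {![1, θ, θ ^ 2, θ ^ 3, θ ^ 4, (θ - a ^ 3 * θ ^ 2 + a ^ 2 * θ ^ 3 - a * θ ^ 4 + θ ^ 5) / 5]} := by
  have hβ : ¬ 5 ∣ β - a ^ 2 := fun h => hu' ((dvd_sub_sq_iff ha hv).mp h)
  refine rowHolds_five_quarter hS ha hb ?_ ?_ (by omega) (padicValInt_five_five hb hβ)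
  · rw [hb, value_five hu]
    omega
  · have h1 := valEq_one_five (n := a - 6 * a ^ 5) (by rw [sub_five hu]; omega) (fun h => by
      rw [sub_five hu] at h
      rcases prime_five_int.dvd_or_dvd (show 5 ∣ a * (1 + 6 * u) by omega) with h' | h'
      · exact ha h'
      · omega)
    exact_mod_cast h1

theorem describes_five (hS : IsTrinomialGenerator θ a b) (hnorm : ¬ (5 ^ 5 ∣ a ∧ 5 ^ 6 ∣ b)) :
    Describes 5 Δ(a,b) θ
      (tableIII a b Δ(a,b) θ) := by
  have h5 := valEq_five
  have h6 : ValEq (6 : Ω 5) 0 := by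
    exact_mod_cast valEq_intCast (p := 5) (n := 6) (by norm_num)
  have h2 : ValEq (2 : Ω 5) 0 := by
    exact_mod_cast valEq_intCast (p := 5) (n := 2) (by norm_num)
  have h3 : ValEq (3 : Ω 5) 0 := by
    exact_mod_cast valEq_intCast (p := 5) (n := 3) (by norm_num)
  have hA (h : emultiplicity (5 : ℤ) a = 0) : ¬ 5 ∣ a := emultiplicity_eq_zero.mp h
  have hB (h : emultiplicity (5 : ℤ) b = 1) : b = 5 * (b / 5) := by
    obtain ⟨m, hm, -⟩ := exists_eq_pow_mul 1 h
    omega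
  have hB' (h : 2 ≤ emultiplicity (5 : ℤ) b) : ∃ m, b = 5 * (5 * m) := by
    obtain ⟨m, hm⟩ := pow_dvd_of_le_emultiplicity (k := 2) h
    exact ⟨m, by rw [hm]; ring⟩
  have hsq (h : ¬ a ^ 2 ≡ b / 5 [ZMOD 5]) : ¬ 5 ∣ b / 5 - a ^ 2 :=
    fun h' => h (Int.modEq_iff_dvd.mpr h')
  refine ⟨exists_row_five θ hnorm, ?_⟩
  simp only [tableIII, List.forall_mem_cons]
  refine ⟨?_, ?_, ?_, ?_, ?_, ?_, ?_, ?_, ?_, ?_, ?_, ?_, ?_, ?_, ?_, ?_, ?_, ?_, ?_, ?_, ?_, ?_,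
    by simp⟩ <;> intro h
  · have hb := valEq_of_emultiplicity (p := 5) (k := 0) h
    exact rowHolds_zero hS (padicValInt_of_gt h5.ge h6 (valGE_intCast a) hb)
  · have ha := hA h.2.1
    have hb := hB h.1
    obtain ⟨u, hu⟩ := exists_fourth_pow_eq a ha
    exact rowHolds_five_of_not_dvd hS ha hb hu ((b_modEq_iff hu hb).not.mp h.2.2.2.1)
      (padicValInt_five_five hb (hsq h.2.2.2.2))
  · have ha := hA h.2.1
    have hb := hB h.1
    obtain ⟨u, hu⟩ := exists_fourth_pow_eq a ha
    exact rowHolds_five_of_not_dvd hS ha hb hu ((b_modEq_iff hu hb).not.mp h.2.2.2.1)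
      (padicValInt_five_six ha hb hu ((fourth_pow_modEq_iff hu).not.mp h.2.2.1) h.2.2.2.2.dvd)
  · have ha := hA h.2.1
    have hb := hB h.1
    obtain ⟨u, hu⟩ := exists_fourth_pow_eq a ha
    exact rowHolds_five_quarter_of_dvd hS ha hb hu ((fourth_pow_modEq_iff hu).not.mp h.2.2.1)
      ((b_modEq_iff hu hb).mp h.2.2.2)
  · have ha := hA h.2.1
    have hb := hB h.1
    obtain ⟨u, hu⟩ := exists_fourth_pow_eq a ha
    have hv := (b_modEq_iff hu hb).not.mp h.2.2.2
    refine rowHolds_five_of_not_dvd hS ha hb hu hv (padicValInt_five_five hb fun h' => hv ?_)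
    rw [show u * a ^ 2 + b / 5 = (b / 5 - a ^ 2) + a ^ 2 * (u + 1) by ring]
    exact h'.add (((fourth_pow_modEq_iff hu).mp h.2.2.1).mul_left _)
  · have ha := hA h.2.1
    have hb := hB h.1
    obtain ⟨u, hu⟩ := exists_fourth_pow_eq a ha
    have hp := Nat.odd_iff.mp h.2.2.2.2
    have hset := fiveSetting_of_dvd
      (k := (padicValInt 5 Δ(a,b) - 5) / 2) hS ha hb hu
      ((fourth_pow_modEq_iff hu).mp h.2.2.1) ((b_modEq_iff hu hb).mp h.2.2.2.1)
    exact rowHolds_five_last_odd hS (hset.2 (by omega) (by omega)) (by omega)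
  · have ha := hA h.2.1
    have hb := hB h.1
    obtain ⟨u, hu⟩ := exists_fourth_pow_eq a ha
    have hp := Nat.even_iff.mp h.2.2.2.2
    have hset := fiveSetting_of_dvd
      (k := (padicValInt 5 Δ(a,b) - 4) / 2) hS ha hb hu
      ((fourth_pow_modEq_iff hu).mp h.2.2.1) ((b_modEq_iff hu hb).mp h.2.2.2.1)
    exact rowHolds_five_last_even hS (hset.2 (by omega) (by omega)) (by omega)
  · exact rowHolds_six_of_gt hS 1 1 5 5 h5 h6 h.2 h.1 (saturatedFamily_six_of_coprime (Or.inl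
      rfl))
  · have ha := hA h.2.1
    obtain ⟨m, hb⟩ := hB' h.1
    obtain ⟨u, hu⟩ := exists_fourth_pow_eq a ha
    have hua : ¬ 5 ∣ u * a ^ 2 := fun h' => h.2.2 (by
      rw [mul_comm, five_dvd_mul_left_iff ha] at h'
      rw [hu, Int.ModEq]
      omega)
    exact rowHolds_five_of_not_dvd hS ha hb hu (by omega)
      (padicValInt_five_five hb (by have := not_five_dvd_pow ha 2; omega))
  · have ha := hA h.2.1
    obtain ⟨m, hb⟩ := hB' h.1
    obtain ⟨u, hu⟩ := exists_fourth_pow_eq a ha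
    have hu' := h.2.2
    rw [hu, Int.ModEq] at hu'
    exact rowHolds_five_quarter_of_dvd hS ha hb hu (by omega)
      (dvd_add (Dvd.dvd.mul_right (by omega) _) (dvd_mul_right _ _))
  · exact rowHolds_five_of_gt hS 1 2 10 8 h5 h6 h.2 h.1
  · exact rowHolds_six_of_gt hS 2 2 10 4 h5 h6 h.2 h.1 (saturatedFamily_six_of_two (e := 1)
      (Or.inl rfl) h2)
  · exact rowHolds_five_of_lt hS 1 3 11 9 h5 h6 h.2 h.1
  · exact rowHolds_five_of_gt hS 2 3 15 7 h5 h6 h.2 h.1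
  · exact rowHolds_six_of_gt hS 3 3 15 3 h5 h6 h.2 h.1 (fun h h' => saturatedFamily_six_of_three
      h3 h h')
  · exact rowHolds_five_of_lt hS 2 4 17 9 h5 h6 h.2 h.1
  · exact rowHolds_five_of_gt hS 3 4 20 6 h5 h6 h.2 h.1
  · exact rowHolds_six_of_gt hS 4 4 20 4 h5 h6 h.2 h.1 (saturatedFamily_six_of_two (e := 2)
      (Or.inr rfl) h2)
  · exact rowHolds_five_of_lt hS 3 5 23 9 h5 h6 h.2 h.1
  · exact rowHolds_five_of_gt hS 4 5 25 5 h5 h6 h.2 h.1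
  · exact rowHolds_six_of_gt hS 5 5 25 5 h5 h6 h.2 h.1 (saturatedFamily_six_of_coprime (Or.inr
      rfl))
  · exact rowHolds_five_of_lt hS 4 6 29 9 h5 h6 h.2 h.1

end TableFive


section TableGeneral

variable {K : Type*} [Field K] [NumberField K] {p : ℕ} [hp : Fact p.Prime] {θ : K} {a b : ℤ}

theorem valEq_natCast_of_lt {n : ℕ} (hn : n ≠ 0) (h : n < p) : ValEq (n : Ω p) 0 := by
  have := valEq_intCast (p := p) (n := n)
    (fun h' => Nat.not_dvd_of_pos_of_lt (by omega) h (by exact_mod_cast h'))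
  exact_mod_cast this

theorem exists_row_general {K : Type*} [Field K] (θ : K)
    (hnorm : ¬ ((p : ℤ) ^ 5 ∣ a ∧ (p : ℤ) ^ 6 ∣ b)) :
    ∃ r ∈ tableIV p a b Δ(a,b) θ, r.cond := by
  obtain ⟨A, hA6, hA, hA'⟩ := exists_truncated_emultiplicity p a
  obtain ⟨B, hB6, hB, hB'⟩ := exists_truncated_emultiplicity p b
  have hab (h : A = 0 ∧ B = 0) : emultiplicity (p : ℤ) (a * b) = 0 := by
    rw [← hA.1, ← hB.1] at h
    rw [emultiplicity_mul (Nat.prime_iff_prime_int.mp hp.out), h.1, h.2, add_zero]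
  simp only [tableIV, List.mem_cons, List.not_mem_nil, exists_eq_or_imp, or_false,
    exists_eq_left, hA, hB]
  rw [hA' 5 (by norm_num), hB' 6 le_rfl] at hnorm
  clear hA hB hA' hB'
  have hd := Nat.even_or_odd (padicValInt p Δ(a,b))
  generalize (emultiplicity (p : ℤ) (a * b) = 0) = p₁ at hab ⊢
  interval_cases B <;> interval_cases A <;> simp at hnorm hab ⊢
  tauto

theorem describes_general (hS : IsTrinomialGenerator θ a b) (hp5 : 5 < p)
    (hnorm : ¬ ((p : ℤ) ^ 5 ∣ a ∧ (p : ℤ) ^ 6 ∣ b)) :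
    Describes p Δ(a,b) θ
      (tableIV p a b Δ(a,b) θ) := by
  have h5 : ValEq (5 : Ω p) 0 := by
    exact_mod_cast valEq_natCast_of_lt (n := 5) (by norm_num) hp5
  have h2 : ValEq (2 : Ω p) 0 := by
    exact_mod_cast valEq_natCast_of_lt (n := 2) (by norm_num) (by omega)
  have h3 : ValEq (3 : Ω p) 0 := by
    exact_mod_cast valEq_natCast_of_lt (n := 3) (by norm_num) (by omega)
  have h6 : ValEq (6 : Ω p) 0 := by
    convert h2.mul h3 (add_zero 0).symm using 1
    norm_num
  have hA (h : emultiplicity (p : ℤ) (a * b) = 0) : ¬ (p : ℤ) ∣ a :=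
    fun h' => emultiplicity_eq_zero.mp h (h'.mul_right b)
  refine ⟨exists_row_general θ hnorm, ?_⟩
  simp only [tableIV, List.forall_mem_cons]
  refine ⟨?_, ?_, ?_, ?_, ?_, ?_, ?_, ?_, ?_, ?_, ?_, ?_, by simp⟩ <;> intro h
  · refine rowHolds_zero hS ?_
    rcases h with ⟨h, h'⟩ | ⟨h, h'⟩
    · have hb := valEq_of_emultiplicity (p := p) (k := 0) h
      have ha := valGE_of_le_emultiplicity (p := p) (k := 1) h'
      exact padicValInt_of_gt h5.ge h6 ha hb (by norm_num)
    · have ha := valEq_of_emultiplicity (p := p) (k := 0) h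
      have hb := valGE_of_le_emultiplicity (p := p) (k := 1) h'
      exact padicValInt_of_lt h5 h6.ge ha hb (by norm_num)
  · exact rowHolds_six_of_gt hS 1 1 5 5 h5 h6 h.2 h.1 (saturatedFamily_six_of_coprime (Or.inl
      rfl))
  · exact rowHolds_five_of_lt hS 1 2 6 4 h5 h6 h.1 h.2
  · exact rowHolds_six_of_gt hS 2 2 10 4 h5 h6 h.2 h.1 (saturatedFamily_six_of_two (e := 1)
      (Or.inl rfl) h2)
  · exact rowHolds_five_of_lt hS 2 3 12 4 h5 h6 h.1 h.2
  · exact rowHolds_six_of_gt hS 3 3 15 3 h5 h6 h.2 h.1 (fun h h' => saturatedFamily_six_of_three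
      h3 h h')
  · exact rowHolds_five_of_lt hS 3 4 18 4 h5 h6 h.1 h.2
  · exact rowHolds_six_of_gt hS 4 4 20 4 h5 h6 h.2 h.1 (saturatedFamily_six_of_two (e := 2)
      (Or.inr rfl) h2)
  · exact rowHolds_five_of_lt hS 4 5 24 4 h5 h6 h.1 h.2
  · exact rowHolds_six_of_gt hS 5 5 25 5 h5 h6 h.2 h.1 (saturatedFamily_six_of_coprime (Or.inr
      rfl))
  · have hd := Nat.even_iff.mp h.2
    exact rowHolds_generalBases hS hp5 (hA h.1) zero_le_one h.2 (by omega)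
  · have hd := Nat.odd_iff.mp h.2
    exact rowHolds_generalBases hS hp5 (hA h.1) le_rfl h.2 (by omega)

end TableGeneral

end Sextic

theorem theorem1p1 {K : Type*} [Field K] [NumberField K] (θ : K) (a b : ℤ)
    (hirr : Irreducible (X ^ 6 + C a * X + C b : ℤ[X]))
    (hroot : aeval θ (X ^ 6 + C a * X + C b : ℤ[X]) = 0)
    (hgen : IntermediateField.adjoin ℚ {θ} = ⊤)
    (hnorm : ∀ p : ℕ, p.Prime → ¬ ((p : ℤ) ^ 5 ∣ a ∧ (p : ℤ) ^ 6 ∣ b)) :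
    (X ^ 6 + C a * X + C b : ℤ[X]).discr = 5 ^ 5 * a ^ 6 - 6 ^ 6 * b ^ 5 ∧
    (X ^ 6 + C a * X + C b : ℤ[X]).discr ≠ 0 ∧
    ∀ (p : ℕ) [Fact p.Prime],
      Sextic.Describes p (X ^ 6 + C a * X + C b : ℤ[X]).discr θ
        (Sextic.table p a b (X ^ 6 + C a * X + C b : ℤ[X]).discr θ) := by
  have hS : Sextic.IsTrinomialGenerator θ a b := ⟨hirr, hroot, hgen⟩
  have hD : (X ^ 6 + C a * X + C b : ℤ[X]).discr = 5 ^ 5 * a ^ 6 - 6 ^ 6 * b ^ 5 :=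
    Sextic.trinomial_discr a b hS.ne_zero
  rw [hD]
  refine ⟨rfl, hS.discr_ne_zero, fun p hp => ?_⟩
  have hn := hnorm p hp.out
  unfold Sextic.table
  split_ifs with h2 h3 h5
  · subst h2
    exact Sextic.describes_two hS (by exact_mod_cast hn)
  · subst h3
    exact Sextic.describes_three hS (by exact_mod_cast hn)
  · subst h5
    exact Sextic.describes_five hS (by exact_mod_cast hn)
  · refine Sextic.describes_general hS ?_ hn
    have h4 : p ≠ 4 := by rintro rfl; exact absurd hp.out (by norm_num)
    have := hp.out.two_le
    omega
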